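/- **Conventions.** Languages are sets of bit strings and $|x|$ is the length of $x$. A function $f$ of $|x|$ is in $\mathrm{poly}$ if it is bounded by a polynomial, and $s\in 1-\mathrm{poly}^{-1}$ means $s(n)\le 1-1/p(n)$ for a polynomial $p>0$. All Hilbert spaces are finite-dimensional. Measuring a reflection $R$ ($R=R^*$, $R^2=1$) gives outcome $a\in\{0,1\}$ with projection $(1+(-1)^aR)/2$. A unary clock register of $N$ qubits encodes $t\in\{0,\dots,N\}$ as $|1^t0^{N-t}\rangle$; a $Z$ measurement of its (non-existent) qubit $0$ has outcome $1$, and of qubit $N+1$ outcome $0$. **Proof systems.** A verifier for $r$ provers and three turns consists of a private register $\mathsf V$ of $q_V\ge1$ qubits, message registers $\mathsf M_1,\dots,\mathsf M_r$ of $q_M$ qubits each, and two circuits $V^1,V^2$ of Hadamard and Toffoli gates on $\mathsf V,\mathsf M_1,\dots,\mathsf M_r$. Provers choose private spaces $\mathcal P_i$, a unit vector $\Psi\in\bigotimes_i(\mathcal M_i\otimes\mathcal P_i)$ and unitaries $W^i$ on $\mathcal M_i\otimes\mathcal P_i$; they are accepted with probability $\|\Pi_{\mathrm{acc}}V^2(\bigotimes_iW^i)V^1(|0^{q_V}\rangle\Psi)\|^2$,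 where $\Pi_{\mathrm{acc}}$ projects the first qubit of $\mathsf V$ onto $|1\rangle$. $\mathrm{MAP}$ is the supremum of this probability. A verifier family $(V_x)_x$ witnesses $A\in\mathrm{QMIP}^*(r,3,c,s)$ if a description of $V_x$ (with numbers in unary) is computable from $x$ in polynomial time (so it has polynomial length), $\mathrm{MAP}(V_x)\ge c(|x|)$ for $x\in A$, and $\mathrm{MAP}(V_x)\le s(|x|)$ for $x\notin A$. *Normal form.* Add two dummy qubits to $\mathsf V$ and one to each $\mathsf M_i$; pair each Hadamard gate with a Hadamard gate on a dummy qubit of the same register; pad both circuits to the same length $L\ge 1$, the larger of $1$ and the two lengths, with pairs of Hadamard gates on the two dummy qubits of $\mathsf V$. Below, $q_V,q_M$ are the new sizes, $T=2L+1$, and the steps $U_1,\dots,U_L$ and $U_{L+2},\dots,U_T$ are those of $V^1$ and $V^2$. **Extended nonlocal games.** In an $r$-player extended nonlocal game the referee samples questions (and private randomness), sends them to the players, receives their answers, measures his own quantum register and accepts or rejects. A strategy is a state shared by the referee's register and the players together with a measurement (POVM) for each player and question; the players do not communicate. The value is the supremum of the acceptance probability over all strategies. **The extended game $G_k(V_x)$**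 ($k\ge3$ a constant). The referee has a clock register $\mathsf C$ of $T$ qubits, a register $\mathsf V$ of $q_V$ qubits, a clock register $\mathsf S$ of $N$ qubits and a register $\mathsf X$ of $2rm$ control qubits, where $m=q_M+1$. Nominally player $(i)$ has $m$ qubits: $\mathsf B_i$ and those of $\mathsf M_i$. An $XZ$-form Pauli operator is a tensor product of factors $I,X,Z$; let $\mathcal P_{m,k}$ be the set of those on $m$ qubits of weight at most $k$, and $\mathcal Q_{m,k}$ the collection of nonempty sets of at most $k$ pairwise commuting ones that act on a common set of at most $k$ qubits. A question to a player is one operator $P$ (answer: one bit), a set $Q$ of operators (answer: a function $Q\to\{0,1\}$), or a special symbol $\ast$ (answer: one bit). The referee performs with equal probability one of: 1. *Clock check.* Sample $t\in\{1,\dots,N-1\}$, measure $Z_{\mathsf S,t},Z_{\mathsf S,t+1}$, and reject iff the outcomes are $0,1$. 2. *Constraint propagation.* Play the $r$-player $(m,k)$-constraint propagation game (below). 3. *Output check.* Measure $Z_{\mathsf S,1}$ with outcome $a$, play the honest-player game (below), and reject iff $a=0$ and that game rejects. *Constraint propagation game.* For each player separately take symbols $P$ ($P\in\mathcal P_{m,k}$)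 and $P|Q$ ($P\in Q\in\mathcal Q_{m,k}$), and the constraints: $D_uE_vD_uE_v=1$ ($u\ne v$; $D,E\in\{X,Z\}$); $X_uZ_uX_uZ_u=-1$; $D_vX_uZ_uX_uZ_uD_v=-1$ (all $u,v$); $P\prod_{v\in\operatorname{supp}P}D_v=1$ if $P=\prod_{v}D_v$; $(P|Q)P=1$. Let $\mathfrak V$ be the sequence of all symbols in the constraints of all players, and let $\mathfrak W$ be the concatenation, over all qubits $u$ of all players, of $\mathfrak V,\Lambda(X_u),\mathfrak V,\Lambda(Z_u)$, where $\Lambda$ denotes control by a qubit of $\mathsf X$, a different one for each of these $2rm$ symbols. Let $\mathfrak Q_1=\emptyset,\mathfrak Q_2,\dots$ be all concatenations of a sequence of at most $k$ symbols $X_u,Z_u$ and a sequence of at most $k$ symbols $P|Q$ of one player with a common $Q$. Let $\mathfrak U=(U_t)_{t=1}^N$ be the concatenation over $l$ of $\mathfrak Q_l,\mathfrak W,\mathfrak W^*,\mathfrak Q_l^*$, where ${}^*$ reverses a sequence; this defines $N$. For $0\le t_1<t_2\le N$ let $\Pi_{(t_1,t_2)}$ be the measurement on $\mathsf S$ with projections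 $\Pi^c=\frac12|10\rangle\langle10|_{t_1,t_2+1}\otimes\sum_{a,b\in\{0,1\}}(-1)^{c(a+b)}|a\cdots a\rangle\langle b\cdots b|_{t_1+1,\dots,t_2}$ for $c=0,1$ and $\Pi^2=1-\Pi^0-\Pi^1$. The referee performs with equal probability one of: (a) *Propagation:* sample $t\in\{1,\dots,N\}$; send the operator $P$ (or the set $Q$) of $U_t$ to its player, let $a$ be the answer bit for $P$, and let $c$ be the outcome of $\Pi_{(t-1,t)}$; accept if $c=2$. Otherwise, if $U_t$ is not controlled, accept iff $c=a$; if $U_t$ is controlled, measure $Z$ on its control qubit with outcome $b$ and reject iff ($b=0$, $c=1$) or ($b=1$, $a\oplus c=1$). (b) *Initialization:* measure $\mathsf S$ in the standard basis and accept if the result is not $0^N$; otherwise measure $X$ on a random qubit of $\mathsf X$ and accept iff the outcome is $0$. (c) *Constraints:* sample $l$, one of the $2rm$ copies of $\mathfrak V$ in the first $\mathfrak W$ of the $l$-th block, and one constraint (with sign $(-1)^\tau$); if its symbols in that copy are $U_{t_1+1},\dots,U_{t_2}$, measure $\Pi_{(t_1,t_2)}$ and accept iff the outcome is $2$ or $\tau$.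 *Honest-player game.* With equal probability: (a) *Clock:* with probability $\frac12$ each, either sample $t\in\{1,\dots,T-1\}$ and reject iff $Z_{\mathsf C,t},Z_{\mathsf C,t+1}$ give $0,1$; or sample $i$, ask player $(i)$ for $Z_{\mathsf B_i}$, measure $Z_{\mathsf C,L+1}$, and reject iff the two bits differ. (b) *Verifier propagation:* sample $t\in\{1,\dots,T\}\setminus\{L+1\}$ and $j\in\{0,1\}$; accept unless $Z_{\mathsf C,t-1},Z_{\mathsf C,t+1}$ give $1,0$; let $x$ be the outcome of $X_{\mathsf C,t}$. If $U_t$ is a pair of Hadamard gates on $u_1,u_2$, obtain $a_1,a_2$ by measuring $X_{u_1}X_{u_2},Z_{u_1}Z_{u_2}$ (if $j=0$) or $X_{u_1}Z_{u_2},Z_{u_1}X_{u_2}$ (if $j=1$) and reject iff $x\oplus a_1=x\oplus a_2=1$. If $U_t$ is a Toffoli gate with target $u_3$, accept if $j=1$; if $j=0$, obtain $a_1,a_2,a_3$ by measuring $Z_{u_1},Z_{u_2},X_{u_3}$ and reject iff ($a_1a_2=1$ and $x\oplus a_3=1$) or ($a_1a_2=0$ and $x=1$). Operators on qubits of $\mathsf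 V$ are measured by the referee; for those on qubits of $\mathsf M_i$ player $(i)$ is asked, all of them in one question. (c) *Prover propagation:* send $\ast$ to all players, with answers $a^{(i)}$; accept if $Z_{\mathsf C,L},Z_{\mathsf C,L+2}$ do not give $1,0$; otherwise measure $X_{\mathsf C,L+1}$ and accept iff the outcome is $\bigoplus_ia^{(i)}$. (d) *Initialization:* accept if $Z_{\mathsf C,1}$ gives $1$; otherwise accept iff $Z$ on a random qubit of $\mathsf V$ gives $0$. (e) *Output:* accept if $Z_{\mathsf C,T}$ gives $0$; otherwise accept iff $Z_{\mathsf V,1}$ gives $1$. **Theorem.** Let $k\ge3$ be an integer, $r\in\mathrm{poly}$ with $r\ge1$, $s\in1-\mathrm{poly}^{-1}$, and let $p$ be a polynomial. There is $s'\in1-\mathrm{poly}^{-1}$ such that for every language $A\in\mathrm{QMIP}^*(r,3,1,s)$, every verifier family $(V_x)_x$ that witnesses this with descriptions of length at most $p(|x|)$, and every $x$: 1. if $x\in A$, then the extended game $G_k(V_x)$ has value $1$; moreover, if some provers make $V_x$ accept with probability $1$, then some strategy is accepted in $G_k(V_x)$ with probability $1$; 2. if $x\notin A$, then the value of $G_k(V_x)$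 is at most $s'(|x|)$. -/

import Mathlib

open Matrix
open scoped Kronecker ComplexOrder

namespace QGame

noncomputable section

/-! ### Operators and measurements -/

/-- The tensor product of a finite family of matrices, acting on the tensor product space, whose
standard basis is indexed by the product of the index sets. -/
def tensor {ι : Type} [Fintype ι] {d : ι → Type} (A : ∀ i, Matrix (d i) (d i) ℂ) :
    Matrix (∀ i, d i) (∀ i, d i) ℂ :=
  Matrix.of fun x y => ∏ i, A i (x i) (y i)

/-- The single-qubit labels that may occur in an `XZ`-form Pauli operator. -/
inductive PauliLabel : Type
  | I
  | X
  | Z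
  deriving DecidableEq

instance : Fintype PauliLabel := ⟨{.I, .X, .Z}, fun D => by cases D <;> simp⟩

/-- The single-qubit operators; the computational basis is indexed by `Bool` (`false` is `0`). -/
def PauliLabel.mat : PauliLabel → Matrix Bool Bool ℂ
  | .I => 1
  | .X => Matrix.of fun a b => if a = b then 0 else 1
  | .Z => Matrix.diagonal fun b => if b then -1 else 1

/-- The `XZ`-form Pauli operator with tensor factors `P u` on the qubits `u : q`. -/
def pauliOp {q : Type} [Fintype q] (P : q → PauliLabel) : Matrix (q → Bool) (q → Bool) ℂ :=
  tensor fun u => (P u).mat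

/-- The weight-one label `D_u`. -/
def single {q : Type} [DecidableEq q] (u : q) (D : PauliLabel) : q → PauliLabel :=
  fun v => if v = u then D else .I

/-- The label `D_u ⊗ E_v` (for `u ≠ v`). -/
def pair {q : Type} [DecidableEq q] (u : q) (D : PauliLabel) (v : q) (E : PauliLabel) :
    q → PauliLabel :=
  fun w => if w = u then D else if w = v then E else .I

/-- The qubits on which a Pauli label acts nontrivially. -/
def support {q : Type} [Fintype q] (P : q → PauliLabel) : Finset q :=
  Finset.univ.filter fun u => P u ≠ .I

theorem tensor_mul {ι : Type} [Fintype ι] [DecidableEq ι] {d : ι → Type} [∀ i, Fintype (d i)]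
    (A B : ∀ i, Matrix (d i) (d i) ℂ) :
    tensor A * tensor B = tensor fun i => A i * B i := by
  ext x z
  simp only [tensor, Matrix.mul_apply, Matrix.of_apply]
  rw [Finset.prod_univ_sum, Fintype.piFinset_univ]
  exact Finset.sum_congr rfl fun y _ => Finset.prod_mul_distrib.symm

theorem tensor_one {ι : Type} [Fintype ι] [DecidableEq ι] {d : ι → Type}
    [∀ i, DecidableEq (d i)] :
    tensor (fun i => (1 : Matrix (d i) (d i) ℂ)) = 1 := by
  ext x y
  simp only [tensor, Matrix.of_apply, Matrix.one_apply]
  by_cases h : x = y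
  · subst h; simp
  · rw [if_neg h]
    obtain ⟨i, hi⟩ := Function.ne_iff.mp h
    exact Finset.prod_eq_zero (Finset.mem_univ i) (if_neg hi)

theorem PauliLabel.mat_mul_self (D : PauliLabel) : D.mat * D.mat = 1 := by
  cases D <;> ext a b <;> cases a <;> cases b <;> simp [PauliLabel.mat, Matrix.mul_apply]

theorem PauliLabel.mat_star (D : PauliLabel) (a b : Bool) : star (D.mat b a) = D.mat a b := by
  cases D <;> cases a <;> cases b <;> simp [PauliLabel.mat]

theorem pauliOp_mul_self {q : Type} [Fintype q] [DecidableEq q] (P : q → PauliLabel) :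
    pauliOp P * pauliOp P = 1 := by
  unfold pauliOp
  rw [tensor_mul]
  simp only [PauliLabel.mat_mul_self]
  exact tensor_one

theorem pauliOp_conjTranspose {q : Type} [Fintype q] (P : q → PauliLabel) :
    (pauliOp P)ᴴ = pauliOp P := by
  ext x y
  simp only [pauliOp, tensor, Matrix.conjTranspose_apply, Matrix.of_apply, star_prod]
  exact Finset.prod_congr rfl fun u _ => PauliLabel.mat_star _ _ _

/-- A quantum measurement on the space with basis `κ` and outcomes in `O`, given by its Kraus
operators: outcome `o` has probability `tr (ρ (K o)ᴴ (K o))`. -/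
structure Meas (κ O : Type) [Fintype κ] [DecidableEq κ] [Fintype O] where
  K : O → Matrix κ κ ℂ
  complete : ∑ o, (K o)ᴴ * K o = 1

namespace Meas

variable {κ O O' : Type} [Fintype κ] [DecidableEq κ] [Fintype O] [Fintype O']

/-- The measurement with the fixed outcome `b`. -/
def const (b : Bool) : Meas κ Bool where
  K o := if o = b then 1 else 0
  complete := by cases b <;> simp

/-- First `m`, then `m'`. -/
def seq (m : Meas κ O) (m' : Meas κ O') : Meas κ (O × O') where
  K o := m'.K o.2 * m.K o.1
  complete := by
    rw [Fintype.sum_prod_type]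
    have h : ∀ o : O, ∑ o' : O', (m'.K o' * m.K o)ᴴ * (m'.K o' * m.K o) = (m.K o)ᴴ * m.K o := by
      intro o
      calc ∑ o' : O', (m'.K o' * m.K o)ᴴ * (m'.K o' * m.K o)
          = ∑ o' : O', (m.K o)ᴴ * ((m'.K o')ᴴ * m'.K o') * m.K o :=
            Finset.sum_congr rfl fun o' _ => by
              rw [Matrix.conjTranspose_mul]; simp only [Matrix.mul_assoc]
        _ = (m.K o)ᴴ * m.K o := by
            rw [← Finset.sum_mul, ← Finset.mul_sum, m'.complete, Matrix.mul_one]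
    simp only [h]
    exact m.complete

/-- The projective two-outcome measurement of a reflection `R`: the projection of the outcome
`a` is `(1 + (-1)^a R) / 2`. -/
def reflection (R : Matrix κ κ ℂ) (h1 : Rᴴ = R) (h2 : R * R = 1) : Meas κ Bool where
  K a := (1 / 2 : ℂ) • (1 + (if a then (-1 : ℂ) else 1) • R)
  complete := by
    simp only [Fintype.sum_bool, Matrix.conjTranspose_smul, Matrix.conjTranspose_add,
      Matrix.conjTranspose_one, h1, if_true, if_false, Bool.false_eq_true, star_one, star_neg,
      one_smul, Matrix.smul_mul, Matrix.mul_smul, Matrix.add_mul, Matrix.mul_add, Matrix.one_mul,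
      Matrix.mul_one, h2]
    ext i j
    simp [Matrix.add_apply, Matrix.smul_apply]
    ring

/-- The measurement of an `XZ`-form Pauli operator. -/
def pauli {q : Type} [Fintype q] [DecidableEq q] (P : q → PauliLabel) : Meas (q → Bool) Bool :=
  reflection (pauliOp P) (pauliOp_conjTranspose P) (pauliOp_mul_self P)

open Classical in
/-- The projective measurement whether a basis state satisfies `p` (outcome `true`) or not. -/
def indicator (p : κ → Prop) : Meas κ Bool where
  K o := Matrix.diagonal fun x => if (o = true ↔ p x) then 1 else 0
  complete := by
    ext i j
    by_cases hij : i = j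
    · subst hij
      by_cases hp : p i <;> simp [Matrix.diagonal_conjTranspose, hp]
    · simp [Matrix.diagonal_conjTranspose, hij]

end Meas

/-! ### Extended nonlocal games -/

/-- An `r`-player extended nonlocal game with questions in `Γ`, answers to the question `g` in
`Λ g` and a referee register with basis `κ`.  The referee's random seed `ω` determines the
questions `ques ω` and, for each tuple `a` of answers, the operator `0 ≤ acc ω a ≤ 1` on the
referee's register that gives the probability of acceptance. -/
structure ExtGame (r : ℕ) (Γ : Type) (Λ : Γ → Type) (κ : Type) [Fintype κ] [DecidableEq κ] where
  Ω : Type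
  [finΩ : Fintype Ω]
  prob : Ω → ℝ
  prob_nonneg : ∀ ω, 0 ≤ prob ω
  prob_sum : ∑ ω, prob ω = 1
  ques : Ω → Fin r → Γ
  acc : (ω : Ω) → (∀ i, Λ (ques ω i)) → Matrix κ κ ℂ
  acc_nonneg : ∀ ω a, (acc ω a).PosSemidef
  acc_le_one : ∀ ω a, (1 - acc ω a).PosSemidef

attribute [instance] ExtGame.finΩ

namespace ExtGame

variable {r : ℕ} {Γ : Type} {Λ : Γ → Type} {κ : Type} [Fintype κ] [DecidableEq κ]

open Classical in
/-- The referee sends the questions `ques`, performs the measurement `m` on his register, and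
accepts if the answers and the outcome satisfy `accept`. -/
def leaf {O : Type} [Fintype O] (ques : Fin r → Γ) (m : Meas κ O)
    (accept : (∀ i, Λ (ques i)) → O → Prop) : ExtGame r Γ Λ κ where
  Ω := Unit
  prob _ := 1
  prob_nonneg _ := zero_le_one
  prob_sum := by simp
  ques _ := ques
  acc _ a := ∑ o, if accept a o then (m.K o)ᴴ * m.K o else 0
  acc_nonneg _ a := by
    refine Matrix.posSemidef_sum Finset.univ fun o _ => ?_
    split_ifs
    · exact Matrix.posSemidef_conjTranspose_mul_self _
    · exact Matrix.PosSemidef.zero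
  acc_le_one _ a := by
    rw [← m.complete, ← Finset.sum_sub_distrib]
    refine Matrix.posSemidef_sum Finset.univ fun o _ => ?_
    split_ifs
    · rw [sub_self]; exact Matrix.PosSemidef.zero
    · rw [sub_zero]; exact Matrix.posSemidef_conjTranspose_mul_self _

/-- The referee accepts without asking anything (that is, he asks the default question). -/
def accepting [Inhabited Γ] : ExtGame r Γ Λ κ :=
  leaf (fun _ => default) (Meas.const true) fun _ _ => True

/-- The referee plays one of the games `G j`, with `j : ι` uniformly random. -/
def mixNonempty {ι : Type} [Fintype ι] [Nonempty ι] (G : ι → ExtGame r Γ Λ κ) :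
    ExtGame r Γ Λ κ where
  Ω := Σ j, (G j).Ω
  prob ω := (Fintype.card ι : ℝ)⁻¹ * (G ω.1).prob ω.2
  prob_nonneg ω := mul_nonneg (by positivity) ((G ω.1).prob_nonneg _)
  prob_sum := by
    rw [Fintype.sum_sigma]
    simp only [← Finset.mul_sum, prob_sum, mul_one, Finset.sum_const, Finset.card_univ,
      nsmul_eq_mul]
    have h : (Fintype.card ι : ℝ) ≠ 0 := by exact_mod_cast Fintype.card_ne_zero
    exact mul_inv_cancel₀ h
  ques ω := (G ω.1).ques ω.2
  acc ω a := (G ω.1).acc ω.2 a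
  acc_nonneg ω a := (G ω.1).acc_nonneg _ _
  acc_le_one ω a := (G ω.1).acc_le_one _ _

open Classical in
/-- The referee plays one of the games `G j`, with `j : ι` uniformly random.  (If there is nothing
to sample from, he accepts; this does not happen below if there is at least one player.) -/
def mix [Inhabited Γ] {ι : Type} [Fintype ι] (G : ι → ExtGame r Γ Λ κ) : ExtGame r Γ Λ κ :=
  if _h : Nonempty ι then mixNonempty G else accepting

/-- The referee performs the two-outcome measurement `m`, then plays `G`; he rejects if the
outcome of `m` was `0` and `G` rejects, and accepts otherwise. -/
def guarded (m : Meas κ Bool) (G : ExtGame r Γ Λ κ) : ExtGame r Γ Λ κ where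
  Ω := G.Ω
  prob := G.prob
  prob_nonneg := G.prob_nonneg
  prob_sum := G.prob_sum
  ques := G.ques
  acc ω a := (m.K true)ᴴ * m.K true + (m.K false)ᴴ * G.acc ω a * m.K false
  acc_nonneg ω a := (Matrix.posSemidef_conjTranspose_mul_self _).add
    ((G.acc_nonneg ω a).conjTranspose_mul_mul_same _)
  acc_le_one ω a := by
    have h : 1 - ((m.K true)ᴴ * m.K true + (m.K false)ᴴ * G.acc ω a * m.K false)
        = (m.K false)ᴴ * (1 - G.acc ω a) * m.K false := by
      have h' := m.complete
      rw [Fintype.sum_bool] at h'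
      rw [Matrix.mul_sub, Matrix.sub_mul, Matrix.mul_one, ← h']
      abel
    rw [h]
    exact (G.acc_le_one ω a).conjTranspose_mul_mul_same _

variable [∀ g, Fintype (Λ g)]

/-- A quantum strategy: finite-dimensional spaces for the players, a state shared between the
referee's register and the players, and a measurement for each player and question. -/
structure Strategy (G : ExtGame r Γ Λ κ) where
  d : Fin r → ℕ
  ρ : Matrix (κ × ∀ i, Fin (d i)) (κ × ∀ i, Fin (d i)) ℂ
  ρ_nonneg : ρ.PosSemidef
  ρ_trace : ρ.trace = 1
  M : (i : Fin r) → (g : Γ) → Λ g → Matrix (Fin (d i)) (Fin (d i)) ℂ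
  M_nonneg : ∀ i g a, (M i g a).PosSemidef
  M_sum : ∀ i g, ∑ a, M i g a = 1

/-- The acceptance probability of a strategy. -/
def Strategy.value {G : ExtGame r Γ Λ κ} (S : G.Strategy) : ℝ :=
  ∑ ω, G.prob ω * ∑ a : ∀ i, Λ (G.ques ω i),
    (S.ρ * (G.acc ω a ⊗ₖ tensor fun i => S.M i (G.ques ω i) (a i))).trace.re

/-- The value of an extended nonlocal game. -/
def value (G : ExtGame r Γ Λ κ) : ℝ := sSup (Set.range fun S : G.Strategy => S.value)

end ExtGame

/-! ### Three-turn quantum multi-prover interactive proofs -/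

/-- The verifier's qubits: those of the private register `V` and those of the message registers
`M_1, …, M_r`. -/
abbrev Wire (qV r qM : ℕ) : Type := Fin qV ⊕ (Fin r × Fin qM)

/-- Hadamard gates, and Toffoli gates with target `u₃`. -/
inductive Gate (q : Type) : Type
  | had (u : q)
  | tof (u₁ u₂ u₃ : q) (h₁₂ : u₁ ≠ u₂) (h₁₃ : u₁ ≠ u₃) (h₂₃ : u₂ ≠ u₃)

/-- The Hadamard matrix. -/
def hadamardMat : Matrix Bool Bool ℂ :=
  Matrix.of fun a b => ((Real.sqrt 2 : ℝ) : ℂ)⁻¹ * if a && b then -1 else 1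

/-- The unitary operator of a gate. -/
def Gate.op {q : Type} [Fintype q] [DecidableEq q] :
    Gate q → Matrix (q → Bool) (q → Bool) ℂ
  | .had u => tensor fun v => if v = u then hadamardMat else 1
  | .tof u₁ u₂ u₃ _ _ _ => Matrix.of fun x y =>
      if x = Function.update y u₃ (xor (y u₃) (y u₁ && y u₂)) then 1 else 0

/-- The unitary operator of a circuit; the first gate of the list is applied first. -/
def circuitOp {q : Type} [Fintype q] [DecidableEq q] (c : List (Gate q)) :
    Matrix (q → Bool) (q → Bool) ℂ :=
  c.foldl (fun U g => g.op * U) 1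

/-- The verifier of an `r`-prover three-turn proof system on one fixed input. -/
structure Verifier (r : ℕ) where
  qV : ℕ
  qM : ℕ
  qV_pos : 0 < qV
  V1 : List (Gate (Wire qV r qM))
  V2 : List (Gate (Wire qV r qM))

namespace Verifier

variable {r : ℕ} (V : Verifier r)

/-- Provers for `V`: prover `i` has a private space of dimension `d i`, `Ψ` is the initial state of
the message registers and the private spaces, and `W i` is applied by prover `i` to `M_i` and to
his private space. -/
structure Provers where
  d : Fin r → ℕ
  Ψ : (Fin r × Fin V.qM → Bool) × (∀ i, Fin (d i)) → ℂ
  Ψ_norm : ∑ x, ‖Ψ x‖ ^ 2 = 1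
  W : ∀ i, Matrix.unitaryGroup ((Fin V.qM → Bool) × Fin (d i)) ℂ

namespace Provers

variable {V} (P : V.Provers)

/-- Basis of the space of all registers. -/
abbrev Idx : Type := (Wire V.qV r V.qM → Bool) × (∀ i, Fin (P.d i))

/-- The initial vector: all qubits of `V` are `0`, the rest is in the state `Ψ`. -/
def initial : P.Idx → ℂ := fun x =>
  if ∀ j, x.1 (Sum.inl j) = false then P.Ψ (fun u => x.1 (Sum.inr u), x.2) else 0

/-- The operator `⊗ᵢ W i`, extended by the identity on `V`. -/
def proverOp : Matrix P.Idx P.Idx ℂ := Matrix.of fun x y =>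
  if ∀ j, x.1 (Sum.inl j) = y.1 (Sum.inl j) then
    ∏ i, (P.W i : Matrix _ _ ℂ) (fun j => x.1 (Sum.inr (i, j)), x.2 i)
      (fun j => y.1 (Sum.inr (i, j)), y.2 i)
  else 0

/-- The state after `V1`, the provers' step and `V2`. -/
def final : P.Idx → ℂ :=
  (circuitOp V.V2 ⊗ₖ (1 : Matrix (∀ i, Fin (P.d i)) (∀ i, Fin (P.d i)) ℂ)) *ᵥ
    (P.proverOp *ᵥ
      ((circuitOp V.V1 ⊗ₖ (1 : Matrix (∀ i, Fin (P.d i)) (∀ i, Fin (P.d i)) ℂ)) *ᵥ P.initial))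

/-- The probability that the first qubit of `V` is measured to be `1` at the end. -/
def acceptProb : ℝ :=
  ∑ x, if x.1 (Sum.inl ⟨0, V.qV_pos⟩) = true then ‖P.final x‖ ^ 2 else 0

end Provers

/-- The maximum acceptance probability. -/
def MAP : ℝ := sSup (Set.range fun P : V.Provers => P.acceptProb)

/-! A verifier as a bit string, with all numbers written in unary. -/

/-- Unary code. -/
def unary (n : ℕ) : List Bool := List.replicate n true ++ [false]

/-- Code of a qubit. -/
def encodeWire {qV r qM : ℕ} : Wire qV r qM → List Bool
  | .inl j => false :: unary j
  | .inr (i, j) => true :: (unary i ++ unary j)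

/-- Code of a gate. -/
def encodeGate {qV r qM : ℕ} : Gate (Wire qV r qM) → List Bool
  | .had u => false :: encodeWire u
  | .tof u₁ u₂ u₃ _ _ _ => true :: (encodeWire u₁ ++ encodeWire u₂ ++ encodeWire u₃)

/-- Code of a circuit. -/
def encodeCircuit {qV r qM : ℕ} (c : List (Gate (Wire qV r qM))) : List Bool :=
  unary c.length ++ c.flatMap encodeGate

/-- Code of a verifier. -/
def encode : List Bool :=
  unary V.qV ++ unary V.qM ++ encodeCircuit V.V1 ++ encodeCircuit V.V2

end Verifier

/-- `f ∈ poly`. -/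
def PolyBounded (f : ℕ → ℕ) : Prop := ∃ p : Polynomial ℕ, ∀ n, f n ≤ p.eval n

/-- `s ∈ 1 - poly⁻¹`. -/
def OneSubInvPoly (s : ℕ → ℝ) : Prop :=
  ∃ p : Polynomial ℕ, ∀ n, 0 < p.eval n ∧ s n ≤ 1 - 1 / ((p.eval n : ℕ) : ℝ)

/-- `V` is the verifier of a proof system that witnesses `A ∈ QMIP*(r, 3, c, s)`.  (The polynomial
bound on the length of the description is implied by its being computable in polynomial time; it
is stated for convenience.) -/
structure WitnessesQMIPStar3 (r : ℕ → ℕ) (c s : ℕ → ℝ) (A : Set (List Bool))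
    (V : (x : List Bool) → Verifier (r x.length)) : Prop where
  polySize : ∃ p : Polynomial ℕ, ∀ x, (V x).encode.length ≤ p.eval x.length
  uniform : Nonempty (Turing.TM2ComputableInPolyTime (id : List Bool → List Bool)
    (id : List Bool → List Bool) fun x => (V x).encode)
  completeness : ∀ x ∈ A, c x.length ≤ (V x).MAP
  soundness : ∀ x ∉ A, (V x).MAP ≤ s x.length

/-! ### Verifiers in normal form

Hadamard gates occur in pairs acting on two qubits of the same register, and both circuits
consist of the same number `L` of elementary steps. -/

/-- An elementary step: two Hadamard gates on qubits of `V`, two Hadamard gates on qubits of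
`M_i`, or a Toffoli gate. -/
inductive Step (qV r qM : ℕ) : Type
  | hadV (j₁ j₂ : Fin qV) (h : j₁ ≠ j₂)
  | hadM (i : Fin r) (j₁ j₂ : Fin qM) (h : j₁ ≠ j₂)
  | tof (u₁ u₂ u₃ : Wire qV r qM) (h₁₂ : u₁ ≠ u₂) (h₁₃ : u₁ ≠ u₃) (h₂₃ : u₂ ≠ u₃)

/-- A verifier in normal form.  The steps of the first and of the second circuit are
`step false` and `step true`. -/
structure NormalVerifier (r : ℕ) where
  qV : ℕ
  qM : ℕ
  L : ℕ
  qV_pos : 0 < qV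
  L_pos : 0 < L
  step : Bool → Fin L → Step qV r qM

namespace Verifier

variable {r : ℕ} (V : Verifier r)

/-- The inclusion of the qubits when two dummy qubits are added to `V` (at the end) and one dummy
qubit is added to each `M_i` (at the end). -/
def padWire : Wire V.qV r V.qM → Wire (V.qV + 2) r (V.qM + 1)
  | .inl j => .inl (j.castAdd 2)
  | .inr (i, j) => .inr (i, j.castSucc)

theorem padWire_injective : Function.Injective V.padWire := by
  rintro (j | ⟨i, j⟩) (j' | ⟨i', j'⟩) h <;> simp_all [padWire]

/-- A Hadamard gate is paired with a Hadamard gate on a dummy qubit of the same register. -/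
def padGate : Gate (Wire V.qV r V.qM) → Step (V.qV + 2) r (V.qM + 1)
  | .had (.inl j) => .hadV (j.castAdd 2) (Fin.natAdd V.qV 0) (by
      intro h; have := congrArg Fin.val h; simp at this; omega)
  | .had (.inr (i, j)) => .hadM i j.castSucc (Fin.last _) (Fin.castSucc_lt_last j).ne
  | .tof u₁ u₂ u₃ h₁₂ h₁₃ h₂₃ => .tof (V.padWire u₁) (V.padWire u₂) (V.padWire u₃)
      (V.padWire_injective.ne h₁₂) (V.padWire_injective.ne h₁₃) (V.padWire_injective.ne h₂₃)

/-- A step on the two dummy qubits of `V`. -/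
def padStep : Step (V.qV + 2) r (V.qM + 1) :=
  .hadV (Fin.natAdd V.qV 0) (Fin.natAdd V.qV 1) (by
    intro h; have := congrArg Fin.val h; simp at this)

/-- The normal form of a verifier: Hadamard gates are doubled with the help of dummy qubits, and
the circuits are brought to the same length by steps on dummy qubits. -/
def normalize : NormalVerifier r where
  qV := V.qV + 2
  qM := V.qM + 1
  L := max 1 (max V.V1.length V.V2.length)
  qV_pos := by omega
  L_pos := by omega
  step b j := (((if b then V.V2 else V.V1).map V.padGate)[(j : ℕ)]?).getD V.padStep

end Verifier

/-! ### Questions -/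

/-- An `XZ`-form Pauli operator on the `m` qubits of one player. -/
abbrev Pauli (m : ℕ) : Type := Fin m → PauliLabel

/-- A question to a player: nothing, one Pauli operator, a set of Pauli operators, or the special
question. -/
inductive Question (m : ℕ) : Type
  | nothing
  | pauli (P : Pauli m)
  | multi (Q : Finset (Pauli m))
  | xap

instance {m : ℕ} : Inhabited (Question m) := ⟨.nothing⟩

/-- The answer to a set `Q` of Pauli operators is a function `Q → {0, 1}`. -/
def Answer {m : ℕ} : Question m → Type
  | .nothing => Unit
  | .pauli _ => Bool
  | .multi Q => Q → Bool
  | .xap => Bool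

instance {m : ℕ} : ∀ g : Question m, Fintype (Answer g)
  | .nothing => inferInstanceAs (Fintype Unit)
  | .pauli _ => inferInstanceAs (Fintype Bool)
  | .multi Q => inferInstanceAs (Fintype (Q → Bool))
  | .xap => inferInstanceAs (Fintype Bool)

/-- The bit that an answer gives for the operator `P`: the answer bit itself if the question is a
single operator, the entry at `P` if the question is a set `Q ∋ P`. -/
def bit {m : ℕ} (P : Pauli m) : (g : Question m) → Answer g → Bool
  | .nothing, _ => false
  | .pauli _, a => a
  | .multi Q, b => if h : P ∈ Q then b ⟨P, h⟩ else false
  | .xap, _ => false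

/-- The answer bit to the special question. -/
def xapBit {m : ℕ} : (g : Question m) → Answer g → Bool
  | .xap, a => a
  | .nothing, _ => false
  | .pauli _, _ => false
  | .multi _, _ => false

/-- Player `i` is asked `g`, the other players nothing. -/
def askOne {r m : ℕ} (i : Fin r) (g : Question m) : Fin r → Question m :=
  fun i' => if i' = i then g else .nothing

/-- Nobody is asked anything. -/
def askNone {r m : ℕ} : Fin r → Question m := fun _ => .nothing

/-- The question that asks for the operators in a list. -/
def askList {m : ℕ} : List (Pauli m) → Question m
  | [] => .nothing
  | [P] => .pauli P
  | l => .multi l.toFinset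

/-! ### The constraint system and its propagation sequence -/

/-- The `XZ`-form Pauli operators of weight at most `k`. -/
def pauliSet (m k : ℕ) : Finset (Pauli m) := Finset.univ.filter fun P => (support P).card ≤ k

open Classical in
/-- The nonempty sets of at most `k` pairwise commuting operators that act on a common set of at
most `k` qubits. -/
def powerSet (m k : ℕ) : Finset (Finset (Pauli m)) := Finset.univ.filter fun Q =>
  Q.Nonempty ∧ Q.card ≤ k ∧ (∀ P ∈ Q, ∀ P' ∈ Q, Commute (pauliOp P) (pauliOp P')) ∧
    ∃ J : Finset (Fin m), J.card ≤ k ∧ ∀ P ∈ Q, support P ⊆ J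

/-- The control qubits: two for each qubit of each player, the first (`false`) for `X` and the
second (`true`) for `Z`. -/
abbrev Ctrl (r m : ℕ) : Type := Fin r × Fin m × Bool

/-- The symbols for reflections: the reflection `P` of player `i`, the controlled reflection
`Λ_c(P)` of player `i`, and the derived reflection `P|Q` of player `i`. -/
inductive Refl (r m : ℕ) : Type
  | refl (i : Fin r) (P : Pauli m)
  | ctrl (c : Ctrl r m) (i : Fin r) (P : Pauli m)
  | derived (i : Fin r) (Q : Finset (Pauli m)) (P : Pauli m)

/-- The reflection `D_u` of player `i`. -/
def one {r m : ℕ} (i : Fin r) (u : Fin m) (D : PauliLabel) : Refl r m := .refl i (single u D)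

/-- A constraint: the product of the reflections in the list is `(-1)^τ`. -/
abbrev Constraint (r m : ℕ) : Type := List (Refl r m) × Bool

/-- The labels `X` and `Z`. -/
def xz : List PauliLabel := [.X, .Z]

/-- The `(m, k)`-constraint system for the reflections of player `i`. -/
def playerConstraints (m k : ℕ) {r : ℕ} (i : Fin r) : List (Constraint r m) :=
  ((List.finRange m).flatMap fun u => ((List.finRange m).filter fun v => v ≠ u).flatMap fun v =>
    xz.flatMap fun D => xz.map fun E =>
      ([one i u D, one i v E, one i u D, one i v E], false)) ++
  ((List.finRange m).map fun u =>
      ([one i u .X, one i u .Z, one i u .X, one i u .Z], true)) ++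
  ((List.finRange m).flatMap fun u => (List.finRange m).flatMap fun v => xz.map fun D =>
      ([one i v D, one i u .X, one i u .Z, one i u .X, one i u .Z, one i v D], true)) ++
  ((pauliSet m k).toList.map fun P =>
      (Refl.refl i P :: (support P).toList.map fun v => one i v (P v), false)) ++
  ((powerSet m k).toList.flatMap fun Q => Q.toList.map fun P =>
      ([Refl.derived i Q P, Refl.refl i P], false))

/-- The union of the constraint systems of the `r` players. -/
def constraints (k r m : ℕ) : List (Constraint r m) :=
  (List.finRange r).flatMap fun i => playerConstraints m k i

/-- The sequence `𝔙` of all reflections in the constraints. -/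
def seqV (k r m : ℕ) : List (Refl r m) := (constraints k r m).flatMap Prod.fst

/-- The sequence `𝔚`. -/
def seqW (k r m : ℕ) : List (Refl r m) :=
  (List.finRange r).flatMap fun i => (List.finRange m).flatMap fun u =>
    seqV k r m ++ [Refl.ctrl (i, u, false) i (single u .X)] ++
      (seqV k r m ++ [Refl.ctrl (i, u, true) i (single u .Z)])

/-- All lists of length at most `k` with entries from `l`, the empty list first. -/
def listsUpTo {α : Type} (l : List α) : ℕ → List (List α)
  | 0 => [[]]
  | k + 1 => [] :: (listsUpTo l k).flatMap fun w => l.map fun a => a :: w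

/-- The primitive sequences. -/
def primitives (k r m : ℕ) : List (List (Refl r m)) :=
  listsUpTo ((List.finRange r).flatMap fun i => (List.finRange m).flatMap fun u =>
    xz.map fun D => one i u D) k

/-- The derived sequences: the empty sequence, and the nonempty sequences over one set `Q`. -/
def derivedSeqs (k r m : ℕ) : List (List (Refl r m)) :=
  [] :: (List.finRange r).flatMap fun i => (powerSet m k).toList.flatMap fun Q =>
    (listsUpTo (Q.toList.map fun P => Refl.derived i Q P) k).tail

/-- The sequences `𝔔_l`: a primitive sequence followed by a derived sequence; the first of them is
empty. -/
def seqQ (k r m : ℕ) : List (List (Refl r m)) :=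
  (primitives k r m).flatMap fun w => (derivedSeqs k r m).map fun w' => w ++ w'

/-- The sequence `𝔘_l` for a given `𝔔_l`. -/
def blockU (k r m : ℕ) (w : List (Refl r m)) : List (Refl r m) :=
  w ++ seqW k r m ++ (seqW k r m).reverse ++ w.reverse

/-- The sequence `𝔘`. -/
def seqU (k r m : ℕ) : List (Refl r m) := (seqQ k r m).flatMap (blockU k r m)

/-- The vertex at which the `j`-th constraint ends (or, with `j` replaced by `j - 1`, starts) in the
`i`-th occurrence of `𝔙` in the first occurrence of `𝔚` in `𝔘_l` (with `i` and `l` counted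
from `0`). -/
def consVertex (k r m : ℕ) (i l j : ℕ) : ℕ :=
  (((seqQ k r m).take l).map fun w => (blockU k r m w).length).sum +
    ((seqQ k r m)[l]?.getD []).length + i * ((seqV k r m).length + 1) +
    (((constraints k r m).take j).map fun C => C.1.length).sum

/-! ### The extended nonlocal game -/

/-- The qubits of the referee. -/
inductive RefQubit (N T qV r m : ℕ) : Type
  | S (t : Fin N)
  | X (c : Ctrl r m)
  | C (t : Fin T)
  | V (j : Fin qV)
  deriving DecidableEq, Fintype

section clock

variable {q : Type} [Fintype q] [DecidableEq q] {N : ℕ} (e : Fin N → q)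

/-- The measurement of `D` on the `t`-th qubit (counted from `1`) of a unary clock register with
qubits `e`.  The outcome is always `1` for `t = 0` and always `0` for `t > N`. -/
def clockMeas (D : PauliLabel) (t : ℕ) : Meas (q → Bool) Bool :=
  if h : 1 ≤ t ∧ t ≤ N then Meas.pauli (single (e ⟨t - 1, by omega⟩) D)
  else Meas.const (decide (t = 0))

/-- The value of the `t`-th qubit of the clock in a basis state, with the same convention. -/
def clockBit (x : q → Bool) (t : ℕ) : Bool :=
  if h : 1 ≤ t ∧ t ≤ N then x (e ⟨t - 1, by omega⟩) else decide (t = 0)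

/-- The basis states in which the qubits `t₁` and `t₂ + 1` of the clock are `1` and `0`, and the
qubits `t₁ + 1, …, t₂` are all equal. -/
def EdgeSpace (t₁ t₂ : ℕ) (x : q → Bool) : Prop :=
  clockBit e x t₁ = true ∧ clockBit e x (t₂ + 1) = false ∧
    ∀ t t', t₁ < t → t ≤ t₂ → t₁ < t' → t' ≤ t₂ → clockBit e x t = clockBit e x t'

open Classical in
/-- The label of the operator `X` on all the clock qubits `t₁ + 1, …, t₂`. -/
def edgeLabel (t₁ t₂ : ℕ) : q → PauliLabel := fun u =>
  if ∃ j : Fin N, e j = u ∧ t₁ < (j : ℕ) + 1 ∧ (j : ℕ) + 1 ≤ t₂ then .X else .I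

/-- The measurement `Π_e` for the edge `e = (t₁, t₂)`.  Let `D` be the projection onto the span of
the basis states in `EdgeSpace` and let `F` be `X` on the qubits `t₁ + 1, …, t₂`, which commutes
with `D`.  Then `Π_e^a = D (1 + (-1)^a F) / 2` for `a = 0, 1` (outcome `(true, a)`), and
`Π_e^2 = 1 - D` (outcomes `(false, _)`). -/
def edgeMeas (t₁ t₂ : ℕ) : Meas (q → Bool) (Bool × Bool) :=
  (Meas.indicator (EdgeSpace e t₁ t₂)).seq (Meas.pauli (edgeLabel e t₁ t₂))

end clock

namespace NormalVerifier

variable {r : ℕ} (W : NormalVerifier r) (k : ℕ)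

/-- The number of qubits `B_i, M_i` of a player; the first one is `B_i`. -/
abbrev m : ℕ := W.qM + 1

/-- The number of time steps. -/
abbrev T : ℕ := 2 * W.L + 1

/-- The number of qubits of the clock register `S`. -/
abbrev N : ℕ := (seqU k r W.m).length

/-- The qubits of the referee. -/
abbrev Ref : Type := RefQubit (W.N k) W.T W.qV r W.m

/-- Games with these registers and questions. -/
abbrev Game : Type 1 := ExtGame r (Question W.m) Answer (W.Ref k → Bool)

/-- Measurement of `D` on the `t`-th qubit of `C`. -/
def cMeas (D : PauliLabel) (t : ℕ) : Meas (W.Ref k → Bool) Bool := clockMeas RefQubit.C D t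

/-- Measurement of `D` on the `t`-th qubit of `S`. -/
def sMeas (D : PauliLabel) (t : ℕ) : Meas (W.Ref k → Bool) Bool := clockMeas RefQubit.S D t

/-- Measurement of `D` on a qubit of `V`. -/
def vMeas (D : PauliLabel) (j : Fin W.qV) : Meas (W.Ref k → Bool) Bool :=
  Meas.pauli (single (RefQubit.V j) D)

/-- The operator `D` on the qubit `B_i` of a player. -/
def onB (D : PauliLabel) : Pauli W.m := single 0 D

/-- The operator `D` on the `j`-th qubit of `M_i`. -/
def onM (D : PauliLabel) (j : Fin W.qM) : Pauli W.m := single j.succ D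

/-! #### The game for honest players -/

/-- Clock check of the game for honest players. -/
def honestClock : W.Game k :=
  ExtGame.mix fun b : Bool => if b then
    ExtGame.mix fun i : Fin r =>
      ExtGame.leaf (askOne i (.pauli (W.onB .Z))) (W.cMeas k .Z (W.L + 1))
        fun a o => o = bit (W.onB .Z) _ (a i)
  else
    ExtGame.mix fun t : Fin (W.T - 1) =>
      ExtGame.leaf askNone ((W.cMeas k .Z (t + 1)).seq (W.cMeas k .Z (t + 2)))
        fun _ o => ¬ (o.1 = false ∧ o.2 = true)

/-- Measurement of `Z` on the qubits `t - 1` and `t + 1` of `C`. -/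
def window (t : ℕ) : Meas (W.Ref k → Bool) (Bool × Bool) :=
  (W.cMeas k .Z (t - 1)).seq (W.cMeas k .Z (t + 1))

/-- Measurement of `D` on `u` by the referee, if `u` is a qubit of `V`. -/
def wireMeas (D : PauliLabel) : Wire W.qV r W.qM → Meas (W.Ref k → Bool) Bool
  | .inl j => W.vMeas k D j
  | .inr _ => Meas.const false

/-- The outcome of the measurement of `D` on `u`: the referee's outcome `o` if `u` is a qubit of
`V`, otherwise taken from the answer of the player who has `u`. -/
def wireBit (D : PauliLabel) {ques : Fin r → Question W.m} (a : ∀ i, Answer (ques i)) (o : Bool) :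
    Wire W.qV r W.qM → Bool
  | .inl _ => o
  | .inr (i, j) => bit (W.onM D j) _ (a i)

/-- The operators in the list that concern player `i`. -/
def playerOps (i : Fin r) (l : List (PauliLabel × Wire W.qV r W.qM)) : List (Pauli W.m) :=
  l.filterMap fun p => match p.2 with
    | .inl _ => none
    | .inr (i', j) => if i' = i then some (W.onM p.1 j) else none

/-- The check of the propagation of a step at time `t`.  The outcomes `z` are those of `Z` on the
qubits `t - 1` and `t + 1` of `C`, and `x` is that of `X` on the qubit `t` of `C`. -/
def stepCheck (t : ℕ) : Step W.qV r W.qM → W.Game k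
  | .hadV j₁ j₂ _ => ExtGame.mix fun j : Bool =>
      ExtGame.leaf askNone
        ((((W.window k t).seq (W.cMeas k .X t)).seq
          (Meas.pauli (pair (RefQubit.V j₁) .X (RefQubit.V j₂) (if j then .Z else .X)))).seq
          (Meas.pauli (pair (RefQubit.V j₁) .Z (RefQubit.V j₂) (if j then .X else .Z))))
        fun _ ⟨⟨⟨z, x⟩, a₁⟩, a₂⟩ =>
          ¬ (z = (true, false) ∧ xor x a₁ = true ∧ xor x a₂ = true)
  | .hadM i j₁ j₂ _ => ExtGame.mix fun j : Bool =>
      let P₁ : Pauli W.m := pair j₁.succ .X j₂.succ (if j then .Z else .X)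
      let P₂ : Pauli W.m := pair j₁.succ .Z j₂.succ (if j then .X else .Z)
      ExtGame.leaf (askOne i (.multi {P₁, P₂})) ((W.window k t).seq (W.cMeas k .X t))
        fun a ⟨z, x⟩ =>
          ¬ (z = (true, false) ∧ xor x (bit P₁ _ (a i)) = true ∧ xor x (bit P₂ _ (a i)) = true)
  | .tof u₁ u₂ u₃ _ _ _ => ExtGame.mix fun j : Bool => if j then ExtGame.accepting else
      ExtGame.leaf (fun i => askList (W.playerOps i [(.Z, u₁), (.Z, u₂), (.X, u₃)]))
        (((((W.window k t).seq (W.cMeas k .X t)).seq (W.wireMeas k .Z u₁)).seq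
          (W.wireMeas k .Z u₂)).seq (W.wireMeas k .X u₃))
        fun a ⟨⟨⟨⟨z, x⟩, o₁⟩, o₂⟩, o₃⟩ =>
          ¬ (z = (true, false) ∧
            if W.wireBit .Z a o₁ u₁ = true ∧ W.wireBit .Z a o₂ u₂ = true
            then xor x (W.wireBit .X a o₃ u₃) = true else x = true)

/-- Verifier propagation check: the steps of the first circuit are those at the times
`1, …, L`, and the steps of the second circuit are those at the times `L + 2, …, T`. -/
def verifierProp : W.Game k :=
  ExtGame.mix fun p : Bool × Fin W.L =>
    W.stepCheck k (if p.1 then W.L + 2 + p.2 else 1 + p.2) (W.step p.1 p.2)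

/-- Prover propagation check. -/
def proverProp : W.Game k :=
  ExtGame.leaf (fun _ => .xap) ((W.window k (W.L + 1)).seq (W.cMeas k .X (W.L + 1)))
    fun a ⟨z, x⟩ => z = (true, false) →
      x = decide (Odd (Finset.univ.filter fun i => xapBit _ (a i) = true).card)

/-- Initialization check of the game for honest players. -/
def honestInit : W.Game k :=
  ExtGame.mix fun j : Fin W.qV =>
    ExtGame.leaf askNone ((W.cMeas k .Z 1).seq (W.vMeas k .Z j))
      fun _ o => o.1 = true ∨ o.2 = false

/-- Output check of the game for honest players. -/
def honestOutput : W.Game k :=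
  ExtGame.leaf askNone ((W.cMeas k .Z W.T).seq (W.vMeas k .Z ⟨0, W.qV_pos⟩))
    fun _ o => o.1 = false ∨ o.2 = true

/-- The game for honest players, as played by the referee. -/
def honestGame : W.Game k :=
  ExtGame.mix fun c : Fin 5 =>
    ![W.honestClock k, W.verifierProp k, W.proverProp k, W.honestInit k, W.honestOutput k] c

/-! #### The constraint propagation game -/

/-- The measurement `Π_e` on `S` for an edge `e = (t₁, t₂)`. -/
def sEdge (t₁ t₂ : ℕ) : Meas (W.Ref k → Bool) (Bool × Bool) := edgeMeas RefQubit.S t₁ t₂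

/-- The check of the propagation of one reflection along the edge `(t - 1, t)`.  The outcome `o`
is that of `Π_e`, and `b` is that of `Z` on the control qubit. -/
def reflCheck (t : ℕ) : Refl r W.m → W.Game k
  | .refl i P => ExtGame.leaf (askOne i (.pauli P)) (W.sEdge k (t - 1) t)
      fun a o => o.1 = false ∨ o.2 = bit P _ (a i)
  | .ctrl c i P => ExtGame.leaf (askOne i (.pauli P))
      ((W.sEdge k (t - 1) t).seq (Meas.pauli (single (RefQubit.X c) .Z)))
      fun a ⟨o, b⟩ => o.1 = false ∨
        ¬ ((b = false ∧ o.2 = true) ∨ (b = true ∧ xor (bit P _ (a i)) o.2 = true))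
  | .derived i Q P => ExtGame.leaf (askOne i (.multi Q)) (W.sEdge k (t - 1) t)
      fun a o => o.1 = false ∨ o.2 = bit P _ (a i)

/-- Propagation check. -/
def propCheck : W.Game k :=
  ExtGame.mix fun t : Fin (W.N k) => W.reflCheck k (t + 1) ((seqU k r W.m).get t)

/-- Initialization check. -/
def initCheck : W.Game k :=
  ExtGame.mix fun c : Ctrl r W.m =>
    ExtGame.leaf askNone
      ((Meas.indicator fun x : W.Ref k → Bool => ∀ t, x (RefQubit.S t) = false).seq
        (Meas.pauli (single (RefQubit.X c) .X)))
      fun _ o => o.1 = false ∨ o.2 = false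

/-- Constraint check. -/
def consCheck : W.Game k :=
  ExtGame.mix fun p : Fin (2 * (r * W.m)) × Fin (seqQ k r W.m).length ×
      Fin (constraints k r W.m).length =>
    ExtGame.leaf askNone
      (W.sEdge k (consVertex k r W.m p.1 p.2.1 p.2.2) (consVertex k r W.m p.1 p.2.1 (p.2.2 + 1)))
      fun _ o => o.1 = false ∨ o.2 = ((constraints k r W.m).get p.2.2).2

/-- The constraint propagation game with `r` players. -/
def consPropGame : W.Game k :=
  ExtGame.mix fun c : Fin 3 => ![W.propCheck k, W.initCheck k, W.consCheck k] c

/-! #### The extended nonlocal game -/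

/-- Clock check for the register `S`. -/
def clockCheck : W.Game k :=
  ExtGame.mix fun t : Fin (W.N k - 1) =>
    ExtGame.leaf askNone ((W.sMeas k .Z (t + 1)).seq (W.sMeas k .Z (t + 2)))
      fun _ o => ¬ (o.1 = false ∧ o.2 = true)

/-- Output check. -/
def outputCheck : W.Game k := ExtGame.guarded (W.sMeas k .Z 1) (W.honestGame k)

/-- The extended nonlocal game of a verifier in normal form. -/
def extendedGame : W.Game k :=
  ExtGame.mix fun c : Fin 3 => ![W.clockCheck k, W.consPropGame k, W.outputCheck k] c

end NormalVerifier

/-- The extended nonlocal game of a verifier. -/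
def Verifier.extendedGame {r : ℕ} (V : Verifier r) (k : ℕ) : V.normalize.Game k :=
  V.normalize.extendedGame k

end

end QGame

open Matrix
open scoped Kronecker ComplexOrder

namespace QGame

noncomputable section

set_option linter.unusedSectionVars false

open Function (Injective update update_of_ne extend_apply' extend update_self)
open Finset (sum_congr mul_sum mem_univ sum_le_sum sum_mul sum_comm mem_filter)
open List (mem_flatMap mem_map mem_append)
open RefQubit (S C)

/-- Complex square matrices. -/
notation "Mat" J:max => Matrix J J ℂ

/-! ### Norms of vectors -/

section Norm

variable {J I : Type} [Fintype J] [Fintype I]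

/-- The Euclidean norm of a vector. -/
def nrm (v : J → ℂ) : ℝ := ‖(WithLp.toLp 2 v : EuclideanSpace ℂ J)‖

theorem nrm_nonneg (v : J → ℂ) : 0 ≤ nrm v := norm_nonneg _

theorem nrm_sq (v : J → ℂ) : nrm v ^ 2 = ∑ x, ‖v x‖ ^ 2 := EuclideanSpace.norm_sq_eq _

theorem nrm_zero : nrm (0 : J → ℂ) = 0 := by simp [nrm]

theorem nrm_add_le (v w : J → ℂ) : nrm (v + w) ≤ nrm v + nrm w := by
  simpa [nrm] using norm_add_le (WithLp.toLp 2 v : EuclideanSpace ℂ J) (WithLp.toLp 2 w)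

theorem nrm_sub_comm (v w : J → ℂ) : nrm (v - w) = nrm (w - v) := by
  simpa [nrm] using norm_sub_rev (WithLp.toLp 2 v : EuclideanSpace ℂ J) (WithLp.toLp 2 w)

theorem nrm_smul (c : ℂ) (v : J → ℂ) : nrm (c • v) = ‖c‖ * nrm v := by
  simpa [nrm] using norm_smul c (WithLp.toLp 2 v : EuclideanSpace ℂ J)

theorem nrm_neg (v : J → ℂ) : nrm (-v) = nrm v := by
  simp [nrm]

theorem nrm_sub_trans (u v w : J → ℂ) : nrm (u - w) ≤ nrm (u - v) + nrm (v - w) := by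
  simpa using nrm_add_le (u - v) (v - w)

theorem nrm_le_add_sub (u v : J → ℂ) : nrm u ≤ nrm v + nrm (u - v) := by
  simpa using nrm_add_le v (u - v)

theorem nrm_sum_le {ι : Type} (s : Finset ι) (f : ι → J → ℂ) :
    nrm (∑ i ∈ s, f i) ≤ ∑ i ∈ s, nrm (f i) := by
  classical
  induction s using Finset.induction_on with
  | empty => simp [nrm_zero]
  | insert a s ha ih =>
    rw [Finset.sum_insert ha, Finset.sum_insert ha]
    exact (nrm_add_le _ _).trans (by gcongr)

theorem nrm_eq_zero {v : J → ℂ} : nrm v = 0 ↔ v = 0 := by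
  simp [nrm]

theorem nrm_sq_eq_re (v : J → ℂ) : nrm v ^ 2 = (star v ⬝ᵥ v).re := by
  rw [nrm_sq, dotProduct, Complex.re_sum]
  refine sum_congr rfl fun x _ => ?_
  simp only [Pi.star_apply, RCLike.star_def]
  rw [← Complex.normSq_eq_norm_sq, ← Complex.normSq_eq_conj_mul_self, Complex.ofReal_re]

theorem nrm_mulVec_sq (A : Matrix J I ℂ) (v : I → ℂ) :
    nrm (A *ᵥ v) ^ 2 = (star v ⬝ᵥ ((Aᴴ * A) *ᵥ v)).re := by
  rw [nrm_sq_eq_re, star_mulVec, ← mulVec_mulVec, dotProduct_mulVec, dotProduct_mulVec,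
    dotProduct_mulVec]

theorem nrm_sq_sum_of_complete [DecidableEq J] {Ω : Type} [Fintype Ω] (F : Ω → Mat J)
    (hF : ∑ ω, (F ω)ᴴ * F ω = 1) (v : J → ℂ) : ∑ ω, nrm (F ω *ᵥ v) ^ 2 = nrm v ^ 2 := by
  simp only [nrm_mulVec_sq]
  rw [← Complex.re_sum, ← dotProduct_sum, ← sum_mulVec, hF, one_mulVec, nrm_sq_eq_re]

/-- Contractions. -/
def Ctr (A : Mat J) : Prop := ∀ v, nrm (A *ᵥ v) ≤ nrm v

theorem Ctr.mul {A B : Mat J} (hA : Ctr A) (hB : Ctr B) : Ctr (A * B) := fun v => by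
  rw [← mulVec_mulVec]; exact (hA _).trans (hB _)

theorem mulVec_ext {A B : Mat J} (h : ∀ v z, (A *ᵥ v) z = (B *ᵥ v) z) : A = B :=
  mulVec_injective (funext fun v => funext (h v))

theorem commute_mulVec {A B : Mat J} (h : Commute A B) (v : J → ℂ) :
    A *ᵥ (B *ᵥ v) = B *ᵥ (A *ᵥ v) := by
  rw [mulVec_mulVec, h.eq, ← mulVec_mulVec]

variable [DecidableEq J]

theorem nrm_isometry {A : Mat J} (hA : Aᴴ * A = 1) (v : J → ℂ) :
    nrm (A *ᵥ v) = nrm v := by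
  have h : nrm (A *ᵥ v) ^ 2 = nrm v ^ 2 := by
    rw [nrm_mulVec_sq, hA, one_mulVec, nrm_sq_eq_re]
  exact (pow_left_inj₀ (nrm_nonneg _) (nrm_nonneg _) two_ne_zero).1 h

theorem Ctr.of_isometry {A : Mat J} (hA : Aᴴ * A = 1) : Ctr A := fun v =>
  (nrm_isometry hA v).le

/-- Reflections. -/
structure IsRefl (R : Mat J) : Prop where
  star_eq : Rᴴ = R
  mul_self : R * R = 1

theorem IsRefl.isometry {R : Mat J} (h : IsRefl R) : Rᴴ * R = 1 := by
  rw [h.star_eq, h.mul_self]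

theorem IsRefl.nrm {R : Mat J} (h : IsRefl R) (v : J → ℂ) : nrm (R *ᵥ v) = nrm v :=
  nrm_isometry h.isometry v

theorem IsRefl.ctr {R : Mat J} (h : IsRefl R) : Ctr R := Ctr.of_isometry h.isometry

theorem IsRefl.mulVec_mulVec {R : Mat J} (h : IsRefl R) (v : J → ℂ) :
    R *ᵥ (R *ᵥ v) = v := by
  rw [Matrix.mulVec_mulVec, h.mul_self, one_mulVec]

theorem IsRefl.one : IsRefl (1 : Mat J) := ⟨by simp, by simp⟩

theorem IsRefl.neg {R : Mat J} (h : IsRefl R) : IsRefl (-R) :=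
  ⟨by simp [h.star_eq], by simp [h.mul_self]⟩

theorem IsRefl.mul {R R' : Mat J} (h : IsRefl R) (h' : IsRefl R') (hc : Commute R R') :
    IsRefl (R * R') :=
  ⟨by rw [conjTranspose_mul, h.star_eq, h'.star_eq, hc.eq], by
    rw [mul_assoc, ← mul_assoc R', ← hc.eq, mul_assoc R, h'.mul_self, mul_one, h.mul_self]⟩

/-- The projection `(1 + R) / 2` is a contraction. -/
theorem IsRefl.half_add_ctr {R : Mat J} (h : IsRefl R) :
    Ctr ((1 / 2 : ℂ) • (1 + R)) := fun v => by
  rw [smul_mulVec, add_mulVec, one_mulVec, nrm_smul]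
  have := nrm_add_le v (R *ᵥ v)
  rw [h.nrm] at this
  have h2 : ‖(1 / 2 : ℂ)‖ = 1 / 2 := by norm_num
  rw [h2]; linarith

theorem IsRefl.half_sub_ctr {R : Mat J} (h : IsRefl R) :
    Ctr ((1 / 2 : ℂ) • (1 - R)) := by
  simpa [sub_eq_add_neg] using h.neg.half_add_ctr

theorem Ctr.diagonal {p : J → ℂ} (hp : ∀ x, ‖p x‖ ≤ 1) : Ctr (Matrix.diagonal p) := fun v => by
  have h : nrm (Matrix.diagonal p *ᵥ v) ^ 2 ≤ nrm v ^ 2 := by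
    rw [nrm_sq, nrm_sq]
    refine sum_le_sum fun x _ => ?_
    rw [mulVec_diagonal, norm_mul]
    gcongr
    exact mul_le_of_le_one_left (norm_nonneg _) (hp x)
  exact (pow_le_pow_iff_left₀ (nrm_nonneg _) (nrm_nonneg _) two_ne_zero).1 h

theorem Ctr.sub_le {A : Mat J} (hA : Ctr A) (v w : J → ℂ) :
    nrm (A *ᵥ v - A *ᵥ w) ≤ nrm (v - w) := by
  rw [← mulVec_sub]; exact hA _

end Norm

/-! ### Lenses: factors of a space, and operators acting on a factor -/

/-- A factor `A` of the index set `J`. -/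
structure Lens (J A : Type) where
  get : J → A
  set : J → A → J
  get_set : ∀ z a, get (set z a) = a
  set_get : ∀ z, set z (get z) = z
  set_set : ∀ z a b, set (set z a) b = set z b

namespace Lens

variable {J A B : Type}

/-- Two lenses that concern different factors. -/
structure Indep (L : Lens J A) (L' : Lens J B) : Prop where
  get_left : ∀ z b, L.get (L'.set z b) = L.get z
  get_right : ∀ z a, L'.get (L.set z a) = L'.get z
  comm : ∀ z a b, L.set (L'.set z b) a = L'.set (L.set z a) b

theorem Indep.symm {L : Lens J A} {L' : Lens J B} (h : L.Indep L') : L'.Indep L :=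
  ⟨h.get_right, h.get_left, fun z a b => (h.comm z b a).symm⟩

/-- Composition of lenses. -/
def comp (L : Lens J A) (L' : Lens A B) : Lens J B where
  get z := L'.get (L.get z)
  set z b := L.set z (L'.set (L.get z) b)
  get_set z b := by rw [L.get_set, L'.get_set]
  set_get z := by rw [L'.set_get, L.set_get]
  set_set z a b := by rw [L.get_set, L.set_set, L'.set_set]

theorem Indep.comp_left {C : Type} {L : Lens J A} {L' : Lens J B} (h : L.Indep L') (l : Lens A C) :
    (L.comp l).Indep L' :=
  ⟨fun z b => by simp [comp, h.get_left], fun z a => by simp [comp, h.get_right],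
    fun z a b => by simp [comp, h.get_left, h.comm]⟩

theorem Indep.comp_right {C : Type} {L : Lens J A} {L' : Lens J B} (h : L.Indep L')
    (l : Lens B C) : L.Indep (L'.comp l) := (h.symm.comp_left l).symm

theorem Indep.comp_comp {C D : Type} {L : Lens J A} {l : Lens A C} {l' : Lens A D}
    (h : l.Indep l') : (L.comp l).Indep (L.comp l') :=
  ⟨fun z b => by simp [comp, L.get_set, h.get_left],
    fun z b => by simp [comp, L.get_set, h.get_right],
    fun z a b => by simp [comp, L.get_set, L.set_set, h.comm]⟩

/-- The first factor of a product. -/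
def fst : Lens (A × B) A := ⟨Prod.fst, fun z a => (a, z.2), fun _ _ => rfl, fun _ => rfl,
  fun _ _ _ => rfl⟩

/-- The second factor of a product. -/
def snd : Lens (A × B) B := ⟨Prod.snd, fun z b => (z.1, b), fun _ _ => rfl, fun _ => rfl,
  fun _ _ _ => rfl⟩

theorem fst_indep_snd : (fst : Lens (A × B) A).Indep snd :=
  ⟨fun _ _ => rfl, fun _ _ => rfl, fun _ _ _ => rfl⟩

/-- A coordinate of a function. -/
def coord {ι : Type} [DecidableEq ι] {d : ι → Type} (i : ι) : Lens (∀ i, d i) (d i) where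
  get x := x i
  set x a := update x i a
  get_set x a := by simp
  set_get x := by simp
  set_set x a b := by simp

theorem coord_indep {ι : Type} [DecidableEq ι] {d : ι → Type} {i j : ι} (h : i ≠ j) :
    (coord i : Lens (∀ i, d i) (d i)).Indep (coord j) :=
  ⟨fun z b => by simp [coord, update_of_ne h],
    fun z b => by simp [coord, update_of_ne h.symm],
    fun z a b => by simp [coord, Function.update_comm h]⟩

variable [Fintype J] [Fintype A] [DecidableEq J] [Fintype B]

/-- The matrix on `J` that acts as `M` on the factor `A`. -/
def mat (L : Lens J A) (M : Mat A) : Mat J :=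
  Matrix.of fun z z' => if L.set z (L.get z') = z' then M (L.get z) (L.get z') else 0

theorem mat_conjTranspose (L : Lens J A) (M : Mat A) : (L.mat M)ᴴ = L.mat Mᴴ := by
  ext z z'
  have h : L.set z' (L.get z) = z ↔ L.set z (L.get z') = z' := by
    constructor <;> intro h <;> rw [← h] <;> simp [L.set_set, L.set_get]
  simp only [mat, conjTranspose_apply, of_apply, h]
  split_ifs <;> simp

theorem mat_mulVec (L : Lens J A) (M : Mat A) (v : J → ℂ) (z : J) :
    (L.mat M *ᵥ v) z = ∑ a, M (L.get z) a * v (L.set z a) := by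
  classical
  simp only [mulVec, dotProduct, mat, of_apply, ite_mul, zero_mul]
  rw [← Finset.sum_filter]
  refine (Finset.sum_nbij' (fun a => L.set z a) L.get ?_ ?_ ?_ ?_ ?_).symm
  · intro a _; simp [L.get_set]
  · simp
  · intro a _; simp [L.get_set]
  · intro z' h; simpa using h
  · intro a _; simp [L.get_set]

variable [DecidableEq A] [DecidableEq B]

/-- The action of matrices on `A` on the space `J`, as a homomorphism. -/
def op (L : Lens J A) : Mat A →⋆ₐ[ℂ] Mat J where
  toFun := L.mat
  map_one' := by
    refine mulVec_ext fun v z => ?_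
    rw [mat_mulVec, one_mulVec]
    simp [Matrix.one_apply, L.set_get]
  map_mul' M N := by
    refine mulVec_ext fun v z => ?_
    rw [← mulVec_mulVec, mat_mulVec, mat_mulVec]
    simp only [mat_mulVec, L.get_set, L.set_set, Matrix.mul_apply, sum_mul, mul_sum,
      mul_assoc]
    rw [sum_comm]
  map_zero' := by ext; simp [mat]
  map_add' M N := by
    ext z z'
    simp only [mat, of_apply, Matrix.add_apply]
    split_ifs <;> simp
  commutes' c := by
    refine mulVec_ext fun v z => ?_
    rw [mat_mulVec]
    simp [Matrix.algebraMap_matrix_apply, L.set_get, Algebra.algebraMap_eq_smul_one, smul_mulVec]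
  map_star' M := by
    rw [star_eq_conjTranspose, star_eq_conjTranspose, mat_conjTranspose]

theorem op_mulVec (L : Lens J A) (M : Mat A) (v : J → ℂ) (z : J) :
    (L.op M *ᵥ v) z = ∑ a, M (L.get z) a * v (L.set z a) := L.mat_mulVec M v z

theorem op_apply (L : Lens J A) (M : Mat A) (z z' : J) :
    L.op M z z' = if L.set z (L.get z') = z' then M (L.get z) (L.get z') else 0 := rfl

theorem op_conjTranspose (L : Lens J A) (M : Mat A) : (L.op M)ᴴ = L.op Mᴴ :=
  L.mat_conjTranspose M

theorem op_isRefl (L : Lens J A) {M : Mat A} (h : IsRefl M) : IsRefl (L.op M) :=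
  ⟨by rw [op_conjTranspose, h.star_eq], by rw [← map_mul, h.mul_self, map_one]⟩

theorem op_commute {L : Lens J A} {L' : Lens J B} (h : L.Indep L') (M : Mat A)
    (N : Mat B) : Commute (L.op M) (L'.op N) := by
  refine mulVec_ext fun v z => ?_
  rw [← mulVec_mulVec, ← mulVec_mulVec, op_mulVec, op_mulVec]
  simp only [op_mulVec, h.get_left, h.get_right, h.comm, mul_sum]
  rw [sum_comm]
  refine sum_congr rfl fun b _ => sum_congr rfl fun a _ => by ring

theorem op_comp (L : Lens J A) (L' : Lens A B) (M : Mat B) :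
    (L.comp L').op M = L.op (L'.op M) := by
  refine mulVec_ext fun v z => ?_
  rw [op_mulVec, op_mulVec]
  simp only [op_apply, ite_mul, zero_mul]
  rw [← Finset.sum_filter]
  refine Finset.sum_nbij' (fun b => L'.set (L.get z) b) L'.get ?_ ?_ ?_ ?_ ?_
  · intro a _; simp [L'.get_set]
  · simp
  · intro a _; simp [L'.get_set]
  · intro z' h; simpa using h
  · intro a _; simp [L'.get_set, comp]

/-- A diagonal operator whose entries do not depend on the factor `A` commutes with the operators
on `A`. -/
theorem diagonal_commute (L : Lens J A) {p : J → ℂ} (hp : ∀ z a, p (L.set z a) = p z)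
    (M : Mat A) : Commute (Matrix.diagonal p) (L.op M) := by
  refine mulVec_ext fun v z => ?_
  rw [← mulVec_mulVec, ← mulVec_mulVec, mulVec_diagonal, op_mulVec, op_mulVec, mul_sum]
  refine sum_congr rfl fun a _ => ?_
  rw [mulVec_diagonal, hp]; ring

/-- The operators on a factor, seen on a subset of `J` that is compatible with that factor. -/
theorem op_mulVec_comp {I A' : Type} [Fintype I] [DecidableEq I] [Fintype A'] [DecidableEq A']
    (L : Lens J A) (L' : Lens I A') (f : I → J) (e : A' ≃ A)
    (hget : ∀ z, L.get (f z) = e (L'.get z)) (hset : ∀ z a, L.set (f z) (e a) = f (L'.set z a))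
    (M : Mat A) (v : J → ℂ) :
    (L.op M *ᵥ v) ∘ f = L'.op (M.submatrix e e) *ᵥ (v ∘ f) := by
  funext z
  rw [Function.comp_apply, op_mulVec, op_mulVec, ← e.sum_comp]
  simp [hget, hset]

/-- Averaging over the values of a factor. -/
theorem sum_set (L : Lens J A) (f : J → ℝ) :
    ∑ z, ∑ a, f (L.set z a) = Fintype.card A * ∑ z, f z := by
  rw [← Fintype.sum_prod_type']
  have h : ∑ p : J × A, f (L.set p.1 p.2) = ∑ p : J × A, f p.1 := by
    refine Finset.sum_nbij' (fun p => (L.set p.1 p.2, L.get p.1)) (fun p => (L.set p.1 p.2,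
      L.get p.1)) ?_ ?_ ?_ ?_ ?_ <;> simp [L.get_set, L.set_get, L.set_set]
  rw [h, Fintype.sum_prod_type]
  simp [mul_sum]

theorem sum_nrm_sq_set (L : Lens J A) (v : J → ℂ) :
    ∑ z, nrm (v ∘ L.set z) ^ 2 = Fintype.card A * nrm v ^ 2 := by
  simp only [nrm_sq, Function.comp_apply]
  exact L.sum_set fun z => ‖v z‖ ^ 2

end Lens

/-! ### Tensor products of matrices -/

section Tensor

variable {ι : Type} [Fintype ι] [DecidableEq ι] {d : ι → Type} [∀ i, Fintype (d i)]
  [∀ i, DecidableEq (d i)]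

theorem coord_op_eq_tensor (i : ι) (M : Mat (d i)) :
    (Lens.coord i).op M = tensor (update (fun _ => 1) i M) := by
  ext x y
  rw [Lens.op_apply]
  simp only [tensor, of_apply]
  rw [← Finset.mul_prod_erase _ _ (mem_univ i), update_self]
  by_cases h : (Lens.coord i).set x ((Lens.coord i).get y) = y
  · rw [if_pos h, Finset.prod_eq_one, mul_one]
    · rfl
    intro j hj
    have hj' := Finset.ne_of_mem_erase hj
    have h' : update x i (y i) = y := h
    rw [update_of_ne hj', ← h', update_of_ne hj', Matrix.one_apply_eq]
  · rw [if_neg h]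
    obtain ⟨j, hj⟩ := Function.ne_iff.1 h
    have hj : update x i (y i) j ≠ y j := hj
    have hji : j ≠ i := by rintro rfl; simp at hj
    rw [update_of_ne hji] at hj
    rw [Finset.prod_eq_zero (Finset.mem_erase.2 ⟨hji, mem_univ j⟩), mul_zero]
    rw [update_of_ne hji, Matrix.one_apply_ne hj]

theorem prod_coord_op (N : ∀ i, Mat (d i)) (l : List ι) (hl : l.Nodup) :
    (l.map fun i => (Lens.coord i).op (N i)).prod = tensor fun i => if i ∈ l then N i else 1 := by
  induction l with
  | nil => simp [tensor_one]
  | cons a l ih =>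
    rw [List.nodup_cons] at hl
    rw [List.map_cons, List.prod_cons, ih hl.2, coord_op_eq_tensor, tensor_mul]
    congr 1
    funext i
    by_cases h : i = a
    · subst h; simp [hl.1]
    · simp [h]

theorem tensor_conjTranspose (N : ∀ i, Mat (d i)) :
    (tensor N)ᴴ = tensor fun i => (N i)ᴴ := by
  ext x y
  simp [tensor]

theorem tensor_mul_coord_op (N : ∀ i, Mat (d i)) (i : ι) {M : Mat (d i)}
    {c : ℂ} (h : N i * M = c • N i) : tensor N * (Lens.coord i).op M = c • tensor N := by
  rw [coord_op_eq_tensor, tensor_mul]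
  ext x y
  simp only [tensor, of_apply, Matrix.smul_apply]
  rw [← Finset.mul_prod_erase _ _ (mem_univ i), ← Finset.mul_prod_erase _ _
    (mem_univ i), update_self, h]
  simp only [Matrix.smul_apply, smul_eq_mul, mul_assoc]
  congr 2
  refine Finset.prod_congr rfl fun j hj => ?_
  rw [update_of_ne (Finset.ne_of_mem_erase hj), mul_one]

theorem sum_tensor {Λ : ι → Type} [∀ i, Fintype (Λ i)] (M : ∀ i, Λ i → Mat (d i)) :
    ∑ a : ∀ i, Λ i, tensor (fun i => M i (a i)) = tensor fun i => ∑ b, M i b := by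
  ext x y
  rw [Matrix.sum_apply]
  simp only [tensor, of_apply, Matrix.sum_apply]
  rw [Finset.prod_univ_sum, Fintype.piFinset_univ]

end Tensor

open Lens (coord op_comp op_commute op_isRefl coord_indep fst)

/-! ### Rejection probabilities -/

open scoped MatrixOrder in
theorem exists_eq_conjTranspose_mul_self {n : Type} [Fintype n] [DecidableEq n]
    {A : Mat n} (hA : A.PosSemidef) : ∃ B : Mat n, A = Bᴴ * B := by
  obtain ⟨B, hB⟩ := CStarAlgebra.nonneg_iff_eq_star_mul_self.mp hA.nonneg
  exact ⟨B, by rw [hB, star_eq_conjTranspose]⟩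

/-- A family `M` of mutually orthogonal projections with sum `1`. -/
structure IsProjFamily {O n : Type} [Fintype O] [Fintype n] [DecidableEq n]
    (M : O → Mat n) : Prop where
  herm : ∀ a, (M a)ᴴ = M a
  idem : ∀ a, M a * M a = M a
  orth : ∀ a b, a ≠ b → M a * M b = 0
  sum : ∑ a, M a = 1

/-- All measurements of all players are projective. -/
abbrev ProjMeas {ι Γ : Type} {Λ : Γ → Type} [∀ g, Fintype (Λ g)] {H : ι → Type}
    [∀ i, Fintype (H i)] [∀ i, DecidableEq (H i)] (M : ∀ i g, Λ g → Mat (H i)) : Prop :=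
  ∀ i g, IsProjFamily (M i g)

/-- Each member of the family `F` multiplied by `R` from the right is a scalar multiple of itself:
the measurement described by `F` determines the value of `R`. -/
def Reads {Ω J : Type} [Fintype J] (F : Ω → Mat J) (R : Mat J) (c : Ω → ℂ) : Prop :=
  ∀ ω, F ω * R = c ω • F ω

namespace Reads

variable {Ω J : Type} [Fintype J] {F : Ω → Mat J} {R R' : Mat J} {c c' : Ω → ℂ}

theorem mul (h : Reads F R c) (h' : Reads F R' c') : Reads F (R * R') (c * c') := fun ω => by
  rw [← mul_assoc, h, smul_mul, h', smul_smul, Pi.mul_apply]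

theorem add (h : Reads F R c) (h' : Reads F R' c') : Reads F (R + R') (c + c') := fun ω => by
  rw [mul_add, h, h', Pi.add_apply, add_smul]

theorem sub (h : Reads F R c) (h' : Reads F R' c') : Reads F (R - R') (c - c') := fun ω => by
  rw [mul_sub, h, h', Pi.sub_apply, sub_smul]

theorem smul (h : Reads F R c) (x : ℂ) : Reads F (x • R) (x • c) := fun ω => by
  rw [mul_smul_comm, h, Pi.smul_apply, smul_smul, smul_eq_mul]

theorem one [DecidableEq J] : Reads F 1 1 := fun ω => by simp

end Reads

namespace ExtGame

variable {r : ℕ} {Γ : Type} {Λ : Γ → Type} {κ : Type} [Fintype κ] [DecidableEq κ]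
  [∀ g, Fintype (Λ g)] {H : Fin r → Type} [∀ i, Fintype (H i)] [∀ i, DecidableEq (H i)]

/-- The (unnormalized) probability that the vector `φ` with the players' measurements `M` is
rejected. -/
def rej (G : ExtGame r Γ Λ κ) (M : ∀ i g, Λ g → Mat (H i))
    (φ : κ × (∀ i, H i) → ℂ) : ℝ :=
  ∑ ω, G.prob ω * ∑ a : ∀ i, Λ (G.ques ω i), (star φ ⬝ᵥ
    (((1 - G.acc ω a) ⊗ₖ tensor fun i => M i (G.ques ω i) (a i)) *ᵥ φ)).re

theorem kronecker_tensor_sum (M : ∀ i g, Λ g → Mat (H i))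
    (hM : ∀ i g, ∑ a, M i g a = 1) (ques : Fin r → Γ) (A : Mat κ) :
    ∑ a : ∀ i, Λ (ques i), A ⊗ₖ (tensor fun i => M i (ques i) (a i)) =
      A ⊗ₖ (1 : Mat (∀ i, H i)) := by
  have h1 : (1 : Mat (∀ i, H i)) =
      ∑ a : ∀ i, Λ (ques i), tensor fun i => M i (ques i) (a i) := by
    rw [sum_tensor fun i => M i (ques i), ← tensor_one]
    simp only [hM]
  rw [h1]
  ext x y
  simp [Matrix.sum_apply, kroneckerMap_apply, mul_sum]

theorem trace_mul_eq_sum {I J : Type} [Fintype I] [Fintype J] (B : Matrix I J ℂ)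
    (A : Mat J) :
    (Bᴴ * B * A).trace = ∑ j, star (star (B j)) ⬝ᵥ (A *ᵥ star (B j)) := by
  rw [Matrix.mul_assoc, Matrix.trace_mul_comm]
  simp only [star_star, Matrix.trace, diag_apply, Matrix.mul_apply, dotProduct, mulVec,
    conjTranspose_apply, sum_mul, mul_sum, Pi.star_apply]
  refine sum_congr rfl fun j _ => ?_
  rw [sum_comm]
  simp only [mul_assoc]

theorem Strategy.value_eq (G : ExtGame r Γ Λ κ) (S : G.Strategy) {I : Type} [Fintype I]
    (B : Matrix I (κ × ∀ i, Fin (S.d i)) ℂ) (hB : S.ρ = Bᴴ * B) :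
    S.value = 1 - ∑ j, G.rej S.M (star (B j)) := by
  have key : ∀ ω, (∑ a : ∀ i, Λ (G.ques ω i),
      (S.ρ * (G.acc ω a ⊗ₖ tensor fun i => S.M i (G.ques ω i) (a i))).trace.re) =
      1 - ∑ a : ∀ i, Λ (G.ques ω i), ∑ j, (star (star (B j)) ⬝ᵥ
        (((1 - G.acc ω a) ⊗ₖ tensor fun i => S.M i (G.ques ω i) (a i)) *ᵥ star (B j))).re := by
    intro ω
    have h1 : ∀ a : ∀ i, Λ (G.ques ω i),
        (S.ρ * (G.acc ω a ⊗ₖ tensor fun i => S.M i (G.ques ω i) (a i))).trace.re =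
        (S.ρ * ((1 : Mat κ) ⊗ₖ tensor fun i => S.M i (G.ques ω i) (a i))).trace.re -
        (S.ρ * ((1 - G.acc ω a) ⊗ₖ tensor fun i => S.M i (G.ques ω i) (a i))).trace.re := by
      intro a
      rw [← Complex.sub_re, ← trace_sub, ← mul_sub]
      congr 3
      ext x y
      simp [kroneckerMap_apply, sub_mul]
    rw [sum_congr rfl fun a _ => h1 a, Finset.sum_sub_distrib]
    congr 1
    · rw [← Complex.re_sum, ← trace_sum, ← mul_sum,
        kronecker_tensor_sum S.M S.M_sum, one_kronecker_one, mul_one, S.ρ_trace, Complex.one_re]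
    · refine sum_congr rfl fun a _ => ?_
      rw [hB, trace_mul_eq_sum, Complex.re_sum]
  unfold Strategy.value
  rw [sum_congr rfl fun ω _ => by rw [key ω]]
  simp only [mul_sub, mul_one, Finset.sum_sub_distrib, G.prob_sum]
  congr 1
  unfold rej
  rw [sum_comm]
  refine sum_congr rfl fun ω _ => ?_
  rw [sum_comm, mul_sum]

/-! ### Rejection probabilities of composite games -/

theorem rej_mixNonempty {ι : Type} [Fintype ι] [Nonempty ι] (G : ι → ExtGame r Γ Λ κ)
    (M : ∀ i g, Λ g → Mat (H i)) (φ : κ × (∀ i, H i) → ℂ) :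
    (mixNonempty G).rej M φ = (Fintype.card ι : ℝ)⁻¹ * ∑ j, (G j).rej M φ := by
  unfold rej
  rw [show (∑ ω : (mixNonempty G).Ω, (mixNonempty G).prob ω * _) = ∑ ω : Σ j, (G j).Ω, _ from rfl,
    Fintype.sum_sigma, mul_sum]
  simp only [mul_sum (s := Finset.univ) (a := (Fintype.card ι : ℝ)⁻¹), ← mul_assoc]
  rfl

theorem _root_.QGame.ProjMeas.tensor {M : ∀ i g, Λ g → Mat (H i)} (hM : ProjMeas M)
    {ques : Fin r → Γ} (a : ∀ i, Λ (ques i)) :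
    (tensor fun i => M i (ques i) (a i))ᴴ * (tensor fun i => M i (ques i) (a i)) =
      tensor fun i => M i (ques i) (a i) := by
  simp only [tensor_conjTranspose, tensor_mul, (hM _ _).herm, (hM _ _).idem]

open Classical in
theorem rej_leaf {O : Type} [Fintype O] (ques : Fin r → Γ) (m : Meas κ O)
    (accept : (∀ i, Λ (ques i)) → O → Prop) (M : ∀ i g, Λ g → Mat (H i))
    (hM : ProjMeas M) (φ : κ × (∀ i, H i) → ℂ) :
    (leaf ques m accept : ExtGame r Γ Λ κ).rej M φ = ∑ p : (∀ i, Λ (ques i)) × O,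
      if accept p.1 p.2 then 0 else
        nrm ((m.K p.2 ⊗ₖ tensor fun i => M i (ques i) (p.1 i)) *ᵥ φ) ^ 2 := by
  have h0 : (leaf ques m accept : ExtGame r Γ Λ κ).rej M φ = ∑ a : ∀ i, Λ (ques i), (star φ ⬝ᵥ
    (((1 - ∑ o, if accept a o then (m.K o)ᴴ * m.K o else 0) ⊗ₖ
      tensor fun i => M i (ques i) (a i)) *ᵥ φ)).re := by
    unfold rej
    rw [show (∑ ω : (leaf ques m accept : ExtGame r Γ Λ κ).Ω, _ ) = ∑ ω : Unit, _ from rfl]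
    simp [leaf]
    rfl
  rw [h0, Fintype.sum_prod_type]
  refine sum_congr rfl fun a _ => ?_
  have h1 : ((1 - ∑ o, if accept a o then (m.K o)ᴴ * m.K o else 0) ⊗ₖ
      tensor fun i => M i (ques i) (a i)) = ∑ o, if accept a o then 0 else
      (m.K o ⊗ₖ tensor fun i => M i (ques i) (a i))ᴴ *
        (m.K o ⊗ₖ tensor fun i => M i (ques i) (a i)) := by
    simp only [conjTranspose_kronecker, ← mul_kronecker_mul, hM.tensor]
    rw [← m.complete, ← Finset.sum_sub_distrib]
    ext x y
    simp only [kroneckerMap_apply, Matrix.sum_apply, sum_mul]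
    refine sum_congr rfl fun o _ => ?_
    split_ifs <;> simp
  rw [h1, sum_mulVec, dotProduct_sum, Complex.re_sum]
  refine sum_congr rfl fun o _ => ?_
  split_ifs
  · simp
  · rw [nrm_mulVec_sq]

/-- The operators of the joint outcomes of the players and the referee. -/
def outcomeOp {O : Type} [Fintype O] (ques : Fin r → Γ) (m : Meas κ O)
    (M : ∀ i g, Λ g → Mat (H i)) (p : (∀ i, Λ (ques i)) × O) :
    Mat (κ × ∀ i, H i) :=
  m.K p.2 ⊗ₖ tensor fun i => M i (ques i) (p.1 i)

theorem outcomeOp_complete {O : Type} [Fintype O] (ques : Fin r → Γ) (m : Meas κ O)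
    (M : ∀ i g, Λ g → Mat (H i)) (hM : ProjMeas M) :
    ∑ p, (outcomeOp ques m M p)ᴴ * outcomeOp ques m M p = 1 := by
  have h : ∀ p, (outcomeOp ques m M p)ᴴ * outcomeOp ques m M p =
      ((m.K p.2)ᴴ * m.K p.2) ⊗ₖ tensor fun i => M i (ques i) (p.1 i) := by
    intro p
    rw [outcomeOp, conjTranspose_kronecker, ← mul_kronecker_mul, hM.tensor]
  simp only [h]
  rw [Fintype.sum_prod_type_right]
  simp only [kronecker_tensor_sum M (fun i g => (hM i g).sum)]
  rw [← one_kronecker_one, ← m.complete]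
  ext x y
  simp [Matrix.sum_apply, kroneckerMap_apply, sum_mul]

open Classical in
theorem rej_leaf_eq {O : Type} [Fintype O] {ques : Fin r → Γ} {m : Meas κ O}
    {accept : (∀ i, Λ (ques i)) → O → Prop} {M : ∀ i g, Λ g → Mat (H i)}
    (hM : ProjMeas M) {E : Mat (κ × ∀ i, H i)}
    {c : (∀ i, Λ (ques i)) × O → ℂ} (hE : Reads (outcomeOp ques m M) E c)
    (hc : ∀ a o, c (a, o) = if accept a o then 0 else 1) (φ : κ × (∀ i, H i) → ℂ) :
    (leaf ques m accept : ExtGame r Γ Λ κ).rej M φ = nrm (E *ᵥ φ) ^ 2 := by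
  rw [rej_leaf _ _ _ _ hM, ← nrm_sq_sum_of_complete _ (outcomeOp_complete ques m M hM)]
  refine sum_congr rfl fun p _ => ?_
  rw [mulVec_mulVec, hE p, hc]
  split_ifs
  · simp [nrm_zero]
  · rw [one_smul]; rfl

theorem rej_guarded (m : Meas κ Bool) (G : ExtGame r Γ Λ κ)
    (M : ∀ i g, Λ g → Mat (H i)) (φ : κ × (∀ i, H i) → ℂ) :
    (guarded m G).rej M φ = G.rej M ((fst.op (m.K false)) *ᵥ φ) := by
  unfold rej
  refine sum_congr rfl fun ω _ => ?_
  refine congrArg (G.prob ω * ·) (sum_congr rfl fun a _ => ?_)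
  have hf : ∀ A : Mat κ, (fst.op A : Mat (κ × ∀ i, H i)) =
      A ⊗ₖ 1 := by
    intro A
    ext x y
    simp only [Lens.op_apply, fst, kroneckerMap_apply, Prod.ext_iff, true_and,
      Matrix.one_apply]
    split_ifs <;> simp
  have h1 : 1 - (guarded m G).acc ω a = (m.K false)ᴴ * (1 - G.acc ω a) * m.K false := by
    have h' := m.complete
    rw [Fintype.sum_bool] at h'
    rw [Matrix.mul_sub, Matrix.sub_mul, Matrix.mul_one, ← h']
    simp only [guarded]
    abel
  rw [h1, hf, star_mulVec, ← dotProduct_mulVec, mulVec_mulVec, mulVec_mulVec,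
    conjTranspose_kronecker, ← mul_kronecker_mul, ← mul_kronecker_mul, conjTranspose_one, one_mul,
    mul_one, mul_assoc]
  rfl

theorem rej_nonneg (G : ExtGame r Γ Λ κ) (M : ∀ i g, Λ g → Mat (H i))
    (hM : ProjMeas M) (φ : κ × (∀ i, H i) → ℂ) : 0 ≤ G.rej M φ := by
  refine Finset.sum_nonneg fun ω _ => mul_nonneg (G.prob_nonneg ω)
    (Finset.sum_nonneg fun a _ => ?_)
  obtain ⟨B, hB⟩ := exists_eq_conjTranspose_mul_self (G.acc_le_one ω a)
  rw [hB, ← hM.tensor, mul_kronecker_mul, ← conjTranspose_kronecker, ← nrm_mulVec_sq]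
  positivity

theorem rej_accepting [Inhabited Γ] (M : ∀ i g, Λ g → Mat (H i))
    (hM : ProjMeas M) (φ : κ × (∀ i, H i) → ℂ) :
    (accepting : ExtGame r Γ Λ κ).rej M φ = 0 := by
  rw [accepting, rej_leaf _ _ _ _ hM]
  simp

theorem rej_le_mix [Inhabited Γ] {ι : Type} [Fintype ι] (G : ι → ExtGame r Γ Λ κ)
    (M : ∀ i g, Λ g → Mat (H i)) (hM : ProjMeas M)
    (φ : κ × (∀ i, H i) → ℂ) (j : ι) :
    (G j).rej M φ ≤ Fintype.card ι * (mix G).rej M φ := by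
  have hn : Nonempty ι := ⟨j⟩
  have h0 : (Fintype.card ι : ℝ) ≠ 0 := by exact_mod_cast Fintype.card_ne_zero
  rw [mix, dif_pos hn, rej_mixNonempty, mul_inv_cancel_left₀ h0]
  exact Finset.single_le_sum (f := fun j => (G j).rej M φ)
    (fun j _ => (G j).rej_nonneg M hM φ) (mem_univ j)

theorem rej_mix_le [Inhabited Γ] {ι : Type} [Fintype ι] (G : ι → ExtGame r Γ Λ κ)
    (M : ∀ i g, Λ g → Mat (H i)) (hM : ProjMeas M)
    (φ : κ × (∀ i, H i) → ℂ) : (mix G).rej M φ ≤ ∑ j, (G j).rej M φ := by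
  have hs : 0 ≤ ∑ j, (G j).rej M φ := Finset.sum_nonneg fun j _ => (G j).rej_nonneg M hM φ
  by_cases hn : Nonempty ι
  · rw [mix, dif_pos hn, rej_mixNonempty]
    have h0 : (1 : ℝ) ≤ Fintype.card ι := by exact_mod_cast Fintype.card_pos
    exact mul_le_of_le_one_left hs (inv_le_one_of_one_le₀ h0)
  · rw [mix, dif_neg hn, rej_accepting _ hM]
    exact hs

theorem rej_mix_eq_zero [Inhabited Γ] {ι : Type} [Fintype ι] (G : ι → ExtGame r Γ Λ κ)
    (M : ∀ i g, Λ g → Mat (H i)) (hM : ProjMeas M)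
    (φ : κ × (∀ i, H i) → ℂ) (h : ∀ j, (G j).rej M φ = 0) : (mix G).rej M φ = 0 :=
  le_antisymm ((rej_mix_le G M hM φ).trans (by simp [h])) ((mix G).rej_nonneg M hM φ)

/-! ### Changing the spaces of the players -/

theorem dotProduct_extend {J J' : Type} [Fintype J] [Fintype J'] {f : J → J'}
    (hf : Injective f) (A : Matrix J' J' ℂ) (φ : J → ℂ) :
    star (extend f φ 0) ⬝ᵥ (A *ᵥ extend f φ 0) =
      star φ ⬝ᵥ (A.submatrix f f *ᵥ φ) := by
  have key : ∀ g : J' → ℂ, ∑ y, g y * extend f φ 0 y = ∑ x, g (f x) * φ x := by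
    intro g
    refine (Fintype.sum_of_injective f hf _ _ ?_ ?_).symm
    · intro y hy
      rw [extend_apply' _ _ _ (by simpa using hy)]; simp
    · intro x; rw [hf.extend_apply]
  simp only [dotProduct, mulVec, Pi.star_apply, key, submatrix_apply]
  rw [← Fintype.sum_of_injective f hf]
  · intro y hy
    rw [extend_apply' _ _ _ (by simpa using hy)]; simp
  · intro x; rw [hf.extend_apply]

theorem nrm_extend {J J' : Type} [Fintype J] [Fintype J'] {f : J → J'}
    (hf : Injective f) (φ : J → ℂ) : nrm (extend f φ 0) = nrm φ := by
  classical
  have h := dotProduct_extend hf 1 φ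
  rw [submatrix_one _ hf, one_mulVec, one_mulVec] at h
  refine (pow_left_inj₀ (nrm_nonneg _) (nrm_nonneg _) two_ne_zero).1 ?_
  rw [nrm_sq_eq_re, nrm_sq_eq_re, h]

theorem rej_extend (G : ExtGame r Γ Λ κ) {H' : Fin r → Type} [∀ i, Fintype (H' i)]
    [∀ i, DecidableEq (H' i)] (M : ∀ i g, Λ g → Mat (H i))
    (M' : ∀ i g, Λ g → Mat (H' i)) (f : ∀ i, H i → H' i)
    (hf : ∀ i, Injective (f i)) (hM : ∀ i g a, (M' i g a).submatrix (f i) (f i) = M i g a)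
    (φ : κ × (∀ i, H i) → ℂ) :
    G.rej M' (extend (fun z : κ × (∀ i, H i) => (z.1, fun i => f i (z.2 i))) φ 0) =
      G.rej M φ := by
  have hF : Injective (fun z : κ × (∀ i, H i) => (z.1, fun i => f i (z.2 i))) := by
    intro z z' h
    simp only [Prod.mk.injEq] at h
    exact Prod.ext h.1 (funext fun i => hf i (congrFun h.2 i))
  unfold rej
  refine sum_congr rfl fun ω _ => ?_
  refine congrArg (G.prob ω * ·) (sum_congr rfl fun a _ => ?_)
  rw [dotProduct_extend hF]
  congr 4
  ext x y
  simp only [submatrix_apply, kroneckerMap_apply, tensor, of_apply, ← hM]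

end ExtGame

/-! ### Projective measurements suffice -/

/-- A measurement on `n` is the restriction of a projective measurement on a larger space, whose
size depends only on that of a set `K` into which the outcomes are embedded. -/
theorem exists_projective_dilation {n O K : Type} [Fintype n] [DecidableEq n] [Fintype O]
    [Fintype K] [DecidableEq K] (enc : O → K) (henc : Injective enc)
    (M : O → Mat n) (hM : ∀ a, (M a).PosSemidef) (hsum : ∑ a, M a = 1) (a₀ : O) :
    ∃ M' : O → Mat (n ⊕ n × K), IsProjFamily M' ∧
      ∀ a, (M' a).submatrix Sum.inl Sum.inl = M a := by
  classical
  choose B hB using fun a => exists_eq_conjTranspose_mul_self (hM a)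
  obtain ⟨dec, hdec⟩ : ∃ dec : K → O, ∀ a, dec (enc a) = a :=
    haveI : Nonempty O := ⟨a₀⟩
    ⟨_, Function.leftInverse_invFun henc⟩
  let V : Matrix (n × K) n ℂ := Matrix.of fun x y =>
    if enc (dec x.2) = x.2 then B (dec x.2) x.1 y else 0
  have hVd : ∀ d : K → ℂ, Vᴴ * diagonal (fun x : n × K => d x.2) * V =
      ∑ a, d (enc a) • M a := by
    intro d
    ext x y
    rw [Matrix.mul_apply, Matrix.sum_apply, Fintype.sum_prod_type_right]
    simp only [mul_diagonal, Matrix.smul_apply, smul_eq_mul, conjTranspose_apply]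
    simp only [hB, Matrix.mul_apply, conjTranspose_apply]
    refine (Fintype.sum_of_injective enc henc _ _ (fun k hk => ?_) fun a => ?_).symm
    · simp [V, show enc (dec k) ≠ k from fun h => hk ⟨_, h⟩]
    · rw [mul_sum]
      exact sum_congr rfl fun z _ => by simp [V, hdec]; ring
  have hV : Vᴴ * V = 1 := by simpa [hsum] using hVd 1
  let U : Mat (n ⊕ n × K) := fromBlocks 0 Vᴴ V (1 - V * Vᴴ)
  have hUs : Uᴴ = U := by simp [U, fromBlocks_conjTranspose]
  have hUU : U * U = 1 := by
    have e1 : Vᴴ * (1 - V * Vᴴ) = 0 := by rw [Matrix.mul_sub, ← Matrix.mul_assoc, hV]; simp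
    have e2 : (1 - V * Vᴴ) * V = 0 := by rw [Matrix.sub_mul, Matrix.mul_assoc, hV]; simp
    have e3 : (1 - V * Vᴴ) * (1 - V * Vᴴ) = 1 - V * Vᴴ := by
      rw [Matrix.mul_sub, ← Matrix.mul_assoc, e2]; simp
    rw [fromBlocks_multiply]
    simp only [hV, e1, e2, e3, Matrix.zero_mul, Matrix.mul_zero, zero_add, add_zero]
    rw [add_sub_cancel, fromBlocks_one]
  let p : O → n ⊕ n × K → ℂ := fun a z =>
    if Sum.elim (fun _ => a₀) (fun x => dec x.2) z = a then 1 else 0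
  have hmul : ∀ X Y : Mat (n ⊕ n × K), U * X * U * (U * Y * U) = U * (X * Y) * U := by
    intro X Y
    calc U * X * U * (U * Y * U) = U * X * (U * U) * Y * U := by simp only [mul_assoc]
      _ = _ := by rw [hUU, mul_one]; simp only [mul_assoc]
  refine ⟨fun a => U * diagonal (p a) * U, ⟨fun a => ?_, fun a => ?_, fun a b hab => ?_, ?_⟩,
    fun a => ?_⟩
  · rw [conjTranspose_mul, conjTranspose_mul, hUs, diagonal_conjTranspose, mul_assoc]
    congr 3
    funext z
    simp [p, apply_ite]
  · rw [hmul, diagonal_mul_diagonal]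
    congr 3
    funext z
    simp [p]
  · rw [hmul, diagonal_mul_diagonal, show (fun z => p a z * p b z) = 0 from funext fun z => by
      simp only [p]; split_ifs <;> simp_all]
    simp
  · rw [← sum_mul, ← mul_sum, show ∑ a, diagonal (p a) = 1 from ?_, mul_one, hUU]
    ext z z'
    rw [Matrix.sum_apply]
    by_cases h : z = z'
    · subst h; simp [p]
    · simp [h]
  · have hd : diagonal (p a) = fromBlocks (diagonal fun z => p a (.inl z)) 0 0
        (diagonal fun z => p a (.inr z)) := by
      ext (z | z) (z' | z') <;> simp [Matrix.diagonal_apply]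
    beta_reduce
    rw [hd, fromBlocks_multiply, fromBlocks_multiply]
    refine .trans ?_ ((hVd fun k => if dec k = a then 1 else 0).trans ?_)
    · ext x y; simp [p]; congr!
    · simp [hdec]

/-! ### Strategies in terms of vectors and projective measurements -/

instance {m : ℕ} : ∀ g : Question m, Inhabited (Answer g)
  | .nothing => ⟨(() : Unit)⟩
  | .pauli _ => ⟨false⟩
  | .multi _ => ⟨fun _ => false⟩
  | .xap => ⟨false⟩

/-- All answers can be written as functions on the set of Pauli operators. -/
def encodeAnswer {m : ℕ} : (g : Question m) → Answer g → (Pauli m → Bool)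
  | .nothing, _ => fun _ => false
  | .pauli _, a => fun _ => a
  | .multi Q, b => fun P => if h : P ∈ Q then b ⟨P, h⟩ else false
  | .xap, a => fun _ => a

theorem encodeAnswer_injective {m : ℕ} (g : Question m) : Injective (encodeAnswer g) := by
  cases g with
  | nothing => intro a b _; rfl
  | pauli P => intro a b h; exact congrFun h fun _ => .I
  | multi Q =>
    intro a b h
    funext P
    have := congrFun h P.1
    simpa [encodeAnswer] using this
  | xap => intro a b h; exact congrFun h fun _ => .I

namespace ExtGame

variable {r m : ℕ} {κ : Type} [Fintype κ] [DecidableEq κ]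

theorem value_le_of_rej (G : ExtGame r (Question m) Answer κ) (γ : ℝ)
    (h : ∀ (H : Fin r → Type) [∀ i, Fintype (H i)] [∀ i, DecidableEq (H i)]
      (M : ∀ i (g : Question m), Answer g → Mat (H i)),
      (ProjMeas M) → ∀ φ : κ × (∀ i, H i) → ℂ, γ * nrm φ ^ 2 ≤ G.rej M φ)
    (S : G.Strategy) : S.value ≤ 1 - γ := by
  obtain ⟨B, hB⟩ := exists_eq_conjTranspose_mul_self S.ρ_nonneg
  rw [Strategy.value_eq G S B hB]
  have htr : ∑ j, nrm (star (B j)) ^ 2 = 1 := by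
    have h1 := ExtGame.trace_mul_eq_sum B 1
    rw [mul_one, ← hB, S.ρ_trace] at h1
    simp only [nrm_sq_eq_re]
    simp only [one_mulVec] at h1
    rw [← Complex.re_sum, ← h1, Complex.one_re]
  have hd := fun i g => exists_projective_dilation (encodeAnswer g) (encodeAnswer_injective g)
    (S.M i g) (S.M_nonneg i g) (S.M_sum i g) default
  choose M' hM' hsub using hd
  have hj : ∀ j, γ * nrm (star (B j)) ^ 2 ≤ G.rej S.M (star (B j)) := by
    intro j
    have h1 := h _ M' hM' (extend (fun z : κ × (∀ i, Fin (S.d i)) =>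
      (z.1, fun i => Sum.inl (z.2 i))) (star (B j)) 0)
    rw [rej_extend G S.M M' (fun i => Sum.inl) (fun i => Sum.inl_injective) hsub, nrm_extend] at h1
    · exact h1
    · intro z z' h
      simp only [Prod.mk.injEq] at h
      exact Prod.ext h.1 (funext fun i => Sum.inl_injective (congrFun h.2 i))
  have := sum_le_sum fun j (_ : j ∈ Finset.univ) => hj j
  rw [← mul_sum, htr] at this
  linarith

theorem value_le_one (G : ExtGame r (Question m) Answer κ) (S : G.Strategy) : S.value ≤ 1 := by
  have := value_le_of_rej G 0 (fun H _ _ M hM φ => by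
    rw [zero_mul]; exact G.rej_nonneg M hM φ) S
  simpa using this

theorem exists_strategy_of_vector (G : ExtGame r (Question m) Answer κ) {H : Fin r → Type}
    [∀ i, Fintype (H i)] [∀ i, DecidableEq (H i)]
    (M : ∀ i (g : Question m), Answer g → Mat (H i))
    (hM : ProjMeas M) (φ : κ × (∀ i, H i) → ℂ) (hφ : nrm φ = 1) :
    ∃ S : G.Strategy, S.value = 1 - G.rej M φ := by
  let e : ∀ i, H i ≃ Fin (Fintype.card (H i)) := fun i => Fintype.equivFin _
  let M' : ∀ i (g : Question m), Answer g → Mat (Fin (Fintype.card (H i))) := fun i g a => (M i g a).submatrix (e i).symm (e i).symm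
  let F : κ × (∀ i, H i) → κ × (∀ i, Fin (Fintype.card (H i))) :=
    fun z => (z.1, fun i => e i (z.2 i))
  let φ' := extend F φ 0
  have hF : Injective F := by
    intro z z' h
    simp only [F, Prod.mk.injEq] at h
    exact Prod.ext h.1 (funext fun i => (e i).injective (congrFun h.2 i))
  have hφ' : nrm φ' = 1 := by rw [nrm_extend hF, hφ]
  let B : Matrix Unit (κ × (∀ i, Fin (Fintype.card (H i)))) ℂ := fun _ => star φ'
  let S : G.Strategy :=
    { d := fun i => Fintype.card (H i)
      ρ := Bᴴ * B
      ρ_nonneg := posSemidef_conjTranspose_mul_self B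
      ρ_trace := by
        have h1 := ExtGame.trace_mul_eq_sum B 1
        rw [mul_one] at h1
        rw [h1]
        have h2 : star φ' ⬝ᵥ φ' = ((nrm φ' ^ 2 : ℝ) : ℂ) := by
          rw [nrm_sq]
          push_cast
          refine sum_congr rfl fun x _ => ?_
          exact Complex.conj_mul' (φ' x)
        simp only [one_mulVec, B, star_star, Finset.univ_unique, Finset.sum_singleton]
        rw [h2, hφ']; simp
      M := M'
      M_nonneg := fun i g a => by
        refine Matrix.PosSemidef.submatrix ?_ _
        rw [← (hM i g).idem]
        nth_rw 1 [← (hM i g).herm]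
        exact posSemidef_conjTranspose_mul_self _
      M_sum := fun i g => by
        have : ∑ a, M' i g a = (∑ a, M i g a).submatrix (e i).symm (e i).symm := by
          ext x y; simp [M', Matrix.sum_apply]
        rw [this, (hM i g).sum, submatrix_one _ (e i).symm.injective] }
  refine ⟨S, ?_⟩
  rw [Strategy.value_eq G S B rfl]
  congr 1
  simp only [Finset.univ_unique, Finset.sum_singleton]
  rw [← rej_extend G M S.M (fun i => e i) (fun i => (e i).injective)]
  · congr 1
    exact star_star φ'
  · intro i g a
    ext x y
    simp [S, M']

end ExtGame

/-! ### Signs, observables and what measurements read -/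

/-- The sign `(-1)^b`. -/
def sgn (b : Bool) : ℂ := if b then -1 else 1

@[simp] theorem sgn_true : sgn true = -1 := rfl
@[simp] theorem sgn_false : sgn false = 1 := rfl

theorem sgn_mul_self (b : Bool) : sgn b * sgn b = 1 := by cases b <;> simp

theorem star_sgn (b : Bool) : star (sgn b) = sgn b := by cases b <;> simp

theorem norm_sgn (b : Bool) : ‖sgn b‖ = 1 := by cases b <;> simp

section Projections

variable {J : Type} [Fintype J] [DecidableEq J]

/-- The projection onto the eigenspace of the reflection `R` with eigenvalue `(-1)^b`. -/
def prj (b : Bool) (R : Mat J) : Mat J := (1 / 2 : ℂ) • (1 + sgn b • R)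

theorem prj_commute {R A : Mat J} (h : Commute R A) (b : Bool) : Commute (prj b R) A :=
  (((Commute.one_left A).add_left (h.smul_left (sgn b)))).smul_left _

theorem prj_ctr {R : Mat J} (h : IsRefl R) (b : Bool) : Ctr (prj b R) := by
  cases b
  · simpa [prj] using h.half_add_ctr
  · simpa [prj, sub_eq_add_neg] using h.half_sub_ctr

theorem map_prj {A : Type} [Fintype A] [DecidableEq A] (f : Mat A →⋆ₐ[ℂ] Mat J)
    (b : Bool) (R : Mat A) : f (prj b R) = prj b (f R) := by
  simp [prj]

theorem prj_add_prj (R : Mat J) : prj false R + prj true R = 1 := by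
  ext x y
  simp only [prj, sgn_false, sgn_true, Matrix.add_apply, Matrix.smul_apply, smul_eq_mul]
  ring

theorem Reads.prj {Ω : Type} {F : Ω → Mat J} {R : Mat J} {β : Ω → Bool}
    (h : Reads F R fun ω => sgn (β ω)) (b : Bool) :
    Reads F (prj b R) fun ω => if β ω = b then 1 else 0 := by
  intro ω
  rw [QGame.prj, ((Reads.one (F := F)).add (h.smul (sgn b))).smul (1 / 2) ω]
  simp only [Pi.smul_apply, Pi.add_apply, Pi.one_apply, smul_eq_mul]
  congr 1
  cases b <;> cases β ω <;> norm_num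

end Projections

section Observable

variable {n O : Type} [Fintype n] [DecidableEq n] [Fintype O]

/-- The observable for the bit `f a` of the outcome `a` of a projective measurement. -/
def obs (M : O → Mat n) (f : O → Bool) : Mat n := ∑ a, sgn (f a) • M a

theorem IsProjFamily.mul_obs {M : O → Mat n} (h : IsProjFamily M) (f : O → Bool) (a : O) :
    M a * obs M f = sgn (f a) • M a := by
  rw [obs, mul_sum, Finset.sum_eq_single a]
  · rw [mul_smul_comm, h.idem]
  · intro b _ hb
    rw [mul_smul_comm, h.orth _ _ hb.symm, smul_zero]
  · simp

theorem IsProjFamily.obs_mul_obs {M : O → Mat n} (h : IsProjFamily M) (f g : O → Bool) :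
    obs M f * obs M g = ∑ a, (sgn (f a) * sgn (g a)) • M a := by
  rw [obs, sum_mul]
  refine sum_congr rfl fun a _ => ?_
  rw [smul_mul_assoc, h.mul_obs, smul_smul]

theorem IsProjFamily.obs_isRefl {M : O → Mat n} (h : IsProjFamily M) (f : O → Bool) :
    IsRefl (obs M f) := by
  constructor
  · rw [obs, conjTranspose_sum]
    refine sum_congr rfl fun a _ => ?_
    rw [conjTranspose_smul, star_sgn, h.herm]
  · rw [h.obs_mul_obs]
    simp [sgn_mul_self, h.sum]

theorem IsProjFamily.obs_eq {M : O → Mat n} (h : IsProjFamily M) {f : O → Bool}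
    {R : Mat n} (hR : ∀ a, M a * R = sgn (f a) • M a) : obs M f = R := by
  rw [obs, ← one_mul R, ← h.sum, sum_mul]
  exact sum_congr rfl fun a _ => (hR a).symm

end Observable

section ReadsMeas

variable {κ O O' : Type} [Fintype κ] [DecidableEq κ] [Fintype O] [Fintype O']

theorem reads_reflection {R : Mat κ} (h1 : Rᴴ = R) (h2 : R * R = 1) :
    Reads (Meas.reflection R h1 h2).K R sgn := fun a => by
  simp only [Meas.reflection, smul_mul_assoc, add_mul, one_mul, h2]
  rw [smul_comm]
  congr 1
  cases a <;> simp [add_comm]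

theorem Reads.seq_fst {m : Meas κ O} {R : Mat κ} {c : O → ℂ} (h : Reads m.K R c)
    (m' : Meas κ O') : Reads (m.seq m').K R fun o => c o.1 := fun o => by
  rw [Meas.seq, mul_assoc, h, mul_smul_comm]

theorem Reads.seq_snd {m' : Meas κ O'} {R : Mat κ} {c : O' → ℂ} (h : Reads m'.K R c)
    {m : Meas κ O} (hc : ∀ o, Commute (m.K o) R) : Reads (m.seq m').K R fun o => c o.2 := fun o => by
  rw [Meas.seq, mul_assoc, (hc _).eq, ← mul_assoc, h, smul_mul_assoc]

theorem seq_commute {m : Meas κ O} {m' : Meas κ O'} {R : Mat κ}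
    (h : ∀ o, Commute (m.K o) R) (h' : ∀ o, Commute (m'.K o) R) (o : O × O') :
    Commute ((m.seq m').K o) R := (h' _).mul_left (h _)

open Classical in
theorem reads_indicator (p : κ → Prop) : Reads (Meas.indicator p).K
    (diagonal fun x => if p x then 1 else 0) fun o => if o = true then 1 else 0 := fun o => by
  simp only [Meas.indicator, diagonal_mul_diagonal]
  rw [← diagonal_smul]
  congr 1
  funext x
  by_cases h : p x <;> cases o <;> simp [h]

end ReadsMeas

section ReadsOutcome

variable {r : ℕ} {Γ : Type} {Λ : Γ → Type} {κ : Type} [Fintype κ] [DecidableEq κ]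
  [∀ g, Fintype (Λ g)] {H : Fin r → Type} [∀ i, Fintype (H i)] [∀ i, DecidableEq (H i)]
  {O : Type} [Fintype O]

/-- The factor of player `i`. -/
def playerLens {κ : Type} {r : ℕ} {H : Fin r → Type} (i : Fin r) : Lens (κ × ∀ i, H i) (H i) :=
  Lens.snd.comp (coord i)

theorem fst_op_eq {κ Y : Type} [Fintype κ] [DecidableEq κ] [Fintype Y] [DecidableEq Y]
    (A : Mat κ) : ((fst : Lens (κ × Y) κ).op A) = A ⊗ₖ 1 := by
  ext x y
  simp only [Lens.op_apply, fst, kroneckerMap_apply, Prod.ext_iff, true_and,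
    Matrix.one_apply]
  split_ifs <;> simp

theorem snd_op_eq {κ Y : Type} [Fintype κ] [DecidableEq κ] [Fintype Y] [DecidableEq Y]
    (A : Mat Y) : ((Lens.snd : Lens (κ × Y) Y).op A) = 1 ⊗ₖ A := by
  ext x y
  simp only [Lens.op_apply, Lens.snd, kroneckerMap_apply, Prod.ext_iff, and_true,
    Matrix.one_apply]
  split_ifs <;> simp

theorem Reads.ref {m : Meas κ O} {R : Mat κ} {c : O → ℂ} (h : Reads m.K R c)
    (ques : Fin r → Γ) (M : ∀ i g, Λ g → Mat (H i)) :
    Reads (ExtGame.outcomeOp ques m M) (fst.op R) fun p => c p.2 := fun p => by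
  rw [ExtGame.outcomeOp, fst_op_eq, ← mul_kronecker_mul, h, mul_one, smul_kronecker]

theorem reads_player (ques : Fin r → Γ) (m : Meas κ O) (M : ∀ i g, Λ g → Mat (H i))
    (hM : ProjMeas M) (i : Fin r) (f : Λ (ques i) → Bool) :
    Reads (ExtGame.outcomeOp ques m M) ((playerLens i).op (obs (M i (ques i)) f))
      fun p => sgn (f (p.1 i)) := fun p => by
  rw [ExtGame.outcomeOp, playerLens, op_comp, snd_op_eq, ← mul_kronecker_mul, mul_one,
    tensor_mul_coord_op (fun i => M i (ques i) (p.1 i)) i ((hM i _).mul_obs f (p.1 i)),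
    kronecker_smul]

theorem reads_players (ques : Fin r → Γ) (m : Meas κ O) (M : ∀ i g, Λ g → Mat (H i))
    (hM : ProjMeas M) (f : ∀ i, Λ (ques i) → Bool) :
    Reads (ExtGame.outcomeOp ques m M) (Lens.snd.op (tensor fun i => obs (M i (ques i)) (f i)))
      fun p => ∏ i, sgn (f i (p.1 i)) := fun p => by
  rw [ExtGame.outcomeOp, snd_op_eq, ← mul_kronecker_mul, mul_one, tensor_mul]
  simp only [(hM _ _).mul_obs]
  rw [← kronecker_smul]
  congr 1
  ext x y
  simp [tensor, Finset.prod_mul_distrib]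

end ReadsOutcome

/-! ### Pauli operators -/

section PauliOps

variable {q : Type} [Fintype q] [DecidableEq q]

theorem PauliLabel.mat_isRefl (D : PauliLabel) : IsRefl D.mat :=
  ⟨by ext a b; exact D.mat_star a b, D.mat_mul_self⟩

theorem pauliOp_isRefl (P : q → PauliLabel) : IsRefl (pauliOp P) :=
  ⟨pauliOp_conjTranspose P, pauliOp_mul_self P⟩

theorem pauliOp_single (u : q) (D : PauliLabel) :
    pauliOp (single u D) = (coord u).op D.mat := by
  rw [coord_op_eq_tensor, pauliOp]
  congr 1
  funext v
  obtain rfl | h := eq_or_ne v u <;> simp [single, PauliLabel.mat, *]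

theorem pauliOp_pair {u v : q} (h : u ≠ v) (D E : PauliLabel) :
    pauliOp (pair u D v E) = (coord u).op D.mat * (coord v).op E.mat := by
  rw [coord_op_eq_tensor, coord_op_eq_tensor, tensor_mul, pauliOp]
  congr 1
  funext w
  obtain rfl | h1 := eq_or_ne w u
  · simp [pair, h]
  · obtain rfl | h2 := eq_or_ne w v <;> simp [pair, PauliLabel.mat, *]

/-- `X` on the qubits in `s` moves basis states. -/
def flipOp (s : q → Bool) : Mat (q → Bool) :=
  pauliOp fun u => if s u then .X else .I

/-- The basis state that `flipOp s` makes of `x`. -/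
def flipBits (s x : q → Bool) : q → Bool := fun u => xor (s u) (x u)

theorem flipOp_apply (s x y : q → Bool) : flipOp s x y = if flipBits s x = y then 1 else 0 := by
  simp only [flipOp, pauliOp, tensor, of_apply]
  by_cases h : flipBits s x = y
  · rw [if_pos h]
    refine Finset.prod_eq_one fun u _ => ?_
    rw [← h, flipBits]
    cases s u <;> cases x u <;> simp [PauliLabel.mat, Matrix.one_apply]
  · rw [if_neg h]
    obtain ⟨u, hu⟩ := Function.ne_iff.1 h
    refine Finset.prod_eq_zero (mem_univ u) ?_
    revert hu
    rw [flipBits]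
    cases s u <;> cases x u <;> cases y u <;> simp [PauliLabel.mat]

theorem flipOp_mulVec (s : q → Bool) (v : (q → Bool) → ℂ) (x : q → Bool) :
    (flipOp s *ᵥ v) x = v (flipBits s x) := by
  simp [mulVec, dotProduct, flipOp_apply]

theorem flipBits_flipBits (s s' x : q → Bool) :
    flipBits s (flipBits s' x) = flipBits (fun u => xor (s u) (s' u)) x := by
  funext u; simp [flipBits]

theorem flipOp_mul (s s' : q → Bool) :
    flipOp s * flipOp s' = flipOp fun u => xor (s u) (s' u) := by
  refine mulVec_ext fun v x => ?_
  rw [← mulVec_mulVec, flipOp_mulVec, flipOp_mulVec, flipOp_mulVec, flipBits_flipBits]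
  congr 2
  funext u; exact Bool.xor_comm _ _

theorem flipOp_commute (s s' : q → Bool) : Commute (flipOp s) (flipOp s') := by
  rw [Commute, SemiconjBy, flipOp_mul, flipOp_mul]
  congr 1
  funext u; exact Bool.xor_comm _ _

theorem flipOp_isRefl (s : q → Bool) : IsRefl (flipOp s) := pauliOp_isRefl _

theorem flipOp_mul_diagonal (s : q → Bool) (p : (q → Bool) → ℂ) :
    flipOp s * diagonal p = diagonal (fun x => p (flipBits s x)) * flipOp s := by
  refine mulVec_ext fun v x => ?_
  rw [← mulVec_mulVec, ← mulVec_mulVec, flipOp_mulVec, mulVec_diagonal, mulVec_diagonal,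
    flipOp_mulVec]

theorem flipOp_commute_diagonal {s : q → Bool} {p : (q → Bool) → ℂ}
    (h : ∀ x, p (flipBits s x) = p x) : Commute (flipOp s) (diagonal p) := by
  rw [Commute, SemiconjBy, flipOp_mul_diagonal]
  simp only [h]

theorem flipOp_commute_coord {s : q → Bool} {u : q} (h : s u = false) (M : Mat Bool) :
    Commute (flipOp s) ((coord u).op M) := by
  refine mulVec_ext fun v x => ?_
  rw [← mulVec_mulVec, ← mulVec_mulVec, flipOp_mulVec, Lens.op_mulVec, Lens.op_mulVec]
  refine sum_congr rfl fun a _ => ?_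
  rw [flipOp_mulVec]
  have h1 : (coord u).get (flipBits s x) = (coord u : Lens (q → Bool) Bool).get x := by
    simp [coord, flipBits, h]
  have h2 : (coord u).set (flipBits s x) a =
      flipBits s ((coord u : Lens (q → Bool) Bool).set x a) := by
    funext w
    by_cases hw : w = u
    · subst hw; simp [coord, flipBits, h]
    · simp [coord, flipBits, hw]
  rw [h1, h2]

theorem single_Z_eq_diagonal (u : q) :
    pauliOp (single u .Z) = diagonal fun x => sgn (x u) := by
  rw [pauliOp_single]
  refine mulVec_ext fun v x => ?_
  rw [Lens.op_mulVec, mulVec_diagonal, Fintype.sum_bool]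
  have : ∀ b, (coord u).set x b = update x u b := fun _ => rfl
  simp only [this]
  change PauliLabel.Z.mat (x u) _ * _ + PauliLabel.Z.mat (x u) _ * _ = _
  cases h : x u <;> simp [PauliLabel.mat, ← h, sgn]

end PauliOps

open Classical in
/-- The number `1` if `p` holds and `0` otherwise. -/
def indic (p : Prop) : ℂ := if p then 1 else 0

theorem indic_pos {p : Prop} (h : p) : indic p = 1 := if_pos h

theorem indic_neg {p : Prop} (h : ¬ p) : indic p = 0 := if_neg h

theorem norm_indic_le (p : Prop) : ‖indic p‖ ≤ 1 := by
  unfold indic; split_ifs <;> simp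

/-- The projection onto the basis states that satisfy `p`. -/
def proj {κ : Type} [DecidableEq κ] (p : κ → Prop) : Mat κ :=
  diagonal fun x => indic (p x)

section Proj

variable {κ : Type} [Fintype κ] [DecidableEq κ]

theorem proj_mul (p p' : κ → Prop) : proj p * proj p' = proj fun x => p x ∧ p' x := by
  rw [proj, proj, diagonal_mul_diagonal, proj]
  congr 1
  funext x
  by_cases h : p x <;> by_cases h' : p' x <;> simp [h, h', indic]

theorem proj_commute (p p' : κ → Prop) : Commute (proj p) (proj p') := by
  rw [Commute, SemiconjBy, proj_mul, proj_mul]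
  simp only [and_comm]

theorem prj_diagonal (b : Bool) (f : κ → Bool) :
    prj b (diagonal fun x => sgn (f x)) = proj fun x => f x = b := by
  ext x y
  by_cases h : x = y
  · subst h
    simp only [prj, proj, Matrix.smul_apply, Matrix.add_apply, Matrix.one_apply_eq,
      diagonal_apply_eq, smul_eq_mul]
    by_cases hf : f x = b
    · rw [indic_pos hf, hf, sgn_mul_self]; norm_num
    · rw [indic_neg hf, Bool.eq_not.2 hf]; cases b <;> norm_num
  · simp [prj, proj, h]

theorem proj_mul_eq_zero {p p' : κ → Prop} (h : ∀ x, p x → ¬ p' x) : proj p * proj p' = 0 := by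
  rw [proj_mul, proj]
  have : ∀ x, indic (p x ∧ p' x) = 0 := fun x => indic_neg fun hx => h x hx.1 hx.2
  simp [this]

theorem proj_mul_eq_left {p p' : κ → Prop} (h : ∀ x, p x → p' x) : proj p * proj p' = proj p := by
  rw [proj_mul]
  congr 1
  funext x
  exact propext ⟨fun hx => hx.1, fun hx => ⟨hx, h x hx⟩⟩

theorem proj_mul_eq_right {p p' : κ → Prop} (h : ∀ x, p x → p' x) : proj p' * proj p = proj p := by
  rw [(proj_commute _ _).eq, proj_mul_eq_left h]

end Proj

/-! ### Unary clocks -/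

section Clock

variable {q : Type} [Fintype q] [DecidableEq q] {N : ℕ} (e : Fin N → q)

/-- The operator that is measured by `clockMeas`. -/
def clockOp (D : PauliLabel) (t : ℕ) : Mat (q → Bool) :=
  if h : 1 ≤ t ∧ t ≤ N then pauliOp (single (e ⟨t - 1, by omega⟩) D) else sgn (decide (t = 0)) • 1

theorem reads_clockMeas (D : PauliLabel) (t : ℕ) :
    Reads (clockMeas e D t).K (clockOp e D t) sgn := by
  unfold clockMeas clockOp
  split_ifs with h
  · exact reads_reflection _ _
  · intro o
    cases decide (t = 0) <;> cases o <;> simp [Meas.const]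

theorem clockMeas_K (D : PauliLabel) (t : ℕ) (a : Bool) :
    (clockMeas e D t).K a = prj a (clockOp e D t) := by
  unfold clockMeas clockOp
  split_ifs with h
  · rfl
  · ext x y
    cases decide (t = 0) <;> cases a <;> simp [Meas.const, prj] <;> ring

theorem clockOp_Z (t : ℕ) : clockOp e .Z t = diagonal fun x => sgn (clockBit e x t) := by
  unfold clockOp clockBit
  split_ifs with h
  · rw [single_Z_eq_diagonal]
  · rw [smul_one_eq_diagonal]

theorem prj_clockOp_Z (b : Bool) (t : ℕ) :
    prj b (clockOp e .Z t) = proj fun x => clockBit e x t = b := by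
  rw [clockOp_Z, prj_diagonal]

open Classical in
/-- The bits `t₁ + 1, …, t₂` of the clock. -/
def clockRange (t₁ t₂ : ℕ) : q → Bool := fun u =>
  decide (∃ j : Fin N, e j = u ∧ t₁ < (j : ℕ) + 1 ∧ (j : ℕ) + 1 ≤ t₂)

theorem edgeLabel_op (t₁ t₂ : ℕ) : pauliOp (edgeLabel e t₁ t₂) = flipOp (clockRange e t₁ t₂) := by
  rw [flipOp]
  congr 1
  funext u
  simp [edgeLabel, clockRange]

/-- `X` on the first `t` qubits of the clock. -/
def shift (t : ℕ) : Mat (q → Bool) := flipOp (clockRange e 0 t)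

/-- The projection onto the basis states in which the clock shows `t`. -/
def atTime (t : ℕ) : Mat (q → Bool) :=
  proj fun x => ∀ j : Fin N, x (e j) = decide ((j : ℕ) < t)

/-- The projection onto the basis states in `EdgeSpace`. -/
def edgeProj (t₁ t₂ : ℕ) : Mat (q → Bool) := proj (EdgeSpace e t₁ t₂)

theorem shift_isRefl (t : ℕ) : IsRefl (shift e t) := flipOp_isRefl _

theorem shift_commute (t t' : ℕ) : Commute (shift e t) (shift e t') := flipOp_commute _ _

theorem shift_zero : shift e 0 = 1 := by
  have : clockRange e 0 0 = fun _ => false := by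
    funext u; simp [clockRange]
  rw [shift, this, flipOp]
  exact (tensor_one (ι := q) (d := fun _ => Bool))

theorem flipOp_clockRange {t₁ t₂ : ℕ} (h : t₁ ≤ t₂) (he : Injective e) :
    flipOp (clockRange e t₁ t₂) = shift e t₁ * shift e t₂ := by
  rw [shift, shift, flipOp_mul]
  congr 1
  funext u
  by_cases hu : ∃ j, e j = u
  · obtain ⟨j, rfl⟩ := hu
    simp only [clockRange, he.eq_iff, exists_eq_left]
    grind
  · simp [clockRange, not_exists.1 hu]

theorem clockOp_X {t : ℕ} (h : 1 ≤ t ∧ t ≤ N) (he : Injective e) :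
    clockOp e .X t = shift e (t - 1) * shift e t := by
  rw [← flipOp_clockRange e (by omega) he, clockOp, dif_pos h, flipOp]
  congr 1
  funext u
  have : clockRange e (t - 1) t u = decide (u = e ⟨t - 1, by omega⟩) := by
    refine decide_eq_decide.2 ⟨?_, ?_⟩
    · rintro ⟨j, rfl, h1, h2⟩
      exact congrArg e (Fin.ext (by simp; omega))
    · rintro rfl
      exact ⟨_, rfl, by simp, by simp; omega⟩
  simp [this, single]

variable {e}

theorem clockBit_flip (he : Injective e) (s : ℕ) {t : ℕ} (x : q → Bool) (hs : s ≤ N) :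
    clockBit e (flipBits (clockRange e 0 s) x) t =
      xor (decide (1 ≤ t ∧ t ≤ s)) (clockBit e x t) := by
  unfold clockBit
  split_ifs with h
  · simp only [flipBits, clockRange, he.eq_iff, exists_eq_left]
    congr 2
    simp only [eq_iff_iff]
    omega
  · have : ¬ (1 ≤ t ∧ t ≤ s) := by omega
    simp [this]

theorem clockBit_of_atTime {t : ℕ} {x : q → Bool} (hx : ∀ j : Fin N, x (e j) = decide ((j : ℕ) < t))
    (ht : t ≤ N) (t' : ℕ) : clockBit e x t' = decide (t' ≤ t) := by
  unfold clockBit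
  split_ifs with h
  · rw [hx]
    simp only [decide_eq_decide]
    omega
  · simp only [decide_eq_decide]
    omega

theorem shift_mul_atTime (he : Injective e) (t : ℕ) :
    shift e t * atTime e t = atTime e 0 * shift e t := by
  rw [shift, atTime, atTime, proj, proj, flipOp_mul_diagonal]
  congr 2
  funext x
  refine congrArg indic ?_
  simp only [flipBits, clockRange, he.eq_iff, exists_eq_left, eq_iff_iff]
  refine forall_congr' fun j => ?_
  cases x (e j) <;> grind

theorem atTime_mul_shift (he : Injective e) (t : ℕ) :
    atTime e t * shift e t = shift e t * atTime e 0 := by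
  have h := congrArg (fun A => shift e t * A * shift e t) (shift_mul_atTime he t)
  simp only [← mul_assoc, (shift_isRefl e t).mul_self, one_mul] at h
  rw [h, mul_assoc, (shift_isRefl e t).mul_self, mul_one]

theorem atTime_mul_atTime {t t' : ℕ} (ht : t ≤ N) (ht' : t' ≤ N) (h : t ≠ t') :
    atTime e t * atTime e t' = 0 := by
  refine proj_mul_eq_zero fun x hx hx' => ?_
  have := (clockBit_of_atTime hx ht (max t t')).symm.trans (clockBit_of_atTime hx' ht' _)
  simp at this
  omega

theorem atTime_mul_self (t : ℕ) : atTime e t * atTime e t = atTime e t :=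
  proj_mul_eq_left fun _ h => h

theorem edgeSpace_of_atTime {t t₁ t₂ : ℕ} {x : q → Bool}
    (hx : ∀ j : Fin N, x (e j) = decide ((j : ℕ) < t)) (h12 : t₁ ≤ t₂) (ht : t ≤ N) :
    EdgeSpace e t₁ t₂ x ↔ t = t₁ ∨ t = t₂ := by
  unfold EdgeSpace
  simp only [clockBit_of_atTime hx ht, decide_eq_true_eq, decide_eq_false_iff_not, decide_eq_decide]
  constructor
  · rintro ⟨h1, h2, h3⟩
    by_contra hc
    have := h3 t (t + 1) (by omega) (by omega) (by omega) (by omega)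
    omega
  · intro h
    refine ⟨by omega, by omega, fun s s' _ _ _ _ => by omega⟩

theorem atTime_mul_edgeProj {t t₁ t₂ : ℕ} (h12 : t₁ ≤ t₂) (ht : t ≤ N)
    (h : t = t₁ ∨ t = t₂) : atTime e t * edgeProj e t₁ t₂ = atTime e t :=
  proj_mul_eq_left fun _ hx => (edgeSpace_of_atTime hx h12 ht).2 h

theorem edgeProj_mul_atTime_eq_zero {t t₁ t₂ : ℕ} (h12 : t₁ ≤ t₂) (ht : t ≤ N)
    (h1 : t ≠ t₁) (h2 : t ≠ t₂) : edgeProj e t₁ t₂ * atTime e t = 0 :=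
  proj_mul_eq_zero fun x hx hx' => by
    rcases (edgeSpace_of_atTime hx' h12 ht).1 hx with h | h <;> contradiction

theorem edgeProj_commute_atTime (t t₁ t₂ : ℕ) : Commute (edgeProj e t₁ t₂) (atTime e t) :=
  proj_commute _ _

theorem edgeProj_commute_flipOp (he : Injective e) {t₁ t₂ : ℕ} (h12 : t₁ ≤ t₂)
    (ht₂ : t₂ ≤ N) (f : Prop → ℂ) :
    Commute (diagonal fun x => f (EdgeSpace e t₁ t₂ x)) (shift e t₁ * shift e t₂) := by
  rw [shift, shift, flipOp_mul]
  refine (flipOp_commute_diagonal fun x => congrArg f ?_).symm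
  have hb : ∀ t, clockBit e (flipBits (fun u => xor (clockRange e 0 t₁ u) (clockRange e 0 t₂ u)) x)
      t = xor (decide (t₁ < t ∧ t ≤ t₂)) (clockBit e x t) := by
    intro t
    rw [← flipBits_flipBits, clockBit_flip he _ _ (h12.trans ht₂), clockBit_flip he _ _ ht₂,
      ← Bool.xor_assoc]
    congr 1
    grind
  simp only [EdgeSpace, hb, eq_iff_iff, lt_irrefl, false_and, decide_false, Bool.false_xor,
    show ¬ t₂ + 1 ≤ t₂ by omega, and_false]
  refine and_congr_right fun _ => and_congr_right fun _ => forall₄_congr fun t t' h1 h2 =>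
    forall₂_congr fun h3 h4 => ?_
  simp [h1, h2, h3, h4]

theorem edgeSpace_succ {t : ℕ} (x : q → Bool) :
    EdgeSpace e (t - 1) t x ↔ clockBit e x (t - 1) = true ∧ clockBit e x (t + 1) = false := by
  unfold EdgeSpace
  refine and_congr_right fun _ => and_iff_left_of_imp fun _ s s' _ _ _ _ => ?_
  rw [show s = s' by omega]

theorem clockProj_mul_atTime {t t' : ℕ} (ht : t ≤ N) (b : Bool) :
    prj b (clockOp e .Z t') * atTime e t = if decide (t' ≤ t) = b then atTime e t else 0 := by
  rw [prj_clockOp_Z]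
  split_ifs with h
  · exact proj_mul_eq_right fun x hx => by rw [clockBit_of_atTime hx ht, h]
  · exact proj_mul_eq_zero fun x hx hx' => h (by rw [← hx, clockBit_of_atTime hx' ht])

/-- The basis states of a clock that pass all checks of neighbouring bits show a time. -/
theorem exists_atTime (x : q → Bool)
    (h : ∀ t : Fin (N - 1), ¬ (clockBit e x (t + 1) = false ∧ clockBit e x (t + 2) = true)) :
    ∃ t ≤ N, ∀ j : Fin N, x (e j) = decide ((j : ℕ) < t) := by
  have hanti : Antitone fun n : ℕ => if h : n < N then x (e ⟨n, h⟩) else false := by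
    refine antitone_nat_of_succ_le fun n => ?_
    by_cases h1 : n + 1 < N
    · have h2 := h ⟨n, by omega⟩
      unfold clockBit at h2
      rw [dif_pos (by simp; omega), dif_pos (by simp; omega)] at h2
      simp only [Nat.add_sub_cancel] at h2
      simp only [h1, show n < N by omega, dif_pos]
      have e1 : (⟨n + 2 - 1, by omega⟩ : Fin N) = ⟨n + 1, h1⟩ := rfl
      rw [e1] at h2
      revert h2
      cases x (e ⟨n, _⟩) <;> cases x (e ⟨n + 1, h1⟩) <;> simp
    · simp [h1]
  have hex : ∃ n, (if h : n < N then x (e ⟨n, h⟩) else false) = false := ⟨N, by simp⟩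
  refine ⟨Nat.find hex, Nat.find_min' hex (by simp), fun j => ?_⟩
  by_cases hj : (j : ℕ) < Nat.find hex
  · have := Nat.find_min hex hj
    rw [decide_eq_true hj]
    simpa using this
  · have h1 := hanti (not_lt.1 hj)
    have h2 := Nat.find_spec hex
    simp only at h1
    rw [h2, dif_pos j.2] at h1
    rw [decide_eq_false hj]
    exact Bool.eq_false_of_le_false h1

variable {Y : Type} [Fintype Y] [DecidableEq Y]

/-- The component of `φ` at time `t`, with the clock reset. -/
def slice (e : Fin N → q) (φ : (q → Bool) × Y → ℂ) (t : ℕ) : (q → Bool) × Y → ℂ :=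
  fst.op (atTime e 0 * shift e t) *ᵥ φ

theorem nrm_slice (he : Injective e) (φ : (q → Bool) × Y → ℂ) (t : ℕ) :
    nrm (slice e φ t) = nrm (fst.op (atTime e t) *ᵥ φ) := by
  rw [slice, ← shift_mul_atTime he, map_mul, ← mulVec_mulVec,
    (op_isRefl _ (shift_isRefl e t)).nrm]

theorem fst_op_diagonal {κ : Type} [Fintype κ] [DecidableEq κ] (p : κ → ℂ) :
    (fst : Lens (κ × Y) κ).op (diagonal p) = diagonal fun z => p z.1 := by
  rw [fst_op_eq, ← diagonal_one, diagonal_kronecker_diagonal]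
  simp

theorem fst_op_ctr {κ : Type} [Fintype κ] [DecidableEq κ] (p : κ → Prop) :
    Ctr ((fst : Lens (κ × Y) κ).op (proj p)) := by
  rw [proj, fst_op_diagonal]
  exact Ctr.diagonal fun x => norm_indic_le _

theorem nrm_le_sum_proj {κ ι : Type} [Fintype κ] [DecidableEq κ] [Fintype ι] (p : ι → κ → Prop)
    (h : ∀ x, ∃ i, p i x) (φ : κ × Y → ℂ) : nrm φ ≤ ∑ i, nrm (fst.op (proj (p i)) *ᵥ φ) := by
  classical
  choose f hf using h
  have hdec : φ = ∑ i, fst.op (proj fun x => f x = i) *ᵥ φ := by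
    funext z
    simp [proj, fst_op_diagonal, mulVec_diagonal, indic]
  refine (congrArg nrm hdec).le.trans ((nrm_sum_le _ _).trans (sum_le_sum fun i _ => ?_))
  rw [← proj_mul_eq_left (p := fun x => f x = i) (p' := p i) (fun x hx => hx ▸ hf x), map_mul,
    ← mulVec_mulVec]
  exact fst_op_ctr _ _

theorem nrm_le_sum_slice (he : Injective e) (φ : (q → Bool) × Y → ℂ) :
    nrm φ ≤ ∑ t ∈ Finset.range (N + 1), nrm (slice e φ t) + ∑ t : Fin (N - 1),
      nrm (fst.op (prj false (clockOp e .Z (t + 1)) * prj true (clockOp e .Z (t + 2))) *ᵥ φ) := by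
  simp only [nrm_slice he, prj_clockOp_Z, proj_mul, Finset.sum_range]
  refine (nrm_le_sum_proj (Sum.elim (fun (t : Fin (N + 1)) x => ∀ j : Fin N, x (e j) =
    decide ((j : ℕ) < t)) fun (t : Fin (N - 1)) x => clockBit e x (t + 1) = false ∧
    clockBit e x (t + 2) = true) (fun x => ?_) φ).trans (by simp [atTime])
  by_contra! hx
  obtain ⟨t, ht, hj⟩ := exists_atTime x fun t h => hx (.inr t) h
  exact hx (.inl ⟨t, by omega⟩) hj

/-- What the check of an edge says about the components at its ends. -/
theorem nrm_slice_sub_le (he : Injective e) (φ : (q → Bool) × Y → ℂ) {t₁ t₂ : ℕ}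
    (h12 : t₁ ≤ t₂) (ht₂ : t₂ ≤ N) (A B : Mat ((q → Bool) × Y))
    (hA : ∀ t, Commute (fst.op (atTime e 0 * shift e t)) A)
    (hB : ∀ t, Commute (fst.op (atTime e 0 * shift e t)) B) :
    nrm (A *ᵥ slice e φ t₁ - B *ᵥ slice e φ t₂) ≤
      nrm ((fst.op (edgeProj e t₁ t₂) * (A - fst.op (shift e t₁ * shift e t₂) * B))
        *ᵥ φ) := by
  have h : A *ᵥ slice e φ t₁ - B *ᵥ slice e φ t₂ = fst.op (shift e t₁ * atTime e t₁) *ᵥ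
      ((fst.op (edgeProj e t₁ t₂) * (A - fst.op (shift e t₁ * shift e t₂) * B)) *ᵥ φ) := by
    rw [mulVec_mulVec, ← mul_assoc, ← map_mul, mul_assoc (shift e t₁),
      atTime_mul_edgeProj h12 (h12.trans ht₂) (Or.inl rfl), mul_sub, ← mul_assoc, ← map_mul,
      shift_mul_atTime he, sub_mulVec, (hA t₁).eq, mul_assoc (atTime e 0), ← mul_assoc (shift e t₁),
      (shift_isRefl e t₁).mul_self, one_mul, (hB t₂).eq, ← mulVec_mulVec, ← mulVec_mulVec]
    rfl
  rw [h, map_mul, ← mulVec_mulVec, (op_isRefl _ (shift_isRefl e _)).nrm]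
  exact fst_op_ctr _ _

end Clock

/-! ### Rejection operators of the individual checks -/

section ClockCommute

variable {q : Type} [Fintype q] [DecidableEq q] {N : ℕ} {e : Fin N → q}

theorem clockRange_of_notMem {u : q} (hu : ∀ j, e j ≠ u) (t₁ t₂ : ℕ) :
    clockRange e t₁ t₂ u = false := by
  simp [clockRange, hu]

theorem clockOp_commute_coord {u : q} (hu : ∀ j, e j ≠ u) (D : PauliLabel) (t : ℕ)
    (A : Mat Bool) : Commute (clockOp e D t) ((coord u).op A) := by
  unfold clockOp
  split_ifs with h
  · rw [pauliOp_single]; exact op_commute (coord_indep (hu _)) _ _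
  · exact (Commute.one_left _).smul_left _

theorem shift_commute_coord {u : q} (hu : ∀ j, e j ≠ u) (t : ℕ)
    (A : Mat Bool) : Commute (shift e t) ((coord u).op A) :=
  flipOp_commute_coord (clockRange_of_notMem hu _ _) A

theorem atTime_commute_coord {u : q} (hu : ∀ j, e j ≠ u) (t : ℕ)
    (A : Mat Bool) : Commute (atTime e t) ((coord u).op A) := by
  refine Lens.diagonal_commute _ (fun x b => ?_) A
  simp only [coord, update_of_ne (hu _)]

theorem clockOp_Z_commute_shift (he : Injective e) {t t' : ℕ} (h : t' ≠ t)
    (ht : t ≤ N) : Commute (clockOp e .Z t') (shift e (t - 1) * shift e t) := by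
  rw [clockOp_Z, shift, shift, flipOp_mul]
  refine (flipOp_commute_diagonal fun x => ?_).symm
  rw [← flipBits_flipBits, clockBit_flip he _ _ (by omega), clockBit_flip he _ _ ht,
    ← Bool.xor_assoc]
  have : decide (1 ≤ t' ∧ t' ≤ t - 1) = decide (1 ≤ t' ∧ t' ≤ t) := by
    rw [decide_eq_decide]; omega
  rw [this, Bool.xor_self, Bool.false_xor]

theorem edgeProj_succ (t : ℕ) : edgeProj e (t - 1) t =
    prj true (clockOp e .Z (t - 1)) * prj false (clockOp e .Z (t + 1)) := by
  rw [prj_clockOp_Z, prj_clockOp_Z, proj_mul, edgeProj]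
  congr 1
  funext x
  exact propext (edgeSpace_succ x)

end ClockCommute

/-- The rejection operator of a check of the edge `(t₁, t₂)` of a clock. -/
def edgeTest {q Y : Type} [Fintype q] [DecidableEq q] [Fintype Y] [DecidableEq Y] {N : ℕ}
    (e : Fin N → q) (t₁ t₂ : ℕ) (A B : Mat ((q → Bool) × Y)) :
    Mat ((q → Bool) × Y) :=
  fst.op (edgeProj e t₁ t₂) * (A - fst.op (shift e t₁ * shift e t₂) * B)

theorem sgn_xor (a b : Bool) : sgn (xor a b) = sgn a * sgn b := by
  cases a <;> cases b <;> simp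

theorem prod_sgn {ι : Type} [Fintype ι] (f : ι → Bool) :
    ∏ i, sgn (f i) = sgn (decide (Odd (Finset.univ.filter fun i => f i = true).card)) := by
  classical
  generalize (Finset.univ : Finset ι) = s
  induction s using Finset.induction_on with
  | empty => simp
  | insert a s ha ih =>
    rw [Finset.prod_insert ha, ih, Finset.filter_insert]
    by_cases h : Odd (s.filter fun i => f i = true).card <;> cases hf : f a <;>
      simp [h, ha, Nat.odd_add_one]

theorem PauliLabel.X_mul_Z : PauliLabel.X.mat * PauliLabel.Z.mat =
    -(PauliLabel.Z.mat * PauliLabel.X.mat) := by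
  ext a b
  cases a <;> cases b <;> simp [PauliLabel.mat, Matrix.mul_apply]

theorem mul_mul_commute {A : Type} [Ring A] {x z x' z' : A} (h : x * z = -(z * x))
    (h' : x' * z' = -(z' * x')) (h1 : Commute x' z) (h2 : Commute z' x) :
    Commute (x * x') (z * z') := by
  have e1 : x * x' * (z * z') = x * z * (x' * z') := by
    rw [mul_assoc, ← mul_assoc x', h1.eq]; simp only [mul_assoc]
  have e2 : z * z' * (x * x') = z * x * (z' * x') := by
    rw [mul_assoc, ← mul_assoc z', h2.eq]; simp only [mul_assoc]
  rw [Commute, SemiconjBy, e1, e2, h, h']; simp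

theorem pair_commute {q : Type} [Fintype q] [DecidableEq q] {u v : q} (h : u ≠ v) (j : Bool) :
    Commute (pauliOp (pair u .X v (if j then .Z else .X)))
      (pauliOp (pair u .Z v (if j then .X else .Z))) := by
  have anti : ∀ w : q, (coord w).op PauliLabel.X.mat * (coord w).op PauliLabel.Z.mat =
      -((coord w : Lens (q → Bool) Bool).op PauliLabel.Z.mat *
        (coord w).op PauliLabel.X.mat) := by
    intro w
    rw [← map_mul, PauliLabel.X_mul_Z, map_neg, map_mul]
  rw [pauliOp_pair h, pauliOp_pair h]
  refine mul_mul_commute (anti u) ?_ (op_commute (coord_indep h.symm) _ _)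
    (op_commute (coord_indep h.symm) _ _)
  cases j
  · exact anti v
  · have := anti v
    simp only [if_true]
    rw [this, neg_neg]

namespace NormalVerifier

/-- Measurements of the players. -/
abbrev Obs {r : ℕ} (W : NormalVerifier r) (H : Fin r → Type) : Type :=
  ∀ i (g : Question W.m), Answer g → Mat (H i)

variable {r : ℕ} (W : NormalVerifier r) (k : ℕ) {H : Fin r → Type} [∀ i, Fintype (H i)]
  [∀ i, DecidableEq (H i)] (M : W.Obs H)

/-- Basis of the space of the referee and the players. -/
abbrev Space (H : Fin r → Type) : Type := (W.Ref k → Bool) × ∀ i, H i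

/-- Operators of the referee. -/
abbrev onRef (A : Mat (W.Ref k → Bool)) :
    Mat (W.Space k H) := fst.op A

/-- The operator `D` on a qubit of the referee. -/
abbrev refPauli (u : W.Ref k) (D : PauliLabel) : Mat (W.Space k H) :=
  fst.op (pauliOp (single u D))

/-- The observable of player `i` for the bit of `P` in the answer to `g`. -/
def playerObs (i : Fin r) (g : Question W.m) (P : Pauli W.m) :
    Mat (W.Space k H) :=
  (playerLens i).op (obs (M i g) (bit P g))

/-- The reflections that the symbols in the constraint system stand for. -/
def reflOp : Refl r W.m → Mat (W.Space k H)
  | .refl i P => W.playerObs k M i (.pauli P) P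
  | .ctrl c i P => prj false (W.refPauli k (.X c) .Z) +
      prj true (W.refPauli k (.X c) .Z) * W.playerObs k M i (.pauli P) P
  | .derived i Q P => W.playerObs k M i (.multi Q) P

theorem S_injective : Injective (S : Fin (W.N k) → W.Ref k) := fun _ _ h => by
  injection h

theorem C_injective : Injective (C : Fin W.T → W.Ref k) := fun _ _ h => by
  injection h

variable {M}

theorem playerObs_isRefl (hM : ProjMeas M) (i : Fin r) (g : Question W.m) (P : Pauli W.m) :
    IsRefl (W.playerObs k M i g P) := op_isRefl _ ((hM i g).obs_isRefl _)

theorem reads_playerObs (hM : ProjMeas M) {O : Type} [Fintype O] (ques : Fin r → Question W.m)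
    (m : Meas (W.Ref k → Bool) O) (i : Fin r) {g : Question W.m} (hg : ques i = g) (P : Pauli W.m) :
    Reads (ExtGame.outcomeOp ques m M) (W.playerObs k M i g P)
      fun p => sgn (bit P _ (p.1 i)) := by
  subst hg
  exact reads_player ques m M hM i (bit P _)

theorem rej_leaf_clock (hM : ProjMeas M) {q : ℕ} {e : Fin q → W.Ref k} (t : ℕ) (φ : W.Space k H → ℂ) :
    (ExtGame.leaf askNone ((clockMeas e .Z (t + 1)).seq (clockMeas e .Z (t + 2)))
        fun _ o => ¬ (o.1 = false ∧ o.2 = true) : W.Game k).rej M φ =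
      nrm (W.onRef k (prj false (clockOp e .Z (t + 1)) * prj true (clockOp e .Z (t + 2)))
        *ᵥ φ) ^ 2 := by
  refine ExtGame.rej_leaf_eq hM (Reads.ref ((((reads_clockMeas e .Z (t + 1)).seq_fst _).prj
    false).mul (((reads_clockMeas e .Z (t + 2)).seq_snd fun o => ?_).prj true)) _ _) ?_ φ
  · rw [clockMeas_K]
    refine prj_commute ?_ _
    rw [clockOp_Z, clockOp_Z]
    exact commute_diagonal _ _
  · rintro a ⟨o₁, o₂⟩
    cases o₁ <;> cases o₂ <;> simp

open Classical in
theorem reads_sEdge {t₁ t₂ : ℕ} (h12 : t₁ ≤ t₂) (ht : t₂ ≤ W.N k) :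
    Reads (W.sEdge k t₁ t₂).K (edgeProj S t₁ t₂) (fun o => if o.1 = true then 1 else 0) ∧
    Reads (W.sEdge k t₁ t₂).K (shift S t₁ * shift S t₂) (fun o => sgn o.2) := by
  constructor
  · exact (reads_indicator (EdgeSpace S t₁ t₂)).seq_fst _
  · refine Reads.seq_snd (c := sgn) ?_ fun o => ?_
    · rw [← flipOp_clockRange _ h12 (W.S_injective k), ← edgeLabel_op]
      exact reads_reflection _ _
    · exact edgeProj_commute_flipOp (W.S_injective k) h12 ht fun p => if o = true ↔ p then 1 else 0

/-- The rejection operator of the propagation check. -/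
theorem rej_reflCheck (hM : ProjMeas M) {t : ℕ} (ht : t + 1 ≤ W.N k) (R : Refl r W.m) (φ : W.Space k H → ℂ) :
    (W.reflCheck k (t + 1) R).rej M φ = nrm (edgeTest S t (t + 1) ((1 / 2 : ℂ) • 1)
      ((1 / 2 : ℂ) • W.reflOp k M R) *ᵥ φ) ^ 2 := by
  obtain ⟨hD, hF⟩ := W.reads_sEdge k (Nat.le_succ t) ht
  rcases R with ⟨i, P⟩ | ⟨c, i, P⟩ | ⟨i, Q, P⟩
  case ctrl =>
    have hZ : Reads ((W.sEdge k t (t + 1)).seq (Meas.pauli (single (RefQubit.X c) .Z))).K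
        (pauliOp (single (RefQubit.X c) .Z)) fun o => sgn o.2 := by
      refine Reads.seq_snd (c := sgn) (reads_reflection _ _) fun o => ?_
      have h2 := fun t => shift_commute_coord (e := (S : Fin (W.N k) → W.Ref k))
        (u := RefQubit.X c) (by simp) t PauliLabel.Z.mat
      rw [← pauliOp_single] at h2
      refine seq_commute (fun o => ?_) (fun o => ?_) o
      · rw [single_Z_eq_diagonal]
        exact commute_diagonal _ _
      · refine prj_commute ?_ o
        rw [edgeLabel_op, flipOp_clockRange _ (Nat.le_succ t) (W.S_injective k)]
        exact (h2 _).mul_left (h2 _)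
    have hZ' := hZ.ref (askOne i (.pauli P)) M
    refine ExtGame.rej_leaf_eq hM (((hD.seq_fst _).ref _ _).mul ((Reads.one.smul _).sub
      (((hF.seq_fst _).ref _ _).mul (((hZ'.prj false).add ((hZ'.prj true).mul
        (W.reads_playerObs k hM _ _ i (by simp [askOne]) P))).smul _)))) ?_ φ
    rintro a ⟨⟨o₁, o₂⟩, o₃⟩
    simp only [Pi.mul_apply, Pi.sub_apply, Pi.smul_apply, Pi.one_apply, smul_eq_mul, Pi.add_apply]
    generalize bit P _ (a i) = b
    cases o₁ <;> cases o₂ <;> cases o₃ <;> cases b <;> norm_num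
  all_goals
    refine ExtGame.rej_leaf_eq hM ((hD.ref _ _).mul ((Reads.one.smul _).sub ((hF.ref _ _).mul
      (((W.reads_playerObs k hM _ _ i (by simp [askOne]) P)).smul _)))) ?_ φ
    rintro a ⟨o₁, o₂⟩
    simp only [Pi.mul_apply, Pi.sub_apply, Pi.smul_apply, Pi.one_apply, smul_eq_mul]
    generalize bit P _ (a i) = b
    cases o₁ <;> cases o₂ <;> cases b <;> norm_num

theorem rej_leaf_cons (hM : ProjMeas M) {t₁ t₂ : ℕ} (h12 : t₁ ≤ t₂) (ht : t₂ ≤ W.N k) (τ : Bool)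
    (φ : W.Space k H → ℂ) :
    (ExtGame.leaf askNone (W.sEdge k t₁ t₂) fun _ o => o.1 = false ∨ o.2 = τ : W.Game k).rej M φ =
      nrm (edgeTest S t₁ t₂ ((1 / 2 : ℂ) • 1)
        ((1 / 2 : ℂ) • (sgn τ • 1)) *ᵥ φ) ^ 2 := by
  obtain ⟨hD, hF⟩ := W.reads_sEdge k h12 ht
  refine ExtGame.rej_leaf_eq hM ((hD.ref _ _).mul ((Reads.one.smul _).sub ((hF.ref _ _).mul
      ((Reads.one.smul _).smul _)))) ?_ φ
  rintro a ⟨o₁, o₂⟩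
  simp only [Pi.mul_apply, Pi.sub_apply, Pi.smul_apply, Pi.one_apply, smul_eq_mul]
  cases o₁ <;> cases o₂ <;> cases τ <;> norm_num

theorem rej_leaf_init (hM : ProjMeas M) (c : Ctrl r W.m) (φ : W.Space k H → ℂ) :
    (ExtGame.leaf askNone
      ((Meas.indicator fun x : W.Ref k → Bool => ∀ t, x (S t) = false).seq
        (Meas.pauli (single (RefQubit.X c) .X)))
      fun _ o => o.1 = false ∨ o.2 = false : W.Game k).rej M φ =
      nrm ((W.onRef k (atTime S 0) * prj true (W.refPauli k (.X c) .X)) *ᵥ φ) ^ 2 := by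
  have h0 : (atTime S 0 : Mat (W.Ref k → Bool)) =
      proj fun x => ∀ t, x (S t) = false := by
    rw [atTime]; simp
  have hD := (reads_indicator fun x : W.Ref k → Bool => ∀ t, x (S t) = false).seq_fst
    (Meas.pauli (single (RefQubit.X c) .X))
  have hX : Reads ((Meas.indicator fun x : W.Ref k → Bool => ∀ t, x (S t) = false).seq
      (Meas.pauli (single (RefQubit.X c) .X))).K (pauliOp (single (RefQubit.X c) .X))
      fun o => sgn o.2 := by
    refine Reads.seq_snd (c := sgn) (reads_reflection _ _) fun o => ?_
    rw [pauliOp_single]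
    exact Lens.diagonal_commute _ (fun x b => by simp [coord]) _
  rw [h0]
  have hX' := (hX.ref askNone M).prj true
  refine ExtGame.rej_leaf_eq hM ((hD.ref _ _).mul hX') ?_ φ
  rintro a ⟨o₁, o₂⟩
  cases o₁ <;> cases o₂ <;> simp

/-! #### The game for honest players -/

theorem rej_leaf_honestB (hM : ProjMeas M) (i : Fin r) (φ : W.Space k H → ℂ) :
    (ExtGame.leaf (askOne i (.pauli (W.onB .Z))) (W.cMeas k .Z (W.L + 1))
        fun a o => o = bit (W.onB .Z) _ (a i) : W.Game k).rej M φ =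
      nrm (prj true (W.onRef k (clockOp C .Z (W.L + 1)) *
        W.playerObs k M i (.pauli (W.onB .Z)) (W.onB .Z)) *ᵥ φ) ^ 2 := by
  have h := ((reads_clockMeas (C : Fin W.T → W.Ref k) .Z (W.L + 1)).ref
    (askOne i (.pauli (W.onB .Z))) M).mul
    (W.reads_playerObs k hM _ _ i (g := .pauli (W.onB .Z)) (by simp [askOne]) (W.onB .Z))
  have h' := Reads.prj (F := ExtGame.outcomeOp (askOne i (.pauli (W.onB .Z)))
    (W.cMeas k .Z (W.L + 1)) M) (β := fun p => xor p.2 (bit (W.onB .Z) _ (p.1 i)))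
    (R := W.onRef k (clockOp C .Z (W.L + 1)) *
        W.playerObs k M i (.pauli (W.onB .Z)) (W.onB .Z))
    (by intro ω; simp only [sgn_xor]; exact h ω) true
  refine ExtGame.rej_leaf_eq hM h' ?_ φ
  intro a o
  generalize bit (W.onB .Z) _ (a i) = b
  cases o <;> cases b <;> simp

/-- What the measurement of the window and of `X` on a qubit of the clock reads. -/
theorem reads_window {t : ℕ} (ht : 1 ≤ t ∧ t ≤ W.T) :
    Reads ((W.window k t).seq (W.cMeas k .X t)).K (edgeProj C (t - 1) t)
      (fun o => if o.1 = (true, false) then 1 else 0) ∧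
    Reads ((W.window k t).seq (W.cMeas k .X t)).K (shift C (t - 1) * shift C t)
      (fun o => sgn o.2) := by
  constructor
  · rw [edgeProj_succ]
    have h1 := ((reads_clockMeas (C : Fin W.T → W.Ref k) .Z (t - 1)).prj (β := id)
      true).seq_fst (W.cMeas k .Z (t + 1))
    have h2 : Reads (W.window k t).K (clockOp C .Z (t + 1)) fun o => sgn o.2 := by
      refine Reads.seq_snd (c := sgn) (reads_clockMeas _ _ _) fun o => ?_
      rw [cMeas, clockMeas_K]
      refine prj_commute ?_ _
      rw [clockOp_Z, clockOp_Z]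
      exact commute_diagonal _ _
    intro o
    refine ((h1.mul (h2.prj (β := fun o => o.2) false)).seq_fst (W.cMeas k .X t) o).trans ?_
    obtain ⟨⟨z₁, z₂⟩, x⟩ := o
    cases z₁ <;> cases z₂ <;> simp [window, cMeas]
  · rw [← clockOp_X _ ht (W.C_injective k)]
    refine Reads.seq_snd (c := sgn) (reads_clockMeas _ _ _) fun o => ?_
    rw [clockOp_X _ ht (W.C_injective k)]
    refine seq_commute (fun o => ?_) (fun o => ?_) o <;> rw [cMeas, clockMeas_K] <;>
    refine prj_commute (clockOp_Z_commute_shift (W.C_injective k) (by omega) ht.2) _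

theorem window_commute {u : W.Ref k} (hu : ∀ j, C j ≠ u) (t : ℕ) (D : PauliLabel)
    (A : Mat Bool) (o : (Bool × Bool) × Bool) :
    Commute (((W.window k t).seq (W.cMeas k D t)).K o) ((coord u).op A) := by
  refine seq_commute (fun o => seq_commute (fun o => ?_) (fun o => ?_) o) (fun o => ?_) o <;>
  rw [cMeas, clockMeas_K] <;> exact prj_commute (clockOp_commute_coord hu _ _ _) _

theorem rej_leaf_hadV (hM : ProjMeas M) {t : ℕ} (ht : 1 ≤ t ∧ t ≤ W.T) {j₁ j₂ : Fin W.qV} (hj : j₁ ≠ j₂) (j : Bool)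
    (φ : W.Space k H → ℂ) :
    (ExtGame.leaf askNone
        ((((W.window k t).seq (W.cMeas k .X t)).seq
          (Meas.pauli (pair (RefQubit.V j₁) .X (RefQubit.V j₂) (if j then .Z else .X)))).seq
          (Meas.pauli (pair (RefQubit.V j₁) .Z (RefQubit.V j₂) (if j then .X else .Z))))
        fun _ ⟨⟨⟨z, x⟩, a₁⟩, a₂⟩ =>
          ¬ (z = (true, false) ∧ xor x a₁ = true ∧ xor x a₂ = true) : W.Game k).rej M φ =
    nrm (edgeTest C (t - 1) t
      ((1 / 4 : ℂ) • (1 + W.onRef k (pauliOp (pair (.V j₁) .X (.V j₂) (if j then .Z else .X))) *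
        W.onRef k (pauliOp (pair (.V j₁) .Z (.V j₂) (if j then .X else .Z)))))
      ((1 / 4 : ℂ) • (W.onRef k (pauliOp (pair (.V j₁) .X (.V j₂) (if j then .Z else .X))) +
        W.onRef k (pauliOp (pair (.V j₁) .Z (.V j₂) (if j then .X else .Z))))) *ᵥ φ) ^ 2 := by
  obtain ⟨hD, hF⟩ := W.reads_window k ht
  have hne : (RefQubit.V j₁ : W.Ref k) ≠ RefQubit.V j₂ := fun h => hj (by injection h)
  have hw : ∀ (D E : PauliLabel) o, Commute (((W.window k t).seq (W.cMeas k .X t)).K o)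
      (pauliOp (pair (RefQubit.V j₁) D (RefQubit.V j₂) E)) := by
    intro D E o
    rw [pauliOp_pair hne]
    exact (W.window_commute k (by simp) t _ _ o).mul_right (W.window_commute k (by simp) t _ _ o)
  have hw₁ := hw .X (if j then .Z else .X)
  have hw₂ := hw .Z (if j then .X else .Z)
  have hc := pair_commute hne j
  generalize pair (RefQubit.V j₁) PauliLabel.X (RefQubit.V j₂) _ = P₁ at *
  generalize pair (RefQubit.V j₁) PauliLabel.Z (RefQubit.V j₂) _ = P₂ at *
  have h1' := ((Reads.seq_snd (m' := Meas.pauli P₁) (c := sgn) (reads_reflection _ _) hw₁).seq_fst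
    (Meas.pauli P₂)).ref askNone M
  have h2' := (Reads.seq_snd (m' := Meas.pauli P₂) (c := sgn) (reads_reflection _ _)
      (seq_commute (m' := Meas.pauli P₁) hw₂ fun o => prj_commute hc o)).ref askNone M
  refine ExtGame.rej_leaf_eq hM ((((hD.seq_fst _).seq_fst _).ref _ _).mul
    (((Reads.one.add (h1'.mul h2')).smul _).sub
      ((((hF.seq_fst _).seq_fst _).ref _ _).mul ((h1'.add h2').smul _)))) ?_ φ
  rintro a ⟨⟨⟨⟨z₁, z₂⟩, x⟩, a₁⟩, a₂⟩
  simp only [Pi.mul_apply, Pi.sub_apply, Pi.smul_apply, Pi.one_apply, smul_eq_mul, Pi.add_apply]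
  cases z₁ <;> cases z₂ <;> cases x <;> cases a₁ <;> cases a₂ <;> norm_num

theorem rej_leaf_hadM (hM : ProjMeas M) {t : ℕ} (ht : 1 ≤ t ∧ t ≤ W.T) (i : Fin r) (P₁ P₂ : Pauli W.m)
    (φ : W.Space k H → ℂ) :
    (ExtGame.leaf (askOne i (.multi {P₁, P₂})) ((W.window k t).seq (W.cMeas k .X t))
        fun a ⟨z, x⟩ =>
          ¬ (z = (true, false) ∧ xor x (bit P₁ _ (a i)) = true ∧ xor x (bit P₂ _ (a i)) = true)
            : W.Game k).rej M φ =
    nrm (edgeTest C (t - 1) t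
      ((1 / 4 : ℂ) • (1 + W.playerObs k M i (.multi {P₁, P₂}) P₁ *
        W.playerObs k M i (.multi {P₁, P₂}) P₂))
      ((1 / 4 : ℂ) • (W.playerObs k M i (.multi {P₁, P₂}) P₁ +
        W.playerObs k M i (.multi {P₁, P₂}) P₂)) *ᵥ φ) ^ 2 := by
  obtain ⟨hD, hF⟩ := W.reads_window k ht
  have h1 := W.reads_playerObs k hM (askOne i (.multi {P₁, P₂}))
    ((W.window k t).seq (W.cMeas k .X t)) i (g := .multi {P₁, P₂}) (by simp [askOne])
  refine ExtGame.rej_leaf_eq hM ((hD.ref _ _).mul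
    (((Reads.one.add ((h1 P₁).mul (h1 P₂))).smul _).sub
      ((hF.ref _ _).mul (((h1 P₁).add (h1 P₂)).smul _)))) ?_ φ
  rintro a ⟨⟨z₁, z₂⟩, x⟩
  simp only [Pi.mul_apply, Pi.sub_apply, Pi.smul_apply, Pi.one_apply, smul_eq_mul, Pi.add_apply]
  generalize bit P₁ _ (a i) = a₁
  generalize bit P₂ _ (a i) = a₂
  cases z₁ <;> cases z₂ <;> cases x <;> cases a₁ <;> cases a₂ <;> norm_num

end NormalVerifier

namespace NormalVerifier

variable {r : ℕ} (W : NormalVerifier r) (k : ℕ) {H : Fin r → Type} [∀ i, Fintype (H i)]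
  [∀ i, DecidableEq (H i)] {M : W.Obs H}

/-- The operator that stands for `D` on a qubit of the verifier in a check in which the operators
in `l` are measured. -/
def wireObs (M : W.Obs H)
    (l : List (PauliLabel × Wire W.qV r W.qM)) (D : PauliLabel) :
    Wire W.qV r W.qM → Mat (W.Space k H)
  | .inl j => W.refPauli k (.V j) D
  | .inr (i, j) => W.playerObs k M i (askList (W.playerOps i l)) (W.onM D j)

theorem reads_wireObs (hM : ProjMeas M) {O : Type} [Fintype O]
    (l : List (PauliLabel × Wire W.qV r W.qM)) (m : Meas (W.Ref k → Bool) O)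
    (D : PauliLabel) (u : Wire W.qV r W.qM) (f : O → Bool)
    (h : ∀ j, u = .inl j → Reads m.K (pauliOp (single (RefQubit.V j) D)) fun o => sgn (f o)) :
    Reads (ExtGame.outcomeOp (fun i => askList (W.playerOps i l)) m M) (W.wireObs k M l D u)
      fun p => sgn (W.wireBit D p.1 (f p.2) u) := by
  rcases u with j | ⟨i, j⟩
  · exact (h j rfl).ref _ _
  · exact W.reads_playerObs k hM _ _ i rfl _

theorem wireMeas_commute (D : PauliLabel) (u : Wire W.qV r W.qM) {j : Fin W.qV}
    (hu : u ≠ .inl j) (A : Mat Bool) (o : Bool) :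
    Commute ((W.wireMeas k D u).K o) ((coord (RefQubit.V j)).op A) := by
  rcases u with j' | ⟨i, j'⟩
  · refine prj_commute ?_ _
    rw [pauliOp_single]
    refine op_commute (coord_indep fun h => hu ?_) _ _
    injection h with h; rw [h]
  · simp only [wireMeas, Meas.const]
    split_ifs
    · exact Commute.one_left _
    · exact Commute.zero_left _

theorem reads_wireMeas {O : Type} [Fintype O] (m : Meas (W.Ref k → Bool) O) (D : PauliLabel)
    (u : Wire W.qV r W.qM) {j : Fin W.qV} (hu : u = .inl j)
    (hm : ∀ o, Commute (m.K o) ((coord (RefQubit.V j)).op D.mat)) :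
    Reads (m.seq (W.wireMeas k D u)).K (pauliOp (single (RefQubit.V j) D)) fun o => sgn o.2 := by
  subst hu
  refine Reads.seq_snd (c := sgn) (m' := W.vMeas k D j)
    (reads_reflection (pauliOp_conjTranspose _) (pauliOp_mul_self _)) fun o => ?_
  rw [pauliOp_single]
  exact hm o

theorem rej_leaf_tof (hM : ProjMeas M) {t : ℕ} (ht : 1 ≤ t ∧ t ≤ W.T)
    {u₁ u₂ u₃ : Wire W.qV r W.qM} (h₁₂ : u₁ ≠ u₂) (h₁₃ : u₁ ≠ u₃) (h₂₃ : u₂ ≠ u₃)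
    (l : List (PauliLabel × Wire W.qV r W.qM))
    (φ : W.Space k H → ℂ) :
    (ExtGame.leaf (fun i => askList (W.playerOps i l))
        (((((W.window k t).seq (W.cMeas k .X t)).seq (W.wireMeas k .Z u₁)).seq
          (W.wireMeas k .Z u₂)).seq (W.wireMeas k .X u₃))
        fun a ⟨⟨⟨⟨z, x⟩, o₁⟩, o₂⟩, o₃⟩ =>
          ¬ (z = (true, false) ∧
            if W.wireBit .Z a o₁ u₁ = true ∧ W.wireBit .Z a o₂ u₂ = true
            then xor x (W.wireBit .X a o₃ u₃) = true else x = true) : W.Game k).rej M φ =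
    nrm (edgeTest C (t - 1) t ((1 / 2 : ℂ) • 1)
      ((1 / 2 : ℂ) • (1 - prj true (W.wireObs k M l .Z u₁) * prj true (W.wireObs k M l .Z u₂) *
        (1 - W.wireObs k M l .X u₃))) *ᵥ φ) ^ 2 := by
  obtain ⟨hD, hF⟩ := W.reads_window k ht
  have hw : ∀ (j : Fin W.qV) (A : Mat Bool) o,
      Commute (((W.window k t).seq (W.cMeas k .X t)).K o)
        ((coord (RefQubit.V j : W.Ref k)).op A) :=
    fun j A o => W.window_commute k (by simp) t _ _ o
  have h1 : ∀ j, u₁ = .inl j → Reads ((((((W.window k t).seq (W.cMeas k .X t)).seq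
      (W.wireMeas k .Z u₁)).seq (W.wireMeas k .Z u₂)).seq (W.wireMeas k .X u₃))).K
      (pauliOp (single (RefQubit.V j) .Z)) fun o => sgn o.1.1.2 := fun j hj =>
    ((W.reads_wireMeas k _ _ _ hj (hw j _)).seq_fst _).seq_fst _
  have h2 : ∀ j, u₂ = .inl j → Reads ((((((W.window k t).seq (W.cMeas k .X t)).seq
      (W.wireMeas k .Z u₁)).seq (W.wireMeas k .Z u₂)).seq (W.wireMeas k .X u₃))).K
      (pauliOp (single (RefQubit.V j) .Z)) fun o => sgn o.1.2 := fun j hj =>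
    (W.reads_wireMeas k _ _ _ hj (seq_commute (hw j _)
      (W.wireMeas_commute k _ _ (hj ▸ h₁₂) _))).seq_fst _
  have h3 : ∀ j, u₃ = .inl j → Reads ((((((W.window k t).seq (W.cMeas k .X t)).seq
      (W.wireMeas k .Z u₁)).seq (W.wireMeas k .Z u₂)).seq (W.wireMeas k .X u₃))).K
      (pauliOp (single (RefQubit.V j) .X)) fun o => sgn o.2 := fun j hj =>
    W.reads_wireMeas k _ _ _ hj (seq_commute (seq_commute (hw j _)
      (W.wireMeas_commute k _ _ (hj ▸ h₁₃) _)) (W.wireMeas_commute k _ _ (hj ▸ h₂₃) _))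
  have r1 := (W.reads_wireObs k hM l _ .Z u₁ (fun o : (((((Bool × Bool) × Bool) × Bool) × Bool) × Bool) =>
    o.1.1.2) h1).prj true
  have r2 := (W.reads_wireObs k hM l _ .Z u₂ (fun o : (((((Bool × Bool) × Bool) × Bool) × Bool) × Bool) =>
    o.1.2) h2).prj true
  have r3 := W.reads_wireObs k hM l _ .X u₃ (fun o : (((((Bool × Bool) × Bool) × Bool) × Bool) × Bool) =>
    o.2) h3
  refine ExtGame.rej_leaf_eq hM (((((hD.seq_fst _).seq_fst _).seq_fst _).ref _ _).mul
    ((Reads.one.smul _).sub ((((((hF.seq_fst _).seq_fst _).seq_fst _).ref _ _)).mul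
      ((Reads.one.sub ((r1.mul r2).mul (Reads.one.sub r3))).smul _)))) ?_ φ
  rintro a ⟨⟨⟨⟨⟨z₁, z₂⟩, x⟩, a₁⟩, a₂⟩, a₃⟩
  simp only [Pi.mul_apply, Pi.sub_apply, Pi.smul_apply, Pi.one_apply, smul_eq_mul]
  rcases Bool.eq_false_or_eq_true (W.wireBit .Z a a₁ u₁) with h1 | h1 <;>
  rcases Bool.eq_false_or_eq_true (W.wireBit .Z a a₂ u₂) with h2 | h2 <;>
  rcases Bool.eq_false_or_eq_true (W.wireBit .X a a₃ u₃) with h3 | h3 <;>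
  cases z₁ <;> cases z₂ <;> cases x <;> norm_num [h1, h2, h3]

/-- The product of the reflections of the players for the special question. -/
def xapOp (M : W.Obs H) :
    Mat (W.Space k H) :=
  Lens.snd.op (tensor fun i => obs (M i .xap) (xapBit _))

theorem rej_proverProp (hM : ProjMeas M) (φ : W.Space k H → ℂ) :
    (W.proverProp k).rej M φ = nrm (edgeTest C W.L (W.L + 1) ((1 / 2 : ℂ) • 1)
      ((1 / 2 : ℂ) • W.xapOp k M) *ᵥ φ) ^ 2 := by
  obtain ⟨hD, hF⟩ := W.reads_window k (t := W.L + 1) ⟨by omega, by unfold T; omega⟩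
  have hX := reads_players (fun _ => Question.xap) ((W.window k (W.L + 1)).seq (W.cMeas k .X (W.L + 1)))
    M hM fun i => xapBit .xap
  have hD' := hD.ref (fun _ : Fin r => Question.xap) M
  have hF' := hF.ref (fun _ : Fin r => Question.xap) M
  refine ExtGame.rej_leaf_eq hM (hD'.mul ((Reads.one.smul _).sub (hF'.mul (hX.smul _)))) ?_ φ
  rintro a ⟨⟨z₁, z₂⟩, x⟩
  simp only [Pi.mul_apply, Pi.sub_apply, Pi.smul_apply, Pi.one_apply, smul_eq_mul, prod_sgn]
  generalize decide (Odd (Finset.card (α := Fin r) _)) = b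
  cases z₁ <;> cases z₂ <;> cases x <;> cases b <;> norm_num

theorem reads_cMeas_vMeas (t : ℕ) (j : Fin W.qV) :
    Reads ((W.cMeas k .Z t).seq (W.vMeas k .Z j)).K (pauliOp (single (RefQubit.V j) .Z))
      fun o => sgn o.2 := by
  refine Reads.seq_snd (c := sgn) (m' := W.vMeas k .Z j)
    (reads_reflection (pauliOp_conjTranspose _) (pauliOp_mul_self _)) fun o => ?_
  rw [cMeas, clockMeas_K, pauliOp_single]
  exact prj_commute (clockOp_commute_coord (by simp) _ _ _) _

theorem rej_leaf_honestInit (hM : ProjMeas M) (j : Fin W.qV)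
    (φ : W.Space k H → ℂ) :
    (ExtGame.leaf askNone ((W.cMeas k .Z 1).seq (W.vMeas k .Z j))
      fun _ o => o.1 = true ∨ o.2 = false : W.Game k).rej M φ =
    nrm ((W.onRef k (prj false (clockOp C .Z 1)) * prj true (W.refPauli k (.V j) .Z)) *ᵥ φ)
      ^ 2 := by
  have h1 := (((reads_clockMeas (C : Fin W.T → W.Ref k) .Z 1).prj (β := id)
    false).seq_fst (W.vMeas k .Z j)).ref askNone M
  have h2 := ((W.reads_cMeas_vMeas k 1 j).ref askNone M).prj (β := fun o : (∀ i : Fin r, Answer (askNone (m := W.m) i)) × Bool × Bool => o.2.2) true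
  refine ExtGame.rej_leaf_eq hM (h1.mul h2) ?_ φ
  rintro a ⟨o₁, o₂⟩
  rw [Pi.mul_apply]
  cases o₁ <;> cases o₂ <;> simp

theorem rej_honestOutput (hM : ProjMeas M) (φ : W.Space k H → ℂ) :
    (W.honestOutput k).rej M φ =
    nrm ((W.onRef k (prj true (clockOp C .Z W.T)) *
      prj false (W.refPauli k (.V ⟨0, W.qV_pos⟩) .Z)) *ᵥ φ) ^ 2 := by
  have h1 := (((reads_clockMeas (C : Fin W.T → W.Ref k) .Z W.T).prj (β := id)
    true).seq_fst (W.vMeas k .Z ⟨0, W.qV_pos⟩)).ref askNone M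
  have h2 := ((W.reads_cMeas_vMeas k W.T ⟨0, W.qV_pos⟩).ref askNone M).prj (β := fun o : (∀ i : Fin r, Answer (askNone (m := W.m) i)) × Bool × Bool => o.2.2)
    false
  refine ExtGame.rej_leaf_eq hM (h1.mul h2) ?_ φ
  rintro a ⟨o₁, o₂⟩
  rw [Pi.mul_apply]
  cases o₁ <;> cases o₂ <;> simp

end NormalVerifier

/-! ### Sequences of reflections -/

section Words

variable {J α : Type} [Fintype J] [DecidableEq J]

/-- The product of the operators in a list, the first of which acts first. -/
def wordOp (op : α → Mat J) : List α → Mat J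
  | [] => 1
  | a :: l => wordOp op l * op a

variable {op : α → Mat J}

theorem wordOp_nil : wordOp op [] = 1 := rfl

theorem wordOp_cons (a : α) (l : List α) : wordOp op (a :: l) = wordOp op l * op a := rfl

theorem wordOp_append (l l' : List α) : wordOp op (l ++ l') = wordOp op l' * wordOp op l := by
  induction l with
  | nil => simp [wordOp]
  | cons a l ih => rw [List.cons_append, wordOp, ih, wordOp, mul_assoc]

theorem wordOp_singleton (a : α) : wordOp op [a] = op a := by simp [wordOp]

theorem wordOp_commute {A : Mat J} {l : List α} (h : ∀ a ∈ l, Commute A (op a)) :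
    Commute A (wordOp op l) := by
  induction l with
  | nil => exact Commute.one_right _
  | cons a l ih =>
    exact (ih fun b hb => h b (List.mem_cons_of_mem _ hb)).mul_right (h a List.mem_cons_self)

theorem wordOp_reverse_mul (hop : ∀ a, IsRefl (op a)) (l : List α) :
    wordOp op l.reverse * wordOp op l = 1 := by
  induction l with
  | nil => simp [wordOp]
  | cons a l ih =>
    rw [List.reverse_cons, wordOp_append, wordOp_singleton, wordOp, mul_assoc,
      ← mul_assoc (wordOp op l.reverse), ih, one_mul, (hop a).mul_self]

theorem wordOp_isometry (hop : ∀ a, IsRefl (op a)) (l : List α) :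
    (wordOp op l)ᴴ * wordOp op l = 1 := by
  induction l with
  | nil => simp [wordOp]
  | cons a l ih =>
    rw [wordOp, conjTranspose_mul, mul_assoc, ← mul_assoc _ _ (op a), ih, one_mul,
      (hop a).isometry]

theorem wordOp_ctr (hop : ∀ a, IsRefl (op a)) (l : List α) : Ctr (wordOp op l) :=
  Ctr.of_isometry (wordOp_isometry hop l)

theorem take_succ_eq {l : List α} {n : ℕ} (h : n < l.length) :
    l.take (n + 1) = l.take n ++ [l[n]] := by simp [-List.take_append_getElem, List.take_add_one, h]

/-- Vectors that are connected by reflections. -/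
theorem nrm_sub_wordOp_le (hop : ∀ a, IsRefl (op a)) {l : List α} {f : ℕ → J → ℂ} {ε : ℝ}
    (h : ∀ t (ht : t < l.length), nrm (f t - op l[t] *ᵥ f (t + 1)) ≤ ε) (t : ℕ)
    (ht : t ≤ l.length) : nrm (f t - wordOp op (l.take t) *ᵥ f 0) ≤ t * ε := by
  induction t with
  | zero => simp [wordOp, nrm_zero]
  | succ t ih =>
    have ht' : t < l.length := ht
    rw [take_succ_eq ht, wordOp_append, wordOp_singleton, ← mulVec_mulVec]
    have e1 : nrm (f (t + 1) - op l[t] *ᵥ (wordOp op (l.take t) *ᵥ f 0)) =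
        nrm (op l[t] *ᵥ f (t + 1) - wordOp op (l.take t) *ᵥ f 0) := by
      rw [← (hop l[t]).nrm (f (t + 1) - _), mulVec_sub, (hop l[t]).mulVec_mulVec]
    rw [e1]
    have h1 := h t ht'
    rw [nrm_sub_comm] at h1
    have h2 := nrm_sub_trans (op l[t] *ᵥ f (t + 1)) (f t) (wordOp op (l.take t) *ᵥ f 0)
    have h3 := ih ht'.le
    push_cast
    linarith

theorem nrm_sgn_smul_sub (τ : Bool) (v w : J → ℂ) : nrm (sgn τ • v - sgn τ • w) = nrm (v - w) := by
  rw [← smul_sub, nrm_smul, norm_sgn, one_mul]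

theorem nrm_sub_sgn_comm (τ : Bool) (v w : J → ℂ) : nrm (v - sgn τ • w) = nrm (w - sgn τ • v) := by
  rw [← nrm_sgn_smul_sub τ v, smul_smul, sgn_mul_self, one_smul, nrm_sub_comm]

theorem nrm_sub_sgn_xor_le (σ τ : Bool) (u v w : J → ℂ) :
    nrm (u - sgn (xor σ τ) • w) ≤ nrm (u - sgn σ • v) + nrm (v - sgn τ • w) := by
  rw [← nrm_sgn_smul_sub σ v, sgn_xor, ← smul_smul]
  exact nrm_sub_trans _ _ _

theorem Ctr.nrm_sub_sgn_le {A : Mat J} (hA : Ctr A) (σ τ : Bool) (v w : J → ℂ) :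
    nrm (A *ᵥ w - sgn σ • w) ≤ nrm (A *ᵥ v - sgn σ • v) + 2 * nrm (v - sgn τ • w) := by
  have h := hA.sub_le w (sgn τ • v)
  rw [mulVec_smul, nrm_sub_sgn_comm τ w] at h
  have h₁ := nrm_sub_sgn_xor_le τ (xor σ τ) (A *ᵥ w) (A *ᵥ v) w
  have h₂ := nrm_sub_sgn_xor_le σ τ (A *ᵥ v) v w
  rw [← Bool.xor_assoc, Bool.xor_comm τ, Bool.xor_assoc, Bool.xor_self, Bool.xor_false] at h₁
  linarith

/-- If each of the words in a list acts approximately as a sign, one after the other, then so do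
they all on the initial vector. -/
theorem nrm_constraint_le (hop : ∀ a, IsRefl (op a)) {cs : List (List α × Bool)} {ξ : J → ℂ} {ε : ℝ}
    (h : ∀ j (hj : j < cs.length), nrm (wordOp op ((cs.take j).flatMap Prod.fst) *ᵥ ξ -
      sgn cs[j].2 • (wordOp op cs[j].1 *ᵥ (wordOp op ((cs.take j).flatMap Prod.fst) *ᵥ ξ))) ≤ ε) :
    (∀ j ≤ cs.length, ∃ τ, nrm (wordOp op ((cs.take j).flatMap Prod.fst) *ᵥ ξ - sgn τ • ξ) ≤ j * ε) ∧
    ∀ C ∈ cs, nrm (wordOp op C.1 *ᵥ ξ - sgn C.2 • ξ) ≤ (2 * cs.length + 1) * ε := by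
  simp only [nrm_sub_sgn_comm _ (_ *ᵥ ξ) (_ *ᵥ (_ *ᵥ ξ))] at h
  refine (and_iff_left_of_imp fun h1 C hC => ?_).2 fun j hj => ?_
  · obtain ⟨j, hj, rfl⟩ := List.getElem_of_mem hC
    obtain ⟨τ, hτ⟩ := h1 j hj.le
    have hε : 0 ≤ ε := (nrm_nonneg _).trans (h j hj)
    have h2 := (wordOp_ctr hop cs[j].1).nrm_sub_sgn_le cs[j].2 τ _ ξ |>.trans
      (add_le_add (h j hj) (mul_le_mul_of_nonneg_left hτ two_pos.le))
    have h8 : (j : ℝ) * ε ≤ cs.length * ε := by gcongr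
    linarith
  · induction j with
    | zero => exact ⟨false, by simp [wordOp, nrm_zero]⟩
    | succ j ih =>
      obtain ⟨τ, hτ⟩ := ih (Nat.le_of_succ_le hj)
      refine ⟨xor cs[j].2 τ, ?_⟩
      rw [take_succ_eq hj, List.flatMap_append, wordOp_append, List.flatMap_singleton,
        ← mulVec_mulVec]
      have h3 := nrm_sub_sgn_xor_le cs[j].2 τ _ _ ξ |>.trans (add_le_add (h j hj) hτ)
      push_cast
      linarith

/-- Segments that consist of a sequence of constraints and one more reflection. -/
theorem nrm_segments_le (hop : ∀ a, IsRefl (op a)) {γ : Type} (s : γ → α)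
    {cs : List (List α × Bool)} {ξ : J → ℂ} {ε : ℝ} {gs : List γ}
    (h : ∀ i < gs.length, ∀ j (hj : j < cs.length),
      nrm (wordOp op ((gs.take i).flatMap (fun g => cs.flatMap Prod.fst ++ [s g]) ++
        (cs.take j).flatMap Prod.fst) *ᵥ ξ - sgn cs[j].2 •
      (wordOp op cs[j].1 *ᵥ (wordOp op ((gs.take i).flatMap
        (fun g => cs.flatMap Prod.fst ++ [s g]) ++ (cs.take j).flatMap Prod.fst) *ᵥ ξ))) ≤ ε)
    (hε : 0 ≤ ε) :
    ∀ i < gs.length, ∀ C ∈ cs,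
      nrm (wordOp op C.1 *ᵥ (wordOp op ((gs.take i).map s) *ᵥ ξ) -
        sgn C.2 • (wordOp op ((gs.take i).map s) *ᵥ ξ)) ≤
        (2 * cs.length + 1 + 2 * gs.length * cs.length) * ε := by
  set F : ℕ → List α := fun i => (gs.take i).flatMap (fun g => cs.flatMap Prod.fst ++ [s g]) with hF
  have hi := fun i (hi : i < gs.length) => nrm_constraint_le (cs := cs) (ξ := wordOp op (F i) *ᵥ ξ)
    (ε := ε) hop fun j hj => by simpa only [wordOp_append, ← mulVec_mulVec] using h i hi j hj
  have key : ∀ i ≤ gs.length, ∃ τ, nrm (wordOp op (F i) *ᵥ ξ -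
      sgn τ • (wordOp op ((gs.take i).map s) *ᵥ ξ)) ≤ i * (cs.length * ε) := by
    intro i hle
    induction i with
    | zero => exact ⟨false, by simp [F, wordOp, nrm_zero]⟩
    | succ i ih =>
      obtain ⟨τ, hτ⟩ := ih (Nat.le_of_succ_le hle)
      obtain ⟨τ', hτ'⟩ := (hi i hle).1 cs.length le_rfl
      rw [List.take_length] at hτ'
      refine ⟨xor τ' τ, ?_⟩
      simp only [hF, take_succ_eq hle, List.flatMap_append, List.flatMap_singleton, wordOp_append,
        wordOp_singleton, List.map_append, List.map_singleton, ← mulVec_mulVec]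
      rw [← mulVec_smul]
      have h1 := ((hop (s gs[i])).ctr.sub_le _ _).trans
        ((nrm_sub_sgn_xor_le τ' τ _ _ _).trans (add_le_add hτ' hτ))
      push_cast
      exact h1.trans_eq (by ring)
  intro i hlt C hC
  obtain ⟨τ, hτ⟩ := key i hlt.le
  have h1 := (wordOp_ctr hop C.1).nrm_sub_sgn_le C.2 τ _ _ |>.trans
    (add_le_add ((hi i hlt).2 C hC) (mul_le_mul_of_nonneg_left hτ two_pos.le))
  have h8 : (i : ℝ) * (cs.length * ε) ≤ gs.length * (cs.length * ε) := by gcongr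
  linarith

end Words

/-! ### Positions in the propagation sequence -/

section Positions

theorem exists_flatMap_eq {α β : Type} (f : α → List β) (L : List α) {n : ℕ} (hn : n < L.length)
    {p rest : List β} (h : f L[n] = p ++ rest) :
    ∃ rest', L.flatMap f = ((L.take n).flatMap f ++ p) ++ rest' ∧
      ((L.take n).flatMap f ++ p).length = ((L.take n).map fun a => (f a).length).sum + p.length := by
  refine ⟨rest ++ (L.drop (n + 1)).flatMap f, ?_, ?_⟩
  · have e : L = L.take n ++ L[n] :: L.drop (n + 1) := by
      rw [← List.drop_eq_getElem_cons hn, List.take_append_drop]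
    have e' := congrArg (List.flatMap f) e
    rw [List.flatMap_append, List.flatMap_cons, h] at e'
    rw [e']
    simp only [List.append_assoc]
  · simp [List.length_flatMap]

/-- The control qubits in the order in which they are used. -/
def ctrlList (r m : ℕ) : List (Ctrl r m) :=
  (List.finRange r).flatMap fun i => (List.finRange m).flatMap fun u => [(i, u, false), (i, u, true)]

/-- The symbol that is controlled by `c`. -/
def ctrlLabel (b : Bool) : PauliLabel := if b then .Z else .X

/-- The controlled reflection with control qubit `c`. -/
def ctrlSym {r m : ℕ} (c : Ctrl r m) : Refl r m := .ctrl c c.1 (single c.2.1 (ctrlLabel c.2.2))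

theorem ctrlList_length (r m : ℕ) : (ctrlList r m).length = 2 * (r * m) := by
  simp [ctrlList, List.length_flatMap]; ring

theorem seqW_eq (k r m : ℕ) :
    seqW k r m = (ctrlList r m).flatMap fun c => seqV k r m ++ [ctrlSym c] := by
  simp [seqW, ctrlList, List.flatMap_assoc, ctrlSym, ctrlLabel]

theorem exists_seqU_eq (k r m : ℕ) {i l j : ℕ} (hi : i < 2 * (r * m)) (hl : l < (seqQ k r m).length) :
    ∃ rest, seqU k r m = ((seqQ k r m).take l).flatMap (blockU k r m) ++ ((seqQ k r m)[l] ++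
      (((ctrlList r m).take i).flatMap (fun c => seqV k r m ++ [ctrlSym c]) ++
        ((constraints k r m).take j).flatMap Prod.fst)) ++ rest ∧
      (((seqQ k r m).take l).flatMap (blockU k r m) ++ ((seqQ k r m)[l] ++
      (((ctrlList r m).take i).flatMap (fun c => seqV k r m ++ [ctrlSym c]) ++
        ((constraints k r m).take j).flatMap Prod.fst))).length = consVertex k r m i l j := by
  have hi' : i < (ctrlList r m).length := by rw [ctrlList_length]; exact hi
  have hV : seqV k r m = ((constraints k r m).take j).flatMap Prod.fst ++
      ((constraints k r m).drop j).flatMap Prod.fst := by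
    rw [← List.flatMap_append, List.take_append_drop]; rfl
  obtain ⟨rest₁, h₁, hlen₁⟩ := exists_flatMap_eq (fun c : Ctrl r m => seqV k r m ++ [ctrlSym c])
    (ctrlList r m) hi' (p := ((constraints k r m).take j).flatMap Prod.fst)
    (rest := ((constraints k r m).drop j).flatMap Prod.fst ++ [ctrlSym (ctrlList r m)[i]])
    (by rw [← List.append_assoc, ← hV])
  rw [← seqW_eq] at h₁
  obtain ⟨rest₂, h₂, hlen₂⟩ := exists_flatMap_eq (blockU k r m) (seqQ k r m) hl
    (p := (seqQ k r m)[l] ++ (((ctrlList r m).take i).flatMap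
      (fun c => seqV k r m ++ [ctrlSym c]) ++ ((constraints k r m).take j).flatMap Prod.fst))
    (rest := rest₁ ++ (seqW k r m).reverse ++ (seqQ k r m)[l].reverse)
    (by rw [blockU]; nth_rw 1 [h₁]; simp only [List.append_assoc])
  refine ⟨rest₂, h₂, ?_⟩
  rw [hlen₂, List.length_append (as := (seqQ k r m)[l]), hlen₁, consVertex,
    List.getElem?_eq_getElem hl]
  have hc : ((List.take i (ctrlList r m)).map fun c => (seqV k r m ++ [ctrlSym c]).length).sum =
      i * ((seqV k r m).length + 1) := by
    simp [List.length_append, hi'.le]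
  rw [hc, List.length_flatMap]
  simp only [Option.getD_some]
  rw [← Nat.add_assoc, ← Nat.add_assoc]

theorem take_consVertex (k r m : ℕ) {i l j : ℕ} (hi : i < 2 * (r * m)) (hl : l < (seqQ k r m).length) :
    (seqU k r m).take (consVertex k r m i l j) =
      ((seqQ k r m).take l).flatMap (blockU k r m) ++ ((seqQ k r m)[l] ++
      (((ctrlList r m).take i).flatMap (fun c => seqV k r m ++ [ctrlSym c]) ++
        ((constraints k r m).take j).flatMap Prod.fst)) := by
  obtain ⟨rest, h, hlen⟩ := exists_seqU_eq k r m (j := j) hi hl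
  rw [h, ← hlen, List.take_left]

theorem consVertex_le (k r m : ℕ) {i l j : ℕ} (hi : i < 2 * (r * m)) (hl : l < (seqQ k r m).length) : consVertex k r m i l j ≤ (seqU k r m).length := by
  obtain ⟨rest, h, hlen⟩ := exists_seqU_eq k r m (j := j) hi hl
  rw [h, List.length_append, hlen]
  omega

theorem consVertex_succ (k r m : ℕ) {i l j : ℕ} (hj : j < (constraints k r m).length) :
    consVertex k r m i l (j + 1) =
      consVertex k r m i l j + ((constraints k r m)[j]).1.length := by
  rw [consVertex, consVertex, take_succ_eq hj, List.map_append, List.sum_append]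
  simp [Nat.add_assoc]

theorem wordOp_blocks {J : Type} [Fintype J] [DecidableEq J] {r m : ℕ}
    {op : Refl r m → Mat J} (hop : ∀ R, IsRefl (op R)) (k : ℕ) (L : List (List (Refl r m))) :
    wordOp op (L.flatMap (blockU k r m)) = 1 := by
  induction L with
  | nil => rfl
  | cons w L ih =>
    rw [List.flatMap_cons, wordOp_append, ih, one_mul, blockU, wordOp_append, wordOp_append,
      wordOp_append, ← mul_assoc (wordOp op (seqW k r m).reverse), wordOp_reverse_mul hop, one_mul,
      wordOp_reverse_mul hop]

end Positions

theorem IsRefl.controlled {J : Type} [Fintype J] [DecidableEq J] {z R : Mat J}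
    (hz : IsRefl z) (hR : IsRefl R) (hc : Commute z R) : IsRefl (prj false z + prj true z * R) := by
  have h0 : ∀ b, (prj b z)ᴴ = prj b z := fun b => by
    simp [prj, hz.star_eq, star_sgn]
  have h1 : ∀ b, prj b z * prj b z = prj b z := fun b => by
    simp only [prj, mul_add, add_mul, one_mul, mul_one, smul_mul_assoc, mul_smul_comm, hz.mul_self]
    cases b <;> simp only [sgn_false, sgn_true] <;> module
  have h2 : prj false z * prj true z = 0 := by
    simp only [prj, mul_add, add_mul, one_mul, mul_one, smul_mul_assoc, mul_smul_comm, hz.mul_self,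
      sgn_false, sgn_true]
    module
  have h3 : prj true z * prj false z = 0 := by
    have := congrArg conjTranspose h2
    simpa [h0] using this
  have hcb := prj_commute hc true
  constructor
  · rw [conjTranspose_add, conjTranspose_mul, h0, h0, hR.star_eq, hcb.eq]
  · rw [add_mul, mul_add, mul_add, h1, ← mul_assoc (prj false z), h2, zero_mul, add_zero,
      hcb.eq, mul_assoc R, h3, mul_zero, zero_add, mul_assoc R, ← mul_assoc _ R, hcb.eq,
      mul_assoc R, h1, ← mul_assoc, hR.mul_self, one_mul, prj_add_prj]

theorem Lens.ext' {J A : Type} {L L' : Lens J A} (h1 : ∀ z, L.get z = L'.get z)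
    (h2 : ∀ z a, L.set z a = L'.set z a) : L = L' := by
  cases L; cases L'
  congr
  · exact funext h1
  · exact funext fun z => funext (h2 z)

theorem Lens.commute_of_permutes {J A : Type} [Fintype J] [DecidableEq J] [Fintype A]
    [DecidableEq A] (L : Lens J A) {B : Mat J} (f : J → J) (hB : ∀ v z, (B *ᵥ v) z = v (f z))
    (hget : ∀ z, L.get (f z) = L.get z) (hset : ∀ z a, L.set (f z) a = f (L.set z a))
    (N : Mat A) : Commute B (L.op N) := by
  refine mulVec_ext fun v z => ?_
  rw [← mulVec_mulVec, ← mulVec_mulVec, hB, op_mulVec, op_mulVec]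
  simp only [hB, hget, hset]

theorem fst_op_flip {q Y : Type} [Fintype q] [DecidableEq q] [Fintype Y] [DecidableEq Y]
    (s : q → Bool) (v : (q → Bool) × Y → ℂ) (z : (q → Bool) × Y) :
    (fst.op (flipOp s) *ᵥ v) z = v (flipBits s z.1, z.2) := by
  rw [Lens.op_mulVec]
  simp [flipOp_apply, fst]

namespace NormalVerifier

variable {r : ℕ} (W : NormalVerifier r) (k : ℕ) {H : Fin r → Type} [∀ i, Fintype (H i)]
  [∀ i, DecidableEq (H i)] {M : W.Obs H}

/-- The factor that consists, for each player, of his control qubits and his space. -/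
def localLens (H : Fin r → Type) :
    Lens (W.Space k H) (∀ i, (Fin W.m × Bool → Bool) × H i) where
  get z i := (fun p => z.1 (.X (i, p)), z.2 i)
  set z a := (fun q => match q with
    | .X c => (a c.1).1 c.2
    | .S t => z.1 (.S t)
    | .C t => z.1 (.C t)
    | .V t => z.1 (.V t), fun i => (a i).2)
  get_set z a := rfl
  set_get z := by
    refine Prod.ext (funext fun q => ?_) rfl
    cases q <;> rfl
  set_set z a b := by
    refine Prod.ext (funext fun q => ?_) rfl
    cases q <;> rfl

theorem localLens_set_of_ne (z : W.Space k H) (a) {q : W.Ref k} (hq : ∀ c, q ≠ .X c) :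
    ((W.localLens k H).set z a).1 q = z.1 q := by
  cases q <;> first | rfl | exact absurd rfl (hq _)

theorem playerLens_eq (i : Fin r) : (playerLens i : Lens (W.Space k H) (H i)) =
    ((W.localLens k H).comp (coord i)).comp Lens.snd := by
  refine Lens.ext' (fun z => rfl) fun z a => ?_
  refine Prod.ext (funext fun q => ?_) (funext fun i' => ?_)
  · cases q with
    | X c =>
      obtain ⟨i', p⟩ := c
      by_cases h : i' = i
      · subst h; simp [localLens, Lens.comp, coord, Lens.snd, playerLens]
      · simp [localLens, Lens.comp, coord, Lens.snd, playerLens, h]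
    | _ => rfl
  · by_cases h : i' = i
    · subst h; simp [localLens, Lens.comp, coord, Lens.snd, playerLens]
    · simp [localLens, Lens.comp, coord, Lens.snd, playerLens, h]

theorem controlLens_eq (c : Ctrl r W.m) :
    (fst.comp (coord (RefQubit.X c)) : Lens (W.Space k H) Bool) =
    ((W.localLens k H).comp (coord c.1)).comp (fst.comp (coord c.2)) := by
  obtain ⟨i, p⟩ := c
  refine Lens.ext' (fun z => rfl) fun z a => ?_
  refine Prod.ext (funext fun q => ?_) (funext fun i' => ?_)
  · change update z.1 _ _ q = _
    cases q with
    | X c =>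
      obtain ⟨i', p'⟩ := c
      by_cases h : i' = i
      · subst h
        by_cases h' : p' = p
        · subst h'; simp [localLens, Lens.comp, coord, fst]
        · simp [localLens, Lens.comp, coord, fst, h']
      · simp [localLens, Lens.comp, coord, fst, h]
    | _ => rw [update_of_ne (by simp)]; rfl
  · by_cases h : i' = i
    · subst h; simp [localLens, Lens.comp, coord, fst]
    · simp [localLens, Lens.comp, coord, fst, h]

/-- The operators on the control qubits and the players' spaces. -/
abbrev localOps (H : Fin r → Type) [∀ i, Fintype (H i)] [∀ i, DecidableEq (H i)] :
    StarSubalgebra ℂ (Mat (W.Space k H)) :=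
  (W.localLens k H).op.range

theorem playerObs_eq (i : Fin r) (g : Question W.m) (P : Pauli W.m) :
    W.playerObs k M i g P = (W.localLens k H).op ((coord i).op
      (Lens.snd.op (obs (M i g) (bit P g)))) := by
  rw [playerObs, playerLens_eq, op_comp, op_comp]

theorem refPauli_X_eq (c : Ctrl r W.m) (D : PauliLabel) : (W.refPauli k (.X c) D :
    Mat (W.Space k H)) =
    (W.localLens k H).op ((coord c.1).op (fst.op ((coord c.2).op D.mat))) := by
  rw [refPauli, pauliOp_single, ← op_comp, controlLens_eq, op_comp, op_comp,
    op_comp]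

theorem playerObs_mem (i : Fin r) (g : Question W.m) (P : Pauli W.m) :
    W.playerObs k M i g P ∈ W.localOps k H := ⟨_, (W.playerObs_eq k i g P).symm⟩

theorem refPauli_X_mem (c : Ctrl r W.m) (D : PauliLabel) : W.refPauli k (.X c) D ∈ W.localOps k H :=
  ⟨_, (W.refPauli_X_eq k c D).symm⟩

theorem prj_mem {b : Bool} {A : Mat (W.Space k H)} (h : A ∈ W.localOps k H) :
    prj b A ∈ W.localOps k H :=
  (W.localOps k H).smul_mem (add_mem (one_mem _) ((W.localOps k H).smul_mem h _)) _

theorem reflOp_mem (R : Refl r W.m) : W.reflOp k M R ∈ W.localOps k H := by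
  cases R with
  | refl i P => exact W.playerObs_mem k i _ _
  | derived i Q P => exact W.playerObs_mem k i _ _
  | ctrl c i P =>
    exact add_mem (W.prj_mem k (W.refPauli_X_mem k c _))
      (mul_mem (W.prj_mem k (W.refPauli_X_mem k c _)) (W.playerObs_mem k i _ _))

theorem refPauli_X_commute_playerObs (c : Ctrl r W.m) (D : PauliLabel) (i : Fin r)
    (g : Question W.m) (P : Pauli W.m) :
    Commute (W.refPauli k (.X c) D) (W.playerObs k M i g P) := by
  rw [playerObs, refPauli]
  exact op_commute (Lens.fst_indep_snd.comp_right _) _ _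

theorem reflOp_isRefl (hM : ProjMeas M) (R : Refl r W.m) :
    IsRefl (W.reflOp k M R) := by
  cases R with
  | refl i P => exact W.playerObs_isRefl k hM i _ _
  | derived i Q P => exact W.playerObs_isRefl k hM i _ _
  | ctrl c i P =>
    exact (op_isRefl _ (pauliOp_isRefl _)).controlled (W.playerObs_isRefl k hM i _ _)
      (W.refPauli_X_commute_playerObs k c .Z i _ _)

/-- Contractions that do not concern the control qubits and the players. -/
structure Outer (B : Mat (W.Space k H)) : Prop where
  ctr : Ctr B
  commute : ∀ A ∈ W.localOps k H, Commute B A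

theorem Outer.mul {B B' : Mat (W.Space k H)} (h : W.Outer k B)
    (h' : W.Outer k B') : W.Outer k (B * B') :=
  ⟨h.ctr.mul h'.ctr, fun A hA => (h.commute A hA).mul_left (h'.commute A hA)⟩

theorem outer_proj {p : (W.Ref k → Bool) → Prop}
    (hp : ∀ x y : W.Ref k → Bool, (∀ q, (∀ c, q ≠ .X c) → x q = y q) → (p x ↔ p y)) :
    W.Outer k (W.onRef k (proj p) : Mat (W.Space k H)) := by
  refine ⟨fst_op_ctr _, ?_⟩
  rintro _ ⟨N, rfl⟩
  rw [onRef, proj, fst_op_diagonal]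
  refine Lens.diagonal_commute (W.localLens k H) (p := fun z => indic (p z.1))
    (fun z a => congrArg indic (propext (hp _ _ fun q hq => ?_))) N
  exact W.localLens_set_of_ne k z a hq

theorem outer_flip {s : W.Ref k → Bool} (hs : ∀ c, s (.X c) = false) :
    W.Outer k (W.onRef k (flipOp s) : Mat (W.Space k H)) := by
  refine ⟨(op_isRefl _ (flipOp_isRefl s)).ctr, ?_⟩
  rintro _ ⟨N, rfl⟩
  refine Lens.commute_of_permutes _ (fun z => (flipBits s z.1, z.2)) (fst_op_flip s) ?_ ?_ N
  · intro z
    funext i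
    refine Prod.ext (funext fun p => ?_) rfl
    simp [localLens, flipBits, hs]
  · intro z a
    refine Prod.ext (funext fun q => ?_) rfl
    cases q <;> simp [localLens, flipBits, hs]

theorem V_commute_localOps (j : Fin W.qV) (A : Mat Bool) {B : Mat (W.Space k H)}
    (hB : B ∈ W.localOps k H) : Commute (W.onRef k ((coord (RefQubit.V j)).op A)) B := by
  obtain ⟨N, rfl⟩ := hB
  rw [onRef, ← op_comp]
  refine op_commute ⟨fun z a => rfl, fun z b => ?_, fun z a b => ?_⟩ _ _
  · funext i
    refine Prod.ext (funext fun p => ?_) rfl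
    simp [localLens, Lens.comp, coord, fst]
  · refine Prod.ext (funext fun q => ?_) rfl
    cases q <;> simp [localLens, Lens.comp, coord, fst, Function.update_apply]

section ClockOuter

variable {n : ℕ} {e : Fin n → W.Ref k}

theorem outer_atTime (he : ∀ j c, e j ≠ .X c) (t : ℕ) :
    W.Outer k (W.onRef k (atTime e t) : Mat (W.Space k H)) :=
  W.outer_proj k fun x y h => forall_congr' fun j => by rw [h _ (he j)]

theorem outer_shift (he : ∀ j c, e j ≠ .X c) (t : ℕ) :
    W.Outer k (W.onRef k (shift e t) : Mat (W.Space k H)) :=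
  W.outer_flip k fun c => clockRange_of_notMem (fun j => he j c) _ _

theorem outer_slice (he : ∀ j c, e j ≠ .X c) (t : ℕ) :
    W.Outer k (W.onRef k (atTime e 0 * shift e t) : Mat (W.Space k H)) := by
  rw [onRef, map_mul]
  exact (W.outer_atTime k he 0).mul _ _ (W.outer_shift k he t)

end ClockOuter

/-! ### The constraint propagation game -/

/-- The checks of the register `S` and the constraint propagation game are passed with
amplitude at least `1 - δ`. -/
structure PropChecks (M : W.Obs H)
    (φ : W.Space k H → ℂ) (δ : ℝ) : Prop where
  clock : ∀ t : Fin (W.N k - 1), nrm (W.onRef k (prj false (clockOp S .Z (t + 1)) *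
    prj true (clockOp S .Z (t + 2))) *ᵥ φ) ≤ δ
  prop : ∀ t : Fin (W.N k), nrm (edgeTest S t (t + 1) ((1 / 2 : ℂ) • 1)
    ((1 / 2 : ℂ) • W.reflOp k M ((seqU k r W.m).get t)) *ᵥ φ) ≤ δ
  start : ∀ c : Ctrl r W.m, nrm ((W.onRef k (atTime S 0) *
    prj true (W.refPauli k (.X c) .X)) *ᵥ φ) ≤ δ
  cons : ∀ p : Fin (2 * (r * W.m)) × Fin (seqQ k r W.m).length × Fin (constraints k r W.m).length,
    nrm (edgeTest S (consVertex k r W.m p.1 p.2.1 p.2.2)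
      (consVertex k r W.m p.1 p.2.1 (p.2.2 + 1)) ((1 / 2 : ℂ) • 1)
      ((1 / 2 : ℂ) • (sgn ((constraints k r W.m).get p.2.2).2 • 1)) *ᵥ φ) ≤ δ

theorem S_ne_X (t : Fin (W.N k)) (c : Ctrl r W.m) : (S t : W.Ref k) ≠ .X c := by simp

theorem C_ne_X (t : Fin W.T) (c : Ctrl r W.m) : (C t : W.Ref k) ≠ .X c := by simp

theorem nrm_half (v : W.Space k H → ℂ) : nrm ((1 / 2 : ℂ) • v) = 1 / 2 * nrm v := by
  rw [nrm_smul]; norm_num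

variable {k} {φ : W.Space k H → ℂ} {δ : ℝ}

theorem PropChecks.slice_succ (h : W.PropChecks k M φ δ) {t : ℕ} (ht : t < W.N k) :
    nrm (slice S φ t - W.reflOp k M (seqU k r W.m)[t] *ᵥ slice S φ (t + 1)) ≤
      2 * δ := by
  have h1 := nrm_slice_sub_le (W.S_injective k) φ (Nat.le_succ t) ht ((1 / 2 : ℂ) • 1)
    ((1 / 2 : ℂ) • W.reflOp k M (seqU k r W.m)[t]) (fun t => (Commute.one_right _).smul_right _)
    (fun t => ((W.outer_slice k (W.S_ne_X k) t).commute _ (W.reflOp_mem k _)).smul_right _)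
  have h2 := h1.trans (h.prop ⟨t, ht⟩)
  rw [smul_mulVec, smul_mulVec, one_mulVec, ← smul_sub, nrm_half] at h2
  linarith

theorem PropChecks.slice_cons (h : W.PropChecks k M φ δ) {i l j : ℕ} (hi : i < 2 * (r * W.m))
    (hl : l < (seqQ k r W.m).length) (hj : j < (constraints k r W.m).length) :
    nrm (slice S φ (consVertex k r W.m i l j) - sgn (constraints k r W.m)[j].2 •
      slice S φ (consVertex k r W.m i l (j + 1))) ≤ 2 * δ := by
  have h1 := nrm_slice_sub_le (W.S_injective k) φ
    (t₁ := consVertex k r W.m i l j) (t₂ := consVertex k r W.m i l (j + 1))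
    (by rw [consVertex_succ _ _ _ hj]; omega)
    (consVertex_le k r W.m hi hl) ((1 / 2 : ℂ) • 1)
    ((1 / 2 : ℂ) • (sgn (constraints k r W.m)[j].2 • 1)) (fun t => (Commute.one_right _).smul_right _)
    (fun t => ((Commute.one_right _).smul_right _).smul_right _)
  have h2 := h1.trans (h.cons (⟨i, hi⟩, ⟨l, hl⟩, ⟨j, hj⟩))
  rw [smul_mulVec, smul_mulVec, smul_mulVec, one_mulVec, one_mulVec, ← smul_sub, nrm_half] at h2
  linarith

/-- The error up to which the constraints hold. -/
def consError (W : NormalVerifier r) (k : ℕ) : ℝ :=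
  (2 * (constraints k r W.m).length + 1 +
    2 * (ctrlList r W.m).length * (constraints k r W.m).length) * (4 * W.N k + 2)

theorem PropChecks.constraint (hM : ProjMeas M) (h : W.PropChecks k M φ δ)
    (hδ : 0 ≤ δ) {w : List (Refl r W.m)} (hw : w ∈ seqQ k r W.m) {i : ℕ}
    (hi : i < (ctrlList r W.m).length) {C : Constraint r W.m} (hC : C ∈ constraints k r W.m) :
    nrm (wordOp (W.reflOp k M) C.1 *ᵥ (wordOp (W.reflOp k M) (((ctrlList r W.m).take i).map ctrlSym) *ᵥ
      (wordOp (W.reflOp k M) w *ᵥ slice S φ 0)) -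
      sgn C.2 • (wordOp (W.reflOp k M) (((ctrlList r W.m).take i).map ctrlSym) *ᵥ
      (wordOp (W.reflOp k M) w *ᵥ slice S φ 0))) ≤ W.consError k * δ := by
  obtain ⟨l, hl, rfl⟩ := List.getElem_of_mem hw
  have hop := W.reflOp_isRefl k hM
  have chain := nrm_sub_wordOp_le hop (l := seqU k r W.m) (f := slice S φ)
    fun t ht => h.slice_succ W ht
  have hN : ∀ t, t ≤ (seqU k r W.m).length → (t : ℝ) * (2 * δ) ≤ W.N k * (2 * δ) := fun t ht => by
    gcongr
  have key := nrm_segments_le hop (ctrlSym (r := r) (m := W.m)) (cs := constraints k r W.m)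
    (ξ := wordOp (W.reflOp k M) (seqQ k r W.m)[l] *ᵥ slice S φ 0)
    (ε := (4 * W.N k + 2) * δ) (gs := ctrlList r W.m) ?_ (by positivity) i hi C hC
  · rw [consError, mul_assoc]; exact key
  intro i hi j hj
  rw [ctrlList_length] at hi
  set p : List (Refl r W.m) := ((ctrlList r W.m).take i).flatMap
    (fun g => (constraints k r W.m).flatMap Prod.fst ++ [ctrlSym g]) with hp
  have e1 : ∀ j, wordOp (W.reflOp k M) ((seqU k r W.m).take (consVertex k r W.m i l j)) *ᵥ
      slice S φ 0 = wordOp (W.reflOp k M) (p ++ ((constraints k r W.m).take j).flatMap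
        Prod.fst) *ᵥ (wordOp (W.reflOp k M) (seqQ k r W.m)[l] *ᵥ slice S φ 0) := by
    intro j
    rw [take_consVertex k r W.m hi hl, wordOp_append, wordOp_blocks hop, mul_one, wordOp_append,
      ← mulVec_mulVec]
    rfl
  have e2 : wordOp (W.reflOp k M) (constraints k r W.m)[j].1 *ᵥ (wordOp (W.reflOp k M)
      (p ++ ((constraints k r W.m).take j).flatMap Prod.fst) *ᵥ
      (wordOp (W.reflOp k M) (seqQ k r W.m)[l] *ᵥ slice S φ 0)) =
      wordOp (W.reflOp k M) (p ++ ((constraints k r W.m).take (j + 1)).flatMap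
        Prod.fst) *ᵥ (wordOp (W.reflOp k M) (seqQ k r W.m)[l] *ᵥ slice S φ 0) := by
    rw [take_succ_eq hj, List.flatMap_append,
      ← List.append_assoc, wordOp_append (p ++ _), List.flatMap_singleton, ← mulVec_mulVec]
  rw [e2, ← e1, ← e1]
  have h1 := chain _ (consVertex_le k r W.m (j := j) hi hl)
  have h2 := chain _ (consVertex_le k r W.m (j := j + 1) hi hl)
  have h3 := hN _ (consVertex_le k r W.m (j := j) hi hl)
  have h4 := hN _ (consVertex_le k r W.m (j := j + 1) hi hl)
  have h5 := h.slice_cons W hi hl hj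
  set v₁ := slice S φ (consVertex k r W.m i l j)
  set v₂ := slice S φ (consVertex k r W.m i l (j + 1))
  set u₁ := wordOp (W.reflOp k M) ((seqU k r W.m).take (consVertex k r W.m i l j)) *ᵥ
      slice S φ 0
  set u₂ := wordOp (W.reflOp k M) ((seqU k r W.m).take (consVertex k r W.m i l (j + 1))) *ᵥ
      slice S φ 0
  set τ := (constraints k r W.m)[j].2
  have h6 := nrm_sub_trans u₁ v₁ (sgn τ • u₂)
  have h7 := nrm_sub_trans v₁ (sgn τ • v₂) (sgn τ • u₂)
  have h8 : nrm (sgn τ • v₂ - sgn τ • u₂) = nrm (v₂ - u₂) := by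
    rw [← smul_sub, nrm_smul, norm_sgn, one_mul]
  rw [nrm_sub_comm u₁ v₁] at h6
  linarith

theorem PropChecks.control (h : W.PropChecks k M φ δ) (c : Ctrl r W.m) :
    nrm (slice S φ 0 - W.refPauli k (.X c) .X *ᵥ slice S φ 0) ≤ 2 * δ := by
  have h1 := h.start c
  rw [((W.outer_atTime k (W.S_ne_X k) 0).commute _
    (W.prj_mem k (b := true) (W.refPauli_X_mem k c .X))).eq, ← mulVec_mulVec, prj, smul_mulVec,
    nrm_half, sgn_true, neg_one_smul, add_mulVec, one_mulVec, neg_mulVec, ← sub_eq_add_neg] at h1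
  rw [slice, shift_zero, mul_one]
  linarith

end NormalVerifier

section PrjAlgebra

variable {J : Type} [Fintype J] [DecidableEq J]

theorem IsRefl.mul_prj {z : Mat J} (hz : IsRefl z) (b : Bool) :
    z * prj b z = sgn b • prj b z := by
  simp only [prj, mul_add, mul_one, mul_smul_comm, hz.mul_self]
  cases b <;> simp only [sgn_false, sgn_true] <;> module

theorem conj_prj {x z : Mat J} (hx : x * x = 1) (h : x * z = -(z * x)) (b : Bool) :
    x * prj b z * x = prj (!b) z := by
  have e : x * z * x = -z := by rw [h, neg_mul, mul_assoc, hx, mul_one]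
  simp only [prj, mul_add, mul_one, mul_smul_comm, smul_mul_assoc, add_mul, hx, e]
  cases b <;> simp

end PrjAlgebra

theorem wordOp_map {J α β : Type} [Fintype J] [DecidableEq J] (op : α → Mat J) (f : β → α)
    (l : List β) : wordOp op (l.map f) = wordOp (fun b => op (f b)) l := by
  induction l with
  | nil => rfl
  | cons a l ih => rw [List.map_cons, wordOp, wordOp, ih]

theorem mem_listsUpTo {α : Type} {l : List α} {k : ℕ} {w : List α} :
    w ∈ listsUpTo l k ↔ w.length ≤ k ∧ ∀ a ∈ w, a ∈ l := by
  induction k generalizing w with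
  | zero => cases w <;> simp [listsUpTo]
  | succ k ih =>
    cases w with
    | nil => simp [listsUpTo]
    | cons a w =>
      simp only [listsUpTo, List.mem_cons, mem_flatMap, mem_map, ih]
      constructor
      · rintro (h | ⟨w', ⟨h1, h2⟩, a', h3, h4⟩)
        · simp at h
        · obtain ⟨rfl, rfl⟩ := List.cons.inj h4
          refine ⟨by simp; omega, ?_⟩
          rintro b (rfl | hb)
          · exact h3
          · exact h2 b hb
      · rintro ⟨h1, h2⟩
        refine Or.inr ⟨w, ⟨by simpa using h1, fun b hb => h2 b (Or.inr hb)⟩, a, h2 a (Or.inl rfl), rfl⟩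

/-- The reflection symbol `X_u` or `Z_u` that belongs to the control qubit `c`. -/
def genSym {r m : ℕ} (c : Ctrl r m) : Refl r m := one c.1 c.2.1 (ctrlLabel c.2.2)

theorem map_genSym_mem_seqQ {k r m : ℕ} {w : List (Ctrl r m)} (hw : w.length ≤ k) :
    w.map genSym ∈ seqQ k r m := by
  rw [seqQ, mem_flatMap]
  refine ⟨w.map genSym, ?_, ?_⟩
  · rw [primitives, mem_listsUpTo]
    refine ⟨by simpa using hw, fun a ha => ?_⟩
    obtain ⟨⟨i, u, b⟩, -, rfl⟩ := mem_map.1 ha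
    simp only [mem_flatMap, List.mem_finRange, true_and, mem_map]
    refine ⟨i, u, ctrlLabel b, ?_, rfl⟩
    cases b <;> simp [xz, ctrlLabel]
  · rw [mem_map]
    exact ⟨[], by simp [derivedSeqs], by simp⟩

theorem exists_ctrlList_eq {r m : ℕ} (i : Fin r) (u : Fin m) : ∃ A C : List (Ctrl r m),
    ctrlList r m = A ++ (i, u, false) :: (i, u, true) :: C ∧ (∀ b, (i, u, b) ∉ A) ∧
      ∀ b, (i, u, b) ∉ C := by
  obtain ⟨l₁, l₂, hl⟩ := List.append_of_mem (List.mem_finRange i)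
  obtain ⟨m₁, m₂, hm⟩ := List.append_of_mem (List.mem_finRange u)
  have hl' := List.nodup_finRange r
  have hm' := List.nodup_finRange m
  rw [hl, List.nodup_middle, List.nodup_cons] at hl'
  rw [hm, List.nodup_middle, List.nodup_cons] at hm'
  simp only [mem_append, not_or] at hl' hm'
  set F : Fin r → List (Ctrl r m) := fun i => (List.finRange m).flatMap fun u =>
    [(i, u, false), (i, u, true)] with hF
  refine ⟨l₁.flatMap F ++ m₁.flatMap (fun u => [(i, u, false), (i, u, true)]),
    m₂.flatMap (fun u => [(i, u, false), (i, u, true)]) ++ l₂.flatMap F, ?_, ?_, ?_⟩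
  · rw [ctrlList, hl, List.flatMap_append, List.flatMap_cons]
    nth_rw 2 [hm]
    rw [List.flatMap_append, List.flatMap_cons]
    simp [hF]
  · intro b
    simp [hF]
    grind
  · intro b
    simp [hF]
    grind

namespace NormalVerifier

variable {r : ℕ} (W : NormalVerifier r) (k : ℕ) {H : Fin r → Type} [∀ i, Fintype (H i)]
  [∀ i, DecidableEq (H i)] (M : W.Obs H)

/-- The reflection `X_u` or `Z_u` of a player. -/
def genOp (c : Ctrl r W.m) : Mat (W.Space k H) := W.reflOp k M (genSym c)

/-- The controlled reflection. -/
def ctrlOp (c : Ctrl r W.m) : Mat (W.Space k H) := W.reflOp k M (ctrlSym c)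

theorem ctrlOp_eq (c : Ctrl r W.m) : W.ctrlOp k M c = prj false (W.refPauli k (.X c) .Z) +
    prj true (W.refPauli k (.X c) .Z) * W.genOp k M c := rfl

theorem refPauli_isRefl (q : W.Ref k) (D : PauliLabel) :
    IsRefl (W.refPauli k q D : Mat (W.Space k H)) :=
  op_isRefl _ (pauliOp_isRefl _)

theorem refPauli_commute {q q' : W.Ref k} (h : q ≠ q') (D D' : PauliLabel) :
    Commute (W.refPauli k q D : Mat (W.Space k H)) (W.refPauli k q' D') := by
  rw [refPauli, refPauli, pauliOp_single, pauliOp_single]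
  exact (op_commute (coord_indep h) _ _).map _

theorem refPauli_commute_self (q q' : W.Ref k) (D : PauliLabel) :
    Commute (W.refPauli k q D : Mat (W.Space k H)) (W.refPauli k q' D) := by
  by_cases h : q = q'
  · rw [h]
  · exact W.refPauli_commute k h _ _

theorem refPauli_anti (q : W.Ref k) : (W.refPauli k q .X : Mat (W.Space k H)) *
    W.refPauli k q .Z = -(W.refPauli k q .Z * W.refPauli k q .X) := by
  rw [refPauli, refPauli, pauliOp_single, pauliOp_single, ← map_mul, ← map_mul, ← map_mul,
    PauliLabel.X_mul_Z, map_neg, map_neg, map_mul]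

theorem genOp_mem (c : Ctrl r W.m) : W.genOp k M c ∈ W.localOps k H := W.reflOp_mem k _

theorem ctrlOp_mem (c : Ctrl r W.m) : W.ctrlOp k M c ∈ W.localOps k H := W.reflOp_mem k _

theorem wordOp_mem {α : Type} {op : α → Mat (W.Space k H)}
    (h : ∀ a, op a ∈ W.localOps k H) (l : List α) : wordOp op l ∈ W.localOps k H := by
  induction l with
  | nil => exact one_mem _
  | cons a l ih => exact mul_mem ih (h a)

theorem refPauli_commute_genOp (c : Ctrl r W.m) (D : PauliLabel) (g : Ctrl r W.m) :
    Commute (W.refPauli k (.X c) D) (W.genOp k M g) := W.refPauli_X_commute_playerObs k c D _ _ _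

theorem refPauli_commute_ctrlOp {c g : Ctrl r W.m} (h : c ≠ g) (D : PauliLabel) :
    Commute (W.refPauli k (.X c) D) (W.ctrlOp k M g) := by
  rw [ctrlOp_eq]
  have hz : Commute (W.refPauli k (.X c) D : Mat (W.Space k H))
      (W.refPauli k (.X g) .Z) := W.refPauli_commute k (by simpa using h) _ _
  have hb := fun b => (prj_commute hz.symm b).symm
  exact (hb false).add_right ((hb true).mul_right (W.refPauli_commute_genOp k M c D g))

theorem genOp_commute {c g : Ctrl r W.m} (h : c.1 ≠ g.1) :
    Commute (W.genOp k M c) (W.genOp k M g) :=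
  op_commute (Lens.Indep.comp_comp (coord_indep h)) _ _

variable {M}

theorem genOp_isRefl (hM : ProjMeas M) (c : Ctrl r W.m) : IsRefl (W.genOp k M c) := W.reflOp_isRefl k hM _

theorem ctrlOp_isRefl (hM : ProjMeas M) (c : Ctrl r W.m) : IsRefl (W.ctrlOp k M c) := W.reflOp_isRefl k hM _

theorem ctrlOp_mul_genOp (hM : ProjMeas M) (c : Ctrl r W.m) : W.ctrlOp k M c * W.genOp k M c =
    W.refPauli k (.X c) .X * W.ctrlOp k M c * W.refPauli k (.X c) .X := by
  have hx := (W.refPauli_isRefl k (H := H) (.X c) .X).mul_self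
  have hD := (W.genOp_isRefl k hM c).mul_self
  have hxD := W.refPauli_commute_genOp k M c .X c
  have hp := conj_prj hx (W.refPauli_anti k (H := H) (.X c))
  rw [ctrlOp_eq]
  set x := (W.refPauli k (.X c) .X : Mat (W.Space k H))
  set z := (W.refPauli k (.X c) .Z : Mat (W.Space k H))
  set D := W.genOp k M c
  rw [add_mul, mul_add, add_mul, hp, mul_assoc (prj true z), hD, mul_one, ← mul_assoc x,
    mul_assoc (x * _), ← hxD.eq, ← mul_assoc, hp]
  simp [add_comm]

variable (M) in
/-- The vectors to which the constraints apply. -/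
def wordVec (φ : W.Space k H → ℂ) (B : Mat (W.Space k H)) (w : List (Ctrl r W.m)) : W.Space k H → ℂ :=
  B *ᵥ (wordOp (W.genOp k M) w *ᵥ slice S φ 0)

variable {k} {φ : W.Space k H → ℂ} {δ : ℝ}

/-- A constraint on the vectors that occur in the extraction of the qubits of the players. -/
theorem outer_constraint (hM : ProjMeas M) (h : W.PropChecks k M φ δ) (hδ : 0 ≤ δ)
    {pre post : List (Ctrl r W.m)} {c : Ctrl r W.m} (hl : ctrlList r W.m = pre ++ c :: post)
    {w : List (Ctrl r W.m)} (hw : w.length ≤ k) {B : Mat (W.Space k H)} (hB : W.Outer k B)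
    {C : Constraint r W.m} (hC : C ∈ constraints k r W.m) :
    nrm (wordOp (W.reflOp k M) C.1 *ᵥ (wordOp (W.ctrlOp k M) pre *ᵥ W.wordVec k M φ B w) -
      sgn C.2 • (wordOp (W.ctrlOp k M) pre *ᵥ W.wordVec k M φ B w)) ≤ W.consError k * δ := by
  have h1 := h.constraint W hM hδ (map_genSym_mem_seqQ hw) (i := pre.length) (by simp [hl]) hC
  rw [hl, List.take_left, wordOp_map, wordOp_map] at h1
  rw [wordVec, ← commute_mulVec (hB.commute _ (W.wordOp_mem k (W.ctrlOp_mem k M) pre)),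
    ← commute_mulVec (hB.commute _ (W.wordOp_mem k (W.reflOp_mem k (M := M)) C.1)), ← mulVec_smul,
    ← mulVec_sub]
  exact (hB.ctr _).trans h1

/-- The approximate commutation relations. -/
theorem nrm_comm_le (hM : ProjMeas M) (h : W.PropChecks k M φ δ) (hδ : 0 ≤ δ)
    {pre post : List (Ctrl r W.m)} {c' : Ctrl r W.m} (hl : ctrlList r W.m = pre ++ c' :: post)
    {w : List (Ctrl r W.m)} (hw : w.length ≤ k) {B : Mat (W.Space k H)} (hB : W.Outer k B)
    {c g : Ctrl r W.m} (hcg : c ≠ g) {χ : W.Space k H → ℂ}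
    (hχ : χ = wordOp (W.ctrlOp k M) pre *ᵥ W.wordVec k M φ B w) :
    nrm (W.genOp k M c *ᵥ (W.genOp k M g *ᵥ χ) - sgn (decide ((c.1, c.2.1) = (g.1, g.2.1))) •
      (W.genOp k M g *ᵥ (W.genOp k M c *ᵥ χ))) ≤ W.consError k * δ := by
  have key : ∀ (c g : Ctrl r W.m) (τ : Bool),
      ([genSym c, genSym g, genSym c, genSym g], τ) ∈ constraints k r W.m →
      nrm (W.genOp k M c *ᵥ (W.genOp k M g *ᵥ χ) - sgn τ • (W.genOp k M g *ᵥ (W.genOp k M c *ᵥ χ)))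
        ≤ W.consError k * δ := by
    intro c g τ hC
    have h1 := W.outer_constraint hM h hδ hl hw hB hC
    have e1 : wordOp (W.reflOp k M) [genSym c, genSym g, genSym c, genSym g] *ᵥ χ =
        W.genOp k M g *ᵥ (W.genOp k M c *ᵥ (W.genOp k M g *ᵥ (W.genOp k M c *ᵥ χ))) := by
      simp only [wordOp, one_mul, mulVec_mulVec, mul_assoc]
      rfl
    have hc := W.genOp_isRefl k hM c
    have hg := W.genOp_isRefl k hM g
    rw [← hχ, e1, ← hg.nrm, ← hc.nrm, mulVec_sub, mulVec_sub, hg.mulVec_mulVec, hc.mulVec_mulVec,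
      mulVec_smul, mulVec_smul] at h1
    refine le_trans (le_of_eq ?_) h1
    rw [← nrm_neg, ← one_mul (nrm (_ - sgn τ • (W.genOp k M c *ᵥ _))), ← norm_sgn τ, ← nrm_smul,
      smul_sub, smul_smul, sgn_mul_self, one_smul, neg_sub]
  obtain ⟨i, u, b⟩ := c
  obtain ⟨i', v, b'⟩ := g
  dsimp only
  by_cases hi : i = i'
  · subst hi
    by_cases hu : u = v
    · subst hu
      have hb : b' = !b := by cases b <;> cases b' <;> simp_all
      subst hb
      have h1 := key (i, u, false) (i, u, true) true (mem_flatMap.2 ⟨i, List.mem_finRange i, by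
        simp only [playerConstraints, mem_append, mem_map]
        exact Or.inl (Or.inl (Or.inl (Or.inr ⟨u, List.mem_finRange u, rfl⟩)))⟩)
      simp only [decide_true]
      cases b
      · exact h1
      · refine le_trans (le_of_eq ?_) h1
        congr 1
        simp [add_comm]
    · rw [show decide ((i, u) = (i, v)) = false by simp [hu]]
      refine key _ _ _ (mem_flatMap.2 ⟨i, List.mem_finRange i, ?_⟩)
      simp only [playerConstraints, mem_flatMap, List.mem_finRange, true_and, mem_append, mem_map,
        List.mem_filter]
      refine Or.inl (Or.inl (Or.inl (Or.inl ⟨u, v, by simpa using Ne.symm hu, ctrlLabel b, ?_,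
        ctrlLabel b', ?_, rfl⟩)))
      · cases b <;> simp [xz, ctrlLabel]
      · cases b' <;> simp [xz, ctrlLabel]
  · rw [show decide ((i, u) = (i', v)) = false by simp [hi],
      commute_mulVec (W.genOp_commute k M hi), sgn_false, one_smul, sub_self, nrm_zero]
    exact mul_nonneg (by unfold consError; positivity) hδ

/-- Moving a reflection past a controlled reflection. -/
theorem nrm_ctrlOp_genOp_le (hM : ProjMeas M) (h : W.PropChecks k M φ δ) (hδ : 0 ≤ δ) {pre post : List (Ctrl r W.m)} {c' : Ctrl r W.m}
    (hl : ctrlList r W.m = pre ++ c' :: post) {w : List (Ctrl r W.m)} (hw : w.length ≤ k)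
    {B : Mat (W.Space k H)} (hB : W.Outer k B) {c g : Ctrl r W.m} (hcg : c ≠ g) :
    nrm (W.ctrlOp k M c *ᵥ (W.genOp k M g *ᵥ (wordOp (W.ctrlOp k M) pre *ᵥ W.wordVec k M φ B w)) -
      (if (c.1, c.2.1) = (g.1, g.2.1) then W.refPauli k (.X c) .Z else 1) *ᵥ
      (W.genOp k M g *ᵥ (W.ctrlOp k M c *ᵥ (wordOp (W.ctrlOp k M) pre *ᵥ W.wordVec k M φ B w)))) ≤ W.consError k * δ := by
  set χ := wordOp (W.ctrlOp k M) pre *ᵥ W.wordVec k M φ B w with hχ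
  have h1 := W.nrm_comm_le hM h hδ hl hw hB hcg hχ
  have hz := W.refPauli_isRefl k (H := H) (.X c) .Z
  have hzg := W.refPauli_commute_genOp k M c .Z g
  have hpg := fun b => prj_commute hzg b
  refine le_trans (le_of_eq ?_) (((prj_ctr hz true) _).trans h1)
  congr 1
  rw [ctrlOp_eq]
  set z := (W.refPauli k (.X c) .Z : Mat (W.Space k H))
  set D := W.genOp k M c
  set E := W.genOp k M g
  have e3 : ∀ ζ : Mat (W.Space k H), ∀ τ : Bool,
      (∀ b, ζ * prj b z = (if b then sgn τ else 1) • prj b z) →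
      (prj false z + prj true z * D) * E - ζ * (E * (prj false z + prj true z * D)) =
      prj true z * (D * E - sgn τ • (E * D)) := by
    intro ζ τ hζ
    rw [mul_add E, ← mul_assoc E, ← (hpg false).eq, ← (hpg true).eq, mul_add ζ, ← mul_assoc ζ,
      hζ false, ← mul_assoc ζ, ← mul_assoc ζ, hζ true, mul_sub, mul_smul_comm, add_mul]
    simp only [Bool.false_eq_true, if_false, if_true, one_smul, smul_mul_assoc, mul_assoc]
    abel
  have e4 := fun ζ τ hζ => congrArg (fun A => A *ᵥ χ) (e3 ζ τ hζ)
  simp only [sub_mulVec, ← mulVec_mulVec, smul_mulVec] at e4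
  split_ifs with hcond
  · rw [e4 z true, decide_eq_true hcond]
    intro b
    rw [hz.mul_prj]
    cases b <;> simp
  · rw [e4 1 false, decide_eq_false hcond]
    intro b
    cases b <;> simp

/-- Moving a reflection past controlled reflections on other qubits. -/
theorem nrm_wordOp_genOp_le (hM : ProjMeas M) (h : W.PropChecks k M φ δ) (hδ : 0 ≤ δ) {w : List (Ctrl r W.m)} (hw : w.length ≤ k)
    {B : Mat (W.Space k H)} (hB : W.Outer k B) {g : Ctrl r W.m}
    (mid : List (Ctrl r W.m)) (hmid : ∀ b, (g.1, g.2.1, b) ∉ mid) :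
    ∀ {pre post : List (Ctrl r W.m)} (_ : ctrlList r W.m = pre ++ (mid ++ post)),
    nrm (wordOp (W.ctrlOp k M) mid *ᵥ (W.genOp k M g *ᵥ (wordOp (W.ctrlOp k M) pre *ᵥ W.wordVec k M φ B w)) -
      W.genOp k M g *ᵥ (wordOp (W.ctrlOp k M) mid *ᵥ (wordOp (W.ctrlOp k M) pre *ᵥ W.wordVec k M φ B w))) ≤ mid.length * (W.consError k * δ) := by
  induction mid with
  | nil => intro pre post _; simp [wordOp, nrm_zero]
  | cons c mid ih =>
    intro pre post hl
    have hc : c ≠ g := by rintro rfl; exact hmid c.2.2 List.mem_cons_self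
    have hne : ¬ (c.1, c.2.1) = (g.1, g.2.1) := by
      intro hcg
      rw [Prod.mk.injEq] at hcg
      refine hmid c.2.2 ?_
      rw [← hcg.1, ← hcg.2]
      exact List.mem_cons_self
    have h1 := W.nrm_ctrlOp_genOp_le hM h hδ hl hw hB hc
    rw [if_neg hne, one_mulVec] at h1
    have h2 := ih (fun b hb => hmid b (List.mem_cons_of_mem _ hb)) (pre := pre ++ [c])
      (post := post) (by rw [hl]; simp)
    rw [wordOp_append, wordOp_singleton, ← mulVec_mulVec] at h2
    have h3 := (wordOp_ctr (W.ctrlOp_isRefl k hM) mid).sub_le _ _ |>.trans h1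
    rw [wordOp_cons, ← mulVec_mulVec, ← mulVec_mulVec]
    refine (nrm_sub_trans _ _ _).trans ((add_le_add h3 h2).trans (le_of_eq ?_))
    push_cast [List.length_cons]
    ring

end NormalVerifier

section ExtractAlgebra

variable {J : Type} [Fintype J] [DecidableEq J] {G C Λg Λf D x z : Mat J}

theorem nrm_extract_X_le (hG : Ctr G) (hC : Ctr C) (hg : Ctr Λg) (hf : Ctr Λf) (hx : Ctr x)
    (hGx : Commute x G) (hCx : Commute x C) (hgx : Commute x Λg) (hD : Λf * D = x * Λf * x)
    {χ η : J → ℂ} {a b : ℝ} (h1 : nrm (η - D *ᵥ χ) ≤ a) (h2 : nrm (x *ᵥ χ - χ) ≤ b) :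
    nrm (G *ᵥ (C *ᵥ (Λg *ᵥ (Λf *ᵥ η))) - x *ᵥ (G *ᵥ (C *ᵥ (Λg *ᵥ (Λf *ᵥ χ))))) ≤ a + b := by
  have e1 : x *ᵥ (G *ᵥ (C *ᵥ (Λg *ᵥ (Λf *ᵥ χ)))) = G *ᵥ (C *ᵥ (Λg *ᵥ (x *ᵥ (Λf *ᵥ χ)))) := by
    rw [mulVec_mulVec, hGx.eq, ← mulVec_mulVec, mulVec_mulVec _ x, hCx.eq, ← mulVec_mulVec,
      mulVec_mulVec _ x, hgx.eq, ← mulVec_mulVec]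
  have e2 : Λf *ᵥ (D *ᵥ χ) = x *ᵥ (Λf *ᵥ (x *ᵥ χ)) := by
    rw [mulVec_mulVec, hD, ← mulVec_mulVec, ← mulVec_mulVec]
  rw [e1]
  refine (hG.sub_le _ _).trans ((hC.sub_le _ _).trans ((hg.sub_le _ _).trans ?_))
  have h3 := (hf.sub_le _ _).trans h1
  rw [e2] at h3
  have h4 := (hx.sub_le _ _).trans ((hf.sub_le _ _).trans h2)
  linarith [nrm_sub_trans (Λf *ᵥ η) (x *ᵥ (Λf *ᵥ (x *ᵥ χ))) (x *ᵥ (Λf *ᵥ χ))]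

theorem nrm_extract_Z_le (hG : Ctr G) (hC : Ctr C) (hg : Ctr Λg) (hf : Ctr Λf) (hx : Ctr x)
    (hz : Ctr z) (hGz : G * (z * x) = z * G) (hCx : Commute x C) (hCz : Commute z C)
    (hgz : Commute z Λg) (hD : Λg * D = x * Λg * x) {χ η : J → ℂ} {a b e : ℝ}
    (h1 : nrm (η - D *ᵥ χ) ≤ a) (h2 : nrm (Λf *ᵥ (D *ᵥ χ) - z *ᵥ (D *ᵥ (Λf *ᵥ χ))) ≤ e)
    (h3 : nrm (x *ᵥ (Λf *ᵥ χ) - Λf *ᵥ χ) ≤ b) :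
    nrm (G *ᵥ (C *ᵥ (Λg *ᵥ (Λf *ᵥ η))) - z *ᵥ (G *ᵥ (C *ᵥ (Λg *ᵥ (Λf *ᵥ χ))))) ≤ a + e + b := by
  have e1 : z *ᵥ (G *ᵥ (C *ᵥ (Λg *ᵥ (Λf *ᵥ χ)))) =
      G *ᵥ (C *ᵥ (z *ᵥ (x *ᵥ (Λg *ᵥ (Λf *ᵥ χ))))) := by
    rw [mulVec_mulVec, ← hGz, ← mulVec_mulVec, ← mulVec_mulVec, mulVec_mulVec _ x, hCx.eq,
      ← mulVec_mulVec, mulVec_mulVec _ z, hCz.eq, ← mulVec_mulVec]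
  have e2 : Λg *ᵥ (z *ᵥ (D *ᵥ (Λf *ᵥ χ))) = z *ᵥ (x *ᵥ (Λg *ᵥ (x *ᵥ (Λf *ᵥ χ)))) := by
    rw [mulVec_mulVec, ← hgz.eq, ← mulVec_mulVec, mulVec_mulVec _ Λg, hD, ← mulVec_mulVec,
      ← mulVec_mulVec]
  rw [e1]
  refine (hG.sub_le _ _).trans ((hC.sub_le _ _).trans ?_)
  have h4 := (hg.sub_le _ _).trans ((hf.sub_le _ _).trans h1)
  have h5 := (hg.sub_le _ _).trans h2
  rw [e2] at h5
  have h6 := (hz.sub_le _ _).trans ((hx.sub_le _ _).trans ((hg.sub_le _ _).trans h3))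
  linarith [nrm_sub_trans (Λg *ᵥ (Λf *ᵥ η)) (Λg *ᵥ (Λf *ᵥ (D *ᵥ χ)))
      (z *ᵥ (x *ᵥ (Λg *ᵥ (Λf *ᵥ χ)))),
    nrm_sub_trans (Λg *ᵥ (Λf *ᵥ (D *ᵥ χ))) (z *ᵥ (x *ᵥ (Λg *ᵥ (x *ᵥ (Λf *ᵥ χ)))))
      (z *ᵥ (x *ᵥ (Λg *ᵥ (Λf *ᵥ χ))))]

end ExtractAlgebra

namespace NormalVerifier

variable {r : ℕ} (W : NormalVerifier r) (k : ℕ) {H : Fin r → Type} [∀ i, Fintype (H i)]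
  [∀ i, DecidableEq (H i)] (M : W.Obs H)

/-- A reflection that exchanges `Z` on the first control qubit of a qubit of a player with its
product with `X` on the second one. -/
def swapOp (p : Fin r × Fin W.m) : Mat (W.Space k H) :=
  prj false (W.refPauli k (.X (p.1, p.2, true)) .X) +
    prj true (W.refPauli k (.X (p.1, p.2, true)) .X) * W.refPauli k (.X (p.1, p.2, false)) .X

/-- The isometry that extracts the qubits of the players. -/
def extractOp : Mat (W.Space k H) :=
  wordOp (W.swapOp k) (Finset.univ : Finset (Fin r × Fin W.m)).toList *
    wordOp (W.ctrlOp k M) (ctrlList r W.m)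

/-- The operator on the extracted qubit. -/
def extPauli (i : Fin r) (u : Fin W.m) (D : PauliLabel) : Mat (W.Space k H) :=
  W.refPauli k (.X (i, u, false)) D

/-- The operator on an extracted qubit that corresponds to `genOp c`. -/
def extGen (c : Ctrl r W.m) : Mat (W.Space k H) :=
  W.extPauli k c.1 c.2.1 (ctrlLabel c.2.2)

theorem swapOp_isRefl (p : Fin r × Fin W.m) :
    IsRefl (W.swapOp k p : Mat (W.Space k H)) :=
  (W.refPauli_isRefl k _ _).controlled (W.refPauli_isRefl k _ _) (W.refPauli_commute_self k _ _ _)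

theorem swapOp_mem (p : Fin r × Fin W.m) : W.swapOp k p ∈ W.localOps k H :=
  add_mem (W.prj_mem k (W.refPauli_X_mem k _ _))
    (mul_mem (W.prj_mem k (W.refPauli_X_mem k _ _)) (W.refPauli_X_mem k _ _))

theorem extractOp_mem : W.extractOp k M ∈ W.localOps k H :=
  mul_mem (W.wordOp_mem k (W.swapOp_mem k) _) (W.wordOp_mem k (W.ctrlOp_mem k M) _)

theorem commute_swapOp {A : Mat (W.Space k H)} {p : Fin r × Fin W.m}
    (h : ∀ b, Commute A (W.refPauli k (.X (p.1, p.2, b)) .X)) : Commute A (W.swapOp k p) := by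
  have hb := fun b => (prj_commute (h true).symm b).symm
  exact (hb false).add_right ((hb true).mul_right (h false))

theorem swapOp_mul (p : Fin r × Fin W.m) : (W.swapOp k p : Mat (W.Space k H)) *
    (W.refPauli k (.X (p.1, p.2, false)) .Z * W.refPauli k (.X (p.1, p.2, true)) .X) =
    W.refPauli k (.X (p.1, p.2, false)) .Z * W.swapOp k p := by
  have hx := (W.refPauli_isRefl k (H := H) (.X (p.1, p.2, true)) .X)
  have hfg := W.refPauli_commute k (H := H) (q := .X (p.1, p.2, true)) (q' := .X (p.1, p.2, false))
    (by simp) .X .Z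
  have hff := W.refPauli_anti k (H := H) (.X (p.1, p.2, false))
  have hxx := W.refPauli_commute_self k (H := H) (.X (p.1, p.2, true)) (.X (p.1, p.2, false)) .X
  rw [swapOp]
  set xg := (W.refPauli k (.X (p.1, p.2, true)) .X : Mat (W.Space k H))
  set xf := (W.refPauli k (.X (p.1, p.2, false)) .X : Mat (W.Space k H))
  set zf := (W.refPauli k (.X (p.1, p.2, false)) .Z : Mat (W.Space k H))
  have h1 := fun b => prj_commute hfg b
  have h2 := fun b => hx.mul_prj b
  have h3 := fun b => (prj_commute (Commute.refl xg) b).symm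
  have e1 : prj false xg * (zf * xg) = zf * prj false xg := by
    rw [← mul_assoc, (h1 false).eq, mul_assoc, ← (h3 false).eq, h2, sgn_false, one_smul]
  have e2 : prj true xg * xf * (zf * xg) = zf * (prj true xg * xf) := by
    rw [mul_assoc, ← mul_assoc xf, hff, neg_mul, mul_neg, mul_assoc zf, ← hxx.eq, ← mul_assoc zf,
      ← hfg.eq, mul_assoc xg, ← mul_assoc, ← (h3 true).eq, h2, sgn_true, neg_smul, one_smul,
      neg_mul, neg_neg, ← mul_assoc, (h1 true).eq, mul_assoc]
  rw [add_mul, e1, e2, mul_add]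

theorem swaps_mul_X (c : Ctrl r W.m) (l : List (Fin r × Fin W.m)) :
    Commute (W.refPauli k (.X c) .X) (wordOp (W.swapOp k (H := H)) l) :=
  wordOp_commute fun _ _ => W.commute_swapOp k fun _ => W.refPauli_commute_self k _ _ _

theorem swaps_mul_Z (i : Fin r) (u : Fin W.m) :
    wordOp (W.swapOp k (H := H)) (Finset.univ : Finset (Fin r × Fin W.m)).toList *
      (W.refPauli k (.X (i, u, false)) .Z * W.refPauli k (.X (i, u, true)) .X) =
    W.refPauli k (.X (i, u, false)) .Z *
      wordOp (W.swapOp k (H := H)) (Finset.univ : Finset (Fin r × Fin W.m)).toList := by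
  obtain ⟨l₁, l₂, hl⟩ := List.append_of_mem (Finset.mem_toList.2 (mem_univ (i, u)))
  have hnd := Finset.nodup_toList (Finset.univ : Finset (Fin r × Fin W.m))
  rw [hl, List.nodup_middle, List.nodup_cons, mem_append, not_or] at hnd
  have hz : ∀ l : List (Fin r × Fin W.m), (i, u) ∉ l →
      Commute (W.refPauli k (.X (i, u, false)) .Z) (wordOp (W.swapOp k (H := H)) l) := by
    intro l hl
    refine wordOp_commute fun p hp => W.commute_swapOp k fun b => ?_
    refine W.refPauli_commute k ?_ _ _
    intro he
    refine hl ?_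
    have : (i, u) = p := by simp at he; exact Prod.ext he.1 he.2.1
    rw [this]; exact hp
  have hx := fun l => W.swaps_mul_X k (H := H) (i, u, true) l
  rw [hl, wordOp_append, wordOp_cons]
  set G₁ := wordOp (W.swapOp k (H := H)) l₁
  set G₂ := wordOp (W.swapOp k (H := H)) l₂
  have h1 := ((hz l₁ hnd.1.1).mul_left (hx l₁)).eq
  have h2 := (hz l₂ hnd.1.2).eq
  have h3 := W.swapOp_mul k (H := H) (i, u)
  calc G₂ * W.swapOp k (i, u) * G₁ * (_ * _)
      = G₂ * (W.swapOp k (i, u) * (W.refPauli k (.X (i, u, false)) .Z *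
          W.refPauli k (.X (i, u, true)) .X)) * G₁ := by
        rw [mul_assoc, ← h1]; simp only [mul_assoc]; rfl
    _ = _ := by
        rw [h3, ← mul_assoc, ← h2]; simp only [mul_assoc]; rfl

/-- The error up to which operators are extracted. -/
def extError (W : NormalVerifier r) (k : ℕ) : ℝ := ((ctrlList r W.m).length + 1) * W.consError k + 2

theorem consError_nonneg (W : NormalVerifier r) (k : ℕ) : 0 ≤ W.consError k := by
  unfold consError; positivity

theorem extError_nonneg (W : NormalVerifier r) (k : ℕ) : 0 ≤ W.extError k := by
  have := consError_nonneg W k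
  unfold extError; positivity

variable {M}

theorem extractOp_isometry (hM : ProjMeas M) : (W.extractOp k M)ᴴ * W.extractOp k M = 1 := by
  rw [extractOp, conjTranspose_mul, mul_assoc, ← mul_assoc _ _ (wordOp (W.ctrlOp k M) _),
    wordOp_isometry (W.swapOp_isRefl k), one_mul, wordOp_isometry (W.ctrlOp_isRefl k hM)]

theorem extractOp_ctr (hM : ProjMeas M) : Ctr (W.extractOp k M) := Ctr.of_isometry (W.extractOp_isometry k hM)

variable {k} {φ : W.Space k H → ℂ} {δ : ℝ}

theorem nrm_control_le (hM : ProjMeas M) (h : W.PropChecks k M φ δ) (c : Ctrl r W.m) {pre : List (Ctrl r W.m)} (hc : c ∉ pre)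
    (w : List (Ctrl r W.m)) {B : Mat (W.Space k H)} (hB : W.Outer k B) :
    nrm (W.refPauli k (.X c) .X *ᵥ (wordOp (W.ctrlOp k M) pre *ᵥ W.wordVec k M φ B w) - (wordOp (W.ctrlOp k M) pre *ᵥ W.wordVec k M φ B w)) ≤ 2 * δ := by
  have c1 : Commute (W.refPauli k (.X c) .X) (wordOp (W.ctrlOp k M) pre) :=
    wordOp_commute fun g hg => W.refPauli_commute_ctrlOp k M (by rintro rfl; exact hc hg) _
  have c2 := (hB.commute _ (W.refPauli_X_mem k c .X)).symm
  have c3 : Commute (W.refPauli k (.X c) .X) (wordOp (W.genOp k M) w) :=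
    wordOp_commute fun g _ => W.refPauli_commute_genOp k M _ _ _
  rw [wordVec, commute_mulVec c1, commute_mulVec c2, commute_mulVec c3]
  refine ((wordOp_ctr (W.ctrlOp_isRefl k hM) pre).sub_le _ _).trans ((hB.ctr.sub_le _ _).trans
    (((wordOp_ctr (W.genOp_isRefl k hM) w).sub_le _ _).trans ?_))
  rw [nrm_sub_comm]
  exact h.control W c

theorem nrm_extract_le (hM : ProjMeas M) (h : W.PropChecks k M φ δ) (hδ : 0 ≤ δ) (c : Ctrl r W.m) {w : List (Ctrl r W.m)} (hw : w.length ≤ k)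
    {B : Mat (W.Space k H)} (hB : W.Outer k B) :
    nrm (W.extractOp k M *ᵥ (W.genOp k M c *ᵥ W.wordVec k M φ B w)
      - W.extGen k c *ᵥ (W.extractOp k M *ᵥ W.wordVec k M φ B w))
      ≤ W.extError k * δ := by
  obtain ⟨i, u, b⟩ := c
  obtain ⟨A, C, hl, hA, hC⟩ := exists_ctrlList_eq i u
  have hε : 0 ≤ W.consError k * δ := mul_nonneg (consError_nonneg W k) hδ
  have hmove := W.nrm_wordOp_genOp_le hM h hδ hw hB (g := (i, u, b)) A hA (pre := [])
    (post := (i, u, false) :: (i, u, true) :: C) hl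
  rw [wordOp_nil, one_mulVec] at hmove
  have hbound : (A.length : ℝ) * (W.consError k * δ) + W.consError k * δ + 2 * δ ≤
      W.extError k * δ := by
    have : (A.length : ℝ) ≤ (ctrlList r W.m).length := by
      rw [hl]; simp only [List.length_append, List.length_cons]; push_cast; linarith
    have := mul_le_mul_of_nonneg_right this hε
    rw [extError]
    linarith
  have hxf := W.nrm_control_le hM h (i, u, false) (hA false) w hB
  have hxg := W.nrm_control_le hM h (i, u, true) (pre := A ++ [(i, u, false)])
    (by simp [hA]) w hB
  have hanti := W.nrm_ctrlOp_genOp_le hM h hδ hl hw hB (c := (i, u, false)) (g := (i, u, true))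
    (by simp)
  rw [if_pos rfl] at hanti
  rw [wordOp_append, wordOp_singleton, ← mulVec_mulVec] at hxg
  have hG : Ctr (wordOp (W.swapOp k (H := H)) (Finset.univ : Finset (Fin r × Fin W.m)).toList) :=
    wordOp_ctr (W.swapOp_isRefl k) _
  have hCc : Ctr (wordOp (W.ctrlOp k M) C) := wordOp_ctr (W.ctrlOp_isRefl k hM) _
  have hxC : ∀ b D, Commute (W.refPauli k (.X (i, u, b)) D) (wordOp (W.ctrlOp k M) C) := fun b D =>
    wordOp_commute fun g hg => W.refPauli_commute_ctrlOp k M (by rintro rfl; exact hC b hg) _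
  have hcomm := fun (D : PauliLabel) => W.refPauli_commute_ctrlOp k M (c := (i, u, false))
    (g := (i, u, true)) (by simp) D
  have hΛ := fun b => (W.ctrlOp_isRefl k hM (i, u, b)).ctr
  have hxr := fun (b : Bool) (D : PauliLabel) =>
    (W.refPauli_isRefl k (H := H) (.X (i, u, b)) D).ctr
  rw [extractOp, hl, wordOp_append, wordOp_cons, wordOp_cons]
  simp only [← mulVec_mulVec]
  cases b
  · have := nrm_extract_X_le hG hCc (hΛ true) (hΛ false) (hxr false .X)
      (W.swaps_mul_X k (i, u, false) _) (hxC false .X) (hcomm .X)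
      (W.ctrlOp_mul_genOp k hM (i, u, false)) hmove hxf
    refine this.trans ?_
    linarith
  · have := nrm_extract_Z_le hG hCc (hΛ true) (hΛ false) (hxr true .X) (hxr false .Z)
      (W.swaps_mul_Z k i u) (hxC true .X) (hxC false .Z) (hcomm .Z)
      (W.ctrlOp_mul_genOp k hM (i, u, true)) hmove hanti hxg
    exact this.trans hbound

end NormalVerifier

theorem support_single_subset {q : Type} [Fintype q] [DecidableEq q] (u : q) (D : PauliLabel) :
    support (single u D) ⊆ {u} := by
  intro v hv
  rw [support, mem_filter] at hv
  by_contra h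
  rw [Finset.mem_singleton] at h
  exact hv.2 (by simp [single, h])

theorem support_pair {q : Type} [Fintype q] [DecidableEq q] {u v : q} {D E : PauliLabel}
    (hD : D ≠ .I) (hE : E ≠ .I) : support (pair u D v E) = {u, v} := by
  ext w
  rw [support, mem_filter, Finset.mem_insert, Finset.mem_singleton]
  simp only [mem_univ, true_and, pair]
  by_cases h1 : w = u
  · simp [h1, hD]
  · by_cases h2 : w = v
    · simp [h2]
      split_ifs <;> assumption
    · simp [h1, h2]

theorem pair_mem_powerSet {m k : ℕ} (hk : 2 ≤ k) {u v : Fin m} (huv : u ≠ v) (j : Bool) :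
    ({pair u .X v (if j then .Z else .X), pair u .Z v (if j then .X else .Z)} :
      Finset (Pauli m)) ∈ powerSet m k := by
  simp only [powerSet, mem_filter, mem_univ, true_and]
  have hc := pair_commute huv j
  refine ⟨⟨_, Finset.mem_insert_self _ _⟩, (Finset.card_le_two).trans hk, ?_, {u, v},
    (Finset.card_le_two).trans hk, ?_⟩
  · intro P hP P' hP'
    simp only [Finset.mem_insert, Finset.mem_singleton] at hP hP'
    rcases hP with rfl | rfl <;> rcases hP' with rfl | rfl
    · exact Commute.refl _
    · exact hc
    · exact hc.symm
    · exact Commute.refl _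
  · intro P hP
    simp only [Finset.mem_insert, Finset.mem_singleton] at hP
    rcases hP with rfl | rfl <;> rw [support_pair (by simp) (by cases j <;> simp)]

theorem singles_mem_powerSet {m k : ℕ} {Q : Finset (Pauli m)} (hne : Q.Nonempty) (hcard : Q.card ≤ k)
    (h : ∀ P ∈ Q, ∀ P' ∈ Q, P ≠ P' → ∃ u D v E, u ≠ v ∧ P = single u D ∧ P' = single v E)
    (h1 : ∀ P ∈ Q, ∃ u D, P = single u D) : Q ∈ powerSet m k := by
  simp only [powerSet, mem_filter, mem_univ, true_and]
  refine ⟨hne, hcard, ?_, Q.biUnion support, ?_, ?_⟩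
  · intro P hP P' hP'
    by_cases he : P = P'
    · rw [he]
    · obtain ⟨u, D, v, E, huv, rfl, rfl⟩ := h P hP P' hP' he
      rw [pauliOp_single, pauliOp_single]
      exact op_commute (coord_indep huv) _ _
  · refine Finset.card_biUnion_le.trans (le_trans ?_ hcard)
    rw [Finset.card_eq_sum_ones]
    refine sum_le_sum fun P hP => ?_
    obtain ⟨u, D, rfl⟩ := h1 P hP
    exact (Finset.card_le_card (support_single_subset u D)).trans (by simp)
  · intro P hP
    exact Finset.subset_biUnion_of_mem support hP

theorem askList_of_mem {m : ℕ} {l : List (Pauli m)} {P : Pauli m} (hP : P ∈ l) :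
    askList l = .pauli P ∨ askList l = .multi l.toFinset := by
  match l, hP with
  | [], hP => simp at hP
  | [P'], hP =>
    left
    rw [List.mem_singleton] at hP
    subst hP
    rfl
  | a :: b :: l, _ => exact Or.inr rfl

namespace NormalVerifier

variable {r : ℕ} (W : NormalVerifier r) (k : ℕ) {H : Fin r → Type} [∀ i, Fintype (H i)]
  [∀ i, DecidableEq (H i)] (M : W.Obs H)
  (φ : W.Space k H → ℂ)

/-- On the vectors to which the constraints apply, `R` is approximately a word of length at most `a`,
and the extraction of the players' qubits makes it `P`. -/
structure Transfers (a : ℕ) (R P : Mat (W.Space k H)) (ε : ℝ) : Prop where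
  ctr_left : Ctr R
  ctr_right : Ctr P
  word : ∀ w B, W.Outer k B → w.length + a ≤ k + 1 → ∃ w' B', W.Outer k B' ∧
    w'.length ≤ w.length + a ∧ nrm (R *ᵥ W.wordVec k M φ B w - W.wordVec k M φ B' w') ≤ ε
  extract : ∀ w B, W.Outer k B → w.length + a ≤ k + 1 →
    nrm (W.extractOp k M *ᵥ (R *ᵥ W.wordVec k M φ B w) -
      P *ᵥ (W.extractOp k M *ᵥ W.wordVec k M φ B w)) ≤ ε

variable {W k M φ}

theorem Transfers.outer {B : Mat (W.Space k H)} (hB : W.Outer k B) :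
    W.Transfers k M φ 0 B B 0 := by
  refine ⟨hB.ctr, hB.ctr, fun w B' hB' hw => ⟨w, B * B', hB.mul _ _ hB', le_rfl, ?_⟩,
    fun w B' hB' hw => ?_⟩
  · rw [wordVec, wordVec, ← mulVec_mulVec, sub_self, nrm_zero]
  · rw [commute_mulVec (hB.commute _ (W.extractOp_mem k M)), sub_self, nrm_zero]

theorem Transfers.mul (hM : ProjMeas M) {a a' : ℕ} {ε ε' : ℝ}
    {R P R' P' : Mat (W.Space k H)} (h : W.Transfers k M φ a R P ε)
    (h' : W.Transfers k M φ a' R' P' ε') (hε : 0 ≤ ε') :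
    W.Transfers k M φ (a + a') (R * R') (P * P') (ε + 3 * ε') := by
  refine ⟨h.ctr_left.mul h'.ctr_left, h.ctr_right.mul h'.ctr_right, fun w B hB hw => ?_,
    fun w B hB hw => ?_⟩
  · obtain ⟨w₁, B₁, hB₁, hw₁, h₁⟩ := h'.word w B hB (by omega)
    obtain ⟨w₂, B₂, hB₂, hw₂, h₂⟩ := h.word w₁ B₁ hB₁ (by omega)
    refine ⟨w₂, B₂, hB₂, by omega, ?_⟩
    rw [← mulVec_mulVec]
    have := (h.ctr_left.sub_le _ _).trans h₁
    linarith [nrm_sub_trans (R *ᵥ (R' *ᵥ W.wordVec k M φ B w)) (R *ᵥ W.wordVec k M φ B₁ w₁)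
      (W.wordVec k M φ B₂ w₂)]
  · obtain ⟨w₁, B₁, hB₁, hw₁, h₁⟩ := h'.word w B hB (by omega)
    have h₂ := h.extract w₁ B₁ hB₁ (by omega)
    have h₃ := h'.extract w B hB (by omega)
    have hU := W.extractOp_ctr k hM
    have e₁ := (hU.sub_le _ _).trans ((h.ctr_left.sub_le _ _).trans h₁)
    have e₂ := (h.ctr_right.sub_le _ _).trans ((hU.sub_le _ _).trans h₁)
    have e₃ := (h.ctr_right.sub_le _ _).trans h₃
    rw [← mulVec_mulVec, ← mulVec_mulVec]
    rw [nrm_sub_comm] at e₂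
    set U := W.extractOp k M
    set v := W.wordVec k M φ B w
    set v₁ := W.wordVec k M φ B₁ w₁
    linarith [nrm_sub_trans (U *ᵥ (R *ᵥ (R' *ᵥ v))) (U *ᵥ (R *ᵥ v₁)) (P *ᵥ (P' *ᵥ (U *ᵥ v))),
      nrm_sub_trans (U *ᵥ (R *ᵥ v₁)) (P *ᵥ (U *ᵥ v₁)) (P *ᵥ (P' *ᵥ (U *ᵥ v))),
      nrm_sub_trans (P *ᵥ (U *ᵥ v₁)) (P *ᵥ (U *ᵥ (R' *ᵥ v))) (P *ᵥ (P' *ᵥ (U *ᵥ v)))]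

theorem Transfers.mono {a a' : ℕ} {ε ε' : ℝ} {R P : Mat (W.Space k H)}
    (h : W.Transfers k M φ a R P ε) (ha : a ≤ a') (hε : ε ≤ ε') : W.Transfers k M φ a' R P ε' := by
  refine ⟨h.ctr_left, h.ctr_right, fun w B hB hw => ?_, fun w B hB hw => ?_⟩
  · obtain ⟨w₁, B₁, hB₁, hw₁, h₁⟩ := h.word w B hB (by omega)
    exact ⟨w₁, B₁, hB₁, by omega, h₁.trans hε⟩
  · exact (h.extract w B hB (by omega)).trans hε

theorem Transfers.congr (hM : ProjMeas M) {a : ℕ} {ε ε' : ℝ}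
    {R R' P : Mat (W.Space k H)} (h : W.Transfers k M φ a R P ε) (ha : 1 ≤ a)
    (hR' : Ctr R') (h' : ∀ w B, W.Outer k B → w.length ≤ k →
      nrm (R' *ᵥ W.wordVec k M φ B w - R *ᵥ W.wordVec k M φ B w) ≤ ε') :
    W.Transfers k M φ a R' P (ε + ε') := by
  refine ⟨hR', h.ctr_right, fun w B hB hw => ?_, fun w B hB hw => ?_⟩
  · obtain ⟨w₁, B₁, hB₁, hw₁, h₁⟩ := h.word w B hB hw
    refine ⟨w₁, B₁, hB₁, hw₁, (nrm_sub_trans _ (R *ᵥ W.wordVec k M φ B w) _).trans ?_⟩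
    linarith [h' w B hB (by omega)]
  · have h₁ := h.extract w B hB hw
    have h₂ := ((W.extractOp_ctr k hM).sub_le _ _).trans (h' w B hB (by omega))
    refine (nrm_sub_trans _ _ _).trans ((add_le_add h₂ h₁).trans (by linarith))

section Checks

variable {δ : ℝ}

theorem transfers_gen (hM : ProjMeas M) (h : W.PropChecks k M φ δ) (hδ : 0 ≤ δ) (c : Ctrl r W.m) :
    W.Transfers k M φ 1 (W.genOp k M c) (W.extGen k c) (W.extError k * δ) := by
  refine ⟨(W.genOp_isRefl k hM c).ctr, (W.refPauli_isRefl k _ _).ctr,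
    fun w B hB hw => ⟨w ++ [c], B, hB, by simp, ?_⟩,
    fun w B hB hw => W.nrm_extract_le hM h hδ c (by omega) hB⟩
  rw [wordVec, wordVec, wordOp_append, wordOp_singleton, ← mulVec_mulVec,
    commute_mulVec (hB.commute _ (W.genOp_mem k M c)), sub_self, nrm_zero]
  exact mul_nonneg (extError_nonneg W k) hδ

theorem outer_constraint_nil (hM : ProjMeas M) (h : W.PropChecks k M φ δ) (hδ : 0 ≤ δ) (i : Fin r) {w : List (Ctrl r W.m)} (hw : w.length ≤ k)
    {B : Mat (W.Space k H)} (hB : W.Outer k B) {C : Constraint r W.m}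
    (hC : C ∈ constraints k r W.m) :
    nrm (wordOp (W.reflOp k M) C.1 *ᵥ W.wordVec k M φ B w - sgn C.2 • W.wordVec k M φ B w) ≤
      W.consError k * δ := by
  obtain ⟨A, C', hl, -, -⟩ := exists_ctrlList_eq i (0 : Fin W.m)
  cases hl' : ctrlList r W.m with
  | nil => rw [hl'] at hl; simp at hl
  | cons c post =>
    have := W.outer_constraint hM h hδ (pre := []) hl' hw hB hC
    rw [wordOp_nil, one_mulVec] at this
    exact this

theorem nrm_derived_sub_le (hM : ProjMeas M) (h : W.PropChecks k M φ δ) (hδ : 0 ≤ δ) (i : Fin r) {Q : Finset (Pauli W.m)} (hQ : Q ∈ powerSet W.m k)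
    {P : Pauli W.m} (hP : P ∈ Q) {w : List (Ctrl r W.m)} (hw : w.length ≤ k)
    {B : Mat (W.Space k H)} (hB : W.Outer k B) :
    nrm (W.reflOp k M (.derived i Q P) *ᵥ W.wordVec k M φ B w -
      W.reflOp k M (.refl i P) *ᵥ W.wordVec k M φ B w) ≤ W.consError k * δ := by
  have hC : (([Refl.derived i Q P, Refl.refl i P], false) : Constraint r W.m) ∈
      constraints k r W.m := by
    simp only [constraints, playerConstraints, mem_flatMap, List.mem_finRange, true_and,
      mem_append, mem_map, Finset.mem_toList]
    exact ⟨i, Or.inr ⟨Q, hQ, P, hP, rfl⟩⟩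
  have h1 := outer_constraint_nil hM h hδ i hw hB hC
  have hR := W.reflOp_isRefl k hM (.refl i P)
  rw [← hR.nrm, mulVec_sub] at h1
  simp only [wordOp, one_mul, sgn_false, one_smul, ← mulVec_mulVec] at h1
  rwa [hR.mulVec_mulVec] at h1

theorem transfers_derived_single (hM : ProjMeas M) (h : W.PropChecks k M φ δ) (hδ : 0 ≤ δ) (i : Fin r) {Q : Finset (Pauli W.m)} (hQ : Q ∈ powerSet W.m k)
    {u : Fin W.m} {b : Bool} (hP : single u (ctrlLabel b) ∈ Q) :
    W.Transfers k M φ 1 (W.playerObs k M i (.multi Q) (single u (ctrlLabel b)))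
      (W.extPauli k i u (ctrlLabel b)) ((W.extError k + W.consError k) * δ) := by
  rw [add_mul]
  exact (transfers_gen hM h hδ (i, u, b)).congr hM le_rfl
    (W.playerObs_isRefl k hM _ _ _).ctr fun w B hB hw => nrm_derived_sub_le hM h hδ i hQ hP hw hB

theorem transfers_derived_pair (hM : ProjMeas M) (h : W.PropChecks k M φ δ) (hδ : 0 ≤ δ) (hk : 2 ≤ k) (i : Fin r) {Q : Finset (Pauli W.m)}
    (hQ : Q ∈ powerSet W.m k) {u v : Fin W.m} (huv : u ≠ v) {b b' : Bool}
    (hP : pair u (ctrlLabel b) v (ctrlLabel b') ∈ Q) :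
    W.Transfers k M φ 2 (W.playerObs k M i (.multi Q) (pair u (ctrlLabel b) v (ctrlLabel b')))
      (W.extPauli k i u (ctrlLabel b) * W.extPauli k i v (ctrlLabel b'))
      ((4 * W.extError k + 2 * W.consError k) * δ) := by
  set P : Pauli W.m := pair u (ctrlLabel b) v (ctrlLabel b') with hPdef
  have hI : ∀ b, ctrlLabel b ≠ .I := fun b => by cases b <;> simp [ctrlLabel]
  have hsupp : support P = {u, v} := support_pair (hI b) (hI b')
  have hPu : P u = ctrlLabel b := by simp [hPdef, pair]
  have hPv : P v = ctrlLabel b' := by simp [hPdef, pair, huv.symm]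
  have hcard : (support P).card = 2 := by rw [hsupp, Finset.card_pair huv]
  have hE := extError_nonneg W k
  have hCn := consError_nonneg W k
  have hC : (Refl.refl i P :: (support P).toList.map (fun v => one i v (P v)), false) ∈
      constraints k r W.m := by
    simp only [constraints, playerConstraints, mem_flatMap, List.mem_finRange, true_and,
      mem_append, mem_map, Finset.mem_toList]
    exact ⟨i, Or.inl (Or.inr ⟨P, by simp [pauliSet, hcard, hk], rfl⟩)⟩
  have key : ∀ (a a' : Fin W.m) (c c' : Bool), (support P).toList = [a, a'] →
      P a = ctrlLabel c → P a' = ctrlLabel c' →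
      W.Transfers k M φ 2 (W.playerObs k M i (.multi Q) P)
      (W.extPauli k i a (ctrlLabel c) * W.extPauli k i a' (ctrlLabel c'))
      ((4 * W.extError k + 2 * W.consError k) * δ) := by
    intro a a' c c' hlist hc hc'
    have ht := (transfers_gen hM h hδ (i, a, c)).mul hM (transfers_gen hM h hδ (i, a', c'))
      (mul_nonneg hE hδ)
    have := ht.congr hM (by norm_num) (R' := W.playerObs k M i (.multi Q) P)
      (ε' := 2 * (W.consError k * δ)) (W.playerObs_isRefl k hM _ _ _).ctr fun w B hB hw => ?_
    · exact this.mono le_rfl (le_of_eq (by ring))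
    · have h1 := nrm_derived_sub_le hM h hδ i hQ hP hw hB
      have h2 := outer_constraint_nil hM h hδ i hw hB hC
      simp only [hlist, List.map_cons, List.map_nil, hc, hc', wordOp, one_mul, sgn_false, one_smul,
        ← mulVec_mulVec] at h2
      change nrm (W.genOp k M (i, a', c') *ᵥ (W.genOp k M (i, a, c) *ᵥ _) - _) ≤ _ at h2
      have r1 := W.genOp_isRefl k hM (i, a, c)
      have r2 := W.genOp_isRefl k hM (i, a', c')
      rw [← r2.nrm, ← r1.nrm, mulVec_sub, mulVec_sub, r2.mulVec_mulVec, r1.mulVec_mulVec] at h2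
      rw [← mulVec_mulVec]
      refine (nrm_sub_trans _ _ _).trans ((add_le_add h1 h2).trans (le_of_eq (by ring)))
  have hlen : (support P).toList.length = 2 := by rw [Finset.length_toList, hcard]
  obtain ⟨a, a', hlist⟩ := List.length_eq_two.1 hlen
  have hmem : ∀ x, x ∈ [a, a'] ↔ x = u ∨ x = v := by
    intro x; rw [← hlist, Finset.mem_toList, hsupp]; simp
  have hnd : [a, a'].Nodup := by rw [← hlist]; exact Finset.nodup_toList _
  have hne : a ≠ a' := by simpa using hnd
  have hcom : Commute (W.extPauli k i u (ctrlLabel b) : Mat (W.Space k H))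
      (W.extPauli k i v (ctrlLabel b')) := W.refPauli_commute k (by simp [huv]) _ _
  rcases (hmem a).1 (by simp) with rfl | rfl
  · rcases (hmem a').1 (by simp) with rfl | rfl
    · exact absurd rfl hne
    · exact key _ _ _ _ hlist hPu hPv
  · rcases (hmem a').1 (by simp) with rfl | rfl
    · rw [hcom.eq]
      exact key _ _ _ _ hlist hPv hPu
    · exact absurd rfl hne

end Checks

end NormalVerifier

/-! ### The operators of the gates and steps -/

section Sub

variable {p q : Type} [Fintype p] [DecidableEq p] [Fintype q] [DecidableEq q]

/-- The qubits in the image of an injection. -/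
def Lens.sub {f : p → q} (hf : Injective f) : Lens (q → Bool) (p → Bool) where
  get x := x ∘ f
  set x a := extend f a x
  get_set x a := by funext j; simp [hf.extend_apply]
  set_get x := by
    funext u
    by_cases h : ∃ j, f j = u
    · obtain ⟨j, rfl⟩ := h; simp [hf.extend_apply]
    · simp [extend_apply' _ _ _ h]
  set_set x a b := by
    funext u
    by_cases h : ∃ j, f j = u
    · obtain ⟨j, rfl⟩ := h; simp [hf.extend_apply]
    · simp [extend_apply' _ _ _ h]

theorem Lens.sub_comp_coord {f : p → q} (hf : Injective f) (j : p) :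
    (Lens.sub hf).comp (coord j) = (coord (f j) : Lens (q → Bool) Bool) := by
  refine Lens.ext' (fun z => rfl) fun z a => ?_
  funext u
  change extend f (update (z ∘ f) j a) z u = update z (f j) a u
  by_cases h : ∃ j, f j = u
  · obtain ⟨j', rfl⟩ := h
    rw [hf.extend_apply]
    by_cases h : j' = j
    · subst h; simp
    · rw [update_of_ne h, update_of_ne (hf.ne h), Function.comp_apply]
  · rw [extend_apply' _ _ _ h, update_of_ne fun hu => h ⟨j, hu.symm⟩]

theorem Lens.sub_op_coord {f : p → q} (hf : Injective f) (j : p)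
    (A : Mat Bool) :
    (Lens.sub hf).op ((coord j).op A) = (coord (f j)).op A := by
  rw [← op_comp, Lens.sub_comp_coord]

theorem Lens.coord_indep_sub {f : p → q} (hf : Injective f) {u : q}
    (hu : ∀ j, f j ≠ u) : (coord u : Lens (q → Bool) Bool).Indep (Lens.sub hf) := by
  have h : ¬ ∃ j, f j = u := fun ⟨j, hj⟩ => hu j hj
  refine ⟨fun z b => extend_apply' _ _ _ h, fun z a => ?_, fun z a b => ?_⟩
  · funext j
    exact update_of_ne (hu j) _ _
  · funext v
    change update (extend f b z) u a v = extend f b (update z u a) v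
    by_cases hv : ∃ j, f j = v
    · obtain ⟨j, rfl⟩ := hv
      rw [update_of_ne (hu j), hf.extend_apply, hf.extend_apply]
    · rw [extend_apply' _ _ _ hv]
      by_cases hvu : v = u
      · subst hvu; simp
      · rw [update_of_ne hvu, update_of_ne hvu, extend_apply' _ _ _ hv]

end Sub

theorem hadamardMat_eq : hadamardMat = (((Real.sqrt 2 : ℝ) : ℂ)⁻¹) •
    (PauliLabel.X.mat + PauliLabel.Z.mat) := by
  ext a b
  cases a <;> cases b <;> simp [hadamardMat, PauliLabel.mat]

theorem inv_sqrt_two_mul_self :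
    (((Real.sqrt 2 : ℝ) : ℂ)⁻¹) * (((Real.sqrt 2 : ℝ) : ℂ)⁻¹) = 1 / 2 := by
  rw [← mul_inv, ← Complex.ofReal_mul, Real.mul_self_sqrt (by norm_num)]
  norm_num

theorem hadamardMat_isRefl : IsRefl hadamardMat := by
  constructor
  · ext a b
    cases a <;> cases b <;> simp [hadamardMat]
  · rw [hadamardMat_eq, smul_mul_smul_comm, inv_sqrt_two_mul_self, mul_add, add_mul, add_mul,
      PauliLabel.mat_mul_self, PauliLabel.mat_mul_self, PauliLabel.X_mul_Z]
    module

section Gates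

variable {q : Type} [Fintype q] [DecidableEq q]

theorem had_op_eq (u : q) : (Gate.had u).op = (coord u).op hadamardMat := by
  rw [coord_op_eq_tensor, Gate.op]
  congr 1
  funext v
  by_cases h : v = u
  · subst h; simp
  · simp [h]

/-- Two Hadamard gates. -/
def hadOp (u₁ u₂ : q) : Mat (q → Bool) :=
  (coord u₁).op hadamardMat * (coord u₂).op hadamardMat

/-- The first of the two operators in the check of a pair of Hadamard gates. -/
def hadX (u₁ u₂ : q) (j : Bool) : Mat (q → Bool) :=
  pauliOp (pair u₁ .X u₂ (if j then .Z else .X))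

/-- The second of the two operators in the check of a pair of Hadamard gates. -/
def hadZ (u₁ u₂ : q) (j : Bool) : Mat (q → Bool) :=
  pauliOp (pair u₁ .Z u₂ (if j then .X else .Z))

theorem hadOp_isRefl {u₁ u₂ : q} (h : u₁ ≠ u₂) : IsRefl (hadOp u₁ u₂) :=
  (op_isRefl _ hadamardMat_isRefl).mul (op_isRefl _ hadamardMat_isRefl)
    (op_commute (coord_indep h) _ _)

theorem hadOp_eq (u₁ u₂ : q) (h : u₁ ≠ u₂) : hadOp u₁ u₂ =
    (1 / 2 : ℂ) • (hadX u₁ u₂ false + hadZ u₁ u₂ false + (hadX u₁ u₂ true + hadZ u₁ u₂ true)) := by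
  simp only [hadOp, hadX, hadZ, pauliOp_pair h, hadamardMat_eq, map_smul, map_add, if_true,
    Bool.false_eq_true, if_false]
  rw [smul_mul_smul_comm, inv_sqrt_two_mul_self]
  congr 1
  noncomm_ring

theorem coord_op_commute {u v : q} (h : u ≠ v) (A B : Mat Bool) :
    Commute ((coord u : Lens (q → Bool) Bool).op A)
      ((coord v : Lens (q → Bool) Bool).op B) :=
  op_commute (coord_indep (d := fun _ : q => Bool) h) A B

theorem coord_op_isRefl (u : q) {A : Mat Bool} (h : IsRefl A) :
    IsRefl ((coord u : Lens (q → Bool) Bool).op A) :=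
  op_isRefl (coord (d := fun _ : q => Bool) u) h

theorem coord_X_mul_Z (u : q) : (coord u).op PauliLabel.X.mat *
    (coord u).op PauliLabel.Z.mat = -((coord u : Lens (q → Bool) Bool).op
      PauliLabel.Z.mat * (coord u).op PauliLabel.X.mat) := by
  rw [← map_mul, PauliLabel.X_mul_Z, map_neg, map_mul]

theorem hadX_mul_hadZ {u₁ u₂ : q} (h : u₁ ≠ u₂) :
    hadX u₁ u₂ true * hadZ u₁ u₂ true = -(hadX u₁ u₂ false * hadZ u₁ u₂ false) := by
  simp only [hadX, hadZ, pauliOp_pair h, if_true, Bool.false_eq_true, if_false]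
  have c := fun D E : PauliLabel => coord_op_commute h.symm E.mat D.mat
  have e : ∀ D E E' : PauliLabel, (coord u₁).op D.mat * (coord u₂).op E.mat *
      ((coord u₁).op PauliLabel.Z.mat * (coord u₂).op E'.mat) =
      ((coord u₁).op D.mat * (coord u₁).op PauliLabel.Z.mat) *
      ((coord u₂ : Lens (q → Bool) Bool).op E.mat * (coord u₂).op E'.mat) := by
    intro D E E'
    exact (c .Z E).mul_mul_mul_comm _ _
  rw [e, e, coord_X_mul_Z u₂, mul_neg, neg_neg]

theorem hadX_mul_self (u₁ u₂ : q) (j : Bool) : hadX u₁ u₂ j * hadX u₁ u₂ j = 1 := pauliOp_mul_self _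

theorem hadZ_mul_self (u₁ u₂ : q) (j : Bool) : hadZ u₁ u₂ j * hadZ u₁ u₂ j = 1 := pauliOp_mul_self _

theorem hadX_commute_hadZ {u₁ u₂ : q} (h : u₁ ≠ u₂) (j : Bool) :
    Commute (hadX u₁ u₂ j) (hadZ u₁ u₂ j) := pair_commute h j

/-- The product of one operator of each of the two checks of a pair of Hadamard gates. -/
theorem had_cross {u₁ u₂ : q} (h : u₁ ≠ u₂) (j : Bool) :
    (hadX u₁ u₂ j + hadZ u₁ u₂ j) * (hadX u₁ u₂ (!j) + hadZ u₁ u₂ (!j)) = 0 := by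
  have hx := coord_X_mul_Z u₁
  have hx' := coord_X_mul_Z u₂
  have c := fun D E : PauliLabel => coord_op_commute h.symm E.mat D.mat
  have s := fun (u : q) (D : PauliLabel) => (coord_op_isRefl u D.mat_isRefl).mul_self
  have e : ∀ D E D' E' : PauliLabel, (coord u₁).op D.mat * (coord u₂).op E.mat *
      ((coord u₁).op D'.mat * (coord u₂).op E'.mat) =
      ((coord u₁).op D.mat * (coord u₁).op D'.mat) *
      ((coord u₂ : Lens (q → Bool) Bool).op E.mat * (coord u₂).op E'.mat) := by
    intro D E D' E'
    exact (c D' E).mul_mul_mul_comm _ _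
  cases j <;>
    simp only [hadX, hadZ, pauliOp_pair h, if_true, Bool.false_eq_true, if_false, Bool.not_false,
      Bool.not_true, add_mul, mul_add, e, s, one_mul, mul_one] <;>
    rw [hx, hx'] <;> abel

/-- The projection that is checked by the `j`-th check of a pair of Hadamard gates. -/
def hadLeft (u₁ u₂ : q) (j : Bool) : Mat (q → Bool) :=
  (1 / 4 : ℂ) • (1 + hadX u₁ u₂ j * hadZ u₁ u₂ j)

/-- The operator that the pair of Hadamard gates becomes in the `j`-th check. -/
def hadRight (u₁ u₂ : q) (j : Bool) : Mat (q → Bool) :=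
  (1 / 4 : ℂ) • (hadX u₁ u₂ j + hadZ u₁ u₂ j)

theorem hadRight_mul_hadOp {u₁ u₂ : q} (h : u₁ ≠ u₂) (j : Bool) :
    hadRight u₁ u₂ j * hadOp u₁ u₂ = hadLeft u₁ u₂ j := by
  have e : hadOp u₁ u₂ = (1 / 2 : ℂ) • ((hadX u₁ u₂ j + hadZ u₁ u₂ j) +
      (hadX u₁ u₂ (!j) + hadZ u₁ u₂ (!j))) := by
    rw [hadOp_eq u₁ u₂ h]
    cases j
    · rfl
    · rw [add_comm]; rfl
  rw [e, hadRight, hadLeft, smul_mul_smul_comm, mul_add, had_cross h, add_zero, mul_add, add_mul,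
    add_mul, hadX_mul_self, hadZ_mul_self, (hadX_commute_hadZ h j).eq]
  module

/-- The basis state that a Toffoli gate makes of `x`. -/
def tofBits (u₁ u₂ u₃ : q) (x : q → Bool) : q → Bool :=
  update x u₃ (xor (x u₃) (x u₁ && x u₂))

theorem tofBits_tofBits {u₁ u₂ u₃ : q} (h₁₃ : u₁ ≠ u₃) (h₂₃ : u₂ ≠ u₃) (x : q → Bool) :
    tofBits u₁ u₂ u₃ (tofBits u₁ u₂ u₃ x) = x := by
  funext u
  by_cases hu : u = u₃
  · subst hu
    simp [tofBits, update_of_ne h₁₃, update_of_ne h₂₃]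
  · simp [tofBits, update_of_ne hu]

theorem tof_op_apply {u₁ u₂ u₃ : q} (h₁₂ : u₁ ≠ u₂) (h₁₃ : u₁ ≠ u₃) (h₂₃ : u₂ ≠ u₃)
    (x y : q → Bool) : (Gate.tof u₁ u₂ u₃ h₁₂ h₁₃ h₂₃).op x y =
      if tofBits u₁ u₂ u₃ x = y then 1 else 0 := by
  have hinv : (x = tofBits u₁ u₂ u₃ y) ↔ tofBits u₁ u₂ u₃ x = y := by
    constructor <;> intro h
    · rw [h, tofBits_tofBits h₁₃ h₂₃]
    · rw [← h, tofBits_tofBits h₁₃ h₂₃]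
  rw [Gate.op, of_apply]
  exact if_congr hinv rfl rfl

theorem tof_mulVec {u₁ u₂ u₃ : q} (h₁₂ : u₁ ≠ u₂) (h₁₃ : u₁ ≠ u₃) (h₂₃ : u₂ ≠ u₃)
    (v : (q → Bool) → ℂ) (x : q → Bool) :
    ((Gate.tof u₁ u₂ u₃ h₁₂ h₁₃ h₂₃).op *ᵥ v) x = v (tofBits u₁ u₂ u₃ x) := by
  simp [mulVec, dotProduct, tof_op_apply]

theorem tof_isRefl {u₁ u₂ u₃ : q} (h₁₂ : u₁ ≠ u₂) (h₁₃ : u₁ ≠ u₃) (h₂₃ : u₂ ≠ u₃) :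
    IsRefl (Gate.tof u₁ u₂ u₃ h₁₂ h₁₃ h₂₃).op := by
  constructor
  · ext x y
    rw [conjTranspose_apply, tof_op_apply, Gate.op, of_apply]
    change star _ = if x = tofBits u₁ u₂ u₃ y then (1 : ℂ) else 0
    by_cases h : x = tofBits u₁ u₂ u₃ y
    · rw [if_pos h, if_pos h.symm, star_one]
    · rw [if_neg h, if_neg (Ne.symm h), star_zero]
  · refine mulVec_ext fun v x => ?_
    rw [← mulVec_mulVec, tof_mulVec, tof_mulVec, tofBits_tofBits h₁₃ h₂₃, one_mulVec]

theorem tof_op_eq {u₁ u₂ u₃ : q} (h₁₂ : u₁ ≠ u₂) (h₁₃ : u₁ ≠ u₃) (h₂₃ : u₂ ≠ u₃) :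
    (Gate.tof u₁ u₂ u₃ h₁₂ h₁₃ h₂₃).op = 1 - prj true (pauliOp (single u₁ .Z)) *
      prj true (pauliOp (single u₂ .Z)) * (1 - pauliOp (single u₃ .X)) := by
  have hX : ∀ (v : (q → Bool) → ℂ) x, (pauliOp (single u₃ .X) *ᵥ v) x =
      v (update x u₃ (!x u₃)) := by
    intro v x
    have : pauliOp (single u₃ .X) = flipOp fun u => decide (u = u₃) := by
      rw [flipOp]; congr 1; funext u; simp [single]
    rw [this, flipOp_mulVec]
    congr 1
    funext u
    by_cases h : u = u₃
    · subst h; simp [flipBits]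
    · simp [flipBits, h]
  refine mulVec_ext fun v x => ?_
  rw [single_Z_eq_diagonal, single_Z_eq_diagonal, prj_diagonal, prj_diagonal, sub_mulVec,
    one_mulVec, Pi.sub_apply, proj_mul, ← mulVec_mulVec, proj, mulVec_diagonal, sub_mulVec,
    one_mulVec, Pi.sub_apply, hX, tof_mulVec, tofBits]
  by_cases h : x u₁ = true ∧ x u₂ = true
  · rw [indic_pos h, h.1, h.2]; simp
  · rw [indic_neg h]
    have : (x u₁ && x u₂) = false := by
      rw [Bool.eq_false_iff]; simpa using h
    rw [this]; simp

end Gates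

namespace Step

variable {qV r qM : ℕ}

/-- The operator of a step. -/
def op : Step qV r qM → Mat (Wire qV r qM → Bool)
  | .hadV j₁ j₂ _ => hadOp (.inl j₁) (.inl j₂)
  | .hadM i j₁ j₂ _ => hadOp (.inr (i, j₁)) (.inr (i, j₂))
  | .tof u₁ u₂ u₃ h₁₂ h₁₃ h₂₃ => (Gate.tof u₁ u₂ u₃ h₁₂ h₁₃ h₂₃).op

/-- The `j`-th check of the step compares `left j` before the step with `right j` after it. -/
def left : Step qV r qM → Bool → Mat (Wire qV r qM → Bool)
  | .hadV j₁ j₂ _, j => hadLeft (.inl j₁) (.inl j₂) j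
  | .hadM i j₁ j₂ _, j => hadLeft (.inr (i, j₁)) (.inr (i, j₂)) j
  | .tof _ _ _ _ _ _, j => if j then 0 else (1 / 2 : ℂ) • 1

/-- The `j`-th check of the step compares `left j` before the step with `right j` after it. -/
def right : Step qV r qM → Bool → Mat (Wire qV r qM → Bool)
  | .hadV j₁ j₂ _, j => hadRight (.inl j₁) (.inl j₂) j
  | .hadM i j₁ j₂ _, j => hadRight (.inr (i, j₁)) (.inr (i, j₂)) j
  | .tof u₁ u₂ u₃ _ _ _, j => if j then 0 else (1 / 2 : ℂ) • (1 -
      prj true (pauliOp (single u₁ .Z)) * prj true (pauliOp (single u₂ .Z)) *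
        (1 - pauliOp (single u₃ .X)))

theorem op_isRefl (s : Step qV r qM) : IsRefl s.op := by
  cases s with
  | hadV j₁ j₂ h => exact hadOp_isRefl (by simpa using h)
  | hadM i j₁ j₂ h => exact hadOp_isRefl (by simpa using h)
  | tof u₁ u₂ u₃ h₁₂ h₁₃ h₂₃ => exact tof_isRefl h₁₂ h₁₃ h₂₃

theorem right_mul_op (s : Step qV r qM) (j : Bool) : s.right j * s.op = s.left j := by
  cases s with
  | hadV j₁ j₂ h => exact hadRight_mul_hadOp (by simpa using h) j
  | hadM i j₁ j₂ h => exact hadRight_mul_hadOp (by simpa using h) j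
  | tof u₁ u₂ u₃ h₁₂ h₁₃ h₂₃ =>
    cases j
    · simp only [right, left, op, Bool.false_eq_true, if_false]
      rw [← tof_op_eq h₁₂ h₁₃ h₂₃, smul_mul_assoc, (tof_isRefl h₁₂ h₁₃ h₂₃).mul_self]
    · simp [right, left]

theorem left_sum (s : Step qV r qM) : s.left false + s.left true = (1 / 2 : ℂ) • 1 := by
  have hh : ∀ {u₁ u₂ : Wire qV r qM}, u₁ ≠ u₂ →
      hadLeft u₁ u₂ false + hadLeft u₁ u₂ true = (1 / 2 : ℂ) • 1 := by
    intro u₁ u₂ h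
    rw [hadLeft, hadLeft, hadX_mul_hadZ h]
    module
  cases s with
  | hadV j₁ j₂ h => exact hh (by simpa using h)
  | hadM i j₁ j₂ h => exact hh (by simpa using h)
  | tof u₁ u₂ u₃ h₁₂ h₁₃ h₂₃ => simp [left]

theorem right_sum (s : Step qV r qM) : s.right false + s.right true = (1 / 2 : ℂ) • s.op := by
  have h := s.left_sum
  rw [← s.right_mul_op, ← s.right_mul_op, ← add_mul] at h
  have := congrArg (· * s.op) h
  simp only [mul_assoc, s.op_isRefl.mul_self, mul_one, smul_mul_assoc, one_mul] at this
  exact this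

end Step

namespace NormalVerifier

variable {r : ℕ} (W : NormalVerifier r) (k : ℕ) {H : Fin r → Type} [∀ i, Fintype (H i)]
  [∀ i, DecidableEq (H i)] (M : W.Obs H)

/-! ### The checks of the game for honest players -/

/-- The observable of player `i` in the check of a pair of Hadamard gates, for the first operator. -/
def playerX (i : Fin r) (j₁ j₂ : Fin W.qM) (j : Bool) : Mat (W.Space k H) :=
  W.playerObs k M i (.multi {pair j₁.succ .X j₂.succ (if j then .Z else .X),
    pair j₁.succ .Z j₂.succ (if j then .X else .Z)}) (pair j₁.succ .X j₂.succ (if j then .Z else .X))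

/-- The observable of player `i` in the check of a pair of Hadamard gates, for the second
operator. -/
def playerZ (i : Fin r) (j₁ j₂ : Fin W.qM) (j : Bool) : Mat (W.Space k H) :=
  W.playerObs k M i (.multi {pair j₁.succ .X j₂.succ (if j then .Z else .X),
    pair j₁.succ .Z j₂.succ (if j then .X else .Z)}) (pair j₁.succ .Z j₂.succ (if j then .X else .Z))

/-- The operator that stands for `s.left j` in the game. -/
def stepLeft : Step W.qV r W.qM → Bool → Mat (W.Space k H)
  | .hadV j₁ j₂ _, j => (1 / 4 : ℂ) • (1 + W.onRef k (hadX (.V j₁) (.V j₂) j) *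
      W.onRef k (hadZ (.V j₁) (.V j₂) j))
  | .hadM i j₁ j₂ _, j => (1 / 4 : ℂ) • (1 + W.playerX k M i j₁ j₂ j * W.playerZ k M i j₁ j₂ j)
  | .tof _ _ _ _ _ _, j => if j then 0 else (1 / 2 : ℂ) • 1

/-- The operators that are measured in the check of a Toffoli gate. -/
def tofList (u₁ u₂ u₃ : Wire W.qV r W.qM) : List (PauliLabel × Wire W.qV r W.qM) :=
  [(.Z, u₁), (.Z, u₂), (.X, u₃)]

/-- The operator that stands for `s.right j` in the game. -/
def stepRight : Step W.qV r W.qM → Bool → Mat (W.Space k H)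
  | .hadV j₁ j₂ _, j => (1 / 4 : ℂ) • (W.onRef k (hadX (.V j₁) (.V j₂) j) +
      W.onRef k (hadZ (.V j₁) (.V j₂) j))
  | .hadM i j₁ j₂ _, j => (1 / 4 : ℂ) • (W.playerX k M i j₁ j₂ j + W.playerZ k M i j₁ j₂ j)
  | .tof u₁ u₂ u₃ _ _ _, j => if j then 0 else (1 / 2 : ℂ) • (1 -
      prj true (W.wireObs k M (W.tofList u₁ u₂ u₃) .Z u₁) *
      prj true (W.wireObs k M (W.tofList u₁ u₂ u₃) .Z u₂) *
        (1 - W.wireObs k M (W.tofList u₁ u₂ u₃) .X u₃))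

/-- The time of a step. -/
def time (b : Bool) (l : Fin W.L) : ℕ := if b then W.L + 2 + l else 1 + l

theorem time_bounds (b : Bool) (l : Fin W.L) : 1 ≤ W.time b l ∧ W.time b l ≤ W.T := by
  have := l.2
  unfold time T
  split_ifs <;> omega

/-- The checks of the game for honest players, except the one of the qubits `B_i`, are passed with
amplitude at least `1 - δ`. -/
structure HonestChecks (φ : W.Space k H → ℂ) (δ : ℝ) : Prop where
  clock : ∀ t : Fin (W.T - 1), nrm (W.onRef k (prj false (clockOp C .Z (t + 1)) *
    prj true (clockOp C .Z (t + 2))) *ᵥ φ) ≤ δ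
  step : ∀ b l j, nrm (edgeTest C (W.time b l - 1) (W.time b l)
    (W.stepLeft k M (W.step b l) j) (W.stepRight k M (W.step b l) j) *ᵥ φ) ≤ δ
  prover : nrm (edgeTest C W.L (W.L + 1) ((1 / 2 : ℂ) • 1) ((1 / 2 : ℂ) • W.xapOp k M)
    *ᵥ φ) ≤ δ
  start : ∀ j, nrm ((W.onRef k (prj false (clockOp C .Z 1)) *
    prj true (W.refPauli k (.V j) .Z)) *ᵥ φ) ≤ δ
  output : nrm ((W.onRef k (prj true (clockOp C .Z W.T)) *
    prj false (W.refPauli k (.V ⟨0, W.qV_pos⟩) .Z)) *ᵥ φ) ≤ δ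

variable {M}

theorem stepCheck_eq_mix (hM : ProjMeas M) {t : ℕ} (ht : 1 ≤ t ∧ t ≤ W.T)
    (s : Step W.qV r W.qM) : ∃ G : Bool → W.Game k, W.stepCheck k t s = ExtGame.mix G ∧
      ∀ j φ, (G j).rej M φ = nrm (edgeTest C (t - 1) t (W.stepLeft k M s j)
        (W.stepRight k M s j) *ᵥ φ) ^ 2 := by
  cases s with
  | hadV j₁ j₂ h => exact ⟨_, rfl, fun j φ => W.rej_leaf_hadV k hM ht h j φ⟩
  | hadM i j₁ j₂ h => exact ⟨_, rfl, fun j φ => W.rej_leaf_hadM k hM ht i _ _ φ⟩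
  | tof u₁ u₂ u₃ h₁₂ h₁₃ h₂₃ =>
    refine ⟨_, rfl, fun j φ => ?_⟩
    cases j
    · exact W.rej_leaf_tof k hM ht h₁₂ h₁₃ h₂₃ _ φ
    · refine (ExtGame.rej_accepting _ hM φ).trans ?_
      simp [edgeTest, stepLeft, stepRight, nrm_zero]

/-- A bound on the number of possibilities in each random choice of the referee. -/
def gameSize : ℕ := W.N k + W.T + W.qV + r * (W.m * 2) +
  2 * (r * W.m) * ((seqQ k r W.m).length * (constraints k r W.m).length) + 1

theorem nrm_le_sqrt {J : Type} [Fintype J] {v : J → ℂ} {a ρ K : ℝ} (h : nrm v ^ 2 ≤ a * ρ)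
    (ha : a ≤ K) (hρ : 0 ≤ ρ) : nrm v ≤ Real.sqrt (K * ρ) :=
  Real.le_sqrt_of_sq_le (h.trans (mul_le_mul_of_nonneg_right ha hρ))

theorem le_card_mul_rej (hM : ProjMeas M) (φ : W.Space k H → ℂ) {ι : Type}
    [Fintype ι] {G : W.Game k} {F : ι → W.Game k} (hG : G = ExtGame.mix F) (j : ι) {a : ℝ}
    (hj : (F j).rej M φ = a) : a ≤ Fintype.card ι * G.rej M φ := by
  rw [hG, ← hj]
  exact ExtGame.rej_le_mix F M hM φ j

theorem propChecks_of_rej (hM : ProjMeas M) (φ : W.Space k H → ℂ) :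
    W.PropChecks k M φ (Real.sqrt (60 * W.gameSize k * (W.extendedGame k).rej M φ)) := by
  set ρ := (W.extendedGame k).rej M φ with hρdef
  have hρ : 0 ≤ ρ := (W.extendedGame k).rej_nonneg M hM φ
  have h0 : (W.clockCheck k).rej M φ ≤ 3 * ρ := by
    simpa using W.le_card_mul_rej k hM φ (G := W.extendedGame k) (ι := Fin 3) rfl 0 rfl
  have h1 : (W.consPropGame k).rej M φ ≤ 3 * ρ := by
    simpa using W.le_card_mul_rej k hM φ (G := W.extendedGame k) (ι := Fin 3) rfl 1 rfl
  have c0 : (W.propCheck k).rej M φ ≤ 3 * (W.consPropGame k).rej M φ := by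
    simpa using W.le_card_mul_rej k hM φ (G := W.consPropGame k) (ι := Fin 3) rfl 0 rfl
  have c1 : (W.initCheck k).rej M φ ≤ 3 * (W.consPropGame k).rej M φ := by
    simpa using W.le_card_mul_rej k hM φ (G := W.consPropGame k) (ι := Fin 3) rfl 1 rfl
  have c2 : (W.consCheck k).rej M φ ≤ 3 * (W.consPropGame k).rej M φ := by
    simpa using W.le_card_mul_rej k hM φ (G := W.consPropGame k) (ι := Fin 3) rfl 2 rfl
  have bound : ∀ {n : ℕ} {a b : ℝ}, n ≤ W.gameSize k → a ≤ n * b → b ≤ 9 * ρ →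
      a ≤ (9 * n) * ρ := by
    intro n a b _ h1 h2
    have : (0 : ℝ) ≤ n := by positivity
    nlinarith
  have size : ∀ {n : ℕ}, n ≤ W.gameSize k → (9 * n : ℝ) ≤ 60 * W.gameSize k := by
    intro n hn
    have : (n : ℝ) ≤ W.gameSize k := by exact_mod_cast hn
    nlinarith [(by positivity : (0 : ℝ) ≤ W.gameSize k)]
  refine ⟨fun t => ?_, fun t => ?_, fun c => ?_, fun p => ?_⟩
  · have := W.le_card_mul_rej k hM φ (G := W.clockCheck k) rfl t (W.rej_leaf_clock k hM (t : ℕ) φ)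
    rw [Fintype.card_fin] at this
    have hn : W.N k - 1 ≤ W.gameSize k := by unfold gameSize; omega
    exact nrm_le_sqrt (bound hn this (h0.trans (by linarith))) (size hn) hρ
  · have := W.le_card_mul_rej k hM φ (G := W.propCheck k) rfl t (W.rej_reflCheck k hM (t := t) t.2 _ φ)
    rw [Fintype.card_fin] at this
    have hn : W.N k ≤ W.gameSize k := by unfold gameSize; omega
    exact nrm_le_sqrt (bound hn this (c0.trans (by linarith))) (size hn) hρ
  · have := W.le_card_mul_rej k hM φ (G := W.initCheck k) rfl c (W.rej_leaf_init k hM c φ)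
    have hn : Fintype.card (Ctrl r W.m) ≤ W.gameSize k := by
      simp only [Fintype.card_prod, Fintype.card_fin, Fintype.card_bool]
      unfold gameSize; omega
    exact nrm_le_sqrt (bound hn this (c1.trans (by linarith))) (size hn) hρ
  · have hv : consVertex k r W.m p.1 p.2.1 p.2.2 ≤ consVertex k r W.m p.1 p.2.1 (p.2.2 + 1) := by
      rw [consVertex_succ _ _ _ p.2.2.2]; omega
    have := W.le_card_mul_rej k hM φ (G := W.consCheck k) rfl p (W.rej_leaf_cons k hM hv
      (consVertex_le k r W.m p.1.2 p.2.1.2) _ φ)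
    have hn : Fintype.card (Fin (2 * (r * W.m)) × Fin (seqQ k r W.m).length ×
        Fin (constraints k r W.m).length) ≤ W.gameSize k := by
      simp only [Fintype.card_prod, Fintype.card_fin]
      unfold gameSize; omega
    exact nrm_le_sqrt (bound hn this (c2.trans (by linarith))) (size hn) hρ

theorem honestChecks_of_rej (hM : ProjMeas M) (φ : W.Space k H → ℂ) :
    W.HonestChecks k M (W.onRef k (prj false (clockOp S .Z 1)) *ᵥ φ)
      (Real.sqrt (60 * W.gameSize k * (W.extendedGame k).rej M φ)) := by
  set ρ := (W.extendedGame k).rej M φ with hρdef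
  have hρ : 0 ≤ ρ := (W.extendedGame k).rej_nonneg M hM φ
  have h2 : (W.outputCheck k).rej M φ ≤ 3 * ρ := by
    simpa using W.le_card_mul_rej k hM φ (G := W.extendedGame k) (ι := Fin 3) rfl 2 rfl
  rw [outputCheck, ExtGame.rej_guarded, sMeas, clockMeas_K] at h2
  set ψ := W.onRef k (prj false (clockOp S .Z 1)) *ᵥ φ
  have c0 : (W.honestClock k).rej M ψ ≤ 5 * (W.honestGame k).rej M ψ := by
    simpa using W.le_card_mul_rej k hM ψ (G := W.honestGame k) (ι := Fin 5) rfl 0 rfl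
  have c1 : (W.verifierProp k).rej M ψ ≤ 5 * (W.honestGame k).rej M ψ := by
    simpa using W.le_card_mul_rej k hM ψ (G := W.honestGame k) (ι := Fin 5) rfl 1 rfl
  have c2 : (W.proverProp k).rej M ψ ≤ 5 * (W.honestGame k).rej M ψ := by
    simpa using W.le_card_mul_rej k hM ψ (G := W.honestGame k) (ι := Fin 5) rfl 2 rfl
  have c3 : (W.honestInit k).rej M ψ ≤ 5 * (W.honestGame k).rej M ψ := by
    simpa using W.le_card_mul_rej k hM ψ (G := W.honestGame k) (ι := Fin 5) rfl 3 rfl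
  have c4 : (W.honestOutput k).rej M ψ ≤ 5 * (W.honestGame k).rej M ψ := by
    simpa using W.le_card_mul_rej k hM ψ (G := W.honestGame k) (ι := Fin 5) rfl 4 rfl
  have bound : ∀ {n : ℕ} {a b : ℝ}, n ≤ W.gameSize k → a ≤ n * b → b ≤ 60 * ρ →
      a ≤ (60 * n) * ρ := by
    intro n a b _ h1 h2
    have : (0 : ℝ) ≤ n := by positivity
    nlinarith
  have size : ∀ {n : ℕ}, n ≤ W.gameSize k → (60 * n : ℝ) ≤ 60 * W.gameSize k := by
    intro n hn
    have : (n : ℝ) ≤ W.gameSize k := by exact_mod_cast hn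
    linarith
  refine ⟨fun t => ?_, fun b l j => ?_, ?_, fun j => ?_, ?_⟩
  · have e := W.le_card_mul_rej k hM ψ (G := W.honestClock k) rfl false rfl
    simp only [Bool.false_eq_true, if_false] at e
    have d := W.le_card_mul_rej k hM ψ (F := fun t : Fin (W.T - 1) =>
      ExtGame.leaf askNone ((W.cMeas k .Z (t + 1)).seq (W.cMeas k .Z (t + 2)))
        fun _ o => ¬ (o.1 = false ∧ o.2 = true)) rfl t (W.rej_leaf_clock k hM (t : ℕ) ψ)
    rw [Fintype.card_fin] at d
    rw [Fintype.card_bool] at e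
    have hn : W.T - 1 ≤ W.gameSize k := by unfold gameSize; omega
    exact nrm_le_sqrt (bound hn d (e.trans (by push_cast; linarith))) (size hn) hρ
  · obtain ⟨G, hG, hrej⟩ := W.stepCheck_eq_mix k hM (W.time_bounds b l) (W.step b l)
    have d := W.le_card_mul_rej k hM ψ hG j (hrej j ψ)
    rw [Fintype.card_bool] at d
    have e := W.le_card_mul_rej k hM ψ (G := W.verifierProp k) rfl (b, l)
      (a := (W.stepCheck k (W.time b l) (W.step b l)).rej M ψ) rfl
    have hn : Fintype.card (Bool × Fin W.L) ≤ W.gameSize k := by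
      simp only [Fintype.card_prod, Fintype.card_fin, Fintype.card_bool]
      unfold gameSize T; omega
    have : (0 : ℝ) ≤ Fintype.card (Bool × Fin W.L) := by positivity
    refine nrm_le_sqrt (bound hn (b := 2 * (W.verifierProp k).rej M ψ) ?_ (by linarith)) (size hn) hρ
    push_cast at d
    linarith
  · have d := W.rej_proverProp k hM ψ
    have hn : 1 ≤ W.gameSize k := by unfold gameSize; omega
    exact nrm_le_sqrt (bound hn (b := (W.proverProp k).rej M ψ) (by rw [d]; simp) (by linarith))
      (size hn) hρ
  · have d := W.le_card_mul_rej k hM ψ (G := W.honestInit k) rfl j (W.rej_leaf_honestInit k hM j ψ)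
    rw [Fintype.card_fin] at d
    have hn : W.qV ≤ W.gameSize k := by unfold gameSize; omega
    exact nrm_le_sqrt (bound hn d (c3.trans (by linarith))) (size hn) hρ
  · have d := W.rej_honestOutput k hM ψ
    have hn : 1 ≤ W.gameSize k := by unfold gameSize; omega
    exact nrm_le_sqrt (bound hn (b := (W.honestOutput k).rej M ψ) (by rw [d]; simp) (by linarith))
      (size hn) hρ

end NormalVerifier

namespace NormalVerifier

variable {r : ℕ} (W : NormalVerifier r) (k : ℕ) {H : Fin r → Type} [∀ i, Fintype (H i)]
  [∀ i, DecidableEq (H i)] {M : W.Obs H}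

/-! ### Operators of the checks and the clock registers -/

theorem onRef_pair {j₁ j₂ : Fin W.qV} (h : j₁ ≠ j₂) (D E : PauliLabel) :
    (W.onRef k (pauliOp (pair (.V j₁) D (.V j₂) E)) : Mat (W.Space k H)) =
      W.refPauli k (.V j₁) D * W.refPauli k (.V j₂) E := by
  rw [onRef, pauliOp_pair (by simpa using h), map_mul, refPauli, refPauli, pauliOp_single,
    pauliOp_single]

theorem outer_refPauli (j : Fin W.qV) (D : PauliLabel) :
    W.Outer k (W.refPauli k (.V j) D : Mat (W.Space k H)) :=
  ⟨(W.refPauli_isRefl k _ _).ctr, fun _ hA => by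
    rw [refPauli, pauliOp_single]; exact W.V_commute_localOps k j _ hA⟩

theorem slice_commute_refPauli {n : ℕ} {e : Fin n → W.Ref k} (he : ∀ j j', e j ≠ .V j') (t : ℕ)
    (j : Fin W.qV) (D : PauliLabel) :
    Commute (W.onRef k (atTime e 0 * shift e t) : Mat (W.Space k H))
      (W.refPauli k (.V j) D) := by
  rw [refPauli, pauliOp_single]
  exact ((atTime_commute_coord (fun i => he i j) 0 _).mul_left
    (shift_commute_coord (fun i => he i j) t _)).map _

theorem onRef_commute_playerObs (A : Mat (W.Ref k → Bool)) (i : Fin r) (g : Question W.m)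
    (P : Pauli W.m) : Commute (W.onRef k A) (W.playerObs k M i g P) :=
  op_commute (Lens.fst_indep_snd.comp_right _) _ _

theorem commute_pair {A : Mat (W.Ref k → Bool)}
    (hA : ∀ j D, Commute (W.onRef k A : Mat (W.Space k H)) (W.refPauli k (.V j) D))
    {j₁ j₂ : Fin W.qV} (h : j₁ ≠ j₂) (D E : PauliLabel) :
    Commute (W.onRef k A : Mat (W.Space k H)) (W.onRef k (pauliOp (pair (.V j₁) D (.V j₂) E))) := by
  rw [W.onRef_pair k h]
  exact (hA _ _).mul_right (hA _ _)

theorem commute_stepLeft {A : Mat (W.Ref k → Bool)}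
    (hA : ∀ j D, Commute (W.onRef k A : Mat (W.Space k H)) (W.refPauli k (.V j) D))
    (s : Step W.qV r W.qM) (j : Bool) : Commute (W.onRef k A) (W.stepLeft k M s j) := by
  cases s with
  | hadV j₁ j₂ h =>
    exact ((Commute.one_right _).add_right ((W.commute_pair k hA h _ _).mul_right
      (W.commute_pair k hA h _ _))).smul_right _
  | hadM i j₁ j₂ h =>
    exact ((Commute.one_right _).add_right ((W.onRef_commute_playerObs k A i _ _).mul_right
      (W.onRef_commute_playerObs k A i _ _))).smul_right _
  | tof u₁ u₂ u₃ h₁₂ h₁₃ h₂₃ =>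
    cases j
    · exact (Commute.one_right _).smul_right _
    · exact Commute.zero_right _

theorem commute_stepRight {A : Mat (W.Ref k → Bool)}
    (hA : ∀ j D, Commute (W.onRef k A : Mat (W.Space k H)) (W.refPauli k (.V j) D))
    (s : Step W.qV r W.qM) (j : Bool) : Commute (W.onRef k A) (W.stepRight k M s j) := by
  cases s with
  | hadV j₁ j₂ h =>
    exact ((W.commute_pair k hA h _ _).add_right (W.commute_pair k hA h _ _)).smul_right _
  | hadM i j₁ j₂ h =>
    exact ((W.onRef_commute_playerObs k A i _ _).add_right
      (W.onRef_commute_playerObs k A i _ _)).smul_right _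
  | tof u₁ u₂ u₃ h₁₂ h₁₃ h₂₃ =>
    have h : ∀ D u, Commute (W.wireObs k M (W.tofList u₁ u₂ u₃) D u) (W.onRef k A) := by
      rintro D (j | ⟨i, j⟩)
      exacts [(hA j D).symm, (W.onRef_commute_playerObs k A i _ _).symm]
    cases j
    · exact (((Commute.one_left _).sub_left (((prj_commute (h _ _) _).mul_left
        (prj_commute (h _ _) _)).mul_left ((Commute.one_left _).sub_left (h _ _)))).smul_left _).symm
    · exact Commute.zero_right _

theorem S_commute_shift (t : ℕ) :
    Commute (atTime S 0 : Mat (W.Ref k → Bool))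
      (shift C t) := by
  refine (flipOp_commute_diagonal fun x => congrArg indic ?_).symm
  have : ∀ j, clockRange (C : Fin W.T → W.Ref k) 0 t (.S j) = false := fun j =>
    clockRange_of_notMem (by simp) _ _
  simp [flipBits, this]

theorem S_commute_edgeTest (t₁ t₂ : ℕ) {A B : Mat (W.Space k H)}
    (hA : Commute (W.onRef k (atTime S 0)) A)
    (hB : Commute (W.onRef k (atTime S 0)) B) :
    Commute (W.onRef k (atTime S 0)) (edgeTest C t₁ t₂ A B) :=
  ((proj_commute _ _).map _).mul_right (hA.sub_right
    ((((W.S_commute_shift k t₁).mul_right (W.S_commute_shift k t₂)).map _).mul_right hB))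

theorem nrm_mulVec_le_of_commute {J : Type} [Fintype J] [DecidableEq J] {A B : Mat J}
    (hA : Ctr A) (h : Commute A B) {v : J → ℂ} {ε : ℝ} (hv : nrm (B *ᵥ v) ≤ ε) :
    nrm (B *ᵥ (A *ᵥ v)) ≤ ε := by
  rw [mulVec_mulVec, ← h.eq, ← mulVec_mulVec]
  exact (hA _).trans hv

variable {k} in
/-- The checks can be restricted to the time `0` of the register `S`. -/
theorem HonestChecks.restrict {φ : W.Space k H → ℂ} {δ : ℝ}
    (h : W.HonestChecks k M (W.onRef k (prj false (clockOp S .Z 1)) *ᵥ φ) δ) :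
    W.HonestChecks k M (slice S φ 0) δ := by
  set A : Mat (W.Space k H) := W.onRef k (atTime S 0) with hAdef
  have hA : Ctr A := fst_op_ctr _
  have e : slice S φ 0 = A *ᵥ (W.onRef k (prj false (clockOp S .Z 1)) *ᵥ φ) := by
    rw [slice, shift_zero, mul_one, mulVec_mulVec, hAdef, onRef, onRef, ← map_mul]
    have h1 := clockProj_mul_atTime (e := (S : Fin (W.N k) → W.Ref k)) (t := 0) (t' := 1)
      (Nat.zero_le _) false
    have h2 : Commute (prj false (clockOp (S : Fin (W.N k) → W.Ref k) .Z 1))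
        (atTime S 0) := by
      rw [prj_clockOp_Z]; exact proj_commute _ _
    rw [← h2.eq, h1]
    simp
  have hP : ∀ j D, Commute A (W.refPauli k (.V j) D) := fun j D => by
    simpa [shift_zero] using W.slice_commute_refPauli k (e := S) (H := H) (by simp) 0 j D
  have hZ : ∀ b t, Commute A (W.onRef k (prj b (clockOp C .Z t))) := fun b t => by
    rw [prj_clockOp_Z]
    exact (proj_commute _ _).map _
  have hV : ∀ b j, Commute A (prj b (W.refPauli k (.V j) .Z)) := fun b j =>
    (prj_commute (hP j .Z).symm b).symm
  rw [e]
  refine ⟨fun t => nrm_mulVec_le_of_commute hA ?_ (h.clock t),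
    fun b l j => nrm_mulVec_le_of_commute hA (W.S_commute_edgeTest k _ _
      (W.commute_stepLeft k hP _ j) (W.commute_stepRight k hP _ j)) (h.step b l j),
    nrm_mulVec_le_of_commute hA (W.S_commute_edgeTest k _ _ ((Commute.one_right _).smul_right _)
      ((op_commute Lens.fst_indep_snd _ _).smul_right _)) h.prover,
    fun j => nrm_mulVec_le_of_commute hA ((hZ _ _).mul_right (hV _ _)) (h.start j),
    nrm_mulVec_le_of_commute hA ((hZ _ _).mul_right (hV _ _)) h.output⟩
  rw [onRef, map_mul]
  exact (hZ _ _).mul_right (hZ _ _)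

/-! ### Extraction of the operators in the game for honest players -/

/-- The qubits of the referee that take the place of the verifier's qubits. -/
def wireQubit : Wire W.qV r W.qM → W.Ref k
  | .inl j => .V j
  | .inr (i, j) => .X (i, j.succ, false)

theorem wireQubit_injective : Injective (W.wireQubit k) := by
  rintro (j | ⟨i, j⟩) (j' | ⟨i', j'⟩) h <;> simp_all [wireQubit]

/-- The qubits of the referee that take the place of the verifier's qubits. -/
def wireLens (H : Fin r → Type) : Lens (W.Space k H) (Wire W.qV r W.qM → Bool) :=
  fst.comp (Lens.sub (W.wireQubit_injective k))

theorem wireLens_coord (u : Wire W.qV r W.qM) (A : Mat Bool) :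
    (W.wireLens k H).op ((coord u).op A) =
      W.onRef k ((coord (W.wireQubit k u)).op A) := by
  rw [wireLens, op_comp, Lens.sub_op_coord]

theorem wireLens_single (u : Wire W.qV r W.qM) (D : PauliLabel) :
    (W.wireLens k H).op (pauliOp (single u D)) = W.refPauli k (W.wireQubit k u) D := by
  rw [pauliOp_single, wireLens_coord, refPauli, pauliOp_single]

theorem wireLens_pair {u v : Wire W.qV r W.qM} (h : u ≠ v) (D E : PauliLabel) :
    (W.wireLens k H).op (pauliOp (pair u D v E)) =
      W.refPauli k (W.wireQubit k u) D * W.refPauli k (W.wireQubit k v) E := by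
  rw [pauliOp_pair h, map_mul, ← pauliOp_single, ← pauliOp_single, wireLens_single, wireLens_single]

variable (M) in
/-- On the vectors that are obtained from `φ` at the time `0` of the register `S`, the extraction
of the players' qubits makes `P` of `R`. -/
def Carries (φ : W.Space k H → ℂ) (R P : Mat (W.Space k H)) (ε : ℝ) : Prop :=
  ∀ B, W.Outer k B → nrm (W.extractOp k M *ᵥ (R *ᵥ (B *ᵥ slice S φ 0)) -
    P *ᵥ (W.extractOp k M *ᵥ (B *ᵥ slice S φ 0))) ≤ ε

variable {W k}

theorem Transfers.carries {φ : W.Space k H → ℂ} {a : ℕ} {ε : ℝ}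
    {R P : Mat (W.Space k H)} (h : W.Transfers k M φ a R P ε) (ha : a ≤ k + 1) :
    W.Carries k M φ R P ε := by
  intro B hB
  have := h.extract [] B hB (by simpa using ha)
  rwa [wordVec, wordOp_nil, one_mulVec] at this

variable {φ : W.Space k H → ℂ}

theorem Carries.one : W.Carries k M φ 1 1 0 := fun B _ => by
  rw [one_mulVec, one_mulVec, sub_self, nrm_zero]

theorem Carries.zero : W.Carries k M φ 0 0 0 := fun B _ => by
  rw [zero_mulVec, mulVec_zero, zero_mulVec, sub_self, nrm_zero]

theorem Carries.add {R P R' P' : Mat (W.Space k H)} {ε ε' : ℝ}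
    (h : W.Carries k M φ R P ε) (h' : W.Carries k M φ R' P' ε') :
    W.Carries k M φ (R + R') (P + P') (ε + ε') := fun B hB => by
  rw [add_mulVec, mulVec_add, add_mulVec, add_sub_add_comm]
  exact (nrm_add_le _ _).trans (add_le_add (h B hB) (h' B hB))

theorem Carries.smul {R P : Mat (W.Space k H)} {ε : ℝ}
    (h : W.Carries k M φ R P ε) (c : ℂ) : W.Carries k M φ (c • R) (c • P) (‖c‖ * ε) := fun B hB => by
  rw [smul_mulVec, mulVec_smul, smul_mulVec, ← smul_sub, nrm_smul]
  exact mul_le_mul_of_nonneg_left (h B hB) (norm_nonneg _)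

theorem Carries.mono {R P : Mat (W.Space k H)} {ε ε' : ℝ}
    (h : W.Carries k M φ R P ε) (hε : ε ≤ ε') : W.Carries k M φ R P ε' := fun B hB =>
  (h B hB).trans hε

/-- The error up to which the operators that are measured in a check are extracted. -/
def obsError (W : NormalVerifier r) (k : ℕ) : ℝ := W.extError k + W.consError k

theorem obsError_nonneg (W : NormalVerifier r) (k : ℕ) : 0 ≤ W.obsError k :=
  add_nonneg (extError_nonneg W k) (consError_nonneg W k)

variable {δ : ℝ}

theorem mem_playerOps {i : Fin r} {l : List (PauliLabel × Wire W.qV r W.qM)} {P : Pauli W.m} :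
    P ∈ W.playerOps i l ↔ ∃ D j, (D, Sum.inr (i, j)) ∈ l ∧ P = W.onM D j := by
  rw [playerOps, List.mem_filterMap]
  constructor
  · rintro ⟨⟨D, j | ⟨i', j⟩⟩, hl, h⟩
    · simp at h
    · simp only at h
      split_ifs at h with hi
      subst hi
      rw [Option.some.injEq] at h
      exact ⟨D, j, hl, h.symm⟩
  · rintro ⟨D, j, hl, rfl⟩
    exact ⟨_, hl, by simp⟩

theorem playerOps_mem_powerSet (hk : 3 ≤ k) {u₁ u₂ u₃ : Wire W.qV r W.qM} (h₁₂ : u₁ ≠ u₂)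
    (h₁₃ : u₁ ≠ u₃) (h₂₃ : u₂ ≠ u₃) {i : Fin r} {P : Pauli W.m}
    (hP : P ∈ W.playerOps i (W.tofList u₁ u₂ u₃)) :
    (W.playerOps i (W.tofList u₁ u₂ u₃)).toFinset ∈ powerSet W.m k := by
  have huniq : ∀ {D D' : PauliLabel} {v : Wire W.qV r W.qM}, (D, v) ∈ W.tofList u₁ u₂ u₃ →
      (D', v) ∈ W.tofList u₁ u₂ u₃ → D = D' := by
    intro D D' v hv hv'
    simp only [tofList, List.mem_cons, Prod.mk.injEq, List.not_mem_nil, or_false] at hv hv'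
    rcases hv with ⟨rfl, rfl⟩ | ⟨rfl, rfl⟩ | ⟨rfl, rfl⟩ <;>
    rcases hv' with ⟨rfl, hv⟩ | ⟨rfl, hv⟩ | ⟨rfl, hv⟩ <;>
      first | rfl | exact absurd hv ‹_› | exact absurd hv.symm ‹_›
  refine singles_mem_powerSet ⟨_, List.mem_toFinset.2 hP⟩
    ((List.toFinset_card_le _).trans ((List.length_filterMap_le _ _).trans hk)) ?_ ?_
  · intro P hP P' hP' hne
    obtain ⟨D, v, hv, rfl⟩ := mem_playerOps.1 (List.mem_toFinset.1 hP)
    obtain ⟨D', v', hv', rfl⟩ := mem_playerOps.1 (List.mem_toFinset.1 hP')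
    refine ⟨v.succ, D, v'.succ, D', fun hvv => hne ?_, rfl, rfl⟩
    rw [Fin.succ_inj] at hvv
    subst hvv
    rw [huniq hv hv']
  · intro P hP
    obtain ⟨D, v, hv, rfl⟩ := mem_playerOps.1 (List.mem_toFinset.1 hP)
    exact ⟨_, _, rfl⟩

theorem transfers_wireObs (hk : 3 ≤ k) (hM : ProjMeas M)
    (h : W.PropChecks k M φ δ) (hδ : 0 ≤ δ) {u₁ u₂ u₃ : Wire W.qV r W.qM} (h₁₂ : u₁ ≠ u₂)
    (h₁₃ : u₁ ≠ u₃) (h₂₃ : u₂ ≠ u₃) {b : Bool} {u : Wire W.qV r W.qM}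
    (hu : (ctrlLabel b, u) ∈ W.tofList u₁ u₂ u₃) :
    W.Transfers k M φ 1 (W.wireObs k M (W.tofList u₁ u₂ u₃) (ctrlLabel b) u)
      (W.refPauli k (W.wireQubit k u) (ctrlLabel b)) (W.obsError k * δ) := by
  rcases u with j | ⟨i, j⟩
  · exact (Transfers.outer (W.outer_refPauli k _ _)).mono (by omega) (mul_nonneg (obsError_nonneg W k) hδ)
  · have hP : W.onM (ctrlLabel b) j ∈ W.playerOps i (W.tofList u₁ u₂ u₃) :=
      mem_playerOps.2 ⟨_, _, hu, rfl⟩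
    rw [wireObs]
    rcases askList_of_mem hP with he | he
    · rw [he]
      refine (transfers_gen hM h hδ (i, j.succ, b)).mono le_rfl ?_
      exact mul_le_mul_of_nonneg_right (le_add_of_nonneg_right (consError_nonneg W k)) hδ
    · rw [he]
      exact transfers_derived_single hM h hδ i (playerOps_mem_powerSet hk h₁₂ h₁₃ h₂₃ hP)
        (List.mem_toFinset.2 hP)

theorem carries_tof (hk : 3 ≤ k) (hM : ProjMeas M)
    (h : W.PropChecks k M φ δ) (hδ : 0 ≤ δ) {u₁ u₂ u₃ : Wire W.qV r W.qM} (h₁₂ : u₁ ≠ u₂)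
    (h₁₃ : u₁ ≠ u₃) (h₂₃ : u₂ ≠ u₃) :
    W.Carries k M φ ((1 / 2 : ℂ) • (1 -
      prj true (W.wireObs k M (W.tofList u₁ u₂ u₃) .Z u₁) *
      prj true (W.wireObs k M (W.tofList u₁ u₂ u₃) .Z u₂) *
        (1 - W.wireObs k M (W.tofList u₁ u₂ u₃) .X u₃)))
      ((1 / 2 : ℂ) • (1 - prj true (W.refPauli k (W.wireQubit k u₁) .Z) *
        prj true (W.refPauli k (W.wireQubit k u₂) .Z) * (1 - W.refPauli k (W.wireQubit k u₃) .X)))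
      (4 * (W.obsError k * δ)) := by
  have hE : 0 ≤ W.obsError k * δ := mul_nonneg (obsError_nonneg W k) hδ
  have t1 := transfers_wireObs hk hM h hδ h₁₂ h₁₃ h₂₃ (b := true) (u := u₁)
    (by simp [tofList, ctrlLabel])
  have t2 := transfers_wireObs hk hM h hδ h₁₂ h₁₃ h₂₃ (b := true) (u := u₂)
    (by simp [tofList, ctrlLabel])
  have t3 := transfers_wireObs hk hM h hδ h₁₂ h₁₃ h₂₃ (b := false) (u := u₃)
    (by simp [tofList, ctrlLabel])
  have t12 := t1.mul hM t2 hE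
  have t13 := t1.mul hM t3 hE
  have t23 := t2.mul hM t3 hE
  have t123 := t12.mul hM t3 hE
  have c1 := (t1.carries (by omega)).smul (1 / 8)
  have c2 := (t2.carries (by omega)).smul (1 / 8)
  have c3 := (t3.carries (by omega)).smul (1 / 8)
  have c12 := (t12.carries (by omega)).smul (-1 / 8)
  have c13 := (t13.carries (by omega)).smul (-1 / 8)
  have c23 := (t23.carries (by omega)).smul (-1 / 8)
  have c123 := (t123.carries (by omega)).smul (1 / 8)
  have c0 := (Carries.one (W := W) (k := k) (M := M) (φ := φ)).smul (3 / 8)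
  have := ((((((c0.add c1).add c2).add c3).add c12).add c13).add c23).add c123
  simp only [ctrlLabel, if_true, Bool.false_eq_true, if_false] at this
  have alg : ∀ a b c : Mat (W.Space k H), (1 / 2 : ℂ) • (1 - prj true a *
      prj true b * (1 - c)) = (3 / 8 : ℂ) • 1 + (1 / 8 : ℂ) • a + (1 / 8 : ℂ) • b + (1 / 8 : ℂ) • c +
      (-1 / 8 : ℂ) • (a * b) + (-1 / 8 : ℂ) • (a * c) + (-1 / 8 : ℂ) • (b * c) +
      (1 / 8 : ℂ) • (a * b * c) := by
    intro a b c
    simp only [prj, sgn_true, smul_mul_assoc, mul_smul_comm, mul_sub, mul_add, add_mul, one_mul,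
      mul_one, neg_smul, one_smul, neg_mul, mul_neg]
    module
  rw [alg, alg]
  refine this.mono ?_
  norm_num
  linarith

theorem carries_step (hk : 3 ≤ k) (hM : ProjMeas M)
    (h : W.PropChecks k M φ δ) (hδ : 0 ≤ δ) (s : Step W.qV r W.qM) (j : Bool) :
    W.Carries k M φ (W.stepLeft k M s j) ((W.wireLens k H).op (s.left j)) (4 * (W.obsError k * δ)) ∧
    W.Carries k M φ (W.stepRight k M s j) ((W.wireLens k H).op (s.right j))
      (4 * (W.obsError k * δ)) := by
  have hE : 0 ≤ W.obsError k * δ := mul_nonneg (obsError_nonneg W k) hδ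
  have key : ∀ {x z : Mat (W.Space k H)} {u₁ u₂ : Wire W.qV r W.qM} {a : ℕ},
      a ≤ 2 → W.Transfers k M φ a x ((W.wireLens k H).op (hadX u₁ u₂ j)) (4 * (W.obsError k * δ)) →
      W.Transfers k M φ a z ((W.wireLens k H).op (hadZ u₁ u₂ j)) (4 * (W.obsError k * δ)) →
      W.Carries k M φ ((1 / 4 : ℂ) • (1 + x * z)) ((W.wireLens k H).op (hadLeft u₁ u₂ j))
        (4 * (W.obsError k * δ)) ∧
      W.Carries k M φ ((1 / 4 : ℂ) • (x + z)) ((W.wireLens k H).op (hadRight u₁ u₂ j))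
        (4 * (W.obsError k * δ)) := by
    intro x z u₁ u₂ a ha hx hz
    have hxz := (hx.mul hM hz (by linarith)).carries (by omega)
    constructor
    · rw [hadLeft, map_smul, map_add, map_one, map_mul]
      refine ((Carries.one.add hxz).smul _).mono ?_
      norm_num
      linarith
    · rw [hadRight, map_smul, map_add]
      refine (((hx.carries (by omega)).add (hz.carries (by omega))).smul _).mono ?_
      norm_num
      linarith
  cases s with
  | hadV j₁ j₂ hj =>
    have ht : ∀ D E, W.Transfers k M φ 0 (W.onRef k (pauliOp (pair (RefQubit.V j₁) D (.V j₂) E)))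
        ((W.wireLens k H).op (pauliOp (pair (.inl j₁) D (.inl j₂) E))) (4 * (W.obsError k * δ)) := by
      intro D E
      rw [W.onRef_pair k hj, W.wireLens_pair k (by simpa using hj)]
      exact (Transfers.outer ((W.outer_refPauli k _ _).mul _ _ (W.outer_refPauli k _ _))).mono le_rfl (by linarith)
    exact key (by omega) (ht _ _) (ht _ _)
  | hadM i j₁ j₂ hj =>
    have hj' : j₁.succ ≠ j₂.succ := fun he => hj (Fin.succ_injective _ he)
    have hQ := pair_mem_powerSet (k := k) (by omega) hj' j
    have hb : ∀ D : PauliLabel, D ≠ .I → ∃ b, D = ctrlLabel b := by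
      intro D hD
      cases D
      · exact absurd rfl hD
      · exact ⟨false, rfl⟩
      · exact ⟨true, rfl⟩
    have ht : ∀ D E, D ≠ .I → E ≠ .I → pair j₁.succ D j₂.succ E ∈
        ({pair j₁.succ .X j₂.succ (if j then .Z else .X),
          pair j₁.succ .Z j₂.succ (if j then .X else .Z)} : Finset (Pauli W.m)) →
        W.Transfers k M φ 2 (W.playerObs k M i (.multi {pair j₁.succ .X j₂.succ (if j then .Z else .X),
          pair j₁.succ .Z j₂.succ (if j then .X else .Z)}) (pair j₁.succ D j₂.succ E))
        ((W.wireLens k H).op (pauliOp (pair (.inr (i, j₁)) D (.inr (i, j₂)) E)))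
        (4 * (W.obsError k * δ)) := by
      intro D E hD hE' hmem
      obtain ⟨b, rfl⟩ := hb D hD
      obtain ⟨b', rfl⟩ := hb E hE'
      rw [W.wireLens_pair k (by simpa using hj)]
      refine (transfers_derived_pair hM h hδ (by omega) i hQ hj' hmem).mono le_rfl ?_
      rw [← mul_assoc]
      refine mul_le_mul_of_nonneg_right ?_ hδ
      have := consError_nonneg W k
      rw [obsError]; linarith
    refine key le_rfl (ht _ _ (by simp) ?_ (by simp)) (ht _ _ (by simp) ?_ (by simp)) <;>
    cases j <;> simp
  | tof u₁ u₂ u₃ h₁₂ h₁₃ h₂₃ =>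
    cases j
    · constructor
      · simp only [stepLeft, Step.left, Bool.false_eq_true, if_false, map_smul, map_one]
        exact (Carries.one.smul _).mono (by simp; linarith)
      · simp only [stepRight, Step.right, Bool.false_eq_true, if_false, map_smul, map_one, map_sub,
          map_mul, map_prj, wireLens_single]
        exact carries_tof hk hM h hδ h₁₂ h₁₃ h₂₃
    · simp only [stepLeft, stepRight, Step.left, Step.right, if_true, map_zero]
      exact ⟨Carries.zero.mono (by linarith), Carries.zero.mono (by linarith)⟩

end NormalVerifier

namespace NormalVerifier

variable {r : ℕ} {W : NormalVerifier r} {k : ℕ} {H : Fin r → Type} [∀ i, Fintype (H i)]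
  [∀ i, DecidableEq (H i)] {M : W.Obs H}
  {φ : W.Space k H → ℂ} {δ : ℝ}

/-! ### The history of the verification -/

variable (M φ) in
/-- The component of `φ` at the time `t` of the register `C` (and the time `0` of `S`), after the
extraction of the players' qubits. -/
def hist (t : ℕ) : W.Space k H → ℂ :=
  W.extractOp k M *ᵥ slice C (slice S φ 0) t

theorem C_ne_V (j : Fin W.T) (j' : Fin W.qV) : (C j : W.Ref k) ≠ .V j' := by simp

/-- The error in one step of the history. -/
def stepError (W : NormalVerifier r) (k : ℕ) : ℝ := 4 + 32 * W.obsError k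

theorem stepError_nonneg (W : NormalVerifier r) (k : ℕ) : 0 ≤ W.stepError k := by
  have := obsError_nonneg W k
  unfold stepError; positivity

theorem nrm_hist_step (hk : 3 ≤ k) (hM : ProjMeas M)
    (h : W.PropChecks k M φ δ) (h' : W.HonestChecks k M (slice S φ 0) δ) (hδ : 0 ≤ δ)
    (b : Bool) (l : Fin W.L) :
    nrm (hist M φ (W.time b l - 1) - (W.wireLens k H).op (W.step b l).op *ᵥ hist M φ (W.time b l)) ≤
      W.stepError k * δ := by
  have ht := W.time_bounds b l
  set s := W.step b l
  set t := W.time b l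
  set U := W.extractOp k M
  set ψ := slice S φ 0
  have key : ∀ j, nrm ((W.wireLens k H).op (s.left j) *ᵥ hist M φ (t - 1) -
      (W.wireLens k H).op (s.right j) *ᵥ hist M φ t) ≤ δ + 8 * (W.obsError k * δ) := by
    intro j
    have h1 := (nrm_slice_sub_le (W.C_injective k) ψ (t₁ := t - 1) (by omega) ht.2
      (W.stepLeft k M s j) (W.stepRight k M s j)
      (fun t => W.commute_stepLeft k (W.slice_commute_refPauli k C_ne_V t) s j)
      (fun t => W.commute_stepRight k (W.slice_commute_refPauli k C_ne_V t) s j)).trans (h'.step b l j)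
    have h2 := ((W.extractOp_ctr k hM).sub_le _ _).trans h1
    have h3 := (carries_step hk hM h hδ s j).1 _ (W.outer_slice k (W.C_ne_X k) (t - 1))
    have h4 := (carries_step hk hM h hδ s j).2 _ (W.outer_slice k (W.C_ne_X k) t)
    rw [nrm_sub_comm] at h3
    change nrm (_ *ᵥ hist M φ (t - 1) - U *ᵥ (_ *ᵥ slice C ψ (t - 1))) ≤ _ at h3
    change nrm (U *ᵥ (_ *ᵥ slice C ψ t) - _ *ᵥ hist M φ t) ≤ _ at h4
    have h5 := (nrm_sub_trans _ _ _).trans (add_le_add h2 h4)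
    exact (nrm_sub_trans _ _ _).trans ((add_le_add h3 h5).trans (by linarith))
  have hsum := (nrm_add_le _ _).trans (add_le_add (key false) (key true))
  rw [sub_add_sub_comm, ← add_mulVec, ← add_mulVec, ← map_add, ← map_add, s.left_sum, s.right_sum,
    map_smul, map_smul, map_one, smul_mulVec, smul_mulVec, one_mulVec, ← smul_sub, W.nrm_half] at hsum
  rw [stepError]
  linarith

theorem nrm_hist_prover (hM : ProjMeas M)
    (h' : W.HonestChecks k M (slice S φ 0) δ) :
    nrm (hist M φ W.L - (W.extractOp k M * W.xapOp k M * (W.extractOp k M)ᴴ) *ᵥ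
      hist M φ (W.L + 1)) ≤ 2 * δ := by
  have h1 := (nrm_slice_sub_le (W.C_injective k) (slice S φ 0) (t₁ := W.L) (t₂ := W.L + 1)
      (by omega) (by unfold T; omega) ((1 / 2 : ℂ) • 1) ((1 / 2 : ℂ) • W.xapOp k M)
      (fun t => (Commute.one_right _).smul_right _)
      (fun t => (op_commute Lens.fst_indep_snd _ _).smul_right _)).trans h'.prover
  rw [smul_mulVec, smul_mulVec, one_mulVec, ← smul_sub, W.nrm_half] at h1
  have h2 := (W.extractOp_ctr k hM).sub_le (slice C (slice S φ 0) W.L)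
    (W.xapOp k M *ᵥ slice C (slice S φ 0) (W.L + 1))
  rw [hist, hist, mulVec_mulVec _ _ (W.extractOp k M), mul_assoc _ _ (W.extractOp k M),
    W.extractOp_isometry k hM, mul_one, ← mulVec_mulVec]
  linarith

theorem outer_prj_V (b : Bool) (j : Fin W.qV) :
    W.Outer k (prj b (W.refPauli k (.V j) .Z) : Mat (W.Space k H)) :=
  ⟨prj_ctr (W.refPauli_isRefl k _ _) b, fun A hA =>
    prj_commute ((W.outer_refPauli k j _).commute A hA) b⟩

theorem atTime_mul_prj {t t' : ℕ} (ht : t ≤ W.T) {c : Bool} (hc : decide (t' ≤ t) = c) :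
    (atTime C t : Mat (W.Ref k → Bool)) =
      atTime C t * prj c (clockOp C .Z t') := by
  have h1 := clockProj_mul_atTime (e := (C : Fin W.T → W.Ref k)) (t' := t') ht c
  rw [if_pos hc] at h1
  conv_lhs => rw [← h1]
  rw [prj_clockOp_Z]
  exact (proj_commute _ _).eq

theorem nrm_prj_slice_le {t t' : ℕ} (ht : t ≤ W.T) {b c : Bool} (hc : decide (t' ≤ t) = c)
    (j : Fin W.qV) (v : W.Space k H → ℂ) :
    nrm (prj b (W.refPauli k (.V j) .Z) *ᵥ slice C v t) ≤
      nrm ((W.onRef k (prj c (clockOp C .Z t')) * prj b (W.refPauli k (.V j) .Z)) *ᵥ v) := by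
  have hctr : Ctr (W.onRef k (atTime C t) : Mat (W.Space k H)) :=
    fst_op_ctr _
  have h1 := commute_mulVec (prj_commute (W.slice_commute_refPauli k C_ne_V t j .Z).symm b) v
  have h2 := nrm_slice (W.C_injective k) (prj b (W.refPauli k (.V j) .Z) *ᵥ v) t
  rw [slice] at h2 ⊢
  rw [h1, h2, atTime_mul_prj ht hc, map_mul, ← mulVec_mulVec, ← mulVec_mulVec]
  exact hctr _

theorem nrm_prj_hist_le (hM : ProjMeas M) {t t' : ℕ} (ht : t ≤ W.T) {b c : Bool}
    (hc : decide (t' ≤ t) = c) (j : Fin W.qV)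
    (h : nrm ((W.onRef k (prj c (clockOp C .Z t')) * prj b (W.refPauli k (.V j) .Z)) *ᵥ
      slice S φ 0) ≤ δ) :
    nrm (prj b (W.refPauli k (.V j) .Z) *ᵥ hist M φ t) ≤ δ := by
  rw [hist, commute_mulVec ((outer_prj_V b j).commute _ (W.extractOp_mem k M)),
    nrm_isometry (W.extractOp_isometry k hM)]
  exact (nrm_prj_slice_le ht hc j _).trans h

theorem nrm_prj_hist_zero (hM : ProjMeas M)
    (h' : W.HonestChecks k M (slice S φ 0) δ) (j : Fin W.qV) :
    nrm (prj true (W.refPauli k (.V j) .Z) *ᵥ hist M φ 0) ≤ δ :=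
  nrm_prj_hist_le hM (Nat.zero_le _) (by simp) j (h'.start j)

theorem nrm_prj_hist_last (hM : ProjMeas M)
    (h' : W.HonestChecks k M (slice S φ 0) δ) :
    nrm (prj false (W.refPauli k (.V ⟨0, W.qV_pos⟩) .Z) *ᵥ hist M φ W.T) ≤ δ :=
  nrm_prj_hist_le hM le_rfl (by simp) _ h'.output

theorem nrm_slice_zero_le (hM : ProjMeas M)
    (h' : W.HonestChecks k M (slice S φ 0) δ) (hδ : 0 ≤ δ) :
    nrm (slice S φ 0) ≤ ∑ t ∈ Finset.range (W.T + 1), nrm (hist M φ t) + W.T * δ := by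
  refine (nrm_le_sum_slice (W.C_injective k) _).trans (add_le_add (le_of_eq ?_) ?_)
  · refine sum_congr rfl fun t _ => ?_
    rw [hist, nrm_isometry (W.extractOp_isometry k hM)]
  · refine (sum_le_sum fun t _ => h'.clock t).trans ?_
    rw [Finset.sum_const, Finset.card_univ, Fintype.card_fin, nsmul_eq_mul]
    refine mul_le_mul_of_nonneg_right ?_ hδ
    exact_mod_cast Nat.sub_le _ _

theorem nrm_le_slice_zero (hM : ProjMeas M) (h : W.PropChecks k M φ δ)
    (hδ : 0 ≤ δ) : nrm φ ≤ (W.N k + 1) * (nrm (slice S φ 0) + 2 * W.N k * δ) + W.N k * δ := by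
  have hop := W.reflOp_isRefl k hM
  refine (nrm_le_sum_slice (W.S_injective k) φ).trans (add_le_add ?_ ?_)
  · have : ∀ t ∈ Finset.range (W.N k + 1), nrm (slice S φ t) ≤
        nrm (slice S φ 0) + 2 * W.N k * δ := by
      intro t ht
      have ht' : t ≤ W.N k := Nat.lt_succ_iff.1 (Finset.mem_range.1 ht)
      have h1 := nrm_sub_wordOp_le hop (l := seqU k r W.m) (f := slice S φ)
        (fun t ht => h.slice_succ W ht) t ht'
      have h2 := nrm_le_add_sub (slice S φ t)
        (wordOp (W.reflOp k M) ((seqU k r W.m).take t) *ᵥ slice S φ 0)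
      rw [nrm_isometry (wordOp_isometry hop _)] at h2
      have h3 : (t : ℝ) * (2 * δ) ≤ W.N k * (2 * δ) := by gcongr
      linarith
    refine (sum_le_sum this).trans ?_
    rw [Finset.sum_const, Finset.card_range, nsmul_eq_mul]
    push_cast
    exact le_rfl
  · refine (sum_le_sum fun t _ => h.clock t).trans ?_
    rw [Finset.sum_const, Finset.card_univ, Fintype.card_fin, nsmul_eq_mul]
    refine mul_le_mul_of_nonneg_right ?_ hδ
    exact_mod_cast Nat.sub_le _ _

end NormalVerifier

/-! ### The acceptance probability of provers -/

theorem Lens.op_isometry {J A : Type} [Fintype J] [DecidableEq J] [Fintype A] [DecidableEq A]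
    (L : Lens J A) {M : Mat A} (h : Mᴴ * M = 1) : (L.op M)ᴴ * L.op M = 1 := by
  rw [Lens.op_conjTranspose, ← map_mul, h, map_one]

theorem isometry_mul {J : Type} [Fintype J] [DecidableEq J] {A B : Mat J} (hA : Aᴴ * A = 1)
    (hB : Bᴴ * B = 1) : (A * B)ᴴ * (A * B) = 1 := by
  rw [conjTranspose_mul, mul_assoc, ← mul_assoc Aᴴ, hA, one_mul, hB]

theorem tensor_isometry {ι : Type} [Fintype ι] [DecidableEq ι] {d : ι → Type} [∀ i, Fintype (d i)]
    [∀ i, DecidableEq (d i)] {A : ∀ i, Mat (d i)} (h : ∀ i, (A i)ᴴ * A i = 1) :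
    (tensor A)ᴴ * tensor A = 1 := by
  rw [tensor_conjTranspose, tensor_mul]
  simp only [h]
  exact tensor_one

theorem Gate.op_isRefl {q : Type} [Fintype q] [DecidableEq q] (g : Gate q) : IsRefl g.op := by
  cases g with
  | had u => rw [had_op_eq]; exact coord_op_isRefl u hadamardMat_isRefl
  | tof u₁ u₂ u₃ h₁₂ h₁₃ h₂₃ => exact tof_isRefl h₁₂ h₁₃ h₂₃

theorem circuitOp_eq {q : Type} [Fintype q] [DecidableEq q] (c : List (Gate q)) :
    circuitOp c = wordOp Gate.op c := by
  have : ∀ (c : List (Gate q)) (U : Mat (q → Bool)),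
      c.foldl (fun U g => g.op * U) U = wordOp Gate.op c * U := by
    intro c
    induction c with
    | nil => intro U; rw [List.foldl_nil, wordOp_nil, one_mul]
    | cons g c ih => intro U; rw [List.foldl_cons, ih, wordOp_cons, mul_assoc]
  rw [circuitOp, this, mul_one]

theorem circuitOp_isometry {q : Type} [Fintype q] [DecidableEq q] (c : List (Gate q)) :
    (circuitOp c)ᴴ * circuitOp c = 1 := by
  rw [circuitOp_eq]; exact wordOp_isometry Gate.op_isRefl c

namespace Verifier

variable {r : ℕ} (V : Verifier r) (d : Fin r → Type)

/-- The spaces on which the provers act. -/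
def proverLens : Lens ((Wire V.qV r V.qM → Bool) × ∀ i, d i) (∀ i, (Fin V.qM → Bool) × d i) where
  get z i := (fun j => z.1 (.inr (i, j)), z.2 i)
  set z a := (Sum.elim (fun j => z.1 (.inl j)) fun p => (a p.1).1 p.2, fun i => (a i).2)
  get_set z a := rfl
  set_get z := by
    refine Prod.ext (funext fun u => ?_) rfl
    cases u <;> rfl
  set_set z a b := rfl

variable {d} [∀ i, Fintype (d i)] [∀ i, DecidableEq (d i)]

/-- The action of the verifier and of the provers. -/
def runOp (A : ∀ i, Mat ((Fin V.qM → Bool) × d i)) :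
    Mat ((Wire V.qV r V.qM → Bool) × ∀ i, d i) :=
  fst.op (circuitOp V.V2) * (V.proverLens d).op (tensor A) * fst.op (circuitOp V.V1)

theorem runOp_isometry {A : ∀ i, Mat ((Fin V.qM → Bool) × d i)}
    (hA : ∀ i, (A i)ᴴ * A i = 1) : (V.runOp A)ᴴ * V.runOp A = 1 :=
  isometry_mul (isometry_mul (Lens.op_isometry _ (circuitOp_isometry _))
    (Lens.op_isometry _ (tensor_isometry hA))) (Lens.op_isometry _ (circuitOp_isometry _))

/-- The projection onto the states in which the first qubit of `V` is `b`. -/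
def outProj (b : Bool) : Mat (Wire V.qV r V.qM → Bool) :=
  proj fun x => x (.inl ⟨0, V.qV_pos⟩) = b

theorem nrm_sq_outProj (b : Bool) (v : (Wire V.qV r V.qM → Bool) × (∀ i, d i) → ℂ) :
    nrm (fst.op (V.outProj b) *ᵥ v) ^ 2 =
      ∑ x, if x.1 (.inl ⟨0, V.qV_pos⟩) = b then ‖v x‖ ^ 2 else 0 := by
  rw [outProj, proj, fst_op_diagonal, nrm_sq]
  refine sum_congr rfl fun x _ => ?_
  rw [mulVec_diagonal]
  split_ifs with h
  · rw [indic_pos h, one_mul]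
  · rw [indic_neg h, zero_mul, norm_zero, zero_pow two_ne_zero]

theorem nrm_sq_outProj_add (v : (Wire V.qV r V.qM → Bool) × (∀ i, d i) → ℂ) :
    nrm (fst.op (V.outProj true) *ᵥ v) ^ 2 + nrm (fst.op (V.outProj false) *ᵥ v) ^ 2 =
      nrm v ^ 2 := by
  rw [nrm_sq_outProj, nrm_sq_outProj, nrm_sq, ← Finset.sum_add_distrib]
  refine sum_congr rfl fun x _ => ?_
  cases x.1 (.inl ⟨0, V.qV_pos⟩) <;> simp

namespace Provers

variable {V} (P : V.Provers)

theorem proverOp_eq : P.proverOp = (V.proverLens fun i => Fin (P.d i)).op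
    (tensor fun i => (P.W i : Mat _)) := by
  ext x y
  rw [Lens.op_apply, proverOp, of_apply]
  refine if_congr ?_ rfl rfl
  constructor
  · intro h
    refine Prod.ext (funext fun u => ?_) rfl
    rcases u with j | p
    · exact h j
    · rfl
  · intro h j
    exact congrFun (congrArg Prod.fst h) (.inl j)

theorem final_eq : P.final = V.runOp (fun i => (P.W i : Mat _)) *ᵥ P.initial := by
  rw [final, proverOp_eq, runOp, ← fst_op_eq, ← fst_op_eq, mulVec_mulVec, mulVec_mulVec]

theorem W_isometry (i : Fin r) : (P.W i).1ᴴ * (P.W i).1 = 1 :=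
  Matrix.mem_unitaryGroup_iff'.1 (P.W i).2

theorem nrm_initial : nrm P.initial = 1 := by
  have h : nrm P.initial ^ 2 = 1 := by
    rw [← P.Ψ_norm, nrm_sq]
    refine (Fintype.sum_of_injective (fun x : (Fin r × Fin V.qM → Bool) × ∀ i, Fin (P.d i) =>
      (Sum.elim (fun _ => false) x.1, x.2)) ?_ _ _ ?_ ?_).symm
    · intro x y h
      simp only [Prod.mk.injEq] at h
      exact Prod.ext (funext fun u => congrFun h.1 (.inr u)) h.2
    · intro x hx
      rw [initial, if_neg, norm_zero, zero_pow two_ne_zero]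
      intro h0
      refine hx ⟨(fun u => x.1 (.inr u), x.2), Prod.ext (funext fun u => ?_) rfl⟩
      rcases u with j | p
      · exact (h0 j).symm
      · rfl
    · intro x
      simp [initial]
  rw [← Real.sqrt_sq (nrm_nonneg P.initial), h, Real.sqrt_one]

theorem acceptProb_eq : P.acceptProb = 1 - nrm (fst.op (V.outProj false) *ᵥ P.final) ^ 2 := by
  have h := V.nrm_sq_outProj_add P.final
  rw [final_eq, nrm_isometry (V.runOp_isometry P.W_isometry), nrm_initial, one_pow] at h
  rw [acceptProb, ← V.nrm_sq_outProj, final_eq]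
  linarith

theorem acceptProb_le_one : P.acceptProb ≤ 1 := by
  rw [acceptProb_eq]
  have := sq_nonneg (nrm (fst.op (V.outProj false) *ᵥ P.final))
  linarith

theorem acceptProb_le_MAP : P.acceptProb ≤ V.MAP :=
  le_csSup ⟨1, by rintro _ ⟨P, rfl⟩; exact P.acceptProb_le_one⟩ ⟨P, rfl⟩

end Provers

/-- The amplitude with which provers are rejected, for an arbitrary initial vector. -/
theorem le_nrm_sq_run (n : Fin r → ℕ)
    {A : ∀ i, Mat ((Fin V.qM → Bool) × Fin (n i))}
    (hA : ∀ i, (A i)ᴴ * A i = 1) {v : (Wire V.qV r V.qM → Bool) × (∀ i, Fin (n i)) → ℂ}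
    (hv : ∀ x, v x ≠ 0 → ∀ j, x.1 (.inl j) = false) :
    (1 - V.MAP) * nrm v ^ 2 ≤ nrm (fst.op (V.outProj false) *ᵥ (V.runOp A *ᵥ v)) ^ 2 := by
  by_cases hv0 : nrm v = 0
  · rw [hv0]; simp; positivity
  have hpos : 0 < nrm v := lt_of_le_of_ne (nrm_nonneg v) (Ne.symm hv0)
  have hc : nrm (((nrm v : ℂ)⁻¹) • v) = 1 := by
    rw [nrm_smul, norm_inv, Complex.norm_real, Real.norm_of_nonneg hpos.le, inv_mul_cancel₀ hv0]
  have hinit : (((nrm v : ℂ)⁻¹) • v) = fun x : (Wire V.qV r V.qM → Bool) × (∀ i, Fin (n i)) =>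
      if ∀ j, x.1 (Sum.inl j) = false then
      (fun y : (Fin r × Fin V.qM → Bool) × (∀ i, Fin (n i)) =>
        ((nrm v : ℂ)⁻¹) * v (Sum.elim (fun _ => false) y.1, y.2)) (fun u => x.1 (Sum.inr u), x.2)
      else 0 := by
    funext x
    split_ifs with h
    · simp only [Pi.smul_apply, smul_eq_mul]
      congr 2
      refine Prod.ext (funext fun u => ?_) rfl
      rcases u with j | p
      · exact h j
      · rfl
    · have : v x = 0 := by
        by_contra h0
        exact h (hv x h0)
      simp [this]
  let P : V.Provers :=
    { d := n
      Ψ := fun y => ((nrm v : ℂ)⁻¹) * v (Sum.elim (fun _ => false) y.1, y.2)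
      Ψ_norm := by
        rw [← one_pow 2, ← hc, nrm_sq]
        refine Fintype.sum_of_injective (fun x : (Fin r × Fin V.qM → Bool) × ∀ i, Fin (n i) =>
          (Sum.elim (fun _ => false) x.1, x.2)) ?_ _ _ ?_ ?_
        · intro x y h
          simp only [Prod.mk.injEq] at h
          exact Prod.ext (funext fun u => congrFun h.1 (.inr u)) h.2
        · intro x hx
          rw [hinit]
          simp only
          rw [if_neg, norm_zero, zero_pow two_ne_zero]
          intro h0
          refine hx ⟨(fun u => x.1 (.inr u), x.2), Prod.ext (funext fun u => ?_) rfl⟩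
          rcases u with j | p
          · exact (h0 j).symm
          · rfl
        · intro x
          rfl
      W := fun i => ⟨A i, Matrix.mem_unitaryGroup_iff'.2 (hA i)⟩ }
  have hP : P.initial = ((nrm v : ℂ)⁻¹) • v := hinit.symm
  have h1 := P.acceptProb_le_MAP
  rw [P.acceptProb_eq, P.final_eq, hP, mulVec_smul, mulVec_smul, nrm_smul, norm_inv,
    Complex.norm_real, Real.norm_of_nonneg hpos.le, mul_pow] at h1
  have h2 : 1 - V.MAP ≤ (nrm v)⁻¹ ^ 2 *
      nrm (fst.op (V.outProj false) *ᵥ (V.runOp A *ᵥ v)) ^ 2 := by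
    have : (fun i => ((P.W i : Mat _))) = A := rfl
    rw [this] at h1
    linarith
  calc (1 - V.MAP) * nrm v ^ 2 ≤ ((nrm v)⁻¹ ^ 2 *
      nrm (fst.op (V.outProj false) *ᵥ (V.runOp A *ᵥ v)) ^ 2) * nrm v ^ 2 := by gcongr
    _ = _ := by field_simp

end Verifier

/-! ### More on lenses -/

namespace Lens

variable {J A B : Type}

/-- Two independent factors together. -/
def prod {L : Lens J A} {L' : Lens J B} (h : L.Indep L') : Lens J (A × B) where
  get z := (L.get z, L'.get z)
  set z a := L.set (L'.set z a.2) a.1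
  get_set z a := Prod.ext (L.get_set _ _) (by rw [h.get_right, L'.get_set])
  set_get z := by rw [L'.set_get, L.set_get]
  set_set z a b := by rw [h.comm, L.set_set, ← h.comm, L'.set_set]

/-- Change of the coordinates on a factor. -/
def congr (L : Lens J A) (e : A ≃ B) : Lens J B where
  get z := e (L.get z)
  set z b := L.set z (e.symm b)
  get_set z b := by rw [L.get_set, e.apply_symm_apply]
  set_get z := by rw [e.symm_apply_apply, L.set_get]
  set_set z a b := L.set_set _ _ _

/-- A complement of a factor. -/
theorem exists_complement [Finite J] (L : Lens J A) (a₀ : A) : ∃ (n : ℕ) (e : A × Fin n ≃ J),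
    (∀ p, L.get (e p) = p.1) ∧ ∀ p a, L.set (e p) a = e (a, p.2) := by
  obtain ⟨n, ⟨f⟩⟩ := Finite.exists_equiv_fin {z : J // L.get z = a₀}
  refine ⟨n, ⟨fun p => L.set (f.symm p.2).1 p.1,
    fun z => (L.get z, f ⟨L.set z a₀, L.get_set _ _⟩), fun p => ?_, fun z => ?_⟩, fun p => ?_,
    fun p a => ?_⟩
  · refine Prod.ext (L.get_set _ _) ?_
    change f _ = _
    rw [← f.eq_symm_apply]
    refine Subtype.ext ?_
    change L.set (L.set _ _) a₀ = _
    rw [L.set_set]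
    exact (congrArg (L.set _) (f.symm p.2).2.symm).trans (L.set_get _)
  · change L.set (f.symm (f _)).1 _ = _
    rw [f.symm_apply_apply, L.set_set, L.set_get]
  · exact L.get_set _ _
  · exact L.set_set _ _ _

variable [Fintype J] [Fintype A] [DecidableEq J] [DecidableEq A]

theorem op_injective [Nonempty J] (L : Lens J A) : Injective L.op := by
  intro M N h
  obtain ⟨z⟩ := ‹Nonempty J›
  ext a b
  have := congrFun (congrFun h (L.set z a)) (L.set z b)
  simpa [op_apply, L.get_set, L.set_set] using this

theorem exists_isometry (L : Lens J A) {X : Mat J} (h : X ∈ L.op.range) (hX : Xᴴ * X = 1) :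
    ∃ a, aᴴ * a = 1 ∧ X = L.op a := by
  rcases isEmpty_or_nonempty J with hJ | hJ
  · exact ⟨1, by simp, Subsingleton.elim _ _⟩
  · obtain ⟨a, rfl⟩ := h
    refine ⟨a, L.op_injective ?_, rfl⟩
    rw [map_mul, ← op_conjTranspose, map_one]
    exact hX

end Lens

theorem Lens.sub_comp_sub {p q s : Type} [Fintype p] [DecidableEq p] [Fintype q] [DecidableEq q]
    [Fintype s] [DecidableEq s] {f : q → s} (hf : Injective f) {g : p → q}
    (hg : Injective g) : (Lens.sub hf).comp (Lens.sub hg) = Lens.sub (hf.comp hg) := by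
  refine Lens.ext' (fun z => rfl) fun z a => ?_
  funext u
  change extend f (extend g a (z ∘ f)) z u = extend (f ∘ g) a z u
  by_cases h : ∃ j, f j = u
  · obtain ⟨j, rfl⟩ := h
    rw [hf.extend_apply]
    by_cases h : ∃ i, g i = j
    · obtain ⟨i, rfl⟩ := h
      rw [hg.extend_apply]
      exact ((hf.comp hg).extend_apply _ _ _).symm
    · rw [extend_apply' _ _ _ h, extend_apply']
      · rfl
      · rintro ⟨i, hi⟩
        exact h ⟨i, hf hi⟩
  · rw [extend_apply' _ _ _ h, extend_apply']
    rintro ⟨i, hi⟩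
    exact h ⟨g i, hi⟩

theorem snd_op_tensor {κ ι : Type} [Fintype κ] [DecidableEq κ] [Fintype ι] [DecidableEq ι]
    {d : ι → Type} [∀ i, Fintype (d i)] [∀ i, DecidableEq (d i)] (N : ∀ i, Mat (d i)) :
    (Lens.snd : Lens (κ × ∀ i, d i) _).op (tensor N) =
      (((Finset.univ : Finset ι).toList.map fun i =>
        (Lens.snd.comp (coord i) : Lens (κ × ∀ i, d i) (d i)).op (N i)).prod) := by
  have h := prod_coord_op N Finset.univ.toList (Finset.nodup_toList _)
  simp only [Finset.mem_toList, mem_univ, if_true] at h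
  rw [← h, map_list_prod, List.map_map]
  simp only [op_comp]
  rfl

/-! ### The normal form of a verifier -/

/-- The operators composed of Hadamard gates on dummy qubits. -/
def dummyOps {p q : Type} [Fintype q] [DecidableEq q] (f : p → q) :
    Submonoid (Mat (q → Bool)) :=
  Submonoid.closure {A | ∃ u, (∀ j, f j ≠ u) ∧ A = (coord u).op hadamardMat}

theorem dummyOps_commute {p q : Type} [Fintype p] [DecidableEq p] [Fintype q] [DecidableEq q]
    {f : p → q} (hf : Injective f) {E : Mat (q → Bool)}
    (hE : E ∈ dummyOps f) (M : Mat (p → Bool)) :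
    Commute E ((Lens.sub hf).op M) := by
  induction hE using Submonoid.closure_induction with
  | mem A hA =>
    obtain ⟨u, hu, rfl⟩ := hA
    exact op_commute (Lens.coord_indep_sub hf hu) _ _
  | one => exact Commute.one_left _
  | mul A B _ _ hA hB => exact hA.mul_left hB

theorem coord_mem_dummyOps {p q : Type} [Fintype q] [DecidableEq q] {f : p → q} {u : q}
    (hu : ∀ j, f j ≠ u) : (coord u).op hadamardMat ∈ dummyOps f :=
  Submonoid.subset_closure ⟨u, hu, rfl⟩

/-- Embedding of the qubits of a verifier into those of its normal form. -/
structure Padding {r : ℕ} (V : Verifier r) (W : NormalVerifier r) where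
  onV : Fin V.qV → Fin W.qV
  onM : Fin V.qM → Fin W.qM
  onV_injective : Injective onV
  onM_injective : Injective onM
  onV_zero : onV ⟨0, V.qV_pos⟩ = ⟨0, W.qV_pos⟩
  circuit : ∀ b : Bool, ∃ E ∈ dummyOps (Sum.map onV (Prod.map (id : Fin r → Fin r) onM)),
    wordOp Step.op ((List.finRange W.L).map (W.step b)) =
      (Lens.sub (onV_injective.sumMap (Function.injective_id.prodMap onM_injective))).op
        (circuitOp (if b then V.V2 else V.V1)) * E

namespace Padding

variable {r : ℕ} {V : Verifier r} {W : NormalVerifier r} (F : Padding V W)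

/-- The embedding of the qubits. -/
def wire : Wire V.qV r V.qM → Wire W.qV r W.qM := Sum.map F.onV (Prod.map id F.onM)

theorem wire_injective : Injective F.wire :=
  F.onV_injective.sumMap (Function.injective_id.prodMap F.onM_injective)

end Padding

namespace Verifier

variable {r : ℕ} (V : Verifier r)

theorem padGate_op (g : Gate (Wire V.qV r V.qM)) :
    ∃ E ∈ dummyOps V.padWire, (V.padGate g).op = (Lens.sub V.padWire_injective).op g.op * E := by
  have hV : ∀ (n : Fin 2) j, V.padWire j ≠ .inl (Fin.natAdd V.qV n) := by
    rintro n (j | ⟨i, j⟩)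
    · simp only [padWire, ne_eq, Sum.inl.injEq]
      intro h; have := congrArg Fin.val h; simp at this; omega
    · simp [padWire]
  cases g with
  | had u =>
    rw [had_op_eq, Lens.sub_op_coord]
    rcases u with j | ⟨i, j⟩
    · exact ⟨_, coord_mem_dummyOps (hV 0), rfl⟩
    · have hop : (V.padGate (.had (.inr (i, j)))).op =
          hadOp (V.padWire (.inr (i, j))) (.inr (i, Fin.last V.qM)) := rfl
      rw [hop, hadOp]
      refine ⟨_, coord_mem_dummyOps ?_, rfl⟩
      rintro (j | ⟨i, j⟩)
      · simp [padWire]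
      · simp only [padWire, ne_eq, Sum.inr.injEq, Prod.mk.injEq, not_and]
        exact fun _ => (Fin.castSucc_lt_last j).ne
  | tof u₁ u₂ u₃ h₁₂ h₁₃ h₂₃ =>
    refine ⟨1, one_mem _, ?_⟩
    rw [mul_one, tof_op_eq]
    change Gate.op (.tof _ _ _ (V.padWire_injective.ne h₁₂) (V.padWire_injective.ne h₁₃)
      (V.padWire_injective.ne h₂₃)) = _
    rw [tof_op_eq]
    simp only [map_sub, map_mul, map_one, map_prj, pauliOp_single, Lens.sub_op_coord]

theorem padStep_op : V.padStep.op ∈ dummyOps V.padWire := by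
  have hV : ∀ (n : Fin 2) j, V.padWire j ≠ .inl (Fin.natAdd V.qV n) := by
    rintro n (j | ⟨i, j⟩)
    · simp only [padWire, ne_eq, Sum.inl.injEq]
      intro h; have := congrArg Fin.val h; simp at this; omega
    · simp [padWire]
  exact mul_mem (coord_mem_dummyOps (hV 0)) (coord_mem_dummyOps (hV 1))

theorem wordOp_padGate (c : List (Gate (Wire V.qV r V.qM))) :
    ∃ E ∈ dummyOps V.padWire, wordOp Step.op (c.map V.padGate) =
      (Lens.sub V.padWire_injective).op (circuitOp c) * E := by
  rw [circuitOp_eq]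
  induction c with
  | nil => exact ⟨1, one_mem _, by simp [wordOp_nil]⟩
  | cons g c ih =>
    obtain ⟨E, hE, h⟩ := ih
    obtain ⟨D, hD, h'⟩ := V.padGate_op g
    refine ⟨E * D, mul_mem hE hD, ?_⟩
    rw [List.map_cons, wordOp_cons, wordOp_cons, h, h', map_mul,
      (dummyOps_commute V.padWire_injective hE _).mul_mul_mul_comm]

theorem finRange_map_getD {α : Type} (l : List α) (a : α) {n : ℕ} (h : l.length ≤ n) :
    (List.finRange n).map (fun j : Fin n => (l[(j : ℕ)]?).getD a) =
      l ++ List.replicate (n - l.length) a := by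
  refine List.ext_getElem (by simp; omega) fun i h1 h2 => ?_
  simp only [List.getElem_map, List.getElem_finRange, List.getElem_append, List.getElem_replicate]
  split_ifs with hi
  · simp [hi]
  · simp [List.getElem?_eq_none (not_lt.1 hi)]

theorem normalize_circuit (b : Bool) : ∃ E ∈ dummyOps V.padWire,
    wordOp Step.op ((List.finRange V.normalize.L).map (V.normalize.step b)) =
      (Lens.sub V.padWire_injective).op (circuitOp (if b then V.V2 else V.V1)) * E := by
  obtain ⟨E, hE, h⟩ := V.wordOp_padGate (if b then V.V2 else V.V1)
  have hlen : ((if b then V.V2 else V.V1).map V.padGate).length ≤ V.normalize.L := by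
    rw [List.length_map]
    change _ ≤ max 1 (max V.V1.length V.V2.length)
    cases b
    · exact (le_max_left _ _).trans (le_max_right _ _)
    · exact (le_max_right _ _).trans (le_max_right _ _)
  have e := finRange_map_getD _ V.padStep hlen
  have hrep : ∀ n, wordOp Step.op (List.replicate n V.padStep) ∈ dummyOps V.padWire := by
    intro n
    induction n with
    | zero => exact one_mem _
    | succ n ih => exact mul_mem ih V.padStep_op
  refine ⟨_, mul_mem (hrep (V.normalize.L - ((if b then V.V2 else V.V1).map V.padGate).length)) hE,
    ?_⟩
  refine (congrArg (wordOp Step.op) e).trans ?_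
  rw [wordOp_append, h, ← mul_assoc, (dummyOps_commute V.padWire_injective (hrep _) _).eq, mul_assoc]

/-- The normal form of a verifier contains its qubits. -/
def padding : Padding V V.normalize where
  onV := fun j => j.castAdd 2
  onM := Fin.castSucc
  onV_injective := Fin.castAdd_injective _ _
  onM_injective := Fin.castSucc_injective _
  onV_zero := rfl
  circuit b := by
    have e : (Sum.map (fun j : Fin V.qV => j.castAdd 2) (Prod.map (id : Fin r → Fin r) Fin.castSucc) :
        Wire V.qV r V.qM → Wire (V.qV + 2) r (V.qM + 1)) = V.padWire := by
      funext u
      rcases u with j | ⟨i, j⟩ <;> rfl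
    have := V.normalize_circuit b
    simp only [← e] at this
    exact this

end Verifier

namespace NormalVerifier

variable {r : ℕ} (W : NormalVerifier r) (k : ℕ) {H : Fin r → Type} [∀ i, Fintype (H i)]
  [∀ i, DecidableEq (H i)] {M : W.Obs H}

/-! ### Local isometries -/

/-- The products of isometries on the control qubits and the space of each player. -/
def IsLocal (A : Mat (W.Space k H)) : Prop :=
  ∃ a : ∀ i, Mat ((Fin W.m × Bool → Bool) × H i),
    (∀ i, (a i)ᴴ * a i = 1) ∧ A = (W.localLens k H).op (tensor a)

variable {W k}

theorem IsLocal.one : W.IsLocal k (1 : Mat (W.Space k H)) :=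
  ⟨fun _ => 1, by simp, by rw [tensor_one, map_one]⟩

theorem IsLocal.mul {A B : Mat (W.Space k H)} (hA : W.IsLocal k A)
    (hB : W.IsLocal k B) : W.IsLocal k (A * B) := by
  obtain ⟨a, ha, rfl⟩ := hA
  obtain ⟨b, hb, rfl⟩ := hB
  exact ⟨fun i => a i * b i, fun i => isometry_mul (ha i) (hb i), by rw [← map_mul, tensor_mul]⟩

theorem IsLocal.conjTranspose {A : Mat (W.Space k H)} (hA : W.IsLocal k A) :
    W.IsLocal k Aᴴ := by
  obtain ⟨a, ha, rfl⟩ := hA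
  refine ⟨fun i => (a i)ᴴ, fun i => ?_, by rw [Lens.op_conjTranspose, tensor_conjTranspose]⟩
  rw [conjTranspose_conjTranspose]
  exact mul_eq_one_comm.1 (ha i)

theorem IsLocal.mem {A : Mat (W.Space k H)} (hA : W.IsLocal k A) :
    A ∈ W.localOps k H := by
  obtain ⟨a, ha, rfl⟩ := hA
  exact ⟨_, rfl⟩

theorem IsLocal.of_mem {A : Mat (W.Space k H)} {i : Fin r}
    (h : A ∈ ((W.localLens k H).comp (coord i)).op.range) (hA : Aᴴ * A = 1) :
    W.IsLocal k A := by
  obtain ⟨a, ha, rfl⟩ := Lens.exists_isometry _ h hA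
  refine ⟨update (fun _ => 1) i a, fun i' => ?_, by
    rw [op_comp, coord_op_eq_tensor]⟩
  by_cases hi : i' = i
  · subst hi; simpa using ha
  · simp [hi]

theorem IsLocal.wordOp {α : Type} {op : α → Mat (W.Space k H)}
    (h : ∀ a, W.IsLocal k (op a)) (l : List α) : W.IsLocal k (wordOp op l) := by
  induction l with
  | nil => exact IsLocal.one
  | cons a l ih => exact ih.mul (h a)

theorem onRef_X_mem (c : Ctrl r W.m) (A : Mat Bool) :
    (W.onRef k ((coord (RefQubit.X c)).op A) : Mat (W.Space k H)) ∈
      ((W.localLens k H).comp (coord c.1)).op.range := by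
  rw [onRef, ← op_comp, controlLens_eq, op_comp]
  exact ⟨_, rfl⟩

theorem refPauli_X_mem_coord (c : Ctrl r W.m) (D : PauliLabel) :
    (W.refPauli k (.X c) D : Mat (W.Space k H)) ∈
      ((W.localLens k H).comp (coord c.1)).op.range := by
  rw [refPauli, pauliOp_single]
  exact onRef_X_mem c _

theorem prj_mem_range {J A : Type} [Fintype J] [DecidableEq J] [Fintype A] [DecidableEq A]
    {L : Lens J A} {X : Mat J} (h : X ∈ L.op.range) (b : Bool) : prj b X ∈ L.op.range := by
  obtain ⟨x, rfl⟩ := h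
  exact ⟨prj b x, map_prj _ _ _⟩

theorem swapOp_isLocal (p : Fin r × Fin W.m) :
    W.IsLocal k (W.swapOp k p : Mat (W.Space k H)) :=
  IsLocal.of_mem (i := p.1) (add_mem (prj_mem_range (refPauli_X_mem_coord (p.1, p.2, true) _) _)
    (mul_mem (prj_mem_range (refPauli_X_mem_coord (p.1, p.2, true) _) _)
      (refPauli_X_mem_coord (p.1, p.2, false) _))) (W.swapOp_isRefl k p).isometry

theorem player_mem (i : Fin r) (A : Mat (H i)) :
    (playerLens i : Lens (W.Space k H) (H i)).op A ∈
      ((W.localLens k H).comp (coord i)).op.range := by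
  rw [playerLens_eq, op_comp]
  exact ⟨_, rfl⟩

theorem ctrlOp_isLocal (hM : ProjMeas M) (c : Ctrl r W.m) :
    W.IsLocal k (W.ctrlOp k M c) := by
  refine IsLocal.of_mem (i := c.1) ?_ (W.ctrlOp_isRefl k hM c).isometry
  rw [ctrlOp_eq]
  exact add_mem (prj_mem_range (refPauli_X_mem_coord c _) _)
    (mul_mem (prj_mem_range (refPauli_X_mem_coord c _) _) (player_mem c.1 _))

theorem extractOp_isLocal (hM : ProjMeas M) : W.IsLocal k (W.extractOp k M) :=
  (IsLocal.wordOp swapOp_isLocal _).mul (IsLocal.wordOp (ctrlOp_isLocal hM) _)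

theorem xapOp_isLocal (hM : ProjMeas M) : W.IsLocal k (W.xapOp k M) := by
  rw [xapOp, snd_op_tensor]
  induction (Finset.univ : Finset (Fin r)).toList with
  | nil => exact IsLocal.one
  | cons i l ih =>
    rw [List.map_cons, List.prod_cons]
    exact (IsLocal.of_mem (player_mem i _)
      (op_isRefl _ ((hM i .xap).obs_isRefl _)).isometry).mul ih

end NormalVerifier

namespace Padding

variable {r : ℕ} {V : Verifier r} {W : NormalVerifier r} (F : Padding V W) (k : ℕ)
  {H : Fin r → Type} [∀ i, Fintype (H i)] [∀ i, DecidableEq (H i)]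
  {M : W.Obs H}

/-! ### Provers from the strategy of the players -/

/-- The qubits of the referee that take the place of the qubits of the original verifier. -/
def innerLens (H : Fin r → Type) : Lens (W.Space k H) (Wire V.qV r V.qM → Bool) :=
  (W.wireLens k H).comp (Lens.sub F.wire_injective)

/-- The operators on dummy qubits are products of local isometries and isometries that are not
related to the provers. -/
theorem dummy_factor {E : Mat (Wire W.qV r W.qM → Bool)}
    (hE : E ∈ dummyOps F.wire) : ∃ a v : Mat (W.Space k H),
      W.IsLocal k a ∧ (∀ N, Commute a ((F.innerLens k H).op N)) ∧ vᴴ * v = 1 ∧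
      (∀ A ∈ W.localOps k H, Commute v A) ∧ (∀ N, Commute v ((F.innerLens k H).op N)) ∧
      (W.wireLens k H).op E = a * v := by
  induction hE using Submonoid.closure_induction with
  | mem A hA =>
    obtain ⟨u, hu, rfl⟩ := hA
    have hc : ∀ N, Commute ((W.wireLens k H).op ((coord u).op hadamardMat))
        ((F.innerLens k H).op N) := by
      intro N
      rw [innerLens, op_comp]
      exact (op_commute (Lens.coord_indep_sub F.wire_injective hu) _ _).map _
    have hi : ((W.wireLens k H).op ((coord u).op hadamardMat))ᴴ *
        (W.wireLens k H).op ((coord u).op hadamardMat) = 1 :=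
      (op_isRefl _ (coord_op_isRefl u hadamardMat_isRefl)).isometry
    rcases u with j | ⟨i, j⟩
    · refine ⟨1, _, NormalVerifier.IsLocal.one, fun _ => Commute.one_left _, hi, ?_, hc,
        (one_mul _).symm⟩
      rw [W.wireLens_coord]
      exact fun A hA => W.V_commute_localOps k j _ hA
    · refine ⟨_, 1, ?_, hc, by simp, fun _ _ => Commute.one_left _, fun _ => Commute.one_left _,
        (mul_one _).symm⟩
      refine NormalVerifier.IsLocal.of_mem (i := i) ?_ hi
      rw [W.wireLens_coord]
      exact NormalVerifier.onRef_X_mem (i, j.succ, false) _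
  | one => exact ⟨1, 1, NormalVerifier.IsLocal.one, fun _ => Commute.one_left _, by simp,
      fun _ _ => Commute.one_left _, fun _ => Commute.one_left _, by simp⟩
  | mul A B _ _ hA hB =>
    obtain ⟨a, v, h1, h2, h3, h4, h5, h6⟩ := hA
    obtain ⟨b, w, h1', h2', h3', h4', h5', h6'⟩ := hB
    refine ⟨a * b, v * w, h1.mul h1', fun N => (h2 N).mul_left (h2' N), isometry_mul h3 h3',
      fun A hA => (h4 A hA).mul_left (h4' A hA), fun N => (h5 N).mul_left (h5' N), ?_⟩
    rw [map_mul, h6, h6', (h4 b h1'.mem).mul_mul_mul_comm]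

/-- The qubits of `V`. -/
def vLens (H : Fin r → Type) : Lens (W.Space k H) (Fin V.qV → Bool) :=
  fst.comp (Lens.sub (f := fun j => (RefQubit.V (F.onV j) : W.Ref k))
    (fun j j' h => F.onV_injective (by simpa using h)))

/-- The qubits of `M_i` among the control qubits of a player. -/
def mLens (Y : Type) : Lens ((Fin W.m × Bool → Bool) × Y) (Fin V.qM → Bool) :=
  fst.comp (Lens.sub (f := fun j => ((F.onM j).succ, false))
    (fun j j' h => F.onM_injective (by simpa using h)))

theorem vLens_indep : (F.vLens k H).Indep (W.localLens k H) := by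
  have hx : ∀ (c : Ctrl r W.m), ¬ ∃ j, (RefQubit.V (F.onV j) : W.Ref k) = .X c := by simp
  refine ⟨fun z a => rfl, fun z b => ?_, fun z a b => ?_⟩
  · funext i
    refine Prod.ext (funext fun p => ?_) rfl
    exact extend_apply' _ _ _ (hx (i, p))
  · refine Prod.ext (funext fun q => ?_) rfl
    change extend _ a _ q = _
    by_cases h : ∃ j, (RefQubit.V (F.onV j) : W.Ref k) = q
    · obtain ⟨j, rfl⟩ := h
      change _ = extend (fun j => (RefQubit.V (F.onV j) : W.Ref k)) a z.1
        (RefQubit.V (F.onV j))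
      rw [Injective.extend_apply (f := fun j => (RefQubit.V (F.onV j) : W.Ref k)),
        Injective.extend_apply (f := fun j => (RefQubit.V (F.onV j) : W.Ref k))] <;>
      exact fun j j' h => F.onV_injective (by simpa using h)
    · rw [extend_apply' _ _ _ h]
      have := fun x => extend_apply' a x q h
      cases q with
      | X c => rfl
      | S t => exact (this z.1).symm
      | C t => exact (this z.1).symm
      | V t => exact (this z.1).symm

theorem innerLens_set (z : W.Space k H) (w : Wire V.qV r V.qM → Bool) :
    (F.innerLens k H).set z w = (F.vLens k H).set ((W.localLens k H).set z fun i =>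
      (F.mLens (H i)).set ((W.localLens k H).get z i) fun j => w (.inr (i, j)))
        fun j => w (.inl j) := by
  have hinj : Injective fun j => (RefQubit.V (F.onV j) : W.Ref k) :=
    fun j j' h => F.onV_injective (by simpa using h)
  have hinjM : Injective fun j => ((F.onM j).succ, false) :=
    fun j j' h => F.onM_injective (by simpa using h)
  have hf : Injective (W.wireQubit k ∘ F.wire) :=
    (W.wireQubit_injective k).comp F.wire_injective
  have e : (F.innerLens k H) = fst.comp (Lens.sub hf) := by
    rw [← Lens.sub_comp_sub]; rfl
  rw [e]
  refine Prod.ext (funext fun q => ?_) rfl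
  change extend (W.wireQubit k ∘ F.wire) w z.1 q =
    extend (fun j => (RefQubit.V (F.onV j) : W.Ref k)) (fun j => w (.inl j)) _ q
  have hno : ∀ q : W.Ref k, (∀ j, q ≠ .V j) → (∀ c, q ≠ .X c) →
      ¬ ∃ u, (W.wireQubit k ∘ F.wire) u = q := by
    rintro q h1 h2 ⟨j | ⟨i, j⟩, rfl⟩
    · exact h1 _ rfl
    · exact h2 _ rfl
  cases q with
  | S t =>
    rw [extend_apply' _ _ _ (hno _ (by simp) (by simp)), extend_apply' _ _ _ (by simp)]
    rfl
  | C t =>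
    rw [extend_apply' _ _ _ (hno _ (by simp) (by simp)), extend_apply' _ _ _ (by simp)]
    rfl
  | V t =>
    by_cases h : ∃ j, F.onV j = t
    · obtain ⟨j, rfl⟩ := h
      exact (hf.extend_apply _ _ (.inl j)).trans (hinj.extend_apply (fun j => w (.inl j)) _ j).symm
    · rw [extend_apply', extend_apply']
      · rfl
      · rintro ⟨j, hj⟩
        exact h ⟨j, by simpa using hj⟩
      · rintro ⟨j | ⟨i, j⟩, hj⟩
        · exact h ⟨j, by simpa [NormalVerifier.wireQubit, wire] using hj⟩
        · simp [NormalVerifier.wireQubit, wire] at hj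
  | X c =>
    obtain ⟨i, p⟩ := c
    rw [extend_apply' (fun j => w (.inl j)) _ _ (by simp)]
    change _ = extend (fun j => ((F.onM j).succ, false)) (fun j => w (.inr (i, j)))
      (fun p => z.1 (.X (i, p))) p
    by_cases h : ∃ j, ((F.onM j).succ, false) = p
    · obtain ⟨j, rfl⟩ := h
      exact (hf.extend_apply _ _ (.inr (i, j))).trans (hinjM.extend_apply (fun j => w (.inr (i, j))) _ j).symm
    · rw [extend_apply' _ _ _ h, extend_apply']
      rintro ⟨j | ⟨i', j⟩, hj⟩
      · simp [NormalVerifier.wireQubit, wire] at hj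
      · simp only [NormalVerifier.wireQubit, wire, Function.comp_apply, Sum.map_inr, Prod.map_apply,
          id_eq, RefQubit.X.injEq, Prod.mk.injEq] at hj
        exact h ⟨j, hj.2⟩

theorem innerLens_get (z : W.Space k H) : (F.innerLens k H).get z =
    Sum.elim ((F.vLens k H).get z) fun p => (F.mLens (H p.1)).get ((W.localLens k H).get z p.1) p.2 := by
  funext u
  rcases u with j | ⟨i, j⟩ <;> rfl

theorem tensor_submatrix {d d' : Fin r → Type} (a : ∀ i, Mat (d i)) (e : ∀ i, d' i ≃ d i) :
    (tensor a).submatrix (Equiv.piCongrRight e) (Equiv.piCongrRight e) =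
      tensor fun i => (a i).submatrix (e i) (e i) := rfl

/-- A lower bound for the amplitude with which provers that start with `β` are rejected. -/
theorem le_nrm_sq_local {A : Mat (W.Space k H)} (hA : W.IsLocal k A)
    {β : W.Space k H → ℂ} (hβ : ∀ z, β z ≠ 0 → ∀ j, (F.vLens k H).get z j = false) :
    (1 - V.MAP) * nrm β ^ 2 ≤ nrm ((F.innerLens k H).op (V.outProj false) *ᵥ
      ((F.innerLens k H).op (circuitOp V.V2) *ᵥ (A *ᵥ
        ((F.innerLens k H).op (circuitOp V.V1) *ᵥ β)))) ^ 2 := by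
  obtain ⟨a, ha, rfl⟩ := hA
  choose n e hget hset using fun i => (F.mLens (H i)).exists_complement fun _ => false
  let eq : (Fin V.qV → Bool) × (∀ i, (Fin W.m × Bool → Bool) × H i) ≃
      (Wire V.qV r V.qM → Bool) × ∀ i, Fin (n i) :=
    { toFun := fun p => (Sum.elim p.1 fun u => ((e u.1).symm (p.2 u.1)).1 u.2,
        fun i => ((e i).symm (p.2 i)).2)
      invFun := fun p => (fun j => p.1 (.inl j), fun i => e i (fun j => p.1 (.inr (i, j)), p.2 i))
      left_inv := fun p => Prod.ext rfl (funext fun i => (e i).apply_symm_apply (p.2 i))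
      right_inv := fun p => by
        refine Prod.ext (funext fun u => ?_) ?_
        · rcases u with j | ⟨i, j⟩ <;> simp
        · simp }
  let out : Lens (W.Space k H) ((Wire V.qV r V.qM → Bool) × ∀ i, Fin (n i)) :=
    (Lens.prod (F.vLens_indep k)).congr eq
  have hout : ∀ z p, out.set z p = (F.vLens k H).set ((W.localLens k H).set z fun i =>
      e i (fun j => p.1 (.inr (i, j)), p.2 i)) fun j => p.1 (.inl j) := fun z p => rfl
  have hind := F.vLens_indep (H := H) k
  have hin : ∀ z N (v : W.Space k H → ℂ), ((F.innerLens k H).op N *ᵥ v) ∘ out.set z =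
      fst.op N *ᵥ (v ∘ out.set z) := by
    intro z N v
    refine Lens.op_mulVec_comp (F.innerLens k H) fst (out.set z) (Equiv.refl _) ?_ ?_ N v
    · intro p
      rw [innerLens_get, hout, Lens.get_set, hind.get_right, Lens.get_set]
      funext u
      rcases u with j | ⟨i, j⟩
      · rfl
      · change (F.mLens (H i)).get (e i _) j = _
        rw [hget]; rfl
    · intro p w
      rw [innerLens_set, hout, hout, hind.get_right, ← hind.comm, Lens.set_set, Lens.set_set,
        Lens.get_set]
      simp only [hset]
      rfl
  have hloc : ∀ z (v : W.Space k H → ℂ), ((W.localLens k H).op (tensor a) *ᵥ v) ∘ out.set z =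
      (V.proverLens fun i => Fin (n i)).op (tensor fun i => (a i).submatrix (e i) (e i)) *ᵥ
        (v ∘ out.set z) := by
    intro z v
    rw [← tensor_submatrix]
    refine Lens.op_mulVec_comp (W.localLens k H) (V.proverLens fun i => Fin (n i)) (out.set z)
      (Equiv.piCongrRight e) ?_ ?_ _ v
    · intro p
      rw [hout, hind.get_right, Lens.get_set]
      rfl
    · intro p w
      rw [hout, hout, ← hind.comm, Lens.set_set]
      rfl
  have hslice : ∀ z, (1 - V.MAP) * nrm (β ∘ out.set z) ^ 2 ≤
      nrm (((F.innerLens k H).op (V.outProj false) *ᵥ ((F.innerLens k H).op (circuitOp V.V2) *ᵥ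
        ((W.localLens k H).op (tensor a) *ᵥ
          ((F.innerLens k H).op (circuitOp V.V1) *ᵥ β)))) ∘ out.set z) ^ 2 := by
    intro z
    rw [hin, hin, hloc, hin]
    have := V.le_nrm_sq_run n (A := fun i => (a i).submatrix (e i) (e i)) (fun i => by
      rw [conjTranspose_submatrix, submatrix_mul_equiv, ha, submatrix_one_equiv])
      (v := β ∘ out.set z) (fun p hp j => by
        have := hβ _ hp j
        rwa [hout, Lens.get_set] at this)
    rwa [Verifier.runOp, ← mulVec_mulVec, ← mulVec_mulVec] at this
  have hsum := sum_le_sum fun z (_ : z ∈ Finset.univ) => hslice z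
  rw [← mul_sum, Lens.sum_nrm_sq_set, Lens.sum_nrm_sq_set, mul_left_comm] at hsum
  rcases isEmpty_or_nonempty (W.Space k H) with hJ | hJ
  · rw [Subsingleton.elim β 0, nrm_zero, zero_pow two_ne_zero, mul_zero]
    positivity
  · have hpos : (0 : ℝ) < Fintype.card ((Wire V.qV r V.qM → Bool) × ∀ i, Fin (n i)) := by
      have : Nonempty ((Wire V.qV r V.qM → Bool) × ∀ i, Fin (n i)) := hJ.map out.get
      exact_mod_cast Fintype.card_pos
    exact le_of_mul_le_mul_left hsum hpos

end Padding

/-! ### Soundness -/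

theorem Lens.op_wordOp {J A α : Type} [Fintype J] [DecidableEq J] [Fintype A] [DecidableEq A]
    (L : Lens J A) (op : α → Mat A) (l : List α) :
    wordOp (fun a => L.op (op a)) l = L.op (wordOp op l) := by
  induction l with
  | nil => rw [wordOp_nil, wordOp_nil, map_one]
  | cons a l ih => rw [wordOp_cons, wordOp_cons, map_mul, ih]

theorem tensor_isRefl {ι : Type} [Fintype ι] [DecidableEq ι] {d : ι → Type} [∀ i, Fintype (d i)]
    [∀ i, DecidableEq (d i)] {A : ∀ i, Mat (d i)} (h : ∀ i, IsRefl (A i)) :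
    IsRefl (tensor A) := by
  constructor
  · rw [tensor_conjTranspose]; simp only [(h _).star_eq]
  · rw [tensor_mul]; simp only [(h _).mul_self]; exact tensor_one

namespace NormalVerifier

variable {r : ℕ} {W : NormalVerifier r} {k : ℕ} {H : Fin r → Type} [∀ i, Fintype (H i)]
  [∀ i, DecidableEq (H i)] {M : W.Obs H}
  {φ : W.Space k H → ℂ} {δ : ℝ}

theorem xapOp_isRefl (hM : ProjMeas M) : IsRefl (W.xapOp k M) :=
  op_isRefl _ (tensor_isRefl fun i => (hM i .xap).obs_isRefl _)

variable (M) in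
/-- The action of the provers on the extracted qubits. -/
def proverStep : Mat (W.Space k H) :=
  W.extractOp k M * W.xapOp k M * (W.extractOp k M)ᴴ

theorem proverStep_isRefl (hM : ProjMeas M) :
    IsRefl (proverStep M : Mat (W.Space k H)) := by
  have hU := W.extractOp_isometry k hM
  have hU' := mul_eq_one_comm.1 hU
  have hx := xapOp_isRefl (W := W) (k := k) hM
  constructor
  · rw [proverStep, conjTranspose_mul, conjTranspose_mul, conjTranspose_conjTranspose, hx.star_eq,
      mul_assoc]
  · rw [proverStep, mul_assoc, ← mul_assoc (W.extractOp k M)ᴴ, ← mul_assoc (W.extractOp k M)ᴴ, hU,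
      one_mul, mul_assoc, ← mul_assoc (W.xapOp k M), hx.mul_self, one_mul, hU']

variable (W) in
/-- The operator of one of the circuits. -/
def circuit (b : Bool) : Mat (Wire W.qV r W.qM → Bool) :=
  wordOp Step.op ((List.finRange W.L).map (W.step b))

theorem circuit_isometry (b : Bool) : (W.circuit b)ᴴ * W.circuit b = 1 :=
  wordOp_isometry Step.op_isRefl _

theorem nrm_hist_chain (hk : 3 ≤ k) (hM : ProjMeas M)
    (h : W.PropChecks k M φ δ) (h' : W.HonestChecks k M (slice S φ 0) δ) (hδ : 0 ≤ δ)
    (b : Bool) {l : ℕ} (hl : l ≤ W.L) :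
    nrm (hist M φ ((if b then W.L + 1 else 0) + l) - wordOp (fun s => (W.wireLens k H).op s.op)
      (((List.finRange W.L).map (W.step b)).take l) *ᵥ hist M φ (if b then W.L + 1 else 0)) ≤
      l * (W.stepError k * δ) := by
  refine nrm_sub_wordOp_le (op := fun s : Step W.qV r W.qM => (W.wireLens k H).op s.op)
    (fun s => op_isRefl _ s.op_isRefl)
    (f := fun t => hist M φ ((if b then W.L + 1 else 0) + t)) ?_ l (by simpa using hl)
  intro t ht
  have ht' : t < W.L := by simpa using ht
  have := nrm_hist_step hk hM h h' hδ b ⟨t, ht'⟩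
  have e1 : W.time b ⟨t, ht'⟩ = (if b then W.L + 1 else 0) + (t + 1) := by
    cases b <;> simp [time] <;> omega
  have e2 : W.time b ⟨t, ht'⟩ - 1 = (if b then W.L + 1 else 0) + t := by
    rw [e1]; omega
  rw [e2, e1] at this
  simpa using this

theorem nrm_hist_circuit (hk : 3 ≤ k) (hM : ProjMeas M)
    (h : W.PropChecks k M φ δ) (h' : W.HonestChecks k M (slice S φ 0) δ) (hδ : 0 ≤ δ)
    (b : Bool) :
    nrm (hist M φ ((if b then W.L + 1 else 0) + W.L) - (W.wireLens k H).op (W.circuit b) *ᵥ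
      hist M φ (if b then W.L + 1 else 0)) ≤ W.L * (W.stepError k * δ) := by
  have := nrm_hist_chain hk hM h h' hδ b le_rfl
  rwa [List.take_of_length_le (by simp), Lens.op_wordOp] at this

theorem nrm_hist_le_start (hk : 3 ≤ k) (hM : ProjMeas M)
    (h : W.PropChecks k M φ δ) (h' : W.HonestChecks k M (slice S φ 0) δ) (hδ : 0 ≤ δ)
    (b : Bool) {l : ℕ} (hl : l ≤ W.L) :
    nrm (hist M φ ((if b then W.L + 1 else 0) + l)) ≤
      nrm (hist M φ (if b then W.L + 1 else 0)) + W.L * (W.stepError k * δ) := by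
  have h1 := nrm_hist_chain hk hM h h' hδ b hl
  have h2 := nrm_le_add_sub (hist M φ ((if b then W.L + 1 else 0) + l))
    (wordOp (fun s => (W.wireLens k H).op s.op)
      (((List.finRange W.L).map (W.step b)).take l) *ᵥ hist M φ (if b then W.L + 1 else 0))
  rw [nrm_isometry (wordOp_isometry (fun s => op_isRefl _ s.op_isRefl) _)] at h2
  have h3 : (l : ℝ) * (W.stepError k * δ) ≤ W.L * (W.stepError k * δ) :=
    mul_le_mul_of_nonneg_right (by exact_mod_cast hl) (mul_nonneg (stepError_nonneg W k) hδ)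
  linarith

theorem nrm_hist_prover_symm (hM : ProjMeas M)
    (h' : W.HonestChecks k M (slice S φ 0) δ) :
    nrm (hist M φ (W.L + 1) - proverStep M *ᵥ hist M φ W.L) ≤ 2 * δ := by
  have hX := proverStep_isRefl (W := W) (k := k) hM
  rw [nrm_sub_comm, ← hX.nrm, mulVec_sub, hX.mulVec_mulVec]
  exact nrm_hist_prover hM h'

variable (W k) in
/-- The error of the whole verification. -/
def runError : ℝ := 2 * (W.L * W.stepError k) + 2

theorem nrm_hist_le (hk : 3 ≤ k) (hM : ProjMeas M)
    (h : W.PropChecks k M φ δ) (h' : W.HonestChecks k M (slice S φ 0) δ) (hδ : 0 ≤ δ)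
    {t : ℕ} (ht : t ≤ W.T) : nrm (hist M φ t) ≤ nrm (hist M φ 0) + W.runError k * δ := by
  have hη : 0 ≤ W.L * (W.stepError k * δ) :=
    mul_nonneg (Nat.cast_nonneg _) (mul_nonneg (stepError_nonneg W k) hδ)
  have h0 := fun {l} (hl : l ≤ W.L) => nrm_hist_le_start hk hM h h' hδ false hl
  have h1 := fun {l} (hl : l ≤ W.L) => nrm_hist_le_start hk hM h h' hδ true hl
  simp only [Bool.false_eq_true, if_false, if_true, zero_add] at h0 h1
  rw [runError]
  rcases le_or_gt t W.L with htL | htL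
  · linarith [h0 htL]
  · obtain ⟨l, rfl⟩ := Nat.exists_eq_add_of_le (show W.L + 1 ≤ t from htL)
    have h2 := h1 (l := l) (by unfold T at ht; omega)
    have h3 := nrm_le_add_sub (hist M φ (W.L + 1)) (proverStep M *ᵥ hist M φ W.L)
    rw [(proverStep_isRefl hM).nrm] at h3
    linarith [nrm_hist_prover_symm hM h', h0 (l := W.L) le_rfl]

theorem nrm_hist_run (hk : 3 ≤ k) (hM : ProjMeas M)
    (h : W.PropChecks k M φ δ) (h' : W.HonestChecks k M (slice S φ 0) δ) (hδ : 0 ≤ δ) :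
    nrm (hist M φ W.T - (W.wireLens k H).op (W.circuit true) *ᵥ (proverStep M *ᵥ
      ((W.wireLens k H).op (W.circuit false) *ᵥ hist M φ 0))) ≤ W.runError k * δ := by
  have h1 := nrm_hist_circuit hk hM h h' hδ false
  have h2 := nrm_hist_circuit hk hM h h' hδ true
  simp only [Bool.false_eq_true, if_false, if_true, zero_add] at h1 h2
  have hT : W.L + 1 + W.L = W.T := by unfold T; omega
  rw [hT] at h2
  have hc : Ctr ((W.wireLens k H).op (W.circuit true)) :=
    Ctr.of_isometry (Lens.op_isometry _ (circuit_isometry true))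
  have h3 := (hc.sub_le _ _).trans (nrm_hist_prover_symm hM h')
  have h4 := (hc.sub_le _ _).trans (((proverStep_isRefl hM).ctr.sub_le _ _).trans h1)
  have h5 := (nrm_sub_trans _ _ _).trans (add_le_add h3 h4)
  refine (nrm_sub_trans _ _ _).trans ((add_le_add h2 h5).trans (le_of_eq ?_))
  rw [runError]; ring

variable (W k H) in
/-- The projection onto the states in which all qubits of `V` are `0`. -/
def startProj : Mat (W.Space k H) := proj fun z => ∀ j, z.1 (.V j) = false

theorem prj_refPauli_V (b : Bool) (j : Fin W.qV) :
    (prj b (W.refPauli k (.V j) .Z) : Mat (W.Space k H)) =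
      proj fun z => z.1 (.V j) = b := by
  rw [refPauli, ← map_prj, single_Z_eq_diagonal, prj_diagonal, proj, fst_op_diagonal, proj]

theorem nrm_sub_startProj_le (v : W.Space k H → ℂ) (hδ : 0 ≤ δ)
    (hv : ∀ j, nrm (prj true (W.refPauli k (.V j) .Z) *ᵥ v) ≤ δ) :
    nrm (v - W.startProj k H *ᵥ v) ≤ W.qV * δ := by
  have h1 : nrm (v - W.startProj k H *ᵥ v) ^ 2 ≤
      ∑ j, nrm (prj true (W.refPauli k (.V j) .Z) *ᵥ v) ^ 2 := by
    simp only [nrm_sq, prj_refPauli_V]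
    rw [sum_comm]
    refine sum_le_sum fun z _ => ?_
    simp only [startProj, proj, Pi.sub_apply, mulVec_diagonal]
    by_cases hz : ∀ j, z.1 (.V j) = false
    · rw [indic_pos hz, one_mul, sub_self, norm_zero, zero_pow two_ne_zero]
      positivity
    · rw [indic_neg hz, zero_mul, sub_zero]
      obtain ⟨j, hj⟩ := not_forall.1 hz
      have hj' : z.1 (.V j) = true := by simpa using hj
      have := Finset.single_le_sum (f := fun j => ‖indic (z.1 (.V j) = true) * v z‖ ^ 2)
        (fun j _ => sq_nonneg _) (mem_univ j)
      rwa [indic_pos hj', one_mul] at this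
  have h2 : ∑ j, nrm (prj true (W.refPauli k (.V j) .Z) *ᵥ v) ^ 2 ≤ (W.qV * δ) ^ 2 := by
    refine (sum_le_sum fun j _ => pow_le_pow_left₀ (nrm_nonneg _) (hv j) 2).trans ?_
    rw [Finset.sum_const, Finset.card_univ, Fintype.card_fin, nsmul_eq_mul, mul_pow]
    refine mul_le_mul_of_nonneg_right ?_ (sq_nonneg _)
    exact_mod_cast Nat.le_self_pow two_ne_zero _
  exact (pow_le_pow_iff_left₀ (nrm_nonneg _) (by positivity) two_ne_zero).1 (h1.trans h2)

end NormalVerifier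

namespace Padding

variable {r : ℕ} {V : Verifier r} {W : NormalVerifier r} {k : ℕ}
  {H : Fin r → Type} [∀ i, Fintype (H i)] [∀ i, DecidableEq (H i)]
  {M : W.Obs H}

open NormalVerifier

theorem wireLens_circuit (F : Padding V W) (b : Bool) : ∃ a v : Mat (W.Space k H),
      W.IsLocal k a ∧ (∀ N, Commute a ((F.innerLens k H).op N)) ∧ vᴴ * v = 1 ∧
      (∀ A ∈ W.localOps k H, Commute v A) ∧ (∀ N, Commute v ((F.innerLens k H).op N)) ∧
      (W.wireLens k H).op (W.circuit b) =
        (F.innerLens k H).op (circuitOp (if b then V.V2 else V.V1)) * (a * v) := by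
  obtain ⟨E, hE, h⟩ := F.circuit b
  obtain ⟨a, v, h1, h2, h3, h4, h5, h6⟩ := F.dummy_factor k (H := H) hE
  refine ⟨a, v, h1, h2, h3, h4, h5, ?_⟩
  rw [NormalVerifier.circuit, h, map_mul, h6, innerLens, op_comp]
  rfl

theorem prj_zero_eq (F : Padding V W) (b : Bool) :
    (prj b (W.refPauli k (.V ⟨0, W.qV_pos⟩) .Z) : Mat (W.Space k H)) =
      (F.innerLens k H).op (V.outProj b) := by
  have h1 : V.outProj b = prj b (pauliOp (single (.inl ⟨0, V.qV_pos⟩) .Z)) := by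
    rw [single_Z_eq_diagonal, prj_diagonal]; rfl
  have h2 : F.wire (.inl ⟨0, V.qV_pos⟩) = .inl ⟨0, W.qV_pos⟩ := congrArg Sum.inl F.onV_zero
  rw [h1, map_prj, innerLens, op_comp, pauliOp_single, Lens.sub_op_coord, h2, ← pauliOp_single,
    W.wireLens_single]
  rfl

theorem le_nrm_sq_run (F : Padding V W) {X : Mat (W.Space k H)} (hX : W.IsLocal k X)
    (v : W.Space k H → ℂ) :
    (1 - V.MAP) * nrm (W.startProj k H *ᵥ v) ^ 2 ≤
      nrm (prj false (W.refPauli k (.V ⟨0, W.qV_pos⟩) .Z) *ᵥ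
        ((W.wireLens k H).op (W.circuit true) *ᵥ (X *ᵥ ((W.wireLens k H).op (W.circuit false) *ᵥ
          (W.startProj k H *ᵥ v))))) ^ 2 := by
  obtain ⟨a₁, v₁, h1, h2, h3, h4, h5, h6⟩ := F.wireLens_circuit (k := k) (H := H) false
  obtain ⟨a₂, v₂, h1', h2', h3', h4', h5', h6'⟩ := F.wireLens_circuit (k := k) (H := H) true
  simp only [Bool.false_eq_true, if_false, if_true] at h6 h6'
  set β := W.startProj k H *ᵥ v with hβdef
  have key := F.le_nrm_sq_local k ((h1'.mul hX).mul h1) (β := β) (by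
    intro z hz j
    rw [hβdef, startProj, proj, mulVec_diagonal] at hz
    by_contra hj
    refine hz ?_
    rw [indic_neg, zero_mul]
    exact fun h => hj (h (F.onV j)))
  refine key.trans (le_of_eq (congrArg (· ^ 2) ?_))
  rw [F.prj_zero_eq, h6, h6']
  set P := (F.innerLens k H).op (V.outProj false) with hP
  set C₁ := (F.innerLens k H).op (circuitOp V.V1) with hC₁
  set C₂ := (F.innerLens k H).op (circuitOp V.V2) with hC₂
  have c2 : Commute v₂ (P * C₂ * a₂) := ((h5' _).mul_right (h5' _)).mul_right (h4' _ h1'.mem)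
  have c1 : Commute v₁ (P * C₂ * a₂ * X * a₁ * C₁) :=
    (((((h5 _).mul_right (h5 _)).mul_right (h4 _ h1'.mem)).mul_right (h4 _ hX.mem)).mul_right
      (h4 _ h1.mem)).mul_right (h5 _)
  have e : P * (C₂ * (a₂ * v₂)) * X * (C₁ * (a₁ * v₁)) =
      v₂ * v₁ * (P * (C₂ * (a₂ * X * a₁ * C₁))) := by
    have hc : C₁ * a₁ = a₁ * C₁ := (h2 _).eq.symm
    calc P * (C₂ * (a₂ * v₂)) * X * (C₁ * (a₁ * v₁))
        = (P * C₂ * a₂ * v₂) * X * (C₁ * a₁ * v₁) := by simp only [mul_assoc]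
      _ = v₂ * ((P * C₂ * a₂ * X * a₁ * C₁) * v₁) := by
          rw [← c2.eq, hc]; simp only [mul_assoc]
      _ = _ := by rw [← c1.eq]; simp only [mul_assoc]
  simp only [mulVec_mulVec]
  simp only [← mul_assoc]
  simp only [← mul_assoc] at e
  rw [e, ← nrm_isometry (isometry_mul h3' h3)]
  simp only [mulVec_mulVec, ← mul_assoc]

/-- The ratio of the norm of a vector and the amplitude of its rejection. -/
def totalError (W : NormalVerifier r) (k : ℕ) (p : ℝ) : ℝ :=
  (W.N k + 1) * ((W.T + 1) * ((p + 1) * (W.runError k + 1 + W.qV)) + W.T + 2 * W.N k) + W.N k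

theorem nrm_le_totalError (F : Padding V W) (hk : 3 ≤ k) (hM : ProjMeas M) {p : ℝ} (hp : 1 ≤ p)
    (hMAP : 1 / p ≤ 1 - V.MAP) {φ : W.Space k H → ℂ} {δ : ℝ}
    (h : W.PropChecks k M φ δ) (h' : W.HonestChecks k M (slice S φ 0) δ) (hδ : 0 ≤ δ) :
    nrm φ ≤ totalError W k p * δ := by
  have hp0 : 0 < p := by linarith
  have hE : 0 ≤ W.runError k * δ := by
    have := stepError_nonneg W k
    unfold runError; positivity
  have hq : 0 ≤ W.qV * δ := by positivity
  set κ := W.runError k + 1 + W.qV with hκ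
  have hX : W.IsLocal k (proverStep M : Mat (W.Space k H)) :=
    ((extractOp_isLocal hM).mul (xapOp_isLocal hM)).mul (extractOp_isLocal hM).conjTranspose
  have hP : Ctr (prj false (W.refPauli k (.V ⟨0, W.qV_pos⟩) .Z) :
      Mat (W.Space k H)) := prj_ctr (W.refPauli_isRefl k _ _) _
  have hF : ∀ b, Ctr ((W.wireLens k H).op (W.circuit b)) := fun b =>
    Ctr.of_isometry (Lens.op_isometry _ (circuit_isometry b))
  have h0 := nrm_sub_startProj_le (hist M φ 0) hδ (nrm_prj_hist_zero hM h')
  set v := hist M φ 0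
  have h1 := (hP.sub_le _ _).trans (nrm_hist_run hk hM h h' hδ)
  have h2 := (hP.sub_le _ _).trans (((hF true).sub_le _ _).trans
    (((proverStep_isRefl hM).ctr.sub_le _ _).trans (((hF false).sub_le _ _).trans h0)))
  have h3 := nrm_prj_hist_last hM h'
  have hrun : nrm (prj false (W.refPauli k (.V ⟨0, W.qV_pos⟩) .Z) *ᵥ
        ((W.wireLens k H).op (W.circuit true) *ᵥ (proverStep M *ᵥ
          ((W.wireLens k H).op (W.circuit false) *ᵥ (W.startProj k H *ᵥ v))))) ≤ κ * δ := by
    rw [nrm_sub_comm] at h1 h2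
    have h4 := (nrm_le_add_sub _ _).trans (add_le_add h3 h1)
    have h5 := (nrm_le_add_sub _ _).trans (add_le_add h4 h2)
    rw [hκ]
    linarith
  have hsq := (F.le_nrm_sq_run hX v).trans (pow_le_pow_left₀ (nrm_nonneg _) hrun 2)
  have hβ : nrm (W.startProj k H *ᵥ v) ≤ p * (κ * δ) := by
    have h6 : 1 / p * nrm (W.startProj k H *ᵥ v) ^ 2 ≤ (κ * δ) ^ 2 :=
      (mul_le_mul_of_nonneg_right hMAP (sq_nonneg _)).trans hsq
    have h7 : nrm (W.startProj k H *ᵥ v) ^ 2 ≤ p * (κ * δ) ^ 2 := by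
      rw [one_div, inv_mul_le_iff₀ hp0] at h6
      exact h6
    have h8 : p * (κ * δ) ^ 2 ≤ (p * (κ * δ)) ^ 2 := by
      rw [mul_pow p]
      exact mul_le_mul_of_nonneg_right (le_self_pow₀ hp two_ne_zero) (sq_nonneg _)
    refine (pow_le_pow_iff_left₀ (nrm_nonneg _) ?_ two_ne_zero).1 (h7.trans h8)
    have : 0 ≤ κ * δ := by rw [hκ]; linarith
    positivity
  have hv : nrm v ≤ p * (κ * δ) + W.qV * δ := (nrm_le_add_sub _ _).trans (add_le_add hβ h0)
  have ht : ∀ t ∈ Finset.range (W.T + 1), nrm (hist M φ t) ≤ (p + 1) * κ * δ := by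
    intro t ht
    have := nrm_hist_le hk hM h h' hδ (Nat.lt_succ_iff.1 (Finset.mem_range.1 ht))
    have e : (p + 1) * κ * δ = p * (κ * δ) + W.qV * δ + W.runError k * δ + δ := by rw [hκ]; ring
    rw [e]
    linarith
  have hS := nrm_slice_zero_le hM h' hδ
  have hsum := sum_le_sum ht
  rw [Finset.sum_const, Finset.card_range, nsmul_eq_mul] at hsum
  have hφ := nrm_le_slice_zero hM h hδ
  refine hφ.trans ?_
  have hS' : nrm (slice S φ 0) ≤ ((W.T + 1) * ((p + 1) * κ) + W.T) * δ := by
    push_cast at hsum hS ⊢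
    linarith
  calc _ ≤ (W.N k + 1) * (((W.T + 1) * ((p + 1) * κ) + W.T) * δ + 2 * W.N k * δ) + W.N k * δ := by
        gcongr
    _ = _ := by rw [totalError]; ring

/-- Soundness of the extended nonlocal game. -/
theorem value_le (F : Padding V W) (hk : 3 ≤ k) {p : ℝ} (hp : 1 ≤ p) (hMAP : 1 / p ≤ 1 - V.MAP)
    (S : (W.extendedGame k).Strategy) :
    S.value ≤ 1 - 1 / (60 * W.gameSize k * totalError W k p ^ 2) := by
  refine ExtGame.value_le_of_rej _ _ (fun H _ _ M hM φ => ?_) S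
  have h := W.propChecks_of_rej k hM φ
  have h' := (W.honestChecks_of_rej k hM φ).restrict W
  have hρ : 0 ≤ (W.extendedGame k).rej M φ := (W.extendedGame k).rej_nonneg M hM φ
  have key := F.nrm_le_totalError hk hM hp hMAP h h' (Real.sqrt_nonneg _)
  have h2 := pow_le_pow_left₀ (nrm_nonneg _) key 2
  rw [mul_pow, Real.sq_sqrt (by positivity)] at h2
  rw [one_div]
  by_cases hz : 60 * W.gameSize k * totalError W k p ^ 2 = 0
  · rw [hz, _root_.inv_zero, zero_mul]; exact hρ
  · have hpos : 0 < 60 * W.gameSize k * totalError W k p ^ 2 :=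
      lt_of_le_of_ne (by positivity) (Ne.symm hz)
    rw [inv_mul_le_iff₀ hpos]
    linarith

end Padding

/-! ### History states -/

section History

variable {q Y : Type} [Fintype q] [DecidableEq q] [Fintype Y] [DecidableEq Y] {N : ℕ}
  {e : Fin N → q}

/-- The history state of the sequence `f` of vectors. -/
def history (e : Fin N → q) (f : ℕ → (q → Bool) × Y → ℂ) : (q → Bool) × Y → ℂ :=
  ∑ t ∈ Finset.range (N + 1), fst.op (shift e t) *ᵥ f t

theorem atTime_mulVec_shift (he : Injective e) {v : (q → Bool) × Y → ℂ}
    (hv : fst.op (atTime e 0) *ᵥ v = v) (t : ℕ) :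
    fst.op (atTime e t) *ᵥ (fst.op (shift e t) *ᵥ v) = fst.op (shift e t) *ᵥ v := by
  rw [mulVec_mulVec, ← map_mul, atTime_mul_shift he, map_mul, ← mulVec_mulVec, hv]

theorem mulVec_history (he : Injective e) {f : ℕ → (q → Bool) × Y → ℂ}
    (hf : ∀ t, fst.op (atTime e 0) *ᵥ f t = f t) {A : Mat (q → Bool)}
    {p : ℕ → Prop} [DecidablePred p]
    (hA : ∀ t ≤ N, A * atTime e t = if p t then atTime e t else 0) :
    fst.op A *ᵥ history e f =
      ∑ t ∈ (Finset.range (N + 1)).filter p, fst.op (shift e t) *ᵥ f t := by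
  rw [history, mulVec_sum, Finset.sum_filter]
  refine sum_congr rfl fun t ht => ?_
  rw [← atTime_mulVec_shift he (hf t) t, mulVec_mulVec, ← map_mul,
    hA t (Nat.lt_succ_iff.1 (Finset.mem_range.1 ht))]
  split_ifs
  · rfl
  · rw [map_zero, zero_mulVec]

theorem clockProj_history (he : Injective e) {f : ℕ → (q → Bool) × Y → ℂ}
    (hf : ∀ t, fst.op (atTime e 0) *ᵥ f t = f t) (b : Bool) (t' : ℕ) :
    fst.op (prj b (clockOp e .Z t')) *ᵥ history e f =
      ∑ t ∈ (Finset.range (N + 1)).filter (fun t => decide (t' ≤ t) = b),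
        fst.op (shift e t) *ᵥ f t :=
  mulVec_history he hf fun _ ht => clockProj_mul_atTime ht b

theorem clockProj_false_one_history (he : Injective e) {f : ℕ → (q → Bool) × Y → ℂ}
    (hf : ∀ t, fst.op (atTime e 0) *ᵥ f t = f t) :
    fst.op (prj false (clockOp e .Z 1)) *ᵥ history e f = f 0 := by
  have h0 : (Finset.range (N + 1)).filter (fun t => decide (1 ≤ t) = false) = {0} := by
    ext t
    simp
  rw [clockProj_history he hf, h0, Finset.sum_singleton, shift_zero, map_one, one_mulVec]

theorem clockProj_true_last_history (he : Injective e) {f : ℕ → (q → Bool) × Y → ℂ}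
    (hf : ∀ t, fst.op (atTime e 0) *ᵥ f t = f t) :
    fst.op (prj true (clockOp e .Z N)) *ᵥ history e f = fst.op (shift e N) *ᵥ f N := by
  have h0 : (Finset.range (N + 1)).filter (fun t => decide (N ≤ t) = true) = {N} := by
    ext t
    simp
    omega
  rw [clockProj_history he hf, h0, Finset.sum_singleton]

theorem atTime_zero_history (he : Injective e) {f : ℕ → (q → Bool) × Y → ℂ}
    (hf : ∀ t, fst.op (atTime e 0) *ᵥ f t = f t) :
    fst.op (atTime e 0) *ᵥ history e f = f 0 := by
  have h0 : (Finset.range (N + 1)).filter (fun t => t = 0) = {0} := by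
    ext t
    simp
  rw [mulVec_history he hf (p := fun t => t = 0), h0, Finset.sum_singleton, shift_zero, map_one,
    one_mulVec]
  intro t ht
  split_ifs with h
  · rw [h, atTime_mul_self]
  · exact atTime_mul_atTime (Nat.zero_le _) ht (Ne.symm h)

theorem nrm_le_nrm_history (he : Injective e) {f : ℕ → (q → Bool) × Y → ℂ}
    (hf : ∀ t, fst.op (atTime e 0) *ᵥ f t = f t) : nrm (f 0) ≤ nrm (history e f) := by
  have hc : Ctr (fst.op (atTime e 0) : Matrix ((q → Bool) × Y) _ ℂ) := fst_op_ctr _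
  rw [← atTime_zero_history he hf]
  exact hc _

theorem clockCheck_history (he : Injective e) {f : ℕ → (q → Bool) × Y → ℂ}
    (hf : ∀ t, fst.op (atTime e 0) *ᵥ f t = f t) (t' : ℕ) :
    fst.op (prj false (clockOp e .Z (t' + 1)) * prj true (clockOp e .Z (t' + 2))) *ᵥ
      history e f = 0 := by
  rw [mulVec_history he hf (p := fun _ => False), Finset.filter_false, Finset.sum_empty]
  intro t ht
  rw [if_neg not_false, mul_assoc, clockProj_mul_atTime ht]
  split_ifs with h
  · rw [clockProj_mul_atTime ht, if_neg]
    simp at h ⊢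
    omega
  · rw [mul_zero]

theorem edgeTest_history (he : Injective e) {f : ℕ → (q → Bool) × Y → ℂ}
    (hf : ∀ t, fst.op (atTime e 0) *ᵥ f t = f t) {t₁ t₂ : ℕ} (h12 : t₁ < t₂) (ht : t₂ ≤ N)
    {A B : Mat ((q → Bool) × Y)}
    (hA : ∀ t, Commute (fst.op (shift e t)) A) (hB : ∀ t, Commute (fst.op (shift e t)) B)
    (hA' : Commute (fst.op (edgeProj e t₁ t₂)) A)
    (hB' : Commute (fst.op (edgeProj e t₁ t₂)) B)
    (h : A *ᵥ f t₁ = B *ᵥ f t₂) (h' : A *ᵥ f t₂ = B *ᵥ f t₁) :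
    edgeTest e t₁ t₂ A B *ᵥ history e f = 0 := by
  have hD : fst.op (edgeProj e t₁ t₂) *ᵥ history e f =
      fst.op (shift e t₁) *ᵥ f t₁ + fst.op (shift e t₂) *ᵥ f t₂ := by
    rw [mulVec_history he hf (p := fun t => t = t₁ ∨ t = t₂)]
    · have : (Finset.range (N + 1)).filter (fun t => t = t₁ ∨ t = t₂) = {t₁, t₂} := by
        ext t
        simp
        omega
      rw [this, Finset.sum_pair h12.ne]
    · intro t ht
      split_ifs with h
      · rw [(edgeProj_commute_atTime _ _ _).eq, atTime_mul_edgeProj h12.le ht h]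
      · rw [not_or] at h
        exact edgeProj_mul_atTime_eq_zero h12.le ht h.1 h.2
  have hs : Commute (fst.op (edgeProj e t₁ t₂))
      (fst.op (shift e t₁ * shift e t₂) : Mat ((q → Bool) × Y)) :=
    (edgeProj_commute_flipOp he h12.le ht indic).map _
  have hself : ∀ t (v : (q → Bool) × Y → ℂ),
      fst.op (shift e t) *ᵥ (fst.op (shift e t) *ᵥ v) = v := fun t v =>
    (op_isRefl _ (shift_isRefl e t)).mulVec_mulVec v
  have hcomm : ∀ v : (q → Bool) × Y → ℂ, fst.op (shift e t₁) *ᵥ (fst.op (shift e t₂) *ᵥ v) =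
      fst.op (shift e t₂) *ᵥ (fst.op (shift e t₁) *ᵥ v) := fun v =>
    commute_mulVec ((shift_commute e t₁ t₂).map fst.op) v
  have hA1 := fun t v => (commute_mulVec (hA t) v).symm
  have hB1 := fun t v => (commute_mulVec (hB t) v).symm
  rw [edgeTest, (hA'.sub_right (hs.mul_right hB')).eq, ← mulVec_mulVec, hD, sub_mulVec, mulVec_add,
    ← mulVec_mulVec, mulVec_add, hA1, hA1, hB1, hB1, h, h', map_mul, ← mulVec_mulVec, mulVec_add,
    mulVec_add, hself t₂, hcomm, hself t₁]
  abel

end History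

/-! ### Joint measurements of commuting reflections -/

theorem prj_isProjFamily {n : Type} [Fintype n] [DecidableEq n] {R : Mat n} (hR : IsRefl R) :
    IsProjFamily fun b => prj b R := by
  refine ⟨fun b => by simp [prj, hR.star_eq, star_sgn], fun b => ?_, fun b c h => ?_, ?_⟩
  · simp only [prj, mul_add, add_mul, one_mul, mul_one, smul_mul_assoc, mul_smul_comm, hR.mul_self]
    cases b <;> simp only [sgn_false, sgn_true] <;> module
  · simp only [prj, mul_add, add_mul, one_mul, mul_one, smul_mul_assoc, mul_smul_comm, hR.mul_self]
    cases b <;> cases c <;> simp only [sgn_false, sgn_true] <;> first | exact absurd rfl h | module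
  · rw [Fintype.sum_bool, add_comm, prj_add_prj]

theorem prj_mul_refl {n : Type} [Fintype n] [DecidableEq n] {R : Mat n} (hR : IsRefl R)
    (b : Bool) : prj b R * R = sgn b • prj b R := by
  simp only [prj, add_mul, one_mul, smul_mul_assoc, hR.mul_self]
  cases b <;> simp only [sgn_false, sgn_true] <;> module

/-- The projections of the joint measurement of commuting reflections. -/
def jointProj {n : Type} [Fintype n] [DecidableEq n] :
    ∀ {l : ℕ}, (Fin l → Mat n) → (Fin l → Bool) → Mat n
  | 0, _, _ => 1
  | _ + 1, R, a => prj (a 0) (R 0) * jointProj (fun j => R j.succ) fun j => a j.succ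

theorem commute_jointProj {n : Type} [Fintype n] [DecidableEq n] {A : Mat n} {l : ℕ}
    {R : Fin l → Mat n} (h : ∀ j, Commute A (R j)) (a : Fin l → Bool) :
    Commute A (jointProj R a) := by
  induction l with
  | zero => exact Commute.one_right _
  | succ l ih => exact ((prj_commute (h 0).symm _).symm).mul_right (ih (fun j => h j.succ) _)

theorem jointProj_mul {n : Type} [Fintype n] [DecidableEq n] {l : ℕ} {R : Fin l → Mat n}
    (hR : ∀ j, IsRefl (R j)) (h : ∀ j j', Commute (R j) (R j')) (a : Fin l → Bool) (j : Fin l) :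
    jointProj R a * R j = sgn (a j) • jointProj R a := by
  induction l with
  | zero => exact j.elim0
  | succ l ih =>
    refine Fin.cases ?_ (fun j => ?_) j
    · rw [jointProj, mul_assoc, ← (commute_jointProj (fun j => h 0 j.succ) _).eq, ← mul_assoc,
        prj_mul_refl (hR 0), smul_mul_assoc]
    · rw [jointProj, mul_assoc, ih (fun j => hR j.succ) (fun j j' => h _ _), mul_smul_comm]

theorem jointProj_isProjFamily {n : Type} [Fintype n] [DecidableEq n] {l : ℕ}
    {R : Fin l → Mat n} (hR : ∀ j, IsRefl (R j)) (h : ∀ j j', Commute (R j) (R j')) :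
    IsProjFamily (jointProj R) := by
  induction l with
  | zero =>
    exact ⟨fun a => conjTranspose_one, fun a => one_mul _,
      fun a b hab => absurd (Subsingleton.elim a b) hab, by simp [jointProj]⟩
  | succ l ih =>
    have ih := ih (fun j => hR j.succ) fun j j' => h _ _
    have hp := prj_isProjFamily (hR 0)
    have hc : ∀ b a, Commute (prj b (R 0)) (jointProj (fun j => R j.succ) a) := fun b a =>
      prj_commute (commute_jointProj (fun j => h 0 j.succ) a) b
    refine ⟨fun a => ?_, fun a => ?_, fun a b hab => ?_, ?_⟩
    · rw [jointProj, conjTranspose_mul, hp.herm, ih.herm, (hc _ _).eq]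
    · rw [jointProj, (hc _ _).symm.mul_mul_mul_comm, hp.idem, ih.idem]
    · rw [jointProj, jointProj, (hc _ _).symm.mul_mul_mul_comm]
      by_cases h0 : a 0 = b 0
      · rw [ih.orth, mul_zero]
        intro hs
        refine hab (funext fun j => Fin.cases h0 (fun j => congrFun hs j) j)
      · rw [hp.orth _ _ h0, zero_mul]
    · rw [← (Fin.consEquiv fun _ => Bool).sum_comp, Fintype.sum_prod_type]
      simp only [jointProj, Fin.consEquiv, Equiv.coe_fn_mk, Fin.cons_zero, Fin.cons_succ,
        ← mul_sum, ih.sum, mul_one]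
      exact hp.sum

theorem exists_joint {n ι : Type} [Fintype n] [DecidableEq n] [Fintype ι] [DecidableEq ι]
    {R : ι → Mat n} (hR : ∀ j, IsRefl (R j)) (h : ∀ j j', Commute (R j) (R j')) :
    ∃ M : (ι → Bool) → Mat n, IsProjFamily M ∧ ∀ j, obs M (fun a => a j) = R j := by
  let e := Fintype.equivFin ι
  have hJ := jointProj_isProjFamily (R := fun j => R (e.symm j)) (fun j => hR _) fun j j' => h _ _
  have hM : IsProjFamily fun a : ι → Bool => jointProj (fun j => R (e.symm j)) (a ∘ e.symm) := by
    refine ⟨fun a => hJ.herm _, fun a => hJ.idem _, fun a b hab => hJ.orth _ _ fun hc => hab ?_, ?_⟩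
    · funext j
      simpa using congrFun hc (e j)
    · rw [← hJ.sum]
      exact (e.arrowCongr (Equiv.refl Bool)).sum_comp (jointProj fun j => R (e.symm j))
  refine ⟨_, hM, fun j => hM.obs_eq fun a => ?_⟩
  have := jointProj_mul (R := fun j => R (e.symm j)) (fun j => hR _) (fun j j' => h _ _)
    (a ∘ e.symm) (e j)
  simpa using this

/-! ### The rejection probability of strategies that pass almost all checks -/

namespace NormalVerifier

variable {r : ℕ} {W : NormalVerifier r} {k : ℕ} {H : Fin r → Type} [∀ i, Fintype (H i)]
  [∀ i, DecidableEq (H i)] {M : W.Obs H}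

/-- The checks of the game for honest players, except the one of the output, are passed. -/
structure PassesHonest (W : NormalVerifier r) (k : ℕ)
    (M : W.Obs H) (φ : W.Space k H → ℂ) : Prop where
  clock : ∀ t : ℕ, W.onRef k (prj false (clockOp C .Z (t + 1)) *
    prj true (clockOp C .Z (t + 2))) *ᵥ φ = 0
  player : ∀ i, prj true (W.onRef k (clockOp C .Z (W.L + 1)) *
    W.playerObs k M i (.pauli (W.onB .Z)) (W.onB .Z)) *ᵥ φ = 0
  step : ∀ b l j, edgeTest C (W.time b l - 1) (W.time b l)
    (W.stepLeft k M (W.step b l) j) (W.stepRight k M (W.step b l) j) *ᵥ φ = 0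
  prover : edgeTest C W.L (W.L + 1) ((1 / 2 : ℂ) • 1) ((1 / 2 : ℂ) • W.xapOp k M) *ᵥ φ = 0
  start : ∀ j, (W.onRef k (prj false (clockOp C .Z 1)) *
    prj true (W.refPauli k (.V j) .Z)) *ᵥ φ = 0

theorem nrm_sq_eq_zero {J : Type} [Fintype J] {v : J → ℂ} (h : v = 0) : nrm v ^ 2 = 0 := by
  rw [h, nrm_zero, zero_pow two_ne_zero]

theorem rej_honestGame_le (hM : ProjMeas M) {φ : W.Space k H → ℂ}
    (h : W.PassesHonest k M φ) : (W.honestGame k).rej M φ ≤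
      nrm ((W.onRef k (prj true (clockOp C .Z W.T)) *
        prj false (W.refPauli k (.V ⟨0, W.qV_pos⟩) .Z)) *ᵥ φ) ^ 2 := by
  have c0 : (W.honestClock k).rej M φ = 0 := by
    refine ExtGame.rej_mix_eq_zero _ M hM φ fun b => ?_
    cases b
    · simp only [Bool.false_eq_true, if_false]
      exact ExtGame.rej_mix_eq_zero _ M hM φ fun t =>
        (W.rej_leaf_clock k hM (t : ℕ) φ).trans (nrm_sq_eq_zero (h.clock t))
    · simp only [if_true]
      exact ExtGame.rej_mix_eq_zero _ M hM φ fun i =>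
        (W.rej_leaf_honestB k hM i φ).trans (nrm_sq_eq_zero (h.player i))
  have c1 : (W.verifierProp k).rej M φ = 0 := by
    refine ExtGame.rej_mix_eq_zero _ M hM φ fun p => ?_
    obtain ⟨G, hG, hrej⟩ := W.stepCheck_eq_mix k hM (W.time_bounds p.1 p.2) (W.step p.1 p.2)
    refine (congrArg (fun G : W.Game k => G.rej M φ) hG).trans ?_
    exact ExtGame.rej_mix_eq_zero _ M hM φ fun j =>
      (hrej j φ).trans (nrm_sq_eq_zero (h.step p.1 p.2 j))
  have c2 : (W.proverProp k).rej M φ = 0 :=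
    (W.rej_proverProp k hM φ).trans (nrm_sq_eq_zero h.prover)
  have c3 : (W.honestInit k).rej M φ = 0 :=
    ExtGame.rej_mix_eq_zero _ M hM φ fun j =>
      (W.rej_leaf_honestInit k hM j φ).trans (nrm_sq_eq_zero (h.start j))
  refine (ExtGame.rej_mix_le _ M hM φ).trans (le_of_eq ?_)
  rw [Fin.sum_univ_five, ← W.rej_honestOutput k hM φ]
  change (W.honestClock k).rej M φ + (W.verifierProp k).rej M φ + (W.proverProp k).rej M φ +
    (W.honestInit k).rej M φ + (W.honestOutput k).rej M φ = _
  rw [c0, c1, c2, c3]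
  ring

theorem rej_extendedGame_le (hM : ProjMeas M) {φ ψ : W.Space k H → ℂ}
    (h : W.PropChecks k M φ 0) (hψ : W.onRef k (prj false (clockOp S .Z 1)) *ᵥ φ = ψ)
    (h' : W.PassesHonest k M ψ) : (W.extendedGame k).rej M φ ≤
      nrm ((W.onRef k (prj true (clockOp C .Z W.T)) *
        prj false (W.refPauli k (.V ⟨0, W.qV_pos⟩) .Z)) *ᵥ ψ) ^ 2 := by
  have sq : ∀ {v : W.Space k H → ℂ}, nrm v ≤ 0 → nrm v ^ 2 = 0 := fun hv => by
    rw [le_antisymm hv (nrm_nonneg _), zero_pow two_ne_zero]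
  have c0 : (W.clockCheck k).rej M φ = 0 :=
    ExtGame.rej_mix_eq_zero _ M hM φ fun t =>
      (W.rej_leaf_clock k hM (t : ℕ) φ).trans (sq (h.clock t))
  have d0 : (W.propCheck k).rej M φ = 0 :=
    ExtGame.rej_mix_eq_zero _ M hM φ fun t =>
      (W.rej_reflCheck k hM (t := t) t.2 _ φ).trans (sq (h.prop t))
  have d1 : (W.initCheck k).rej M φ = 0 :=
    ExtGame.rej_mix_eq_zero _ M hM φ fun c => (W.rej_leaf_init k hM c φ).trans (sq (h.start c))
  have d2 : (W.consCheck k).rej M φ = 0 := by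
    refine ExtGame.rej_mix_eq_zero _ M hM φ fun p => ?_
    have hv : consVertex k r W.m p.1 p.2.1 p.2.2 ≤ consVertex k r W.m p.1 p.2.1 (p.2.2 + 1) := by
      rw [consVertex_succ _ _ _ p.2.2.2]; omega
    exact (W.rej_leaf_cons k hM hv (consVertex_le k r W.m p.1.2 p.2.1.2) _ φ).trans (sq (h.cons p))
  have c1 : (W.consPropGame k).rej M φ = 0 := by
    refine ExtGame.rej_mix_eq_zero _ M hM φ fun c => ?_
    fin_cases c
    · exact d0
    · exact d1
    · exact d2
  have c2 : (W.outputCheck k).rej M φ = (W.honestGame k).rej M ψ := by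
    rw [outputCheck, ExtGame.rej_guarded, sMeas, clockMeas_K, ← hψ]
  refine (ExtGame.rej_mix_le _ M hM φ).trans ?_
  rw [Fin.sum_univ_three]
  change (W.clockCheck k).rej M φ + (W.consPropGame k).rej M φ + (W.outputCheck k).rej M φ ≤ _
  rw [c0, c1, c2, zero_add, zero_add]
  exact rej_honestGame_le hM h'

end NormalVerifier

namespace NormalVerifier

variable {r : ℕ} {W : NormalVerifier r} {k : ℕ} {d : Fin r → Type} [∀ i, Fintype (d i)]
  [∀ i, DecidableEq (d i)]

/-! ### Honest players -/

/-- The spaces of honest players: their qubits and a private space. -/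
abbrev HonestSpace (W : NormalVerifier r) (d : Fin r → Type) (i : Fin r) : Type :=
  (Fin W.m → Bool) × d i

/-- Honest players measure the operators they are asked for. -/
structure HonestObs (M : W.Obs (W.HonestSpace d))
    (X : ∀ i, Mat (W.HonestSpace d i)) : Prop where
  proj : ProjMeas M
  pauli : ∀ i P, obs (M i (.pauli P)) (bit P _) = fst.op (pauliOp P)
  multi : ∀ i (Q : Finset (Pauli W.m)), (∀ P ∈ Q, ∀ P' ∈ Q, Commute (pauliOp P) (pauliOp P')) →
    ∀ P ∈ Q, obs (M i (.multi Q)) (bit P _) = fst.op (pauliOp P)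
  xap : ∀ i, obs (M i .xap) (xapBit _) = X i

theorem exists_isProjFamily (i : Fin r) {X : Mat (W.HonestSpace d i)}
    (hX : IsRefl X) (g : Question W.m) :
    ∃ M : Answer g → Mat (W.HonestSpace d i), IsProjFamily M ∧
      (∀ P, g = .pauli P → obs M (bit P _) = fst.op (pauliOp P)) ∧
      (∀ Q : Finset (Pauli W.m), g = .multi Q →
        (∀ P ∈ Q, ∀ P' ∈ Q, Commute (pauliOp P) (pauliOp P')) →
        ∀ P ∈ Q, obs M (bit P _) = fst.op (pauliOp P)) ∧
      (g = .xap → obs M (xapBit _) = X) := by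
  have hone : ∀ {R : Mat (W.HonestSpace d i)}, IsRefl R →
      obs (fun b => prj b R) (fun b : Bool => b) = R := fun hR =>
    (prj_isProjFamily hR).obs_eq fun b => prj_mul_refl hR b
  cases g with
  | nothing =>
    refine ⟨fun _ => 1, ⟨by simp, by simp, fun a b h => absurd (Subsingleton.elim (α := Unit) a b) h, ?_⟩,
      by simp, by simp, by simp⟩
    exact Fintype.sum_unique (ι := Unit) fun _ => (1 : Matrix (W.HonestSpace d i) _ ℂ)
  | pauli P =>
    have hR : IsRefl (fst.op (pauliOp P) : Matrix (W.HonestSpace d i) _ ℂ) :=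
      op_isRefl _ (pauliOp_isRefl P)
    refine ⟨fun b : Bool => prj b (fst.op (pauliOp P)), prj_isProjFamily hR, ?_, by simp, by simp⟩
    intro P' hP'
    rw [Question.pauli.injEq] at hP'
    subst hP'
    exact hone hR
  | multi Q =>
    by_cases hc : ∀ P ∈ Q, ∀ P' ∈ Q, Commute (pauliOp P) (pauliOp P')
    · obtain ⟨M, hM, h⟩ := exists_joint (ι := Q)
        (R := fun P => (fst.op (pauliOp P.1) : Matrix (W.HonestSpace d i) _ ℂ))
        (fun P => op_isRefl _ (pauliOp_isRefl _)) fun P P' => (hc _ P.2 _ P'.2).map _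
      refine ⟨M, hM, by simp, ?_, by simp⟩
      intro Q' hQ' _ P hP
      rw [Question.multi.injEq] at hQ'
      subst hQ'
      have hb : bit P (.multi Q) = fun a : Q → Bool => a ⟨P, hP⟩ := by
        funext a
        exact dif_pos hP
      rw [hb]
      exact h ⟨P, hP⟩
    · obtain ⟨M, hM, h⟩ := exists_joint (ι := Q)
        (R := fun _ => (1 : Mat (W.HonestSpace d i)))
        (fun P => IsRefl.one) fun P P' => Commute.one_left _
      refine ⟨M, hM, by simp, ?_, by simp⟩
      intro Q' hQ' hc'
      rw [Question.multi.injEq] at hQ'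
      subst hQ'
      exact absurd hc' hc
  | xap =>
    exact ⟨fun b : Bool => prj b X, prj_isProjFamily hX, by simp, by simp, fun _ => hone hX⟩

theorem exists_honestObs {X : ∀ i, Mat (W.HonestSpace d i)}
    (hX : ∀ i, IsRefl (X i)) : ∃ M, HonestObs M X := by
  choose M h1 h2 h3 h4 using fun i => exists_isProjFamily (W := W) i (hX i)
  exact ⟨M, h1, fun i P => h2 i _ P rfl, fun i Q hQ P hP => h3 i _ Q rfl hQ P hP,
    fun i => h4 i _ rfl⟩

variable (W k d) in
/-- The qubits of player `i`. -/
def qubitsLens (i : Fin r) : Lens (W.Space k (W.HonestSpace d)) (Fin W.m → Bool) :=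
  (playerLens i).comp fst

variable {M : W.Obs (W.HonestSpace d)}
  {X : ∀ i, Mat (W.HonestSpace d i)}

theorem HonestObs.playerObs_pauli (h : HonestObs M X) (i : Fin r) (P : Pauli W.m) :
    W.playerObs k M i (.pauli P) P = (W.qubitsLens k d i).op (pauliOp P) := by
  rw [playerObs, h.pauli, qubitsLens, op_comp]

theorem HonestObs.playerObs_multi (h : HonestObs M X) (i : Fin r) {Q : Finset (Pauli W.m)} {l : ℕ}
    (hQ : Q ∈ powerSet W.m l) {P : Pauli W.m} (hP : P ∈ Q) :
    W.playerObs k M i (.multi Q) P = (W.qubitsLens k d i).op (pauliOp P) := by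
  simp only [powerSet, mem_filter, mem_univ, true_and] at hQ
  rw [playerObs, h.multi i Q hQ.2.2.1 P hP, qubitsLens, op_comp]

/-! ### The constraints hold -/

theorem wordOp_eq_prod {J α : Type} [Fintype J] [DecidableEq J] (op : α → Mat J)
    (l : List α) : wordOp op l = (l.reverse.map op).prod := by
  induction l with
  | nil => rfl
  | cons a l ih => rw [wordOp_cons, ih, List.reverse_cons, List.map_append, List.prod_append]; simp

theorem wordOp_support {m : ℕ} (P : Pauli m) :
    wordOp (fun v => pauliOp (single v (P v))) (support P).toList = pauliOp P := by
  rw [wordOp_eq_prod]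
  have h := prod_coord_op (d := fun _ : Fin m => Bool) (fun v => (P v).mat) (support P).toList.reverse
    (List.nodup_reverse.2 (Finset.nodup_toList _))
  simp only [pauliOp_single]
  rw [h, pauliOp]
  congr 1
  funext v
  simp only [List.mem_reverse, Finset.mem_toList, support, mem_filter, mem_univ, true_and]
  split_ifs with hv
  · rfl
  · rw [not_not.1 hv]; rfl

theorem pauliOp_X_Z {m : ℕ} (u : Fin m) : pauliOp (single u .Z) * pauliOp (single u .X) *
    (pauliOp (single u .Z) * pauliOp (single u .X)) = -1 := by
  have h : pauliOp (single u .X) * pauliOp (single u .Z) =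
      -(pauliOp (single u .Z) * pauliOp (single u .X)) := by
    rw [pauliOp_single, pauliOp_single, coord_X_mul_Z]
  rw [mul_assoc, ← mul_assoc (pauliOp (single u .X)), h, neg_mul, mul_neg, mul_assoc,
    pauliOp_mul_self, mul_one, pauliOp_mul_self]

theorem HonestObs.constraint (h : HonestObs M X) {C : Constraint r W.m}
    (hC : C ∈ constraints k r W.m) : wordOp (W.reflOp k M) C.1 = sgn C.2 • 1 := by
  obtain ⟨i, -, hC⟩ := mem_flatMap.1 hC
  set π := (W.qubitsLens k d i).op
  have hrefl : ∀ P, W.reflOp k M (.refl i P) = π (pauliOp P) := h.playerObs_pauli i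
  have hone : ∀ u D, W.reflOp k M (one i u D) = π (pauliOp (single u D)) := fun u D => hrefl _
  have hsq : ∀ P : Pauli W.m, π (pauliOp P) * π (pauliOp P) = 1 := fun P => by
    rw [← map_mul, pauliOp_mul_self, map_one]
  have hXZ : ∀ u : Fin W.m, π (pauliOp (single u .Z)) * (π (pauliOp (single u .X)) *
      (π (pauliOp (single u .Z)) * π (pauliOp (single u .X)))) = -1 := fun u => by
    rw [← map_mul, ← map_mul, ← map_mul, ← mul_assoc, pauliOp_X_Z, map_neg, map_one]
  simp only [playerConstraints, mem_append] at hC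
  rcases hC with (((hC | hC) | hC) | hC) | hC
  · obtain ⟨u, -, hC⟩ := mem_flatMap.1 hC
    obtain ⟨v, hv, hC⟩ := mem_flatMap.1 hC
    obtain ⟨D, -, hC⟩ := mem_flatMap.1 hC
    obtain ⟨E, -, rfl⟩ := mem_map.1 hC
    have hvu : v ≠ u := by simpa using (List.mem_filter.1 hv).2
    have hc : Commute (π (pauliOp (single v E))) (π (pauliOp (single u D))) := by
      rw [pauliOp_single, pauliOp_single]
      exact (coord_op_commute hvu _ _).map _
    simp only [wordOp_cons, wordOp_nil, one_mul, hone, sgn_false, one_smul]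
    rw [mul_assoc, hc.symm.mul_mul_mul_comm, hsq, hsq, one_mul]
  · obtain ⟨u, -, rfl⟩ := mem_map.1 hC
    simp only [wordOp_cons, wordOp_nil, one_mul, hone, sgn_true, neg_smul, one_smul, mul_assoc]
    exact hXZ u
  · obtain ⟨u, -, hC⟩ := mem_flatMap.1 hC
    obtain ⟨v, -, hC⟩ := mem_flatMap.1 hC
    obtain ⟨D, -, rfl⟩ := mem_map.1 hC
    simp only [wordOp_cons, wordOp_nil, one_mul, hone, sgn_true, neg_smul, one_smul]
    calc _ = π (pauliOp (single v D)) * (π (pauliOp (single u .Z)) * (π (pauliOp (single u .X)) *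
          (π (pauliOp (single u .Z)) * π (pauliOp (single u .X))))) * π (pauliOp (single v D)) := by
          simp only [mul_assoc]
      _ = _ := by rw [hXZ, mul_neg, mul_one, neg_mul, hsq]
  · obtain ⟨P, -, rfl⟩ := mem_map.1 hC
    simp only [wordOp_cons, hrefl, sgn_false, one_smul, wordOp_map]
    simp only [hone]
    rw [Lens.op_wordOp, wordOp_support, hsq]
  · obtain ⟨Q, hQ, hC⟩ := mem_flatMap.1 hC
    obtain ⟨P, hP, rfl⟩ := mem_map.1 hC
    have hd : W.reflOp k M (.derived i Q P) = π (pauliOp P) :=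
      h.playerObs_multi i (Finset.mem_toList.1 hQ) (Finset.mem_toList.1 hP)
    simp only [wordOp_cons, wordOp_nil, one_mul, hrefl, hd, sgn_false, one_smul]
    exact hsq P

theorem constraint_ne_nil {C : Constraint r W.m} (hC : C ∈ constraints k r W.m) : C.1 ≠ [] := by
  obtain ⟨i, -, hC⟩ := mem_flatMap.1 hC
  simp only [playerConstraints, mem_append] at hC
  rcases hC with (((hC | hC) | hC) | hC) | hC
  · obtain ⟨u, -, hC⟩ := mem_flatMap.1 hC
    obtain ⟨v, hv, hC⟩ := mem_flatMap.1 hC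
    obtain ⟨D, -, hC⟩ := mem_flatMap.1 hC
    obtain ⟨E, -, rfl⟩ := mem_map.1 hC
    simp
  · obtain ⟨u, -, rfl⟩ := mem_map.1 hC
    simp
  · obtain ⟨u, -, hC⟩ := mem_flatMap.1 hC
    obtain ⟨v, -, hC⟩ := mem_flatMap.1 hC
    obtain ⟨D, -, rfl⟩ := mem_map.1 hC
    simp
  · obtain ⟨P, -, rfl⟩ := mem_map.1 hC
    simp
  · obtain ⟨Q, hQ, hC⟩ := mem_flatMap.1 hC
    obtain ⟨P, hP, rfl⟩ := mem_map.1 hC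
    simp

theorem take_consVertex_succ (k r m : ℕ) {i l j : ℕ} (hi : i < 2 * (r * m))
    (hl : l < (seqQ k r m).length) (hj : j < (constraints k r m).length) :
    (seqU k r m).take (consVertex k r m i l (j + 1)) =
      (seqU k r m).take (consVertex k r m i l j) ++ (constraints k r m)[j].1 := by
  rw [take_consVertex k r m hi hl, take_consVertex k r m hi hl, take_succ_eq hj,
    List.flatMap_append]
  simp only [List.append_assoc, List.flatMap_cons, List.flatMap_nil, List.append_nil]

/-- The history state over the register `S`. -/
def sHistory (M : W.Obs (W.HonestSpace d))
    (ψ : W.Space k (W.HonestSpace d) → ℂ) : W.Space k (W.HonestSpace d) → ℂ :=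
  history S fun t => wordOp (W.reflOp k M) ((seqU k r W.m).take t) *ᵥ ψ

theorem wordOp_reflOp_mem (l : List (Refl r W.m)) :
    wordOp (W.reflOp k M) l ∈ W.localOps k (W.HonestSpace d) :=
  W.wordOp_mem k (W.reflOp_mem k) l

theorem outer_edgeProj (t₁ t₂ : ℕ) : W.Outer k (W.onRef k (edgeProj S t₁ t₂) :
    Mat (W.Space k (W.HonestSpace d))) := by
  refine W.outer_proj k fun x y h => ?_
  have : ∀ t, clockBit S x t = clockBit S y t := by
    intro t
    unfold clockBit
    split_ifs
    · exact h _ (by simp)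
    · rfl
  simp only [EdgeSpace, this]

theorem sHistory_zero {ψ : W.Space k (W.HonestSpace d) → ℂ}
    (hψ : W.onRef k (atTime S 0) *ᵥ ψ = ψ) (t : ℕ) :
    W.onRef k (atTime S 0) *ᵥ (wordOp (W.reflOp k M) ((seqU k r W.m).take t) *ᵥ ψ) =
      wordOp (W.reflOp k M) ((seqU k r W.m).take t) *ᵥ ψ := by
  rw [commute_mulVec ((W.outer_atTime k (W.S_ne_X k) 0).commute _ (wordOp_reflOp_mem _)), hψ]

theorem HonestObs.propChecks (h : HonestObs M X) {ψ : W.Space k (W.HonestSpace d) → ℂ}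
    (hψ : W.onRef k (atTime S 0) *ᵥ ψ = ψ)
    (hX : ∀ c, prj true (W.refPauli k (.X c) .X) *ᵥ ψ = 0) :
    W.PropChecks k M (sHistory M ψ) 0 := by
  have hf := sHistory_zero (M := M) hψ
  have hS := W.S_injective k
  have hsh := fun t => W.outer_shift k (H := W.HonestSpace d) (W.S_ne_X k) t
  have ledge : ∀ {v : W.Space k (W.HonestSpace d) → ℂ}, v = 0 → nrm v ≤ 0 := fun hv => by
    rw [hv, nrm_zero]
  have hrefl := W.reflOp_isRefl k h.proj
  refine ⟨fun t => ledge (clockCheck_history hS hf t), fun t => ledge ?_, fun c => ledge ?_,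
    fun p => ledge ?_⟩
  · have hR := W.reflOp_mem k (M := M) ((seqU k r W.m).get t)
    have hstep : wordOp (W.reflOp k M) ((seqU k r W.m).take (t + 1)) *ᵥ ψ =
        W.reflOp k M ((seqU k r W.m).get t) *ᵥ (wordOp (W.reflOp k M) ((seqU k r W.m).take t) *ᵥ ψ) := by
      rw [take_succ_eq t.2, wordOp_append, wordOp_singleton, ← mulVec_mulVec]
      rfl
    refine edgeTest_history hS hf (Nat.lt_succ_self _) t.2 (fun s => (Commute.one_right _).smul_right _)
      (fun s => ((hsh s).commute _ hR).smul_right _) ((Commute.one_right _).smul_right _)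
      (((outer_edgeProj _ _).commute _ hR).smul_right _) ?_ ?_
    · rw [hstep, smul_mulVec, smul_mulVec, one_mulVec, (hrefl _).mulVec_mulVec]
    · rw [hstep, smul_mulVec, smul_mulVec, one_mulVec]
  · have hc : Commute (W.onRef k (atTime S 0)) (prj true (W.refPauli k (.X c) .X) :
        Mat (W.Space k (W.HonestSpace d))) :=
      (W.outer_atTime k (W.S_ne_X k) 0).commute _ (W.prj_mem k (W.refPauli_X_mem k c _))
    rw [hc.eq, ← mulVec_mulVec, sHistory, atTime_zero_history hS hf, List.take_zero, wordOp_nil,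
      one_mulVec, hX]
  · obtain ⟨⟨i, hi⟩, ⟨l, hl⟩, ⟨j, hj⟩⟩ := p
    have hC : (constraints k r W.m)[j] ∈ constraints k r W.m := List.getElem_mem hj
    have hlen := List.length_pos_iff.2 (constraint_ne_nil hC)
    have hv := consVertex_succ k r W.m (i := i) (l := l) hj
    have hstep : wordOp (W.reflOp k M) ((seqU k r W.m).take (consVertex k r W.m i l (j + 1))) *ᵥ ψ =
        sgn (constraints k r W.m)[j].2 •
          (wordOp (W.reflOp k M) ((seqU k r W.m).take (consVertex k r W.m i l j)) *ᵥ ψ) := by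
      rw [take_consVertex_succ k r W.m hi hl hj, wordOp_append, h.constraint hC, smul_mul_assoc,
        one_mul, smul_mulVec]
    have hcom : ∀ A : Mat (W.Space k (W.HonestSpace d)),
        Commute A ((1 / 2 : ℂ) • (sgn (constraints k r W.m)[j].2 • 1)) := fun A =>
      ((Commute.one_right _).smul_right _).smul_right _
    refine edgeTest_history hS hf (t₁ := consVertex k r W.m i l j)
      (t₂ := consVertex k r W.m i l (j + 1)) (by omega) (consVertex_le k r W.m hi hl)
      (fun s => (Commute.one_right _).smul_right _) (fun s => hcom _)
      ((Commute.one_right _).smul_right _) (hcom _) ?_ ?_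
    · rw [hstep]
      simp only [smul_mulVec, one_mulVec, List.get_eq_getElem]
      cases (constraints k r W.m)[j].2 <;> simp
    · rw [hstep]
      simp only [smul_mulVec, one_mulVec, List.get_eq_getElem]

end NormalVerifier

/-! ### Products of lenses -/

/-- A factor of each of the factors of a product. -/
def Lens.pi {ι : Type} {d e : ι → Type} (L : ∀ i, Lens (d i) (e i)) :
    Lens (∀ i, d i) (∀ i, e i) where
  get z i := (L i).get (z i)
  set z a i := (L i).set (z i) (a i)
  get_set _ _ := funext fun i => (L i).get_set _ _
  set_get _ := funext fun i => (L i).set_get _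
  set_set _ _ _ := funext fun i => (L i).set_set _ _ _

section Tensor

variable {ι : Type} [Fintype ι] [DecidableEq ι] {d e : ι → Type} [∀ i, Fintype (d i)]
  [∀ i, DecidableEq (d i)] [∀ i, Fintype (e i)] [∀ i, DecidableEq (e i)]

theorem Lens.pi_op_tensor (L : ∀ i, Lens (d i) (e i)) (A : ∀ i, Mat (e i)) :
    (Lens.pi L).op (tensor A) = tensor fun i => (L i).op (A i) := by
  ext x y
  rw [Lens.op_apply]
  simp only [tensor, of_apply, Lens.op_apply]
  by_cases h : ∀ i, (L i).set (x i) ((L i).get (y i)) = y i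
  · refine (if_pos (funext h)).trans ?_
    exact Finset.prod_congr rfl fun i _ => (if_pos (h i)).symm
  · refine (if_neg fun h' => h (congrFun h')).trans ?_
    obtain ⟨i, hi⟩ := not_forall.1 h
    exact (Finset.prod_eq_zero (mem_univ i) (if_neg hi)).symm

theorem coord_op_mul_tensor {A : ∀ i, Mat (d i)} {i : ι} {B B' : Mat (d i)}
    (h : B * A i = A i * B') : (coord i).op B * tensor A = tensor A * (coord i).op B' := by
  rw [coord_op_eq_tensor, coord_op_eq_tensor, tensor_mul, tensor_mul]
  congr 1
  funext i'
  by_cases hi : i' = i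
  · subst hi; simpa using h
  · simp [update_of_ne hi]

end Tensor

/-- Operators on a factor, applied to a product of a function that does not depend on that factor
and a vector on a smaller space. -/
theorem Lens.op_mulVec_mul {J I A : Type} [Fintype J] [DecidableEq J] [Fintype I] [DecidableEq I]
    [Fintype A] [DecidableEq A] (L : Lens J A) (L' : Lens I A) {g : J → I}
    (hget : ∀ z, L.get z = L'.get (g z)) (hset : ∀ z a, g (L.set z a) = L'.set (g z) a)
    {c : J → ℂ} (hc : ∀ z a, c (L.set z a) = c z) (M : Mat A) (v : I → ℂ) :
    (L.op M *ᵥ fun z => c z * v (g z)) = fun z => c z * (L'.op M *ᵥ v) (g z) := by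
  funext z
  rw [op_mulVec, op_mulVec, mul_sum]
  refine sum_congr rfl fun a _ => ?_
  rw [hc, hset, hget]
  ring

theorem Lens.card_mul_nrm_sq {J I : Type} [Fintype J] [DecidableEq J] [Fintype I] [DecidableEq I]
    (L : Lens J I) {c : J → ℂ} (hc : ∀ z a, c (L.set z a) = c z) (v : I → ℂ) :
    Fintype.card I * nrm (fun z => c z * v (L.get z)) ^ 2 = nrm c ^ 2 * nrm v ^ 2 := by
  rw [← L.sum_nrm_sq_set, nrm_sq c, sum_mul]
  refine sum_congr rfl fun z _ => ?_
  rw [nrm_sq, nrm_sq, mul_sum]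
  refine sum_congr rfl fun a _ => ?_
  rw [Function.comp_apply, hc, L.get_set, norm_mul, mul_pow]

/-! ### The reflection of a player that applies an isometry -/

section Turn

variable {J : Type} [Fintype J] [DecidableEq J] {z x w : Mat J}

/-- The reflection that applies `w` and flips the qubit with operators `x` and `z` if that qubit is
`0`. -/
def turn (z x w : Mat J) : Mat J := x * (prj false z * w + prj true z * wᴴ)

theorem mul_prj_of_anticommute (hzx : x * z = -(z * x)) (b : Bool) :
    x * prj b z = prj (!b) z * x := by
  rw [prj, prj, mul_smul_comm, smul_mul_assoc, mul_add, add_mul, mul_smul_comm, smul_mul_assoc, hzx]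
  cases b <;> simp

theorem commute_conjTranspose (hz : IsRefl z) (hw : Commute w z) : Commute wᴴ z := by
  have := congrArg conjTranspose hw.eq
  rw [conjTranspose_mul, conjTranspose_mul, hz.star_eq] at this
  exact this.symm

theorem turn_isRefl (hz : IsRefl z) (hx : IsRefl x) (hzx : x * z = -(z * x)) (hw : wᴴ * w = 1)
    (hwz : Commute w z) (hwx : Commute w x) : IsRefl (turn z x w) := by
  have hp := prj_isProjFamily hz
  have hw' : w * wᴴ = 1 := mul_eq_one_comm.1 hw
  have c : ∀ b, Commute (prj b z) w := fun b => prj_commute hwz.symm b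
  have cx := commute_conjTranspose hx hwx
  have c' : ∀ b, Commute (prj b z) wᴴ := fun b => prj_commute (commute_conjTranspose hz hwz).symm b
  have hswap : x * (prj false z * w + prj true z * wᴴ) = (prj true z * w + prj false z * wᴴ) * x := by
    rw [mul_add, ← mul_assoc, ← mul_assoc, mul_prj_of_anticommute hzx, mul_prj_of_anticommute hzx,
      mul_assoc, ← hwx.eq, mul_assoc, ← cx.eq, add_mul, mul_assoc, mul_assoc]
    rfl
  have e : ∀ b b' : Bool, ∀ A B : Mat J, Commute (prj b' z) A →
      prj b z * A * (prj b' z * B) = prj b z * prj b' z * (A * B) := fun b b' A B h =>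
    h.symm.mul_mul_mul_comm _ _
  constructor
  · rw [turn, conjTranspose_mul, conjTranspose_add, conjTranspose_mul, conjTranspose_mul, hp.herm,
      hp.herm, conjTranspose_conjTranspose, hx.star_eq, hswap, ← (c' false).eq, ← (c true).eq,
      add_comm]
  · rw [turn]
    nth_rw 1 [hswap]
    rw [mul_assoc, ← mul_assoc x, hx.mul_self, one_mul, add_mul, mul_add, mul_add,
      e _ _ _ _ (c _), e _ _ _ _ (c _), e _ _ _ _ (c' _), e _ _ _ _ (c' _), hp.idem, hp.idem,
      hp.orth true false (by simp), hp.orth false true (by simp), hw, hw', zero_mul, zero_mul,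
      zero_add, add_zero, mul_one, mul_one, add_comm, prj_add_prj]

theorem turn_mul_prj (hz : IsRefl z) (hw : Commute w z) :
    turn z x w * prj false z = x * w * prj false z := by
  have hw' := commute_conjTranspose hz hw
  have hp := prj_isProjFamily hz
  rw [turn, mul_assoc, add_mul, mul_assoc, mul_assoc, ← (prj_commute hw.symm false).eq,
    ← (prj_commute hw'.symm false).eq, ← mul_assoc, ← mul_assoc, hp.idem,
    hp.orth true false (by simp), zero_mul, add_zero, mul_assoc, (prj_commute hw.symm false).eq]

theorem prj_mul_turn (hz : IsRefl z) (hzx : x * z = -(z * x)) (hw : Commute w z) :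
    prj false z * turn z x w = turn z x w * prj true z := by
  have hw' := commute_conjTranspose hz hw
  have hp := prj_isProjFamily hz
  have h1 : prj false z * x = x * prj true z := (mul_prj_of_anticommute hzx true).symm
  rw [turn, ← mul_assoc, h1, mul_assoc, mul_assoc, mul_add, add_mul, mul_assoc, mul_assoc,
    ← (prj_commute hw.symm true).eq, ← (prj_commute hw'.symm true).eq, ← mul_assoc, ← mul_assoc,
    ← mul_assoc, hp.orth true false (by simp), hp.orth false true (by simp)]

end Turn

namespace NormalVerifier

variable {r : ℕ} (W : NormalVerifier r) (k : ℕ) (d : Fin r → Type)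

/-! ### The qubits of the verifier in the hands of honest players -/

/-- The qubits of the verifier: those of `V` are with the referee, those of `M_i` with player `i`. -/
def realLens : Lens (W.Space k (W.HonestSpace d)) (Wire W.qV r W.qM → Bool) where
  get z := Sum.elim (fun j => z.1 (.V j)) fun p => (z.2 p.1).1 p.2.succ
  set z x := (fun q => match q with
      | .V j => x (.inl j)
      | q => z.1 q,
    fun i => (Fin.cons (α := fun _ => Bool) ((z.2 i).1 0) fun j => x (.inr (i, j)), (z.2 i).2))
  get_set z x := by
    funext u
    rcases u with j | ⟨i, j⟩ <;> rfl
  set_get z := by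
    refine Prod.ext (funext fun q => by cases q <;> rfl) (funext fun i => Prod.ext (funext fun u => ?_) rfl)
    refine Fin.cases ?_ (fun j => ?_) u <;> rfl
  set_set z x y := by
    refine Prod.ext (funext fun q => by cases q <;> rfl) rfl

/-- The private spaces of the players. -/
def privLens : Lens (W.Space k (W.HonestSpace d)) (∀ i, d i) :=
  Lens.snd.comp (Lens.pi fun _ => Lens.snd)

theorem realLens_indep_privLens : (W.realLens k d).Indep (W.privLens k d) :=
  ⟨fun _ _ => rfl, fun _ _ => rfl, fun _ _ _ => rfl⟩

/-- The qubit `B_i`. -/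
def bLens (i : Fin r) : Lens (W.Space k (W.HonestSpace d)) Bool :=
  (playerLens i).comp (fst.comp (coord 0))

theorem realLens_comp_inl (j : Fin W.qV) : (W.realLens k d).comp (coord (.inl j)) =
    fst.comp (coord (RefQubit.V j)) := by
  refine Lens.ext' (fun z => rfl) fun z a => Prod.ext (funext fun q => ?_) (funext fun i =>
    Prod.ext (funext fun u => ?_) rfl)
  · cases q with
    | V j' =>
      change update ((W.realLens k d).get z) (.inl j) a (.inl j') =
        update z.1 (.V j) a (.V j')
      by_cases h : j' = j
      · subst h
        rw [update_self, update_self]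
      · rw [update_of_ne (by simpa using h), update_of_ne (by simpa using h)]
        rfl
    | _ => rfl
  · refine Fin.cases ?_ (fun j => ?_) u <;> rfl

theorem realLens_comp_inr (i : Fin r) (j : Fin W.qM) :
    (W.realLens k d).comp (coord (.inr (i, j))) =
      (playerLens i).comp (fst.comp (coord j.succ)) := by
  refine Lens.ext' (fun z => rfl) fun z a => Prod.ext (funext fun q => ?_) (funext fun i' => ?_)
  · cases q <;> rfl
  · change _ = update z.2 i (update (z.2 i).1 j.succ a, (z.2 i).2) i'
    by_cases hi : i' = i
    · subst hi
      rw [update_self]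
      refine Prod.ext (funext fun u => ?_) rfl
      refine Fin.cases (update_of_ne (Fin.succ_ne_zero j).symm a _).symm (fun j' => ?_) u
      change update ((W.realLens k d).get z) (.inr (i', j)) a (.inr (i', j')) =
        update (z.2 i').1 j.succ a j'.succ
      by_cases hj : j' = j
      · subst hj
        rw [update_self, update_self]
      · rw [update_of_ne (by simpa using hj), update_of_ne (by simpa using hj)]
        rfl
    · rw [update_of_ne hi]
      refine Prod.ext (funext fun u => Fin.cases rfl (fun j' => ?_) u) rfl
      change update ((W.realLens k d).get z) (.inr (i, j)) a (.inr (i', j')) = _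
      rw [update_of_ne (by simp [hi])]
      rfl

theorem realLens_indep_bLens (i : Fin r) : (W.realLens k d).Indep (W.bLens k d i) := by
  have e : ∀ z b i', ((W.bLens k d i).set z b).2 i' =
      (if i' = i then update (z.2 i').1 0 b else (z.2 i').1, (z.2 i').2) := by
    intro z b i'
    change update z.2 i (update (z.2 i).1 0 b, (z.2 i).2) i' = _
    by_cases hi : i' = i
    · subst hi
      rw [update_self, if_pos rfl]
    · rw [update_of_ne hi, if_neg hi]
  refine ⟨fun z b => funext fun u => ?_, fun z a => rfl, fun z a b => Prod.ext rfl (funext fun i' => ?_)⟩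
  · rcases u with j | ⟨i', j⟩
    · rfl
    · change (((W.bLens k d i).set z b).2 i').1 j.succ = (z.2 i').1 j.succ
      rw [e]
      split_ifs <;> simp
  · rw [e]
    change (Fin.cons (α := fun _ => Bool) ((((W.bLens k d i).set z b).2 i').1 0) fun j =>
      a (.inr (i', j)), (((W.bLens k d i).set z b).2 i').2) = _
    rw [e]
    refine Prod.ext (funext fun u => ?_) rfl
    split_ifs
    · refine Fin.cases ?_ (fun j => ?_) u
      · change update (z.2 i').1 0 b 0 =
          update (((W.realLens k d).set z a).2 i').1 0 b 0
        rw [update_self, update_self]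
      · exact (update_of_ne (Fin.succ_ne_zero j) b _).symm
    · rfl

variable {W k d} [∀ i, Fintype (d i)] [∀ i, DecidableEq (d i)]
  {M : W.Obs (W.HonestSpace d)}
  {X : ∀ i, Mat (W.HonestSpace d i)}

theorem realLens_inl (j : Fin W.qV) (A : Mat Bool) :
    (W.realLens k d).op ((coord (.inl j)).op A) =
      W.onRef k ((coord (RefQubit.V j)).op A) := by
  rw [← op_comp, realLens_comp_inl, op_comp]

theorem realLens_inr (i : Fin r) (j : Fin W.qM) (A : Mat Bool) :
    (W.realLens k d).op ((coord (.inr (i, j))).op A) =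
      (W.qubitsLens k d i).op ((coord j.succ).op A) := by
  rw [← op_comp, realLens_comp_inr, op_comp, op_comp, qubitsLens, op_comp]

theorem HonestObs.wireObs_eq (h : HonestObs M X) {u₁ u₂ u₃ : Wire W.qV r W.qM} (h₁₂ : u₁ ≠ u₂)
    (h₁₃ : u₁ ≠ u₃) (h₂₃ : u₂ ≠ u₃) {D : PauliLabel} {u : Wire W.qV r W.qM}
    (hu : (D, u) ∈ W.tofList u₁ u₂ u₃) : W.wireObs k M (W.tofList u₁ u₂ u₃) D u =
      (W.realLens k d).op (pauliOp (single u D)) := by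
  rw [pauliOp_single]
  rcases u with j | ⟨i, j⟩
  · rw [realLens_inl, ← pauliOp_single]
    rfl
  · have hmem := mem_playerOps.2 ⟨D, j, hu, rfl⟩
    rw [realLens_inr, ← pauliOp_single, wireObs]
    rcases askList_of_mem hmem with hq | hq
    · rw [hq, h.playerObs_pauli]
      rfl
    · rw [hq, h.playerObs_multi i (playerOps_mem_powerSet le_rfl h₁₂ h₁₃ h₂₃ hmem)
        (List.mem_toFinset.2 hmem)]
      rfl

theorem realLens_pair_inl {j₁ j₂ : Fin W.qV} (h : j₁ ≠ j₂) (D E : PauliLabel) :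
    (W.realLens k d).op (pauliOp (pair (.inl j₁) D (.inl j₂) E)) =
      W.onRef k (pauliOp (pair (.V j₁) D (.V j₂) E)) := by
  rw [pauliOp_pair (by simpa using h), pauliOp_pair (by simpa using h), map_mul, realLens_inl,
    realLens_inl, onRef, onRef, onRef, map_mul]

theorem HonestObs.playerObs_pair (h : HonestObs M X) {i : Fin r} {j₁ j₂ : Fin W.qM} (hj : j₁ ≠ j₂)
    {D E : PauliLabel} {Q : Finset (Pauli W.m)} (hQ : Q ∈ powerSet W.m 2)
    (hP : pair j₁.succ D j₂.succ E ∈ Q) : W.playerObs k M i (.multi Q) (pair j₁.succ D j₂.succ E) =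
      (W.realLens k d).op (pauliOp (pair (.inr (i, j₁)) D (.inr (i, j₂)) E)) := by
  rw [h.playerObs_multi i hQ hP, pauliOp_pair (by simpa using hj), pauliOp_pair (by simpa using hj),
    map_mul, map_mul, realLens_inr, realLens_inr]

theorem HonestObs.step_eq (h : HonestObs M X) (s : Step W.qV r W.qM) (j : Bool) :
    W.stepLeft k M s j = (W.realLens k d).op (s.left j) ∧
      W.stepRight k M s j = (W.realLens k d).op (s.right j) := by
  cases s with
  | hadV j₁ j₂ hj =>
    simp only [stepLeft, stepRight, Step.left, Step.right, hadLeft, hadRight, map_smul, map_add,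
      map_mul, map_one, hadX, hadZ, realLens_pair_inl hj, and_self]
  | hadM i j₁ j₂ hj =>
    have hQ := fun j => pair_mem_powerSet (m := W.m) le_rfl ((Fin.succ_injective W.qM).ne hj) j
    simp only [stepLeft, stepRight, Step.left, Step.right, hadLeft, hadRight, map_smul, map_add,
      map_mul, map_one, hadX, hadZ, playerX, playerZ]
    rw [h.playerObs_pair hj (hQ j) (Finset.mem_insert_self _ _),
      h.playerObs_pair hj (hQ j) (Finset.mem_insert_of_mem (Finset.mem_singleton_self _))]
    exact ⟨rfl, rfl⟩
  | tof u₁ u₂ u₃ h₁₂ h₁₃ h₂₃ =>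
    have hw := fun {D u} => h.wireObs_eq (k := k) h₁₂ h₁₃ h₂₃ (D := D) (u := u)
    cases j
    · simp only [stepLeft, stepRight, Step.left, Step.right, Bool.false_eq_true, if_false, map_smul,
        map_sub, map_mul, map_one, map_prj]
      rw [hw (by simp [tofList]), hw (by simp [tofList]), hw (by simp [tofList])]
      exact ⟨trivial, rfl⟩
    · simp [stepLeft, stepRight, Step.left, Step.right]

theorem realLens_commute_proj {p : (W.Ref k → Bool) → Prop}
    (hp : ∀ x y : W.Ref k → Bool, (∀ q, (∀ j, q ≠ .V j) → x q = y q) → (p x ↔ p y))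
    (N : Mat (Wire W.qV r W.qM → Bool)) :
    Commute (W.onRef k (proj p)) ((W.realLens k d).op N) := by
  rw [onRef, proj, fst_op_diagonal]
  refine Lens.diagonal_commute (W.realLens k d) (p := fun z => indic (p z.1)) (fun z a => congrArg indic (propext
    (hp ((W.realLens k d).set z a).1 z.1 fun q hq => ?_))) N
  cases q with
  | V j => exact absurd rfl (hq j)
  | _ => rfl

theorem realLens_commute_flip {s : W.Ref k → Bool} (hs : ∀ j, s (.V j) = false)
    (N : Mat (Wire W.qV r W.qM → Bool)) :
    Commute (W.onRef k (flipOp s)) ((W.realLens k d).op N) := by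
  refine Lens.commute_of_permutes _ (fun z => (flipBits s z.1, z.2)) (fst_op_flip s) ?_ ?_ N
  · intro z
    funext u
    rcases u with j | p
    · simp [realLens, flipBits, hs]
    · rfl
  · intro z a
    refine Prod.ext (funext fun q => ?_) rfl
    cases q with
    | V j => simp [realLens, flipBits, hs]
    | _ => rfl

end NormalVerifier

theorem ExtGame.rej_smul {r : ℕ} {Γ : Type} {Λ : Γ → Type} {κ : Type} [Fintype κ] [DecidableEq κ]
    [∀ g, Fintype (Λ g)] {H : Fin r → Type} [∀ i, Fintype (H i)] [∀ i, DecidableEq (H i)]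
    (G : ExtGame r Γ Λ κ) (M : ∀ i g, Λ g → Mat (H i)) (a : ℝ)
    (φ : κ × (∀ i, H i) → ℂ) : G.rej M ((a : ℂ) • φ) = a ^ 2 * G.rej M φ := by
  simp only [rej, mulVec_smul, star_smul, dotProduct_smul, smul_dotProduct, mul_sum,
    smul_eq_mul, RCLike.star_def, Complex.conj_ofReal, Complex.re_ofReal_mul]
  refine sum_congr rfl fun ω _ => sum_congr rfl fun b _ => ?_
  ring

theorem ExtGame.exists_strategy_of_pos {r m : ℕ} {κ : Type} [Fintype κ] [DecidableEq κ]
    {H : Fin r → Type} [∀ i, Fintype (H i)] [∀ i, DecidableEq (H i)]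
    (G : ExtGame r (Question m) Answer κ)
    {M : ∀ i (g : Question m), Answer g → Mat (H i)} (hM : ProjMeas M)
    {φ : κ × (∀ i, H i) → ℂ} (hφ : 0 < nrm φ) :
    ∃ S : G.Strategy, (1 - S.value) * nrm φ ^ 2 = G.rej M φ := by
  obtain ⟨S, hS⟩ := G.exists_strategy_of_vector M hM ((((nrm φ)⁻¹ : ℝ) : ℂ) • φ) (by
    rw [nrm_smul, Complex.norm_real, Real.norm_of_nonneg (inv_nonneg.2 hφ.le),
      inv_mul_cancel₀ hφ.ne'])
  refine ⟨S, ?_⟩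
  rw [hS, rej_smul, sub_sub_cancel]
  field_simp

namespace NormalVerifier

variable {r : ℕ} {W : NormalVerifier r} {k : ℕ} {d : Fin r → Type} [∀ i, Fintype (d i)]
  [∀ i, DecidableEq (d i)]
  {M : W.Obs (W.HonestSpace d)}
  {X : ∀ i, Mat (W.HonestSpace d i)}

/-! ### The history of the honest protocol -/

variable (k M) in
/-- The steps of the protocol. -/
def opList : List (Mat (W.Space k (W.HonestSpace d))) :=
  (List.finRange W.L).map (fun l => (W.realLens k d).op (W.step false l).op) ++
    W.xapOp k M :: (List.finRange W.L).map fun l => (W.realLens k d).op (W.step true l).op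

variable (M) in
/-- The state of the protocol after `t` steps. -/
def protocol (β : W.Space k (W.HonestSpace d) → ℂ) (t : ℕ) : W.Space k (W.HonestSpace d) → ℂ :=
  wordOp id ((opList k M).take t) *ᵥ β

variable {β : W.Space k (W.HonestSpace d) → ℂ}

theorem protocol_succ {t : ℕ} {R : Matrix (W.Space k (W.HonestSpace d)) _ ℂ}
    (h : (opList k M)[t]? = some R) : protocol M β (t + 1) = R *ᵥ protocol M β t := by
  rw [protocol, List.take_add_one, h, Option.toList_some, wordOp_append, wordOp_singleton,
    ← mulVec_mulVec]
  rfl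

theorem opList_time (b : Bool) (l : Fin W.L) : (opList k M)[W.time b l - 1]? =
    some ((W.realLens k d).op (W.step b l).op) := by
  have hl := l.2
  cases b
  · have e : W.time false l - 1 = l := by simp [time]
    rw [e, opList, List.getElem?_append_left (by simp)]
    simp
  · have e : W.time true l - 1 = W.L + (l + 1) := by simp [time]; omega
    rw [e, opList, List.getElem?_append_right (by simp)]
    simp

theorem opList_L : (opList k M)[W.L]? = some (W.xapOp k M) := by
  rw [opList, List.getElem?_append_right (by simp)]
  simp

theorem exists_time {t : ℕ} (ht : t < W.T) (hL : t ≠ W.L) : ∃ b l, W.time b l - 1 = t := by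
  unfold T at ht
  rcases Nat.lt_or_gt_of_ne hL with h | h
  · exact ⟨false, ⟨t, h⟩, by simp [time]⟩
  · exact ⟨true, ⟨t - W.L - 1, by omega⟩, by simp [time]; omega⟩

theorem protocol_T : protocol M β W.T = (W.realLens k d).op (W.circuit true) *ᵥ (W.xapOp k M *ᵥ
    ((W.realLens k d).op (W.circuit false) *ᵥ β)) := by
  have hc : ∀ b, wordOp id ((List.finRange W.L).map fun l => (W.realLens k d).op (W.step b l).op) =
      (W.realLens k d).op (W.circuit b) := by
    intro b
    rw [circuit, ← Lens.op_wordOp, wordOp_map, wordOp_map]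
    rfl
  rw [protocol, List.take_of_length_le (by simp [opList, T]; omega), opList, wordOp_append,
    wordOp_cons, hc, hc, mulVec_mulVec, mulVec_mulVec]
  rfl

theorem commute_protocol {A : Mat (W.Space k (W.HonestSpace d))}
    (h : ∀ N, Commute A ((W.realLens k d).op N)) (h' : Commute A (W.xapOp k M)) (t : ℕ) :
    A *ᵥ protocol M β t = protocol M (A *ᵥ β) t := by
  refine commute_mulVec (wordOp_commute fun R hR => ?_) _
  have hR := List.mem_of_mem_take hR
  simp only [opList, mem_append, mem_map, List.mem_cons] at hR
  rcases hR with ⟨l, -, rfl⟩ | rfl | ⟨l, -, rfl⟩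
  · exact h _
  · exact h'
  · exact h _

theorem onRef_commute_xapOp (A : Mat (W.Ref k → Bool)) :
    Commute (W.onRef k A) (W.xapOp k M) :=
  op_commute Lens.fst_indep_snd _ _

theorem realLens_single_inl (j : Fin W.qV) (D : PauliLabel) :
    (W.realLens k d).op (pauliOp (single (.inl j) D)) = W.refPauli k (.V j) D := by
  rw [pauliOp_single, realLens_inl, refPauli, pauliOp_single]

theorem realLens_commute_shift (t : ℕ)
    (N : Mat (Wire W.qV r W.qM → Bool)) :
    Commute (W.onRef k (shift C t)) ((W.realLens k d).op N) :=
  realLens_commute_flip (fun j => clockRange_of_notMem (by simp) _ _) N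

theorem realLens_commute_edgeProj (t₁ t₂ : ℕ)
    (N : Mat (Wire W.qV r W.qM → Bool)) :
    Commute (W.onRef k (edgeProj C t₁ t₂)) ((W.realLens k d).op N) := by
  refine realLens_commute_proj (fun x y h => ?_) N
  have : ∀ t, clockBit C x t = clockBit C y t := by
    intro t
    unfold clockBit
    split_ifs
    · exact h _ (by simp)
    · rfl
  simp only [EdgeSpace, this]

theorem realLens_commute_atTime {n : ℕ} {e : Fin n → W.Ref k} (he : ∀ j j', e j ≠ .V j') (t : ℕ)
    (N : Mat (Wire W.qV r W.qM → Bool)) :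
    Commute (W.onRef k (atTime e t)) ((W.realLens k d).op N) :=
  realLens_commute_proj (fun x y h => forall_congr' fun j => by rw [h _ (he j)]) N

theorem single_X_eq_flipOp {q : Type} [Fintype q] [DecidableEq q] (u : q) :
    pauliOp (single u .X) = flipOp fun v => decide (v = u) := by
  rw [flipOp]
  congr 1
  funext v
  simp [single]

theorem prj_mulVec_eq_zero {J : Type} [Fintype J] [DecidableEq J] {R : Mat J} {b : Bool}
    {v : J → ℂ} : prj b R *ᵥ v = 0 ↔ R *ᵥ v = -(sgn b • v) := by
  rw [prj, smul_mulVec, smul_eq_zero_iff_right (by norm_num), add_mulVec, one_mulVec, smul_mulVec]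
  cases b <;> simp only [sgn_false, sgn_true, one_smul, neg_smul, neg_neg]
  · rw [add_eq_zero_iff_eq_neg']
  · rw [← sub_eq_add_neg, sub_eq_zero, eq_comm]

/-- The initial states of the protocol. -/
structure IsStart (β : W.Space k (W.HonestSpace d) → ℂ) : Prop where
  atS : W.onRef k (atTime S 0) *ᵥ β = β
  atC : W.onRef k (atTime C 0) *ᵥ β = β
  control : ∀ c, W.refPauli k (.X c) .X *ᵥ β = β
  onV : ∀ j, prj true (W.refPauli k (.V j) .Z) *ᵥ β = 0
  onB : ∀ i, prj true ((W.bLens k d i).op PauliLabel.Z.mat) *ᵥ β = 0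

theorem IsStart.atTime_protocol (hβ : IsStart β) (t : ℕ) :
    W.onRef k (atTime C 0) *ᵥ protocol M β t = protocol M β t := by
  rw [commute_protocol (realLens_commute_atTime (by simp) 0) (onRef_commute_xapOp _), hβ.atC]

theorem IsStart.bLens_protocol (hβ : IsStart β)
    (hx : ∀ i, prj false ((W.bLens k d i).op PauliLabel.Z.mat) * W.xapOp k M =
      W.xapOp k M * prj true ((W.bLens k d i).op PauliLabel.Z.mat)) (i : Fin r) {t : ℕ}
    (ht : t ≤ W.T) : prj (decide (t ≤ W.L)) ((W.bLens k d i).op PauliLabel.Z.mat) *ᵥ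
      protocol M β t = 0 := by
  induction t with
  | zero => simpa [protocol, wordOp_nil] using hβ.onB i
  | succ t ih =>
    have ih := ih (by omega)
    by_cases hL : t = W.L
    · subst hL
      rw [protocol_succ opList_L, mulVec_mulVec]
      simp only [le_refl, decide_true] at ih
      simp only [Nat.not_succ_le_self, decide_false]
      rw [hx, ← mulVec_mulVec, ih, mulVec_zero]
    · obtain ⟨b, l, rfl⟩ := exists_time (W := W) (by omega) hL
      have hd : decide (W.time b l - 1 + 1 ≤ W.L) = decide (W.time b l - 1 ≤ W.L) := by
        rw [decide_eq_decide]; omega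
      rw [hd, protocol_succ (opList_time b l), commute_mulVec, ih, mulVec_zero]
      exact prj_commute (op_commute (W.realLens_indep_bLens k d i).symm _ _) _

variable (M β) in
/-- The history state of the protocol over the register `C`. -/
def cHistory : W.Space k (W.HonestSpace d) → ℂ := history C (protocol M β)

theorem IsStart.passesHonest (hβ : IsStart β) (h : HonestObs M X)
    (hx : ∀ i, prj false ((W.bLens k d i).op PauliLabel.Z.mat) * W.xapOp k M =
      W.xapOp k M * prj true ((W.bLens k d i).op PauliLabel.Z.mat)) :
    W.PassesHonest k M (cHistory M β) := by
  have hC := W.C_injective k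
  have hf := hβ.atTime_protocol (M := M)
  refine ⟨fun t => clockCheck_history hC hf t, fun i => ?_, fun b l j => ?_, ?_, fun j => ?_⟩
  · have hobs : W.playerObs k M i (.pauli (W.onB .Z)) (W.onB .Z) =
        (W.bLens k d i).op PauliLabel.Z.mat := by
      rw [h.playerObs_pauli, NormalVerifier.onB, pauliOp_single, qubitsLens, bLens, op_comp,
        op_comp, op_comp]
    set Z := (W.bLens k d i).op PauliLabel.Z.mat
    set D : Mat (W.Space k (W.HonestSpace d)) := W.onRef k (clockOp C .Z (W.L + 1))
    have hD : D = W.onRef k (prj false (clockOp C .Z (W.L + 1))) -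
        W.onRef k (prj true (clockOp C .Z (W.L + 1))) := by
      rw [onRef, onRef, map_prj, map_prj, prj, prj]
      simp only [sgn_false, sgn_true]
      module
    have hZ : Z *ᵥ cHistory M β = D *ᵥ cHistory M β := by
      rw [hD, sub_mulVec, cHistory, clockProj_history hC hf, clockProj_history hC hf,
        Finset.sum_filter, Finset.sum_filter, history, mulVec_sum, ← Finset.sum_sub_distrib]
      refine sum_congr rfl fun t ht => ?_
      have hz := prj_mulVec_eq_zero.1 (hβ.bLens_protocol hx i (t := t) (by
        have := Finset.mem_range.1 ht; omega))
      have hc : Commute Z (W.onRef k (shift C t)) :=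
        (op_commute (Lens.fst_indep_snd.comp_right _ |>.comp_right _) _ _).symm
      rw [commute_mulVec hc, hz]
      by_cases htL : t ≤ W.L
      · simp [htL, show ¬ W.L + 1 ≤ t by omega]
      · simp [htL, mulVec_neg, show W.L + 1 ≤ t by omega]
    rw [hobs, prj_mulVec_eq_zero, sgn_true, neg_smul, one_smul, neg_neg, ← mulVec_mulVec, hZ,
      mulVec_mulVec]
    have hDD : D * D = 1 := by
      change fst.op _ * fst.op _ = _
      rw [← map_mul, clockOp_Z, diagonal_mul_diagonal]
      have : ∀ x : W.Ref k → Bool, sgn (clockBit C x (W.L + 1)) *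
          sgn (clockBit C x (W.L + 1)) = 1 := fun x => by
        cases clockBit C x (W.L + 1) <;> simp
      simp only [this, diagonal_one, map_one]
    rw [hDD, one_mulVec]
  · obtain ⟨h1, h2⟩ := W.time_bounds b l
    rw [(h.step_eq _ j).1, (h.step_eq _ j).2]
    have hs := protocol_succ (β := β) (opList_time (k := k) (M := M) b l)
    rw [Nat.sub_add_cancel h1] at hs
    refine edgeTest_history hC hf (by omega) h2 (fun t => realLens_commute_shift t _)
      (fun t => realLens_commute_shift t _) (realLens_commute_edgeProj _ _ _)
      (realLens_commute_edgeProj _ _ _) ?_ ?_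
    · rw [hs, mulVec_mulVec, ← map_mul, Step.right_mul_op]
    · rw [hs, mulVec_mulVec, ← map_mul, ← Step.right_mul_op, mul_assoc,
        (W.step b l).op_isRefl.mul_self, mul_one]
  · have hs := protocol_succ (β := β) (opList_L (k := k) (M := M))
    refine edgeTest_history hC hf (Nat.lt_succ_self _) (by unfold T; omega)
      (fun t => (Commute.one_right _).smul_right _) (fun t => (onRef_commute_xapOp _).smul_right _)
      ((Commute.one_right _).smul_right _) ((onRef_commute_xapOp _).smul_right _) ?_ ?_
    · rw [hs, smul_mulVec, smul_mulVec, one_mulVec, (xapOp_isRefl h.proj).mulVec_mulVec]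
    · rw [hs, smul_mulVec, smul_mulVec, one_mulVec]
  · have hc : Commute (W.onRef k (prj false (clockOp C .Z 1)))
        (prj true (W.refPauli k (.V j) .Z) :
          Mat (W.Space k (W.HonestSpace d))) := by
      rw [refPauli, ← map_prj, prj_clockOp_Z, single_Z_eq_diagonal, prj_diagonal]
      exact (proj_commute _ _).map _
    rw [hc.eq, ← mulVec_mulVec, cHistory, clockProj_false_one_history hC hf]
    simpa [protocol, wordOp_nil] using hβ.onV j

theorem IsStart.exists_strategy (hβ : IsStart β) (h : HonestObs M X)
    (hx : ∀ i, prj false ((W.bLens k d i).op PauliLabel.Z.mat) * W.xapOp k M =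
      W.xapOp k M * prj true ((W.bLens k d i).op PauliLabel.Z.mat)) (h0 : 0 < nrm β) :
    ∃ S : (W.extendedGame k).Strategy, (1 - S.value) * nrm β ^ 2 ≤
      nrm (prj false (W.refPauli k (.V ⟨0, W.qV_pos⟩) .Z) *ᵥ protocol M β W.T) ^ 2 := by
  have hC := W.C_injective k
  have hf := hβ.atTime_protocol (M := M)
  have hzero : protocol M β 0 = β := by simp [protocol, wordOp_nil]
  set ψ := cHistory M β
  have hS : W.onRef k (atTime S 0) *ᵥ ψ = ψ := by
    change W.onRef k (atTime S 0) *ᵥ history _ _ = history _ _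
    rw [history, mulVec_sum]
    refine sum_congr rfl fun t _ => ?_
    rw [commute_mulVec ((W.S_commute_shift k t).map _),
      commute_protocol (realLens_commute_atTime (by simp) 0) (onRef_commute_xapOp _), hβ.atS]
  have hX : ∀ c, prj true (W.refPauli k (.X c) .X) *ᵥ ψ = 0 := by
    intro c
    rw [prj_mulVec_eq_zero, sgn_true, neg_smul, one_smul, neg_neg]
    change _ *ᵥ history _ _ = history _ _
    rw [history, mulVec_sum]
    refine sum_congr rfl fun t _ => ?_
    have hc : Commute (W.refPauli k (.X c) .X) (fst.op (shift C t) :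
        Mat (W.Space k (W.HonestSpace d))) := by
      rw [refPauli, single_X_eq_flipOp]
      exact (flipOp_commute _ _).map _
    rw [commute_mulVec hc, commute_protocol (fun N => ?_) (onRef_commute_xapOp _), hβ.control]
    rw [single_X_eq_flipOp]
    exact realLens_commute_flip (by simp) N
  have hψ : W.onRef k (prj false (clockOp S .Z 1)) *ᵥ sHistory M ψ = ψ := by
    refine (clockProj_false_one_history (W.S_injective k) (sHistory_zero hS)).trans ?_
    rw [List.take_zero, wordOp_nil, one_mulVec]
  have hrej := rej_extendedGame_le h.proj (h.propChecks hS hX) hψ (hβ.passesHonest h hx)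
  have hlast : nrm ((W.onRef k (prj true (clockOp C .Z W.T)) *
      prj false (W.refPauli k (.V ⟨0, W.qV_pos⟩) .Z)) *ᵥ ψ) =
      nrm (prj false (W.refPauli k (.V ⟨0, W.qV_pos⟩) .Z) *ᵥ protocol M β W.T) := by
    have hc : Commute (W.onRef k (prj true (clockOp C .Z W.T)))
        (prj false (W.refPauli k (.V ⟨0, W.qV_pos⟩) .Z) :
          Mat (W.Space k (W.HonestSpace d))) := by
      rw [refPauli, ← map_prj, prj_clockOp_Z, single_Z_eq_diagonal, prj_diagonal]
      exact (proj_commute _ _).map _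
    have hc' : Commute (prj false (W.refPauli k (.V ⟨0, W.qV_pos⟩) .Z)) (fst.op
        (shift C W.T) : Mat (W.Space k (W.HonestSpace d))) := by
      refine prj_commute ?_ _
      rw [← realLens_single_inl]
      exact (realLens_commute_shift _ _).symm
    rw [hc.eq, ← mulVec_mulVec]
    change nrm (_ *ᵥ (_ *ᵥ history _ _)) = _
    rw [clockProj_true_last_history hC hf, commute_mulVec hc',
      (op_isRefl _ (shift_isRefl _ _)).nrm]
  have hle : nrm β ≤ nrm (sHistory M ψ) := by
    have h1 := nrm_le_nrm_history hC hf
    have h2 := nrm_le_nrm_history (W.S_injective k) (sHistory_zero (M := M) hS)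
    rw [hzero] at h1
    rw [List.take_zero, wordOp_nil, one_mulVec] at h2
    exact h1.trans h2
  obtain ⟨S, hS⟩ := (W.extendedGame k).exists_strategy_of_pos h.proj (h0.trans_le hle)
  refine ⟨S, ?_⟩
  rw [← hlast]
  refine le_trans ?_ (hS.le.trans hrej)
  exact mul_le_mul_of_nonneg_left (pow_le_pow_left₀ (nrm_nonneg _) hle 2)
    (sub_nonneg.2 (ExtGame.value_le_one _ S))

end NormalVerifier

theorem Lens.Indep.prod {J A B C : Type} {l : Lens J C} {L : Lens J A} {L' : Lens J B}
    (hL : l.Indep L) (hL' : l.Indep L') (h : L.Indep L') : l.Indep (Lens.prod h) :=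
  ⟨fun z a => (hL.get_left _ _).trans (hL'.get_left _ _),
    fun z a => Prod.ext (hL.get_right _ _) (hL'.get_right _ _), fun z a b => by
      change l.set (L.set (L'.set z b.2) b.1) a = L.set (L'.set (l.set z a) b.2) b.1
      rw [hL.comm, hL'.comm]⟩

namespace Padding

variable {r : ℕ} {V : Verifier r} {W : NormalVerifier r} (F : Padding V W)

/-! ### Honest players from provers -/

theorem succ_onM_injective : Injective fun j => (F.onM j).succ := fun _ _ h =>
  F.onM_injective (Fin.succ_injective _ h)

/-- The space of a prover as part of the space of a player. -/
def proverPart (Y : Type) : Lens ((Fin W.m → Bool) × Y) ((Fin V.qM → Bool) × Y) :=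
  Lens.prod (Lens.fst_indep_snd.comp_left (Lens.sub F.succ_onM_injective))

theorem coord_indep_proverPart {Y : Type} {u : Fin W.m} (hu : ∀ j, (F.onM j).succ ≠ u) :
    (fst.comp (coord u) : Lens ((Fin W.m → Bool) × Y) Bool).Indep (F.proverPart Y) :=
  Lens.Indep.prod (Lens.Indep.comp_comp (Lens.coord_indep_sub F.succ_onM_injective hu))
    (Lens.fst_indep_snd.comp_left _) _

variable {k : ℕ} {d : Fin r → Type} [∀ i, Fintype (d i)] [∀ i, DecidableEq (d i)]
  {A : ∀ i, Mat ((Fin V.qM → Bool) × d i)}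

/-- An operator on the qubit `B_i` in the space of a player. -/
def onB (W : NormalVerifier r) (Y : Type) [Fintype Y] [DecidableEq Y] (D : PauliLabel) :
    Mat ((Fin W.m → Bool) × Y) :=
  (fst.comp (coord 0)).op D.mat

/-- The reflection of an honest player for the special question. -/
def honestXap (A : ∀ i, Mat ((Fin V.qM → Bool) × d i)) (i : Fin r) :
    Mat (W.HonestSpace d i) :=
  turn (onB W (d i) .Z) (onB W (d i) .X) ((F.proverPart (d i)).op (A i))

theorem onB_isRefl (Y : Type) [Fintype Y] [DecidableEq Y] (D : PauliLabel) : IsRefl (onB W Y D) :=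
  op_isRefl _ D.mat_isRefl

theorem onB_anticommute (Y : Type) [Fintype Y] [DecidableEq Y] :
    onB W Y .X * onB W Y .Z = -(onB W Y .Z * onB W Y .X) := by
  rw [onB, onB, ← map_mul, PauliLabel.X_mul_Z, map_neg, map_mul]

theorem proverPart_commute_onB (i : Fin r) (D : PauliLabel) :
    Commute ((F.proverPart (d i)).op (A i)) (onB W (d i) D) :=
  (op_commute (F.coord_indep_proverPart fun _ => Fin.succ_ne_zero _) _ _).symm

theorem honestXap_isRefl (hA : ∀ i, (A i)ᴴ * A i = 1) (i : Fin r) : IsRefl (F.honestXap A i) :=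
  turn_isRefl (onB_isRefl _ _) (onB_isRefl _ _) (onB_anticommute _) (Lens.op_isometry _ (hA i))
    (F.proverPart_commute_onB i _) (F.proverPart_commute_onB i _)

theorem bLens_op (i : Fin r) (D : PauliLabel) :
    (W.bLens k d i).op D.mat = (playerLens i).op (onB W (d i) D) := by
  rw [NormalVerifier.bLens, onB, op_comp]

variable {M : W.Obs (W.HonestSpace d)}

theorem prj_mul_xapOp (h : NormalVerifier.HonestObs M (F.honestXap A)) (i : Fin r) :
    prj false ((W.bLens k d i).op PauliLabel.Z.mat) * W.xapOp k M =
      W.xapOp k M * prj true ((W.bLens k d i).op PauliLabel.Z.mat) := by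
  simp only [NormalVerifier.xapOp, h.xap, bLens_op, ← map_prj, playerLens, op_comp, ← map_mul]
  rw [coord_op_mul_tensor]
  exact prj_mul_turn (onB_isRefl _ _) (onB_anticommute _) (F.proverPart_commute_onB i _)

variable (W k d) in
/-- The flip of all the qubits `B_i`. -/
def flipB : Mat (W.Space k (W.HonestSpace d)) :=
  Lens.snd.op (tensor fun i => onB W (d i) .X)

variable (k A) in
/-- The action of the provers. -/
def applyAll : Mat (W.Space k (W.HonestSpace d)) :=
  Lens.snd.op (tensor fun i => (F.proverPart (d i)).op (A i))

theorem xapOp_mulVec (h : NormalVerifier.HonestObs M (F.honestXap A))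
    {v : W.Space k (W.HonestSpace d) → ℂ}
    (hv : ∀ i, prj true ((W.bLens k d i).op PauliLabel.Z.mat) *ᵥ v = 0) :
    W.xapOp k M *ᵥ v = flipB W k d *ᵥ (F.applyAll k A *ᵥ v) := by
  have hp : Lens.snd.op (tensor fun i => prj false (onB W (d i) .Z)) *ᵥ v = v := by
    rw [snd_op_tensor]
    induction (Finset.univ : Finset (Fin r)).toList with
    | nil => exact one_mulVec v
    | cons i l ih =>
      rw [List.map_cons, List.prod_cons, ← mulVec_mulVec, ih, map_prj]
      have h1 := hv i
      rw [bLens_op] at h1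
      have h2 := congrArg (· *ᵥ v) (prj_add_prj ((playerLens i : Lens
        (W.Space k (W.HonestSpace d)) _).op (onB W (d i) .Z)))
      simp only [add_mulVec, h1, add_zero, one_mulVec] at h2
      exact h2
  rw [← hp]
  simp only [NormalVerifier.xapOp, flipB, applyAll, h.xap, mulVec_mulVec, ← map_mul, tensor_mul]
  congr 3
  funext i
  exact (turn_mul_prj (onB_isRefl _ _) (F.proverPart_commute_onB i _)).trans (mul_assoc _ _ _)

theorem flipB_isometry : (flipB W k d)ᴴ * flipB W k d = 1 :=
  Lens.op_isometry _ (tensor_isometry fun _ => (onB_isRefl _ _).isometry)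

theorem flipB_commute (N : Mat (Wire W.qV r W.qM → Bool)) :
    Commute ((W.realLens k d).op N) (flipB W k d) := by
  rw [flipB, snd_op_tensor]
  refine Commute.list_prod_right _ _ fun B hB => ?_
  obtain ⟨i, -, rfl⟩ := mem_map.1 hB
  change Commute _ ((playerLens i).op _)
  rw [← bLens_op]
  exact op_commute (W.realLens_indep_bLens k d i) _ _

theorem applyAll_commute {E : Mat (Wire W.qV r W.qM → Bool)}
    (hE : E ∈ dummyOps F.wire) : Commute ((W.realLens k d).op E) (F.applyAll k A) := by
  induction hE using Submonoid.closure_induction with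
  | mem B hB =>
    obtain ⟨u, hu, rfl⟩ := hB
    rcases u with j | ⟨i, j⟩
    · rw [NormalVerifier.realLens_inl]
      exact op_commute Lens.fst_indep_snd _ _
    · rw [← op_comp, NormalVerifier.realLens_comp_inr, op_comp, applyAll, playerLens,
        op_comp, Commute, SemiconjBy, ← map_mul, ← map_mul, coord_op_mul_tensor]
      refine op_commute (F.coord_indep_proverPart fun j' h => hu (.inr (i, j')) ?_) _ _
      exact congrArg (fun j => Sum.inr (i, j)) (Fin.succ_injective _ h)
  | one => rw [map_one]; exact Commute.one_left _
  | mul B B' _ _ h h' => rw [map_mul]; exact h.mul_left h'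

/-! ### The initial state -/

variable (k d) in
/-- The qubits of the original verifier in the hands of honest players. -/
def origLens : Lens (W.Space k (W.HonestSpace d)) (Wire V.qV r V.qM → Bool) :=
  (W.realLens k d).comp (Lens.sub F.wire_injective)

theorem origLens_indep : (F.origLens k d).Indep (W.privLens k d) :=
  (W.realLens_indep_privLens k d).comp_left _

variable (k d) in
/-- The space of the original proof system. -/
def outerLens : Lens (W.Space k (W.HonestSpace d)) ((Wire V.qV r V.qM → Bool) × ∀ i, d i) :=
  Lens.prod F.origLens_indep

variable (k d) in
/-- The qubits outside the original proof system have their initial values. -/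
def startCoeff (z : W.Space k (W.HonestSpace d)) : ℂ :=
  indic ((∀ t, z.1 (.S t) = false) ∧ (∀ t, z.1 (.C t) = false) ∧
    (∀ j, (∀ j', F.onV j' ≠ j) → z.1 (.V j) = false) ∧ ∀ i, (z.2 i).1 0 = false)

theorem startCoeff_origLens (z : W.Space k (W.HonestSpace d)) (a : Wire V.qV r V.qM → Bool) :
    F.startCoeff k d ((F.origLens k d).set z a) = F.startCoeff k d z := by
  unfold startCoeff
  congr 1
  refine propext (and_congr Iff.rfl (and_congr Iff.rfl (and_congr ?_ Iff.rfl)))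
  refine forall_congr' fun j => forall_congr' fun hj => ?_
  change extend F.wire a _ (.inl j) = false ↔ _
  rw [extend_apply']
  · rfl
  · rintro ⟨j' | p, h⟩
    · exact hj j' (Sum.inl_injective h)
    · exact Sum.inr_ne_inl h

theorem startCoeff_outerLens (z : W.Space k (W.HonestSpace d)) (a) :
    F.startCoeff k d ((F.outerLens k d).set z a) = F.startCoeff k d z :=
  (F.startCoeff_origLens _ _).trans rfl

variable (k) in
/-- The initial state of honest players. -/
def startVec (v : (Wire V.qV r V.qM → Bool) × (∀ i, d i) → ℂ) : W.Space k (W.HonestSpace d) → ℂ :=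
  fun z => F.startCoeff k d z * v ((F.outerLens k d).get z)

theorem origLens_startVec (N : Mat (Wire V.qV r V.qM → Bool))
    (v : (Wire V.qV r V.qM → Bool) × (∀ i, d i) → ℂ) :
    (F.origLens k d).op N *ᵥ F.startVec k v = F.startVec k (fst.op N *ᵥ v) :=
  Lens.op_mulVec_mul (F.origLens k d) fst (g := (F.outerLens k d).get) (fun _ => rfl)
    (fun z a => Prod.ext ((F.origLens k d).get_set z a) (F.origLens_indep.get_right z a))
    F.startCoeff_origLens N v

theorem applyAll_startVec (v : (Wire V.qV r V.qM → Bool) × (∀ i, d i) → ℂ) :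
    F.applyAll k A *ᵥ F.startVec k v = F.startVec k ((V.proverLens d).op (tensor A) *ᵥ v) := by
  have hinj := F.succ_onM_injective
  rw [applyAll, ← Lens.pi_op_tensor (fun i => F.proverPart (d i)) A, ← op_comp]
  refine Lens.op_mulVec_mul (Lens.snd.comp (Lens.pi fun i => F.proverPart (d i)))
    (V.proverLens d) (g := (F.outerLens k d).get) (c := F.startCoeff k d) (fun _ => rfl) (fun z a => ?_) (fun z a => ?_) _ _
  · refine Prod.ext (funext fun u => ?_) rfl
    rcases u with j | ⟨i, j⟩
    · rfl
    · exact hinj.extend_apply _ _ j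
  · unfold startCoeff
    congr 1
    refine propext (and_congr Iff.rfl (and_congr Iff.rfl (and_congr Iff.rfl ?_)))
    refine forall_congr' fun i => ?_
    change extend _ _ _ 0 = false ↔ _
    rw [extend_apply' _ _ _ fun ⟨j, hj⟩ => Fin.succ_ne_zero _ hj]
    rfl

theorem startVec_eq_zero {v : (Wire V.qV r V.qM → Bool) × (∀ i, d i) → ℂ}
    {z : W.Space k (W.HonestSpace d)} (h : F.startVec k v z ≠ 0) :
    ((∀ t, z.1 (.S t) = false) ∧ (∀ t, z.1 (.C t) = false) ∧
    (∀ j, (∀ j', F.onV j' ≠ j) → z.1 (.V j) = false) ∧ ∀ i, (z.2 i).1 0 = false) ∧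
      v ((F.outerLens k d).get z) ≠ 0 := by
  refine ⟨?_, right_ne_zero_of_mul h⟩
  by_contra h'
  exact left_ne_zero_of_mul h (indic_neg h')

theorem diagonal_mulVec_eq {J : Type} [Fintype J] [DecidableEq J] {p : J → Prop} {v : J → ℂ}
    (h : ∀ z, v z ≠ 0 → p z) : proj p *ᵥ v = v := by
  funext z
  rw [proj, mulVec_diagonal]
  by_cases hz : v z = 0
  · rw [hz, mul_zero]
  · rw [indic_pos (h z hz), one_mul]

theorem diagonal_mulVec_eq_zero {J : Type} [Fintype J] [DecidableEq J] {p : J → Prop} {v : J → ℂ}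
    (h : ∀ z, v z ≠ 0 → ¬ p z) : proj p *ᵥ v = 0 := by
  funext z
  rw [proj, mulVec_diagonal]
  by_cases hz : v z = 0
  · rw [hz, mul_zero]; rfl
  · rw [indic_neg (h z hz), zero_mul]; rfl

theorem startVec_isStart {v : (Wire V.qV r V.qM → Bool) × (∀ i, d i) → ℂ}
    (hv : ∀ x, v x ≠ 0 → ∀ j, x.1 (.inl j) = false) :
    NormalVerifier.IsStart (F.startVec k v : W.Space k (W.HonestSpace d) → ℂ) := by
  refine ⟨?_, ?_, fun c => ?_, fun j => ?_, fun i => ?_⟩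
  · rw [NormalVerifier.onRef, atTime, proj, fst_op_diagonal]
    refine diagonal_mulVec_eq fun z hz j => ?_
    simpa using (F.startVec_eq_zero hz).1.1 j
  · rw [NormalVerifier.onRef, atTime, proj, fst_op_diagonal]
    refine diagonal_mulVec_eq fun z hz j => ?_
    simpa using (F.startVec_eq_zero hz).1.2.1 j
  · rw [NormalVerifier.refPauli, NormalVerifier.single_X_eq_flipOp]
    funext z
    rw [fst_op_flip]
    have hb : ∀ q : W.Ref k, q ≠ .X c → flipBits (fun u => decide (u = .X c)) z.1 q = z.1 q := by
      intro q hq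
      simp [flipBits, hq]
    have hg : (F.outerLens k d).get (flipBits (fun u => decide (u = .X c)) z.1, z.2) =
        (F.outerLens k d).get z := by
      refine Prod.ext (funext fun u => ?_) rfl
      rcases u with j | p
      · exact hb _ (by simp)
      · rfl
    simp only [startVec, hg, startCoeff]
    congr 2
    simp only [hb _ (show S _ ≠ _ by simp), hb _ (show C _ ≠ _ by simp),
      hb _ (show RefQubit.V _ ≠ _ by simp)]
  · rw [NormalVerifier.prj_refPauli_V]
    refine diagonal_mulVec_eq_zero fun z hz => ?_
    rw [Bool.not_eq_true]
    obtain ⟨h1, h2⟩ := F.startVec_eq_zero hz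
    by_cases hj : ∃ j', F.onV j' = j
    · obtain ⟨j', rfl⟩ := hj
      exact hv _ h2 j'
    · exact h1.2.2.1 j fun j' h => hj ⟨j', h⟩
  · have e : (W.bLens k d i).op PauliLabel.Z.mat = diagonal fun z => sgn ((z.2 i).1 0) := by
      refine mulVec_ext fun v z => ?_
      rw [Lens.op_mulVec, mulVec_diagonal, Fintype.sum_bool]
      have hg : (W.bLens k d i).get z = (z.2 i).1 0 := rfl
      have hs := (W.bLens k d i).set_get z
      rw [hg] at hs ⊢
      cases hb : (z.2 i).1 0 <;> rw [hb] at hs <;> simp [PauliLabel.mat, hs]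
    rw [e, prj_diagonal]
    refine diagonal_mulVec_eq_zero fun z hz => ?_
    rw [Bool.not_eq_true]
    exact (F.startVec_eq_zero hz).1.2.2.2 i

theorem card_mul_nrm_sq_startVec (v : (Wire V.qV r V.qM → Bool) × (∀ i, d i) → ℂ) :
    Fintype.card ((Wire V.qV r V.qM → Bool) × ∀ i, d i) * nrm (F.startVec k v) ^ 2 =
      nrm (F.startCoeff k d) ^ 2 * nrm v ^ 2 :=
  (F.outerLens k d).card_mul_nrm_sq F.startCoeff_outerLens v

/-! ### Completeness -/

theorem exists_strategy (F : Padding V W) (P : V.Provers) (k : ℕ) :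
    ∃ S : (W.extendedGame k).Strategy, P.acceptProb ≤ S.value := by
  let d : Fin r → Type := fun i => Fin (P.d i)
  obtain ⟨M, hM⟩ := NormalVerifier.exists_honestObs (F.honestXap_isRefl P.W_isometry)
  have hstart : NormalVerifier.IsStart (F.startVec k P.initial : W.Space k (W.HonestSpace d) → ℂ) := by
    refine F.startVec_isStart fun x hx => ?_
    by_contra h
    exact hx (if_neg h)
  have hone := P.nrm_initial
  obtain ⟨x, hx⟩ : ∃ x, P.initial x ≠ 0 := by
    by_contra! h
    rw [show P.initial = 0 from funext h, nrm_zero] at hone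
    exact zero_ne_one hone
  have : Nonempty P.Idx := ⟨x⟩
  have hcard : (0 : ℝ) < Fintype.card P.Idx := by exact_mod_cast Fintype.card_pos
  have hcoeff : 0 < nrm (F.startCoeff k d) ^ 2 := by
    refine pow_pos (lt_of_le_of_ne (nrm_nonneg _) fun h => ?_) 2
    have := congrFun (nrm_eq_zero.1 h.symm) (fun _ => false, fun i => (fun _ => false, x.2 i))
    simp [startCoeff, indic] at this
  have hnorm := fun v : P.Idx → ℂ => F.card_mul_nrm_sq_startVec (k := k) (d := d) v
  have hpos : 0 < nrm (F.startVec k P.initial : W.Space k (W.HonestSpace d) → ℂ) := by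
    have := hnorm P.initial
    rw [hone, one_pow, mul_one] at this
    refine lt_of_le_of_ne (nrm_nonneg _) fun h => ?_
    rw [← h, zero_pow two_ne_zero, mul_zero] at this
    exact hcoeff.ne this
  obtain ⟨S, hS⟩ := hstart.exists_strategy hM (F.prj_mul_xapOp hM) hpos
  refine ⟨S, ?_⟩
  obtain ⟨E, hE, hcE⟩ := F.circuit false
  obtain ⟨E', hE', hcE'⟩ := F.circuit true
  have hrun : nrm (prj false (W.refPauli k (.V ⟨0, W.qV_pos⟩) .Z) *ᵥ
      NormalVerifier.protocol M (F.startVec k P.initial) W.T) =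
      nrm (F.startVec k (fst.op (V.outProj false) *ᵥ P.final) :
        W.Space k (W.HonestSpace d) → ℂ) := by
    have hout : (prj false (W.refPauli k (.V ⟨0, W.qV_pos⟩) .Z) :
        Mat (W.Space k (W.HonestSpace d))) =
        (F.origLens k d).op (V.outProj false) := by
      rw [Verifier.outProj, ← prj_diagonal, ← single_Z_eq_diagonal, map_prj, pauliOp_single,
        origLens, op_comp, Lens.sub_op_coord, ← pauliOp_single]
      change _ = prj false ((W.realLens k d).op (pauliOp (single (.inl (F.onV _)) .Z)))
      rw [F.onV_zero, NormalVerifier.realLens_single_inl]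
    have horig : ∀ N, (W.realLens k d).op ((Lens.sub F.wire_injective).op N) = (F.origLens k d).op N :=
      fun N => (op_comp _ _ _).symm
    have c1 : W.circuit false = (Lens.sub F.wire_injective).op (circuitOp V.V1) * E := hcE
    have c2 : W.circuit true = (Lens.sub F.wire_injective).op (circuitOp V.V2) * E' := hcE'
    have hEo : ∀ {E}, E ∈ dummyOps F.wire → ∀ N,
        Commute ((W.realLens k d).op E) ((F.origLens k d).op N) := fun hE N => by
      rw [← horig]
      exact (dummyOps_commute F.wire_injective hE N).map _
    have hiso : ∀ {E}, E ∈ dummyOps F.wire →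
        ((W.realLens k d).op E)ᴴ * (W.realLens k d).op E = 1 := fun hE => by
      refine Lens.op_isometry _ ?_
      induction hE using Submonoid.closure_induction with
      | mem B hB =>
        obtain ⟨u, hu, rfl⟩ := hB
        exact (coord_op_isRefl u hadamardMat_isRefl).isometry
      | one => simp
      | mul B B' _ _ h h' => exact isometry_mul h h'
    have hfl : ∀ N, Commute ((F.origLens k d).op N) (flipB W k d) := fun N => by
      rw [← horig]
      exact flipB_commute _
    have hB : ∀ i, prj true ((W.bLens k d i).op PauliLabel.Z.mat) *ᵥ
        ((W.realLens k d).op (W.circuit false) *ᵥ F.startVec k P.initial) = 0 := fun i => by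
      rw [commute_mulVec (prj_commute
        (op_commute (W.realLens_indep_bLens k d i).symm _ _) _), hstart.onB, mulVec_zero]
    rw [NormalVerifier.protocol_T, F.xapOp_mulVec hM hB, c1, c2, map_mul, map_mul, horig, horig,
      hout, ← (hEo hE _).eq, ← (hEo hE' _).eq, ← mulVec_mulVec, ← mulVec_mulVec,
      commute_mulVec (hfl _), commute_mulVec (hEo hE' _).symm,
      commute_mulVec (hfl _), nrm_isometry (hiso hE'), nrm_isometry flipB_isometry,
      commute_mulVec (F.applyAll_commute hE).symm,
      commute_mulVec (hEo hE _).symm, commute_mulVec (hEo hE _).symm,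
      nrm_isometry (hiso hE), origLens_startVec, applyAll_startVec, origLens_startVec,
      origLens_startVec, P.final_eq, Verifier.runOp, mulVec_mulVec, mulVec_mulVec, mulVec_mulVec,
      mulVec_mulVec]
    simp only [mul_assoc]
  rw [hrun] at hS
  have h1 := hnorm P.initial
  have h2 := hnorm (fst.op (V.outProj false) *ᵥ P.final)
  rw [hone, one_pow, mul_one] at h1
  have h3 := mul_le_mul_of_nonneg_left hS hcard.le
  rw [h2, mul_left_comm, h1, mul_comm] at h3
  have h4 := le_of_mul_le_mul_left h3 hcoeff
  rw [P.acceptProb_eq]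
  linarith

end Padding

/-! ### Polynomial bounds -/

theorem length_flatMap_le {α β : Type} {l : List α} {f : α → List β} {B : ℕ}
    (h : ∀ a ∈ l, (f a).length ≤ B) : (l.flatMap f).length ≤ l.length * B := by
  rw [List.length_flatMap, ← List.length_map (f := fun a => (f a).length)]
  exact List.sum_le_card_nsmul _ _ (by simpa using h)

theorem length_listsUpTo_le {α : Type} (l : List α) (k : ℕ) :
    (listsUpTo l k).length ≤ (l.length + 1) ^ k := by
  induction k with
  | zero => simp [listsUpTo]
  | succ k ih =>
    have h := length_flatMap_le (l := listsUpTo l k) (f := fun w => l.map fun a => a :: w)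
      (B := l.length) (by simp)
    have h1 : 1 ≤ (l.length + 1) ^ k := Nat.one_le_pow _ _ (by omega)
    rw [listsUpTo, List.length_cons, pow_succ]
    nlinarith

/-- The number of values of a function on short lists. -/
theorem card_le_of_lists {α β : Type} [DecidableEq β] {s : Finset β} (l : List α) (k : ℕ)
    (f : List α → β) (h : ∀ b ∈ s, ∃ w, w.length ≤ k ∧ (∀ a ∈ w, a ∈ l) ∧ f w = b) :
    s.card ≤ (l.length + 1) ^ k := by
  have hs : s ⊆ ((listsUpTo l k).map f).toFinset := by
    intro b hb
    obtain ⟨w, hw, hl, rfl⟩ := h b hb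
    exact List.mem_toFinset.2 (mem_map.2 ⟨w, mem_listsUpTo.2 ⟨hw, hl⟩, rfl⟩)
  refine (Finset.card_le_card hs).trans ((List.toFinset_card_le _).trans ?_)
  rw [List.length_map]
  exact length_listsUpTo_le l k

theorem card_pauliSet_le (m k : ℕ) : (pauliSet m k).card ≤ (m * 3 + 1) ^ k := by
  classical
  have h := card_le_of_lists (s := pauliSet m k) (Finset.univ : Finset (Fin m × PauliLabel)).toList k
    (fun w u => if (u, PauliLabel.X) ∈ w then .X else if (u, PauliLabel.Z) ∈ w then .Z else .I)
    fun P hP => ⟨(support P).toList.map fun u => (u, P u), by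
        simpa [pauliSet] using hP, by simp, by
        funext u
        have hX : ∀ D, (u, D) ∈ ((support P).toList.map fun u => (u, P u)) ↔ P u ≠ .I ∧ P u = D := by
          intro D; simp [support]
        simp only [hX]
        cases P u <;> simp⟩
  have hc : Fintype.card PauliLabel = 3 := rfl
  simpa [hc] using h

theorem card_powerSet_le (m k : ℕ) :
    (powerSet m k).card ≤ ((pauliSet m k).card + 1) ^ k := by
  classical
  have h := card_le_of_lists (s := powerSet m k) (pauliSet m k).toList k List.toFinset
    fun Q hQ => by
      rw [powerSet, mem_filter] at hQ
      obtain ⟨-, -, hc, -, J, hJ, hQJ⟩ := hQ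
      refine ⟨Q.toList, by simpa using hc, fun P hP => ?_, by simp⟩
      have := (Finset.card_le_card (hQJ P (by simpa using hP))).trans hJ
      simpa [pauliSet] using this
  simpa using h

theorem card_le_of_mem_powerSet {m k : ℕ} {Q : Finset (Pauli m)} (hQ : Q ∈ powerSet m k) :
    Q.card ≤ k := by
  classical
  rw [powerSet, mem_filter] at hQ
  exact hQ.2.2.1

theorem length_playerConstraints_le (m k : ℕ) {r : ℕ} (i : Fin r) :
    (playerConstraints m k i).length ≤
      m * (m * 4) + m + m * (m * 2) + (pauliSet m k).card + (powerSet m k).card * k := by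
  simp only [playerConstraints, List.length_append]
  gcongr
  · refine (length_flatMap_le (B := m * 4) fun u _ => ?_).trans (by simp)
    refine (length_flatMap_le (B := 4) fun v _ => by simp [xz]).trans ?_
    gcongr
    exact (List.length_filter_le _ _).trans (by simp)
  · simp
  · refine (length_flatMap_le (B := m * 2) fun u _ => ?_).trans (by simp)
    exact (length_flatMap_le (B := 2) fun v _ => by simp [xz]).trans (by simp)
  · simp
  · refine (length_flatMap_le (B := k) fun Q hQ => ?_).trans (by simp)
    simpa using card_le_of_mem_powerSet (Finset.mem_toList.1 hQ)

theorem length_constraint_le {k r m : ℕ} {C : Constraint r m} (hC : C ∈ constraints k r m) :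
    C.1.length ≤ 6 + k := by
  obtain ⟨i, -, hC⟩ := mem_flatMap.1 hC
  simp only [playerConstraints, mem_append, mem_flatMap, mem_map] at hC
  rcases hC with (((⟨u, -, v, -, D, -, E, -, rfl⟩ | ⟨u, -, rfl⟩) | ⟨u, -, v, -, D, -, rfl⟩) |
    ⟨P, hP, rfl⟩) | ⟨Q, -, P, -, rfl⟩
  · simp; omega
  · simp; omega
  · simp
  · have : (support P).card ≤ k := by simpa [pauliSet] using hP
    simp; omega
  · simp; omega

theorem length_seqW_le (k r m : ℕ) :
    (seqW k r m).length ≤ r * (m * (2 * ((constraints k r m).length * (6 + k)) + 2)) := by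
  have hV : (seqV k r m).length ≤ (constraints k r m).length * (6 + k) :=
    length_flatMap_le fun C hC => length_constraint_le hC
  refine (length_flatMap_le (B := m * (2 * ((constraints k r m).length * (6 + k)) + 2))
    fun i _ => ?_).trans (by simp)
  refine (length_flatMap_le fun u _ => ?_).trans (by simp; rfl)
  simp
  omega

theorem length_derivedSeqs_le (k r m : ℕ) :
    (derivedSeqs k r m).length ≤ r * ((powerSet m k).card * (k + 1) ^ k) + 1 := by
  rw [derivedSeqs, List.length_cons]
  gcongr
  refine (length_flatMap_le (B := (powerSet m k).card * (k + 1) ^ k) fun i _ => ?_).trans (by simp)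
  refine (length_flatMap_le (B := (k + 1) ^ k) fun Q hQ => ?_).trans (by simp)
  rw [List.length_tail]
  refine (Nat.sub_le _ _).trans ((length_listsUpTo_le _ _).trans ?_)
  gcongr
  simpa using card_le_of_mem_powerSet (Finset.mem_toList.1 hQ)

theorem length_seqQ_le (k r m : ℕ) :
    (seqQ k r m).length ≤
      (r * (m * 2) + 1) ^ k * (r * ((powerSet m k).card * (k + 1) ^ k) + 1) := by
  refine (length_flatMap_le fun w _ => ?_).trans (Nat.mul_le_mul_right _ ?_)
  · rw [List.length_map]
    exact length_derivedSeqs_le k r m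
  · refine (length_listsUpTo_le _ _).trans ?_
    gcongr
    simp [xz, List.length_flatMap]

theorem length_of_mem_seqQ {k r m : ℕ} {w : List (Refl r m)} (hw : w ∈ seqQ k r m) :
    w.length ≤ 2 * k := by
  obtain ⟨w₁, h₁, w', h', rfl⟩ : ∃ w₁ ∈ primitives k r m, ∃ w' ∈ derivedSeqs k r m, w₁ ++ w' = w := by
    simpa [seqQ] using hw
  have h1 := (mem_listsUpTo.1 h₁).1
  have h2 : w'.length ≤ k := by
    rcases List.mem_cons.1 h' with rfl | h'
    · simp
    · simp only [mem_flatMap] at h'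
      obtain ⟨i, -, Q, -, h'⟩ := h'
      exact (mem_listsUpTo.1 (List.mem_of_mem_tail h')).1
  rw [List.length_append]
  omega

theorem length_seqU_le (k r m : ℕ) :
    (seqU k r m).length ≤ (seqQ k r m).length * (4 * k + 2 * (seqW k r m).length) := by
  refine length_flatMap_le fun w hw => ?_
  have := length_of_mem_seqQ hw
  simp [blockU]
  omega

/-- `f` is bounded by a polynomial in `size`. -/
def PolyIn {ι : Type} (size f : ι → ℕ) : Prop := ∃ q : Polynomial ℕ, ∀ i, f i ≤ q.eval (size i)

namespace PolyIn

variable {ι : Type} {size f g : ι → ℕ}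

theorem const (c : ℕ) : PolyIn size fun _ => c := ⟨Polynomial.C c, fun i => by simp⟩

theorem add (hf : PolyIn size f) (hg : PolyIn size g) : PolyIn size fun i => f i + g i := by
  obtain ⟨a, ha⟩ := hf
  obtain ⟨b, hb⟩ := hg
  exact ⟨a + b, fun i => by rw [Polynomial.eval_add]; exact add_le_add (ha i) (hb i)⟩

theorem mul (hf : PolyIn size f) (hg : PolyIn size g) : PolyIn size fun i => f i * g i := by
  obtain ⟨a, ha⟩ := hf
  obtain ⟨b, hb⟩ := hg
  exact ⟨a * b, fun i => by rw [Polynomial.eval_mul]; exact Nat.mul_le_mul (ha i) (hb i)⟩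

theorem pow (hf : PolyIn size f) (n : ℕ) : PolyIn size fun i => f i ^ n := by
  obtain ⟨a, ha⟩ := hf
  exact ⟨a ^ n, fun i => by rw [Polynomial.eval_pow]; exact Nat.pow_le_pow_left (ha i) n⟩

theorem mono (hg : PolyIn size g) (h : ∀ i, f i ≤ g i) : PolyIn size f := by
  obtain ⟨a, ha⟩ := hg
  exact ⟨a, fun i => (h i).trans (ha i)⟩

end PolyIn

namespace NormalVerifier

/-- The denominator in the soundness bound of the game. -/
def denominator {r : ℕ} (W : NormalVerifier r) (k p : ℕ) : ℕ :=
  let N := W.N k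
  let C := (constraints k r W.m).length
  let cons := (2 * C + 1 + 2 * (2 * (r * W.m)) * C) * (4 * N + 2)
  let run := 2 * (W.L * (4 + 32 * ((2 * (r * W.m) + 1) * cons + 2 + cons))) + 2
  60 * W.gameSize k *
    ((N + 1) * ((W.T + 1) * ((p + 1) * (run + 1 + W.qV)) + W.T + 2 * N) + N) ^ 2

theorem denominator_pos {r : ℕ} (W : NormalVerifier r) (k p : ℕ) : 0 < W.denominator k p := by
  rw [denominator, gameSize, T]; positivity

theorem cast_denominator {r : ℕ} (W : NormalVerifier r) (k p : ℕ) :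
    (W.denominator k p : ℝ) = 60 * W.gameSize k * Padding.totalError W k p ^ 2 := by
  simp only [denominator, Padding.totalError, runError, stepError, obsError, extError, consError,
    ctrlList_length]
  push_cast
  rfl

open PolyIn in
theorem polyIn_denominator {ι : Type} {size r : ι → ℕ} {W : ∀ i, NormalVerifier (r i)} (k : ℕ)
    {p : ι → ℕ} (hr : PolyIn size r) (hV : PolyIn size fun i => (W i).qV)
    (hM : PolyIn size fun i => (W i).qM) (hL : PolyIn size fun i => (W i).L)
    (hp : PolyIn size p) : PolyIn size fun i => (W i).denominator k (p i) := by
  have hm : PolyIn size fun i => (W i).m := hM.add (const 1)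
  have hP : PolyIn size fun i => (pauliSet (W i).m k).card :=
    (((hm.mul (const 3)).add (const 1)).pow k).mono fun i => card_pauliSet_le _ _
  have hS : PolyIn size fun i => (powerSet (W i).m k).card :=
    ((hP.add (const 1)).pow k).mono fun i => card_powerSet_le _ _
  have hC : PolyIn size fun i => (constraints k (r i) (W i).m).length :=
    PolyIn.mono (by apply_rules [add, mul, const]) fun i =>
      (length_flatMap_le fun j _ => length_playerConstraints_le (W i).m k j).trans
        (Nat.mul_le_mul_right _ (List.length_finRange (n := r i)).le)
  have hQ : PolyIn size fun i => (seqQ k (r i) (W i).m).length :=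
    PolyIn.mono (by apply_rules [add, mul, const, pow]) fun i => length_seqQ_le _ _ _
  have hW : PolyIn size fun i => (seqW k (r i) (W i).m).length :=
    PolyIn.mono (by apply_rules [add, mul, const, pow]) fun i => length_seqW_le _ _ _
  have hN : PolyIn size fun i => (W i).N k :=
    PolyIn.mono (by apply_rules [add, mul, const]) fun i => length_seqU_le _ _ _
  have hT : PolyIn size fun i => (W i).T := ((const 2).mul hL).add (const 1)
  have hG : PolyIn size fun i => (W i).gameSize k := by
    unfold gameSize
    apply_rules [add, mul, const]
  have hrm : PolyIn size fun i => 2 * (r i * (W i).m) := (const 2).mul (hr.mul hm)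
  have hcons := ((((const 2).mul hC).add (const 1)).add (((const 2).mul hrm).mul hC)).mul
    (((const 4).mul hN).add (const 2))
  have hrun := ((const 2).mul (hL.mul ((const 4).add ((const 32).mul
    ((((hrm.add (const 1)).mul hcons).add (const 2)).add hcons))))).add (const 2)
  have herr := ((hN.add (const 1)).mul ((((hT.add (const 1)).mul ((hp.add (const 1)).mul
    ((hrun.add (const 1)).add hV))).add hT).add ((const 2).mul hN))).add hN
  exact ((const 60).mul hG).mul (herr.pow 2)

end NormalVerifier

theorem Verifier.length_encode {r : ℕ} (V : Verifier r) :
    V.qV + V.qM + V.V1.length + V.V2.length ≤ V.encode.length := by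
  simp [Verifier.encode, Verifier.encodeCircuit, Verifier.unary]
  omega

/-- The denominators for all short descriptions of verifiers have a common polynomial bound. -/
theorem exists_denominator_le (k : ℕ) {r : ℕ → ℕ} (hr : PolyBounded r) (p q : Polynomial ℕ) :
    ∃ b : Polynomial ℕ, ∀ n (V : Verifier (r n)), V.encode.length ≤ p.eval n →
      V.normalize.denominator k (q.eval n) ≤ b.eval n := by
  let ι := {y : Σ n, Verifier (r n) // y.2.encode.length ≤ p.eval y.1}
  let size : ι → ℕ := fun y => y.1.1
  have hlen : PolyIn size fun y : ι => y.1.2.qV + y.1.2.qM + y.1.2.V1.length + y.1.2.V2.length + 3 :=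
    PolyIn.add (PolyIn.mono ⟨p, fun y => y.2⟩ fun y => y.1.2.length_encode) (PolyIn.const 3)
  obtain ⟨b, hb⟩ := NormalVerifier.polyIn_denominator (size := size)
    (W := fun y : ι => y.1.2.normalize) (p := fun y => q.eval y.1.1) k
    (hr.imp fun c hc y => hc _)
    (hlen.mono fun y => by simp only [Verifier.normalize]; omega)
    (hlen.mono fun y => by simp only [Verifier.normalize]; omega)
    (hlen.mono fun y => by simp only [Verifier.normalize]; omega) ⟨q, fun y => le_rfl⟩
  exact ⟨b, fun n V hV => hb ⟨⟨n, V⟩, hV⟩⟩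

end

end QGame

theorem mainTheorem5 (k : ℕ) (hk : 3 ≤ k) (r : ℕ → ℕ) (hr : QGame.PolyBounded r)
    (hr_pos : ∀ n, 0 < r n) (s : ℕ → ℝ) (hs : QGame.OneSubInvPoly s) (p : Polynomial ℕ) :
    ∃ s' : ℕ → ℝ, QGame.OneSubInvPoly s' ∧
      ∀ (A : Set (List Bool)) (V : (x : List Bool) → QGame.Verifier (r x.length)),
        QGame.WitnessesQMIPStar3 r (fun _ => 1) s A V →
        (∀ x, (V x).encode.length ≤ p.eval x.length) →
        ∀ x : List Bool,
          (x ∈ A → ((V x).extendedGame k).value = 1 ∧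
            ((∃ P : (V x).Provers, P.acceptProb = 1) →
              ∃ S : ((V x).extendedGame k).Strategy, S.value = 1)) ∧
          (x ∉ A → ((V x).extendedGame k).value ≤ s' x.length) := by
  obtain ⟨q, hq⟩ := hs
  obtain ⟨b, hb⟩ := QGame.exists_denominator_le k hr p q
  refine ⟨fun n => 1 - 1 / (((b + 1).eval n : ℕ) : ℝ), ⟨b + 1, fun n => ⟨by simp, le_rfl⟩⟩,
    fun A V hV hlen x => ⟨fun hx => ⟨?_, ?_⟩, fun hx => ?_⟩⟩
  · have hle : ∀ S : ((V x).extendedGame k).Strategy, S.value ≤ 1 :=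
      QGame.ExtGame.value_le_one _
    refine le_antisymm (Real.sSup_le (by rintro _ ⟨S, rfl⟩; exact hle S) zero_le_one) ?_
    refine le_of_forall_lt fun c hc => ?_
    have hM := hc.trans_le (hV.completeness x hx)
    have hne : (Set.range fun P : (V x).Provers => P.acceptProb).Nonempty := by
      by_contra h
      have h0 := hV.completeness x hx
      rw [QGame.Verifier.MAP, Set.not_nonempty_iff_eq_empty.1 h, Real.sSup_empty] at h0
      exact absurd h0 (by norm_num)
    obtain ⟨_, ⟨P, rfl⟩, hP⟩ := exists_lt_of_lt_csSup hne hM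
    obtain ⟨S, hS⟩ := (V x).padding.exists_strategy P k
    exact hP.trans_le (hS.trans (le_csSup ⟨1, by rintro _ ⟨S, rfl⟩; exact hle S⟩ ⟨S, rfl⟩))
  · rintro ⟨P, hP⟩
    obtain ⟨S, hS⟩ := (V x).padding.exists_strategy P k
    exact ⟨S, (QGame.ExtGame.value_le_one _ S).antisymm (hP ▸ hS)⟩
  · have hD := QGame.NormalVerifier.denominator_pos (V x).normalize k (q.eval x.length)
    have hDb : ((V x).normalize.denominator k (q.eval x.length) : ℝ) ≤
        (((b + 1).eval x.length : ℕ) : ℝ) := by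
      have := hb _ (V x) (hlen x)
      exact_mod_cast this.trans (by simp)
    have hinv := one_div_le_one_div_of_le (Nat.cast_pos.2 hD) hDb
    have hle : 1 / (((b + 1).eval x.length : ℕ) : ℝ) ≤ 1 := by
      rw [div_le_one (by simp; positivity)]
      exact_mod_cast (by simp : 1 ≤ (b + 1).eval x.length)
    refine Real.sSup_le ?_ (by linarith)
    rintro _ ⟨S, rfl⟩
    have hS := (V x).padding.value_le hk (p := (q.eval x.length : ℕ))
      (by exact_mod_cast (hq x.length).1) (by linarith [hV.soundness x hx, (hq x.length).2]) S
    rw [← QGame.NormalVerifier.cast_denominator] at hS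
    exact hS.trans (by linarith)
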